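/- **Setting.** Let $0\le\gamma\le\alpha\le 1$ and $n\ge 2$. An $[n]$-tree is a non-planar rooted tree with leaves labelled $1,\dots,n$, a root of degree one, and all other vertices (branch points) of degree at least three; $\mathbb T_{[n]}$ is the set of these trees. For a branch point $v$ let $c_v\ge 2$ be its number of children, and rank the subtrees of $v$ by increasing least leaf label. A semi-planar $[n]$-tree is a pair $\hat t=(t,(\sigma_v)_v)$ with $t\in\mathbb T_{[n]}$ and $\sigma_v$ a permutation of $[c_v-2]$ for each branch point $v$: the subtrees of rank $1$ and $2$ are placed leftmost in $v$ (their mutual order being irrelevant), and to their right the subtree of rank $r\ge 3$ is the $\sigma_v(r-2)$-th from the left. Let $\hat\pi(t,\sigma)=t$, and let $\hat{\mathbb T}_{[n]}$ be the set of semi-planar $[n]$-trees. **Growth.** $T_1$ is the tree with one leaf. Given $T_m$, the tree $T_{m+1}$ is obtained by inserting leaf $m+1$ with probability $w_x/(m-\alpha)$ into the edge or branch point $x$ of $T_m$, where $w_x=1-\alpha$ for a leaf edge, $w_x=\gamma$ for an internal edge, and $w_x=(c_x-1)\alpha-\gamma$ for a branch point (for $m=1$ there is only one choice, made with probability $1$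 also if $\alpha=1$). In the semi-planar growth rule the weight of a branch point $x$ is split: weight $\alpha$ for inserting the new leaf as the $l$-th subtree after the two leftmost ones, for each $1\le l\le c_x-2$, and weight $\alpha-\gamma$ for $l=c_x-1$, i.e. at the right end. **Semi-planar $(\alpha,\gamma)$-chain** (transition matrix $\hat K_n$ on $\hat{\mathbb T}_{[n]}$). Select a leaf $i\in[n]$ uniformly, and let $v$ be its parent. Let $a$ be the least label among the descendants of $v$ other than $i$. If $c_v=2$, let $b$ be the least label among the leaves that are descendants of the parent of $v$ but not of $v$ ($b=0$ if the parent of $v$ is the root). If $c_v>2$, let $b$ be the least label in the first subtree of $v$ not containing $a$ to the right of leaf $i$ if $i$ has rank at most $2$ in $v$, and to the left of leaf $i$ otherwise. Put $\tilde\imath=\max\{i,a,b\}$; swap the labels $i$ and $\tilde\imath$, keeping all positions of subtrees; delete leaf $\tilde\imath$ (contracting its parent if that had only two children), keeping the relative order of the other subtrees; relabel the remaining leaves increasingly by $[n-1]$; forget the order of the two leftmost subtrees at each branch point; and insert leaf $n$ according to the semi-planar growth rule. **$(\alpha,\gamma)$-chain** (transition matrix $K_n$ on $\mathbb T_{[n]}$).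 Select a leaf $i\in[n]$ uniformly, with parent $v$. If $c_v=2$, let $\tilde I=\max\{i,a,b\}$ with $a,b$ as above. If $c_v>2$, let $i_1<\dots<i_{c_v}$ be the least labels in the subtrees of $v$ and let $i=i_j$; let $\tilde I=i_{j'}$ with probability $$\begin{cases}\frac{\alpha-\gamma}{(c_v-2)\alpha-\gamma}, & j\le 2,\ j'=3,\\[2pt] \frac{\alpha}{(c_v-2)\alpha-\gamma}, & j\le 2,\ 3<j'\le c_v,\\[2pt] \frac{\alpha}{(c_v-2)\alpha-\gamma}, & 2<j<j'\le c_v,\\[2pt] \frac{(j-2)\alpha-\gamma}{(c_v-2)\alpha-\gamma}, & 2<j=j'\le c_v,\end{cases}$$ and $0$ otherwise, where for $c_v=3$ this means $\tilde I=i_3$ with probability $1$ (also if $\alpha=\gamma$). Swap the labels $i$ and $\tilde I$, delete leaf $\tilde I$, relabel increasingly by $[n-1]$, and insert leaf $n$ according to the $(\alpha,\gamma)$-growth rule. **Kernel $\hat\Pi_n$.** Given $t$, let $\hat\Pi_n(t,\cdot)$ be the law of $(t,(\Sigma_v)_v)$, where the $\Sigma_v$ are independent and $\Sigma_v$ is the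 table order in an ordered Chinese restaurant process oCRP$(\alpha,\alpha-\gamma)$ with $c_v-2$ tables: with $\theta=\alpha-\gamma$, when $L\ge1$ tables are present, the next table is put to the left of the leftmost table, or between a given pair of neighbouring tables, with probability $\alpha/(L\alpha+\theta)$ each, and to the right of the rightmost table with probability $\theta/(L\alpha+\theta)$. Call $t\in\mathbb T_{[n]}$ *admissible* if $\alpha>0$, or if $\alpha=0$ and every branch point of $t$ has at most three children (for $\alpha=\gamma=0$ the rules above are not defined at other trees). **Theorem.** The rows $\hat K_n(\hat t,\cdot)$ for all $\hat t\in\hat{\mathbb T}_{[n]}$, and $\hat\Pi_n(t,\cdot)$ and $K_n(t,\cdot)$ for all admissible $t$, are probability distributions, and $K_n(t,\cdot)=(\hat\Pi_n\hat K_n\hat\pi)(t,\cdot)$ for every admissible $t$, where $\hat\pi$ also denotes the matrix $(1_{\hat\pi(\hat t)=t})_{\hat t,t}$. If $t$ is admissible and $(\hat T_n(m))_{m\ge 0}$ is a semi-planar $(\alpha,\gamma)$-chain with $\hat T_n(0)\sim\hat\Pi_n(t,\cdot)$, then $(\hat\pi(\hat T_n(m)))_{m\ge 0}$ is an $(\alpha,\gamma)$-chain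 started from $t$, i.e. a Markov chain with transition matrix $K_n$ and initial state $t$. The law of $T_n$ is concentrated on admissible trees and is the unique stationary distribution of the $(\alpha,\gamma)$-chain (among the distributions on admissible trees). -/

import Mathlib

open MeasureTheory

namespace AlphaGamma

/-! ### Trees

A rooted tree with leaves labelled by a finite set `A ⊆ ℕ`, with a root of degree one and with all
branch points of degree at least three, is encoded by the family `t` of the sets of leaf labels
below its vertices other than the root. A member of `t` stands for such a vertex, and also for the
edge between this vertex and its parent: singletons are the leaves (leaf edges), the other members
are the branch points (internal edges). Label-preserving isomorphism classes of such trees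
correspond exactly to the families that satisfy `IsTree`. -/

structure IsTree (A : Finset ℕ) (t : Finset (Finset ℕ)) : Prop where
  top_mem : A ∈ t
  singleton_mem : ∀ i ∈ A, {i} ∈ t
  nonempty_of_mem : ∀ C ∈ t, C.Nonempty
  subset_of_mem : ∀ C ∈ t, C ⊆ A
  laminar : ∀ C ∈ t, ∀ D ∈ t, C ⊆ D ∨ D ⊆ C ∨ Disjoint C D

/-- The space of (non-planar) `[n]`-trees. -/
def Tree (n : ℕ) : Type := {t : Finset (Finset ℕ) // IsTree (Finset.Icc 1 n) t}

/-- The branch points of `t`. -/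
def branchPoints (t : Finset (Finset ℕ)) : Finset (Finset ℕ) := t.filter (fun C => 2 ≤ C.card)

/-- The children of the vertex `v`: the maximal members of `t` strictly below `v`. -/
def children (t : Finset (Finset ℕ)) (v : Finset ℕ) : Finset (Finset ℕ) :=
  t.filter (fun D => D ⊂ v ∧ ∀ E ∈ t, ¬ (D ⊂ E ∧ E ⊂ v))

/-- The parent of the vertex `C`: the intersection of all members of `t` strictly containing `C`
(which form a chain). If there is none, i.e. if the parent of `C` is the root, the value is the set
of all labels, i.e. `C` itself. -/
def parent (t : Finset (Finset ℕ)) (C : Finset ℕ) : Finset ℕ :=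
  (t.sup id).filter (fun x => ∀ D ∈ t, C ⊂ D → x ∈ D)

/-- The least element of a set of labels, with the convention `0` for the empty set. -/
def minLabel (S : Finset ℕ) : ℕ := if h : S.Nonempty then S.min' h else 0

/-- The rank (`1, 2, …`) of the child `D` among the children of `v`, in the order of the least
leaf labels of the subtrees. -/
def rank (t : Finset (Finset ℕ)) (v D : Finset ℕ) : ℕ :=
  ((children t v).filter (fun E => minLabel E ≤ minLabel D)).card

/-! ### Operations on trees -/

/-- Insertion of leaf `j` into the edge above the vertex `C`: the vertex `C` stays, a new branch
point `insert j C` with children `C` and `{j}` appears on the edge. -/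
def insertEdge (t : Finset (Finset ℕ)) (C : Finset ℕ) (j : ℕ) : Finset (Finset ℕ) :=
  insert {j} (t.filter (fun D => ¬ C ⊂ D) ∪ (t.filter (fun D => C ⊆ D)).image (insert j))

/-- Insertion of leaf `j` as a new child of the branch point `C`. -/
def insertBranch (t : Finset (Finset ℕ)) (C : Finset ℕ) (j : ℕ) : Finset (Finset ℕ) :=
  insert {j} (t.filter (fun D => ¬ C ⊆ D) ∪ (t.filter (fun D => C ⊆ D)).image (insert j))

/-- Swapping the labels `i` and `k` in a set of labels. -/
def swapSet (i k : ℕ) (D : Finset ℕ) : Finset ℕ := D.image (Equiv.swap i k)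

/-- Swapping the leaf labels `i` and `k` in a tree. -/
def swapTree (t : Finset (Finset ℕ)) (i k : ℕ) : Finset (Finset ℕ) := t.image (swapSet i k)

/-- Deletion of leaf `k` (a parent of `k` with only two children gets contracted: it is then
identified with the sibling of `k`). -/
def deleteTree (t : Finset (Finset ℕ)) (k : ℕ) : Finset (Finset ℕ) :=
  (t.image (fun D => D.erase k)).erase ∅

/-- Relabelling `k + 1, k + 2, …` by `k, k + 1, …`. -/
def relabelSet (k : ℕ) (D : Finset ℕ) : Finset ℕ := D.image (fun x => if k < x then x - 1 else x)

/-- The inverse of `relabelSet k` (on sets that do not contain `k`). -/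
def unrelabelSet (k : ℕ) (D : Finset ℕ) : Finset ℕ :=
  D.image (fun x => if k ≤ x then x + 1 else x)

/-- Relabelling of a tree without leaf `k`. -/
def relabelTree (t : Finset (Finset ℕ)) (k : ℕ) : Finset (Finset ℕ) := t.image (relabelSet k)

/-- Swap the labels `i` and `k`, delete leaf `k` and relabel by the increasing bijection. -/
def downTree (t : Finset (Finset ℕ)) (i k : ℕ) : Finset (Finset ℕ) :=
  relabelTree (deleteTree (swapTree t i k) k) k

/-! ### The growth process -/

/-- The insertion weight of the edge above `C`. -/
def edgeWeight (α γ : ℝ) (C : Finset ℕ) : ℝ := if C.card = 1 then 1 - α else γ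

/-- The probability of an insertion of weight `w` into a tree with `n` leaves. The total weight is
`n - α`; in the tree with a single leaf there is only one edge to choose (this matters only for
`α = 1`, where the total weight vanishes for `n = 1`). -/
noncomputable def insertionProb (α : ℝ) (n : ℕ) (w : ℝ) : ℝ := if n = 1 then 1 else w / (n - α)

/-- The `(α, γ)`-growth rule: the probability that inserting leaf `n + 1` into the tree `t` with
leaves `1, …, n` yields `s`. -/
noncomputable def growthRule (α γ : ℝ) (n : ℕ) (t s : Finset (Finset ℕ)) : ℝ :=
  (∑ C ∈ t, if insertEdge t C (n + 1) = s then insertionProb α n (edgeWeight α γ C) else 0) +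
  ∑ C ∈ branchPoints t, if insertBranch t C (n + 1) = s then
    insertionProb α n ((((children t C).card : ℝ) - 1) * α - γ) else 0

instance (n : ℕ) : DecidableEq (Tree n) :=
  inferInstanceAs (DecidableEq {t : Finset (Finset ℕ) // IsTree (Finset.Icc 1 n) t})

theorem finite_tree (n : ℕ) : Finite (Tree n) := by
  refine Set.Finite.subset
    (Finset.finite_toSet ((Finset.Icc 1 n).powerset.powerset)) (fun t ht => ?_)
  simp only [Finset.mem_coe, Finset.mem_powerset]
  exact fun C hC => Finset.mem_powerset.2 (ht.subset_of_mem C hC)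

noncomputable instance (n : ℕ) : Fintype (Tree n) := @Fintype.ofFinite _ (finite_tree n)

/-- The law of the `n`-th step `T_n` of the `(α, γ)`-growth process (`n ≥ 1`; `Tree 1` has exactly
one element). -/
noncomputable def growthLaw (α γ : ℝ) : (n : ℕ) → Tree n → ℝ
  | 0 => fun _ => 0
  | 1 => fun _ => 1
  | n + 2 => fun s => ∑ t : Tree (n + 1), growthLaw α γ (n + 1) t * growthRule α γ (n + 1) t.1 s.1

/-! ### The `(α, γ)`-chain -/

/-- In a branch point with `c ≥ 3` children, the conditional probability that the leaf to be deleted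
is the least label of the subtree of rank `j'`, given that the selected leaf has rank `j`. For
`c = 3` this is the point mass at `j' = 3` (the general formula then reads `0 / 0` if `α = γ`). -/
noncomputable def searchProb (α γ : ℝ) (c j j' : ℕ) : ℝ :=
  if c = 3 then (if j' = 3 then 1 else 0)
  else if j ≤ 2 ∧ j' = 3 then (α - γ) / (((c : ℝ) - 2) * α - γ)
  else if j ≤ 2 ∧ 3 < j' then α / (((c : ℝ) - 2) * α - γ)
  else if 2 < j ∧ j < j' then α / (((c : ℝ) - 2) * α - γ)
  else if 2 < j ∧ j = j' then (((j : ℝ) - 2) * α - γ) / (((c : ℝ) - 2) * α - γ)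
  else 0

/-- Least label in the first spinal bush on the ancestral line from leaf `i`. -/
def firstBushMin (t : Finset (Finset ℕ)) (i : ℕ) : ℕ := minLabel (parent t {i} \ {i})

/-- Least label in the second spinal bush on the ancestral line from leaf `i` (`0` if there is
none). -/
def secondBushMin (t : Finset (Finset ℕ)) (i : ℕ) : ℕ :=
  minLabel (parent t (parent t {i}) \ parent t {i})

/-- The transition matrix of the `(α, γ)`-chain on `[n]`-trees: select a leaf `i` uniformly, find the
leaf to be deleted by the local search, swap, delete, relabel, and insert leaf `n` by the
`(α, γ)`-growth rule. -/
noncomputable def chainKernel (α γ : ℝ) (n : ℕ) : Matrix (Tree n) (Tree n) ℝ := fun t s =>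
  ∑ i ∈ Finset.Icc 1 n, (1 / (n : ℝ)) *
    if (children t.1 (parent t.1 {i})).card = 2 then
      growthRule α γ (n - 1)
        (downTree t.1 i (max i (max (firstBushMin t.1 i) (secondBushMin t.1 i)))) s.1
    else
      ∑ D ∈ children t.1 (parent t.1 {i}),
        searchProb α γ (children t.1 (parent t.1 {i})).card
          (rank t.1 (parent t.1 {i}) {i}) (rank t.1 (parent t.1 {i}) D) *
        growthRule α γ (n - 1) (downTree t.1 i (minLabel D)) s.1

/-! ### Semi-planar trees -/

/-- A tree shape with, for each branch point, a left-to-right list of subtrees. It is used both for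
planar trees (where the list contains all children) and for semi-planar trees (where it contains
all children but the two with the least leaf labels, which are placed leftmost, their mutual order
being forgotten). -/
@[ext] structure OrderedTree where
  shape : Finset (Finset ℕ)
  order : Finset ℕ → List (Finset ℕ)

/-- `x` is a semi-planar tree with label set `A`. A permutation `σ` of `[c - 2]` at a branch point
with `c` children is given by the list of the subtrees of rank at least three, from left to right:
`σ (r - 2)` is the position in the list of the subtree of rank `r`. -/
structure IsSemiPlanar (A : Finset ℕ) (x : OrderedTree) : Prop where
  isTree : IsTree A x.shape
  nodup : ∀ v ∈ branchPoints x.shape, (x.order v).Nodup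
  mem_order : ∀ v ∈ branchPoints x.shape, ∀ D,
    D ∈ x.order v ↔ D ∈ children x.shape v ∧ 3 ≤ rank x.shape v D
  order_eq_nil : ∀ v, v ∉ branchPoints x.shape → x.order v = []

/-- The space of semi-planar `[n]`-trees. -/
def SemiPlanarTree (n : ℕ) : Type := {x : OrderedTree // IsSemiPlanar (Finset.Icc 1 n) x}

/-- The projection from semi-planar to non-planar trees. -/
def proj {n : ℕ} (x : SemiPlanarTree n) : Tree n := ⟨x.1.shape, x.2.isTree⟩

theorem finite_semiPlanarTree (n : ℕ) : Finite (SemiPlanarTree n) := by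
  classical
  have hfin : ∀ P : Finset (Finset ℕ),
      {l : List (Finset ℕ) | l.Nodup ∧ ∀ D ∈ l, D ∈ P}.Finite := by
    intro P
    refine Set.Finite.subset (Finset.finite_toSet
      (P.powerset.biUnion fun s => s.toList.permutations.toFinset)) (fun l hl => ?_)
    simp only [Finset.mem_coe, Finset.mem_biUnion, Finset.mem_powerset, List.mem_toFinset,
      List.mem_permutations]
    refine ⟨l.toFinset, fun D hD => hl.2 D (List.mem_toFinset.1 hD), ?_⟩
    exact (List.toFinset_toList hl.1).symm
  have hmem : ∀ (x : SemiPlanarTree n) (v : Finset ℕ),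
      x.1.order v ∈ {l : List (Finset ℕ) | l.Nodup ∧ ∀ D ∈ l, D ∈ (Finset.Icc 1 n).powerset} := by
    intro x v
    by_cases hv : v ∈ branchPoints x.1.shape
    · refine ⟨x.2.nodup v hv, fun D hD => ?_⟩
      have h := ((x.2.mem_order v hv D).1 hD).1
      exact Finset.mem_powerset.2 (x.2.isTree.subset_of_mem D (Finset.mem_filter.1 h).1)
    · rw [x.2.order_eq_nil v hv]
      simp
  have := finite_tree n
  have := (hfin (Finset.Icc 1 n).powerset).to_subtype
  refine Finite.of_injective (β := Tree n × ((Finset.Icc 1 n).powerset →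
    {l : List (Finset ℕ) | l.Nodup ∧ ∀ D ∈ l, D ∈ (Finset.Icc 1 n).powerset}))
    (fun x => (proj x, fun v => ⟨x.1.order v, hmem x v⟩)) ?_
  intro x y hxy
  have hs : x.1.shape = y.1.shape := congrArg (fun p => p.1.1) hxy
  refine Subtype.ext (OrderedTree.ext hs (funext fun v => ?_))
  by_cases hv : v ∈ branchPoints x.1.shape
  · have hvA : v ∈ (Finset.Icc 1 n).powerset :=
      Finset.mem_powerset.2 (x.2.isTree.subset_of_mem v (Finset.mem_filter.1 hv).1)
    exact congrArg (fun p => (p.2 ⟨v, hvA⟩).1) hxy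
  · rw [x.2.order_eq_nil v hv, y.2.order_eq_nil v (hs ▸ hv)]

noncomputable instance (n : ℕ) : Fintype (SemiPlanarTree n) :=
  @Fintype.ofFinite _ (finite_semiPlanarTree n)

/-! ### The semi-planar growth rule -/

/-- How the vertex `X` of the old tree appears in the new tree, after inserting `j` at `C`. -/
def liftVertex (C : Finset ℕ) (j : ℕ) (X : Finset ℕ) : Finset ℕ := if C ⊆ X then insert j X else X

/-- Insertion of a leaf with a new largest label `j` into the edge above `C`: the new branch point
has two children, hence an empty list, all other lists stay the same. -/
def insertEdgeSP (x : OrderedTree) (C : Finset ℕ) (j : ℕ) : OrderedTree where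
  shape := insertEdge x.shape C j
  order E :=
    if E ∉ branchPoints (insertEdge x.shape C j) then []
    else if E = insert j C then []
    else if j ∈ E then (x.order (E.erase j)).map (liftVertex C j)
    else x.order E

/-- Insertion of a leaf with a new largest label `j` into the branch point `C`, at location `l`
(`1 ≤ l ≤ c - 1`, if `C` has `c` children): the new leaf becomes the `l`-th subtree from the left,
after the two leftmost ones. -/
def insertBranchSP (x : OrderedTree) (C : Finset ℕ) (l j : ℕ) : OrderedTree where
  shape := insertBranch x.shape C j
  order E :=
    if E ∉ branchPoints (insertBranch x.shape C j) then []
    else if E = insert j C then (x.order C).insertIdx (l - 1) {j}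
    else if j ∈ E then (x.order (E.erase j)).map (liftVertex C j)
    else x.order E

open Classical in
/-- The semi-planar `(α, γ)`-growth rule: weight `α` in the locations `1, …, c - 2` of a branch
point with `c` children, and `α - γ` in the rightmost location `c - 1`. -/
noncomputable def growthRuleSP (α γ : ℝ) (n : ℕ) (x y : OrderedTree) : ℝ :=
  (∑ C ∈ x.shape,
    if insertEdgeSP x C (n + 1) = y then insertionProb α n (edgeWeight α γ C) else 0) +
  ∑ C ∈ branchPoints x.shape, ∑ l ∈ Finset.Icc 1 ((children x.shape C).card - 1),
    if insertBranchSP x C l (n + 1) = y then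
      insertionProb α n (if l ≤ (children x.shape C).card - 2 then α else α - γ) else 0

/-! ### The semi-planar down-step -/

/-- The canonical planar representative of a semi-planar tree: the subtrees of rank one and two are
placed first and second from the left. -/
noncomputable def toPlanar (x : OrderedTree) : OrderedTree where
  shape := x.shape
  order v :=
    if v ∈ branchPoints x.shape then
      ((children x.shape v).filter (fun D => rank x.shape v D = 1)).toList ++
      ((children x.shape v).filter (fun D => rank x.shape v D = 2)).toList ++ x.order v
    else []

/-- Forgetting the order of the two leftmost subtrees in each branch point of a planar tree. -/
def toSemiPlanar (x : OrderedTree) : OrderedTree where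
  shape := x.shape
  order v := if v ∈ branchPoints x.shape then (x.order v).drop 2 else []

/-- Swapping labels in a planar tree: all subtrees keep their positions. -/
def swapPlanar (x : OrderedTree) (i k : ℕ) : OrderedTree where
  shape := swapTree x.shape i k
  order v := (x.order (swapSet i k v)).map (swapSet i k)

/-- Deletion of leaf `k` from a planar tree: the remaining subtrees keep their relative order. If
both `E` and `insert k E` are vertices, then `E` is the only sibling of leaf `k` and the parent
`insert k E` is contracted. -/
def deletePlanar (x : OrderedTree) (k : ℕ) : OrderedTree where
  shape := deleteTree x.shape k
  order E :=
    if E ∈ x.shape then x.order E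
    else ((x.order (insert k E)).map (fun D => D.erase k)).filter (fun D => D ≠ ∅)

/-- Relabelling of a planar tree without leaf `k` by the increasing bijection. -/
def relabelPlanar (x : OrderedTree) (k : ℕ) : OrderedTree where
  shape := relabelTree x.shape k
  order F := (x.order (unrelabelSet k F)).map (relabelSet k)

/-- The label `b` of the local search from leaf `i` in a semi-planar tree. If the parent `v` of `i`
has two children, it is the least label in the second spinal bush (`0` if there is none).
Otherwise it is the least label in the first subtree of `v` that does not contain `a` to the right
of leaf `i` (if `i` has rank at most two), respectively to the left of leaf `i` (if not). -/
noncomputable def secondSearchLabel (x : OrderedTree) (i : ℕ) : ℕ :=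
  let v := parent x.shape {i}
  let a := firstBushMin x.shape i
  let l := (toPlanar x).order v
  if (children x.shape v).card = 2 then secondBushMin x.shape i
  else if rank x.shape v {i} ≤ 2 then
    minLabel (((l.drop (l.idxOf {i} + 1)).find? (fun D => a ∉ D)).getD ∅)
  else
    minLabel (((l.take (l.idxOf {i})).reverse.find? (fun D => a ∉ D)).getD ∅)

/-- The label `max {i, a, b}` of the leaf to be deleted. -/
noncomputable def searchLabel (x : OrderedTree) (i : ℕ) : ℕ :=
  max i (max (firstBushMin x.shape i) (secondSearchLabel x i))

/-- The semi-planar down-step, given that leaf `i` has been selected. -/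
noncomputable def downSP (x : OrderedTree) (i : ℕ) : OrderedTree :=
  toSemiPlanar (relabelPlanar
    (deletePlanar (swapPlanar (toPlanar x) i (searchLabel x i)) (searchLabel x i))
    (searchLabel x i))

/-- The transition matrix of the semi-planar `(α, γ)`-chain. -/
noncomputable def semiPlanarKernel (α γ : ℝ) (n : ℕ) :
    Matrix (SemiPlanarTree n) (SemiPlanarTree n) ℝ := fun x y =>
  ∑ i ∈ Finset.Icc 1 n, (1 / (n : ℝ)) * growthRuleSP α γ (n - 1) (downSP x.1 i) y.1

/-! ### Ordered Chinese restaurants -/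

/-- The probability that the tables of an ordered Chinese restaurant process with parameters
`(α, θ)`, which are opened in the order of their (distinct) labels, stand in the left-to-right
order `l`. If `m ≥ 1` tables are present, the next table is placed to the left of the leftmost
table or between two neighbouring tables with probability `α / (m α + θ)` for each such place, and
to the right of the rightmost table with probability `θ / (m α + θ)`. -/
noncomputable def ocrpProb (α θ : ℝ) (l : List ℕ) : ℝ :=
  ∏ p ∈ l.toFinset,
    if ∀ q ∈ l, p ≤ q then 1
    else (if ∀ q ∈ l, q < p → l.idxOf q < l.idxOf p then θ else α) /
      (((l.filter (fun q => q < p)).length : ℝ) * α + θ)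

/-- The Markov kernel from non-planar to semi-planar trees that orders the subtrees of rank at least
three in each branch point as the tables of independent `(α, α - γ)`-ordered Chinese restaurants,
a subtree being represented by its least label. -/
noncomputable def liftKernel (α γ : ℝ) (n : ℕ) : Matrix (Tree n) (SemiPlanarTree n) ℝ := fun t x =>
  if proj x = t then
    ∏ v ∈ branchPoints t.1, ocrpProb α (α - γ) ((x.1.order v).map minLabel)
  else 0

/-- The matrix of the projection from semi-planar to non-planar trees. -/
noncomputable def projMatrix (n : ℕ) : Matrix (SemiPlanarTree n) (Tree n) ℝ := fun x t =>
  if proj x = t then 1 else 0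

/-- The trees in which the ordered Chinese restaurants, and the transition probabilities of the
`(α, γ)`-chain, are defined: all trees if `α > 0`. For `α = 0` (hence `γ = 0`) there is no
`(0, 0)`-ordered Chinese restaurant with more than one table, and the branch points must have at
most three children. -/
def Admissible (α : ℝ) {n : ℕ} (t : Tree n) : Prop :=
  α = 0 → ∀ v ∈ branchPoints t.1, (children t.1 v).card ≤ 3

/-! ### Markov chains -/

/-- `X` is, under `P`, a time-homogeneous Markov chain on the countable (discrete) state space `S`
with initial law `init` and transition matrix `K`. -/
def IsMarkovChain {Ω : Type*} [MeasurableSpace Ω] (P : Measure Ω) {S : Type*}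
    (init : S → ℝ) (K : Matrix S S ℝ) (X : ℕ → Ω → S) : Prop :=
  (∀ (m : ℕ) (s : S), MeasurableSet (X m ⁻¹' {s})) ∧
  ∀ (m : ℕ) (x : ℕ → S), P {ω | ∀ k ≤ m, X k ω = x k} =
    ENNReal.ofReal (init (x 0) * ∏ k ∈ Finset.range m, K (x k) (x (k + 1)))

end AlphaGamma

/-!
Two identities carry the result, one for trees and one for the random orders of their subtrees.

**Stationarity and uniqueness.** Write `G` for the growth step from `m` to `m + 1` leaves and `D`
for the down-step in the opposite direction, so that the `(α, γ)`-chain has the transition matrix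
`K = D G`. If a tree is grown by one leaf and the down-step is then performed from an old leaf `i`,
either the new leaf is removed again, with total insertion weight one, or the new leaf is not
involved, and the result is the same as for the down-step from `i` followed by growth
(`rawGrowth_downLaw`). The down-step from the new leaf always removes it (`rawGrowth_downLaw_self`).
Summation over `i` yields the commutation relation `c • (G D) = a • 1 + b • (D G)` with `a + b = c`
and `b ≠ 0` apart from trivial cases (`growthMatrix_mul_downMatrix`). By induction on the number of
leaves, `D` maps the law of the growth process to its law one step earlier, whence this law is
stationary for `K` (`growthLaw_vecMul_chainKernel`). Conversely, if `μ` is stationary for `D G`,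
then `μ D` is stationary for `G D`, hence for the chain on trees with one leaf less, so `μ D` is
unique by induction, and so is `μ = μ D G` (`eq_growthLaw_of_stationary`).

**Intertwining.** For fixed shape, a sum over semi-planar trees factorizes over the branch points
(`sum_prod_order`), and under the kernel `liftKernel` the order at each branch point is that of the
tables of an ordered Chinese restaurant process. The locations of the semi-planar growth rule are
the steps of these processes, so growth commutes with the random ordering
(`sum_liftKernel_mul_growthRuleSP`). So does the down-step (`sum_liftKernel_downSP`): at a branch
point that is not the parent of the selected leaf, least labels are only relabelled increasingly
(the properties `Searched` of the outcome of the local search), while at the parent a table is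
deleted that is leftmost or has an older neighbour. Insertion of such a table changes the
probability of a table order by an explicit factor (`ocrpProb_insert`, `sum_ocrpProb_insertIdx`);
this factor is the search probability in the definition of the `(α, γ)`-chain. Together, with `Π̂`,
`K̂` for `liftKernel`, `semiPlanarKernel`, the rows satisfy `(Π̂ K̂)(t, y) = K(t, s) Π̂(s, y)` if
`y` projects to `s` (`sum_liftKernel_mul_semiPlanarKernel`). Summation over `y` gives the formula
for `K`, and its rows inherit from `Π̂` and `K̂` that they are probability distributions. For the
projected chain, the relation shows inductively that, given the past of the projection, the
semi-planar tree is a random ordering of its projection (`filterLaw_eq`), which is the Markov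
property (`isMarkovChain_proj`). Admissibility is preserved by `K`
(`admissible_of_chainKernel_ne_zero`), so that `Π̂` is stochastic at all trees that are visited.
-/

namespace AlphaGamma

/-! ### Least labels and ranks -/

theorem minLabel_mem {S : Finset ℕ} (h : S.Nonempty) : minLabel S ∈ S := by
  rw [minLabel, dif_pos h]; exact S.min'_mem h

theorem minLabel_le {S : Finset ℕ} {x : ℕ} (h : x ∈ S) : minLabel S ≤ x := by
  rw [minLabel, dif_pos ⟨x, h⟩]; exact S.min'_le x h

theorem minLabel_eq {S : Finset ℕ} {x : ℕ} (hx : x ∈ S) (h : ∀ y ∈ S, x ≤ y) : minLabel S = x :=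
  le_antisymm (minLabel_le hx) (h _ (minLabel_mem ⟨x, hx⟩))

@[simp] theorem minLabel_singleton (i : ℕ) : minLabel {i} = i := by simp [minLabel]

@[simp] theorem minLabel_empty : minLabel ∅ = 0 := by simp [minLabel]

theorem minLabel_insert_of_lt {S : Finset ℕ} {j : ℕ} (h : S.Nonempty) (hj : ∀ x ∈ S, x < j) :
    minLabel (insert j S) = minLabel S := by
  refine minLabel_eq (Finset.mem_insert_of_mem (minLabel_mem h)) fun y hy => ?_
  rcases Finset.mem_insert.1 hy with rfl | hy
  · exact (hj _ (minLabel_mem h)).le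
  · exact minLabel_le hy

theorem mem_children {t : Finset (Finset ℕ)} {v D : Finset ℕ} :
    D ∈ children t v ↔ D ∈ t ∧ D ⊂ v ∧ ∀ E ∈ t, ¬ (D ⊂ E ∧ E ⊂ v) := by
  simp [children]

theorem mem_branchPoints {t : Finset (Finset ℕ)} {v : Finset ℕ} :
    v ∈ branchPoints t ↔ v ∈ t ∧ 2 ≤ v.card := by
  simp [branchPoints]

theorem children_subset (t : Finset (Finset ℕ)) (v : Finset ℕ) : children t v ⊆ t :=
  Finset.filter_subset _ _

section RankBy

variable {β : Type*} {M : Finset β} {f : β → ℕ}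

theorem card_filter_le_le_iff {x y : β} (hx : x ∈ M) :
    (M.filter fun z => f z ≤ f x).card ≤ (M.filter fun z => f z ≤ f y).card ↔ f x ≤ f y := by
  constructor
  · intro h
    by_contra! hlt
    have hss : (M.filter fun z => f z ≤ f y) ⊂ (M.filter fun z => f z ≤ f x) := by
      rw [Finset.ssubset_iff_of_subset]
      · exact ⟨x, by simp [hx], by simp [hlt]⟩
      · intro z hz
        simp only [Finset.mem_filter] at hz ⊢
        exact ⟨hz.1, hz.2.trans hlt.le⟩
    exact absurd (Finset.card_lt_card hss) (by omega)
  · intro h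
    refine Finset.card_le_card fun z hz => ?_
    simp only [Finset.mem_filter] at hz ⊢
    exact ⟨hz.1, hz.2.trans h⟩

theorem exists_card_filter_le_eq (hf : Set.InjOn f M) {r : ℕ} (h1 : 1 ≤ r) (h2 : r ≤ M.card) :
    ∃ x ∈ M, (M.filter fun z => f z ≤ f x).card = r := by
  classical
  have hinj : Set.InjOn (fun x => (M.filter fun z => f z ≤ f x).card) (M : Set β) := by
    intro x hx y hy hxy
    refine hf hx hy (le_antisymm ?_ ?_)
    · exact (card_filter_le_le_iff hx).1 hxy.le
    · exact (card_filter_le_le_iff hy).1 hxy.ge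
  have hmaps : Set.MapsTo (fun x => (M.filter fun z => f z ≤ f x).card) (M : Set β)
      (Finset.Icc 1 M.card : Finset ℕ) := by
    intro x hx
    simp only [Finset.coe_Icc, Set.mem_Icc]
    exact ⟨Finset.card_pos.2 ⟨x, by simpa using hx⟩, Finset.card_le_card (Finset.filter_subset _ _)⟩
  have := Finset.surjOn_of_injOn_of_card_le _ hmaps hinj (by simp)
  obtain ⟨x, hx, hxr⟩ := this (show r ∈ ((Finset.Icc 1 M.card : Finset ℕ) : Set ℕ) by simp; omega)
  exact ⟨x, hx, hxr⟩

end RankBy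

/-! ### Parents and children in a tree -/

namespace IsTree

variable {A : Finset ℕ} {t : Finset (Finset ℕ)}

/-- In a tree, `D` is a child of `u` exactly if `u` is the least vertex strictly above `D`. -/
theorem mem_children_iff (ht : IsTree A t) {u D : Finset ℕ} (hu : u ∈ t) :
    D ∈ children t u ↔ D ∈ t ∧ D ⊂ u ∧ ∀ E ∈ t, D ⊂ E → u ⊆ E := by
  rw [mem_children]
  refine and_congr_right fun hD => and_congr_right fun hDu => forall₂_congr fun E hE => ?_
  constructor
  · intro h hDE
    rcases ht.laminar u hu E hE with h1 | h1 | h1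
    · exact h1
    · by_contra h2
      exact h ⟨hDE, h1, h2⟩
    · obtain ⟨x, hx⟩ := ht.nonempty_of_mem D hD
      exact absurd (hDE.subset hx) (Finset.disjoint_left.1 h1 (hDu.subset hx))
  · rintro h ⟨h1, h2⟩
    exact h2.2 (h h1)

theorem exists_mem_children (ht : IsTree A t) {C : Finset ℕ} (hC : C ∈ t) (hCA : C ≠ A) :
    ∃ P ∈ t, C ∈ children t P := by
  have hne : (t.filter (fun D => C ⊂ D)).Nonempty :=
    ⟨A, by simp [ht.top_mem, (ht.subset_of_mem C hC).ssubset_of_ne hCA]⟩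
  obtain ⟨P, hP, hmin⟩ := Finset.exists_min_image _ Finset.card hne
  simp only [Finset.mem_filter] at hP hmin
  refine ⟨P, hP.1, (ht.mem_children_iff hP.1).2 ⟨hC, hP.2, fun E hE hCE => ?_⟩⟩
  rcases ht.laminar P hP.1 E hE with h1 | h1 | h1
  · exact h1
  · exact (Finset.eq_of_subset_of_card_le h1 (hmin E ⟨hE, hCE⟩)).ge
  · obtain ⟨x, hx⟩ := ht.nonempty_of_mem C hC
    exact absurd (hCE.subset hx) (Finset.disjoint_left.1 h1 (hP.2.subset hx))

theorem sup_eq (ht : IsTree A t) : t.sup id = A :=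
  le_antisymm (Finset.sup_le fun C hC => ht.subset_of_mem C hC)
    (Finset.le_sup (f := id) ht.top_mem)

theorem parent_eq (ht : IsTree A t) {C P : Finset ℕ} (hP : P ∈ t) (h : C ∈ children t P) :
    parent t C = P := by
  obtain ⟨hC, hCP, hmin⟩ := (ht.mem_children_iff hP).1 h
  ext x
  simp only [parent, ht.sup_eq, Finset.mem_filter]
  exact ⟨fun hx => hx.2 P hP hCP,
    fun hx => ⟨ht.subset_of_mem P hP hx, fun D hD hCD => hmin D hD hCD hx⟩⟩

theorem parent_top (ht : IsTree A t) : parent t A = A := by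
  ext x
  simp only [parent, ht.sup_eq, Finset.mem_filter, and_iff_left_iff_imp]
  exact fun _ D hD h => absurd (ht.subset_of_mem D hD) h.2

theorem parent_mem (ht : IsTree A t) {C : Finset ℕ} (hC : C ∈ t) (hCA : C ≠ A) :
    parent t C ∈ t ∧ C ∈ children t (parent t C) := by
  obtain ⟨P, hP, h⟩ := ht.exists_mem_children hC hCA
  rw [ht.parent_eq hP h]
  exact ⟨hP, h⟩

theorem exists_child_of_mem (ht : IsTree A t) {u : Finset ℕ} (hu : u ∈ branchPoints t) {x : ℕ}
    (hx : x ∈ u) : ∃ D ∈ children t u, x ∈ D := by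
  obtain ⟨hut, hu2⟩ := mem_branchPoints.1 hu
  have hne : (t.filter (fun D => D ⊂ u ∧ x ∈ D)).Nonempty := by
    refine ⟨{x}, ?_⟩
    simp only [Finset.mem_filter, Finset.mem_singleton, and_true]
    refine ⟨ht.singleton_mem x (ht.subset_of_mem u hut hx), ?_⟩
    refine (Finset.singleton_subset_iff.2 hx).ssubset_of_ne fun h => ?_
    rw [← h] at hu2
    simp at hu2
  obtain ⟨D, hD, hmax⟩ := Finset.exists_max_image _ Finset.card hne
  simp only [Finset.mem_filter] at hD hmax
  refine ⟨D, mem_children.2 ⟨hD.1, hD.2.1, fun E hE h => ?_⟩, hD.2.2⟩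
  have := hmax E ⟨hE, h.2, h.1.subset hD.2.2⟩
  exact absurd (Finset.card_lt_card h.1) (by omega)

theorem mem_branchPoints_of_children (ht : IsTree A t) {u D : Finset ℕ} (hu : u ∈ t)
    (hD : D ∈ children t u) : u ∈ branchPoints t := by
  rw [mem_children] at hD
  have h1 := Finset.card_lt_card hD.2.1
  have h2 := Finset.card_pos.2 (ht.nonempty_of_mem D hD.1)
  exact mem_branchPoints.2 ⟨hu, by omega⟩

theorem children_disjoint (ht : IsTree A t) {u D E : Finset ℕ} (hD : D ∈ children t u)
    (hE : E ∈ children t u) (hne : D ≠ E) : Disjoint D E := by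
  rw [mem_children] at hD hE
  rcases ht.laminar D hD.1 E hE.1 with h | h | h
  · exact absurd ⟨h.ssubset_of_ne hne, hE.2.1⟩ (hD.2.2 E hE.1)
  · exact absurd ⟨h.ssubset_of_ne hne.symm, hD.2.1⟩ (hE.2.2 D hD.1)
  · exact h

theorem children_nonempty (ht : IsTree A t) {u D : Finset ℕ} (hD : D ∈ children t u) :
    D.Nonempty := ht.nonempty_of_mem D (children_subset _ _ hD)

theorem child_eq_of_mem (ht : IsTree A t) {u D E : Finset ℕ} {x : ℕ} (hD : D ∈ children t u)
    (hE : E ∈ children t u) (hxD : x ∈ D) (hxE : x ∈ E) : D = E := by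
  by_contra h
  exact Finset.disjoint_left.1 (ht.children_disjoint hD hE h) hxD hxE

theorem minLabel_injOn (ht : IsTree A t) (u : Finset ℕ) :
    Set.InjOn minLabel (children t u : Set (Finset ℕ)) := fun _ hD _ hE h =>
  ht.child_eq_of_mem hD hE (minLabel_mem (ht.children_nonempty hD))
    (h ▸ minLabel_mem (ht.children_nonempty hE))

theorem two_le_card_children (ht : IsTree A t) {u : Finset ℕ} (hu : u ∈ branchPoints t) :
    2 ≤ (children t u).card := by
  have hut := (mem_branchPoints.1 hu).1
  obtain ⟨x, hx⟩ := ht.nonempty_of_mem u hut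
  obtain ⟨D, hD, -⟩ := ht.exists_child_of_mem hu hx
  obtain ⟨y, hy, hyD⟩ := Finset.exists_of_ssubset (mem_children.1 hD).2.1
  obtain ⟨E, hE, hyE⟩ := ht.exists_child_of_mem hu hy
  exact Finset.one_lt_card.2 ⟨D, hD, E, hE, fun h => hyD (h ▸ hyE)⟩

theorem rank_le_rank_iff {u D E : Finset ℕ} (hD : D ∈ children t u) :
    rank t u D ≤ rank t u E ↔ minLabel D ≤ minLabel E :=
  card_filter_le_le_iff hD

theorem rank_lt_rank_iff {u D E : Finset ℕ} (hE : E ∈ children t u) :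
    rank t u D < rank t u E ↔ minLabel D < minLabel E := by
  rw [← not_le, ← not_le, rank_le_rank_iff hE]

theorem rank_injOn (ht : IsTree A t) (u : Finset ℕ) :
    Set.InjOn (rank t u) (children t u : Set (Finset ℕ)) := fun _ hD _ hE h =>
  ht.minLabel_injOn u hD hE (le_antisymm ((rank_le_rank_iff hD).1 h.le)
    ((rank_le_rank_iff hE).1 h.ge))

theorem exists_rank_eq (ht : IsTree A t) {u : Finset ℕ} {r : ℕ} (h1 : 1 ≤ r)
    (h2 : r ≤ (children t u).card) : ∃ D ∈ children t u, rank t u D = r :=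
  exists_card_filter_le_eq (ht.minLabel_injOn u) h1 h2

theorem sum_card_children (ht : IsTree A t) :
    ∑ v ∈ branchPoints t, (children t v).card = t.card - 1 := by
  rw [← Finset.card_erase_of_mem ht.top_mem, ← Finset.card_biUnion]
  · congr 1
    ext D
    simp only [Finset.mem_biUnion, Finset.mem_erase]
    constructor
    · rintro ⟨v, hv, hD⟩
      have := mem_children.1 hD
      refine ⟨?_, this.1⟩
      rintro rfl
      exact this.2.1.2 (ht.subset_of_mem v (mem_branchPoints.1 hv).1)
    · rintro ⟨hDA, hD⟩
      obtain ⟨P, hP, h⟩ := ht.exists_mem_children hD hDA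
      exact ⟨P, ht.mem_branchPoints_of_children hP h, h⟩
  · intro v hv w hw hvw
    refine Finset.disjoint_left.2 fun D hDv hDw => hvw ?_
    rw [← ht.parent_eq (mem_branchPoints.1 hv).1 hDv, ht.parent_eq (mem_branchPoints.1 hw).1 hDw]

theorem filter_card_eq_one (ht : IsTree A t) :
    t.filter (fun C => C.card = 1) = A.image (fun i => {i}) := by
  ext C
  simp only [Finset.mem_filter, Finset.mem_image, Finset.card_eq_one]
  constructor
  · rintro ⟨hC, i, rfl⟩
    exact ⟨i, ht.subset_of_mem _ hC (by simp), rfl⟩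
  · rintro ⟨i, hi, rfl⟩
    exact ⟨ht.singleton_mem i hi, i, rfl⟩

theorem card_filter_card_eq_one (ht : IsTree A t) :
    (t.filter (fun C => C.card = 1)).card = A.card := by
  rw [ht.filter_card_eq_one, Finset.card_image_of_injective _ Finset.singleton_injective]

theorem filter_card_ne_one (ht : IsTree A t) :
    t.filter (fun C => ¬ C.card = 1) = branchPoints t := by
  ext C
  simp only [Finset.mem_filter, mem_branchPoints, and_congr_right_iff]
  intro hC
  have := Finset.card_pos.2 (ht.nonempty_of_mem C hC)
  omega

/-- The total insertion weight of a tree with `m` leaves is `m - α`. -/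
theorem sum_weights (ht : IsTree A t) (α γ : ℝ) :
    ∑ C ∈ t, edgeWeight α γ C +
      ∑ C ∈ branchPoints t, ((((children t C).card : ℝ) - 1) * α - γ) = A.card - α := by
  have h1 : ∑ C ∈ t, edgeWeight α γ C = A.card * (1 - α) + (branchPoints t).card * γ := by
    simp only [edgeWeight]
    rw [Finset.sum_ite, ht.filter_card_ne_one]
    simp only [Finset.sum_const, nsmul_eq_mul, ht.card_filter_card_eq_one]
  have h2 := ht.sum_card_children
  have h3 : t.card = A.card + (branchPoints t).card := by
    rw [← ht.card_filter_card_eq_one, ← ht.filter_card_ne_one,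
      Finset.card_filter_add_card_filter_not]
  have h4 : 0 < t.card := Finset.card_pos.2 ⟨A, ht.top_mem⟩
  have h5 : (∑ v ∈ branchPoints t, ((children t v).card : ℝ)) =
      A.card + (branchPoints t).card - 1 := by
    rw [← Nat.cast_sum, h2, h3, Nat.cast_sub (by omega)]
    push_cast
    ring
  have h6 : ∑ C ∈ branchPoints t, ((((children t C).card : ℝ) - 1) * α - γ) =
      (∑ v ∈ branchPoints t, ((children t v).card : ℝ)) * α - (branchPoints t).card * α
        - (branchPoints t).card * γ := by
    simp only [Finset.sum_sub_distrib, sub_mul, one_mul, Finset.sum_mul, Finset.sum_const,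
      nsmul_eq_mul]
  rw [h1, h6, h5]
  ring

end IsTree

/-! ### Trees with an inserted leaf -/

section Insert

variable {A C : Finset ℕ} {t : Finset (Finset ℕ)} {j : ℕ}

theorem mem_liftVertex {D : Finset ℕ} {x : ℕ} :
    x ∈ liftVertex C j D ↔ x ∈ D ∨ x = j ∧ C ⊆ D := by
  unfold liftVertex
  split_ifs with h <;> simp [h, or_comm]

theorem self_mem_liftVertex {D : Finset ℕ} (hj : j ∉ D) : j ∈ liftVertex C j D ↔ C ⊆ D := by
  simp [mem_liftVertex, hj]

theorem subset_liftVertex (D : Finset ℕ) : D ⊆ liftVertex C j D := fun _ h =>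
  mem_liftVertex.2 (.inl h)

theorem liftVertex_self : liftVertex C j C = insert j C := by simp [liftVertex]

theorem liftVertex_of_subset {D : Finset ℕ} (h : C ⊆ D) : liftVertex C j D = insert j D :=
  if_pos h

theorem liftVertex_of_not_subset {D : Finset ℕ} (h : ¬ C ⊆ D) : liftVertex C j D = D :=
  if_neg h

theorem image_liftVertex_children (t : Finset (Finset ℕ)) (C : Finset ℕ) (j : ℕ) :
    (children t C).image (liftVertex C j) = children t C := by
  ext X
  rw [Finset.mem_image]
  have h : ∀ D ∈ children t C, liftVertex C j D = D := fun D hD =>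
    liftVertex_of_not_subset (mem_children.1 hD).2.1.2
  constructor
  · rintro ⟨D, hD, rfl⟩
    rwa [h D hD]
  · exact fun hX => ⟨X, hX, h X hX⟩

theorem liftVertex_erase {D : Finset ℕ} (hj : j ∉ D) : (liftVertex C j D).erase j = D := by
  ext x
  simp only [Finset.mem_erase, mem_liftVertex]
  constructor
  · rintro ⟨h, h1 | h1⟩
    · exact h1
    · exact absurd h1.1 h
  · intro h
    exact ⟨fun h1 => hj (h1 ▸ h), .inl h⟩

theorem liftVertex_subset_iff {D E : Finset ℕ} (hD : j ∉ D) :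
    liftVertex C j D ⊆ liftVertex C j E ↔ D ⊆ E := by
  constructor
  · intro h x hx
    rcases mem_liftVertex.1 (h (subset_liftVertex D hx)) with h1 | h1
    · exact h1
    · exact absurd (h1.1 ▸ hx) hD
  · intro h x hx
    rcases mem_liftVertex.1 hx with h1 | h1
    · exact mem_liftVertex.2 (.inl (h h1))
    · exact mem_liftVertex.2 (.inr ⟨h1.1, h1.2.trans h⟩)

theorem liftVertex_ssubset_iff {D E : Finset ℕ} (hD : j ∉ D) (hE : j ∉ E) :
    liftVertex C j D ⊂ liftVertex C j E ↔ D ⊂ E := by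
  rw [Finset.ssubset_def, Finset.ssubset_def, liftVertex_subset_iff hD, liftVertex_subset_iff hE]

theorem liftVertex_inj {D E : Finset ℕ} (hD : j ∉ D) (hE : j ∉ E)
    (h : liftVertex C j D = liftVertex C j E) : D = E := by
  rw [← liftVertex_erase (C := C) hD, h, liftVertex_erase hE]

theorem liftVertex_nonempty {D : Finset ℕ} (hD : D.Nonempty) : (liftVertex C j D).Nonempty :=
  hD.mono (subset_liftVertex D)

theorem minLabel_liftVertex {D : Finset ℕ} (hD : D.Nonempty) (hj : ∀ x ∈ D, x < j) :
    minLabel (liftVertex C j D) = minLabel D := by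
  unfold liftVertex
  split_ifs
  · exact minLabel_insert_of_lt hD hj
  · rfl

theorem insertBranch_eq (t : Finset (Finset ℕ)) (C : Finset ℕ) (j : ℕ) :
    insertBranch t C j = insert {j} (t.image (liftVertex C j)) := by
  unfold insertBranch
  congr 1
  ext X
  simp only [Finset.mem_union, Finset.mem_filter, Finset.mem_image]
  constructor
  · rintro (⟨h1, h2⟩ | ⟨D, ⟨h1, h2⟩, rfl⟩)
    · exact ⟨X, h1, liftVertex_of_not_subset h2⟩
    · exact ⟨D, h1, liftVertex_of_subset h2⟩
  · rintro ⟨D, hD, rfl⟩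
    by_cases h : C ⊆ D
    · exact .inr ⟨D, ⟨hD, h⟩, (liftVertex_of_subset h).symm⟩
    · rw [liftVertex_of_not_subset h]
      exact .inl ⟨hD, h⟩

theorem insertEdge_eq (hC : C ∈ t) (j : ℕ) :
    insertEdge t C j = insert C (insertBranch t C j) := by
  ext X
  simp only [insertEdge, insertBranch, Finset.mem_insert, Finset.mem_union, Finset.mem_filter]
  constructor
  · rintro (h | ⟨h1, h2⟩ | h)
    · exact .inr (.inl h)
    · by_cases hX : C ⊆ X
      · left
        by_contra hne
        exact h2 (hX.ssubset_of_ne (Ne.symm hne))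
      · exact .inr (.inr (.inl ⟨h1, hX⟩))
    · exact .inr (.inr (.inr h))
  · rintro (rfl | h | ⟨h1, h2⟩ | h)
    · exact .inr (.inl ⟨hC, fun h => h.2 subset_rfl⟩)
    · exact .inl h
    · exact .inr (.inl ⟨h1, fun h => h2 h.1⟩)
    · exact .inr (.inr h)

theorem mem_insertBranch {X : Finset ℕ} :
    X ∈ insertBranch t C j ↔ X = {j} ∨ ∃ D ∈ t, liftVertex C j D = X := by
  simp [insertBranch_eq]

theorem mem_insertEdge (hC : C ∈ t) {X : Finset ℕ} :
    X ∈ insertEdge t C j ↔ X = C ∨ X = {j} ∨ ∃ D ∈ t, liftVertex C j D = X := by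
  rw [insertEdge_eq hC, Finset.mem_insert, mem_insertBranch]

theorem IsTree.notMem (ht : IsTree A t) (hj : j ∉ A) {D : Finset ℕ} (hD : D ∈ t) : j ∉ D :=
  fun h => hj (ht.subset_of_mem D hD h)

theorem IsTree.laminar_liftVertex (ht : IsTree A t) (hj : j ∉ A) (hC : C ∈ t) {D E : Finset ℕ}
    (hD : D ∈ t) (hE : E ∈ t) : liftVertex C j D ⊆ liftVertex C j E ∨
      liftVertex C j E ⊆ liftVertex C j D ∨ Disjoint (liftVertex C j D) (liftVertex C j E) := by
  rw [liftVertex_subset_iff (ht.notMem hj hD), liftVertex_subset_iff (ht.notMem hj hE)]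
  rcases ht.laminar D hD E hE with h | h | h
  · exact .inl h
  · exact .inr (.inl h)
  · refine .inr (.inr (Finset.disjoint_left.2 fun x hx hx' => ?_))
    rw [mem_liftVertex] at hx hx'
    obtain ⟨y, hy⟩ := ht.nonempty_of_mem C hC
    rcases hx with hx | ⟨rfl, hx⟩ <;> rcases hx' with hx' | ⟨hx1, hx'⟩
    · exact Finset.disjoint_left.1 h hx hx'
    · exact ht.notMem hj hD (hx1 ▸ hx)
    · exact ht.notMem hj hE hx'
    · exact Finset.disjoint_left.1 h (hx hy) (hx' hy)

theorem singleton_subset_or_disjoint (j : ℕ) (X : Finset ℕ) :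
    {j} ⊆ X ∨ Disjoint {j} X := by
  by_cases h : j ∈ X
  · exact .inl (Finset.singleton_subset_iff.2 h)
  · exact .inr (Finset.disjoint_singleton_left.2 h)

theorem IsTree.insertBranch (ht : IsTree A t) (hj : j ∉ A) (hC : C ∈ branchPoints t) :
    IsTree (insert j A) (insertBranch t C j) := by
  obtain ⟨hCt, hC2⟩ := mem_branchPoints.1 hC
  refine ⟨?_, ?_, ?_, ?_, ?_⟩
  · exact mem_insertBranch.2 (.inr ⟨A, ht.top_mem, liftVertex_of_subset (ht.subset_of_mem C hCt)⟩)
  · intro i hi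
    rcases Finset.mem_insert.1 hi with rfl | hi
    · exact mem_insertBranch.2 (.inl rfl)
    · refine mem_insertBranch.2 (.inr ⟨_, ht.singleton_mem i hi, liftVertex_of_not_subset ?_⟩)
      intro h
      have := Finset.card_le_card h
      simp at this
      omega
  · intro X hX
    rcases mem_insertBranch.1 hX with rfl | ⟨D, hD, rfl⟩
    · simp
    · exact liftVertex_nonempty (ht.nonempty_of_mem D hD)
  · intro X hX x hx
    rcases mem_insertBranch.1 hX with rfl | ⟨D, hD, rfl⟩
    · rw [Finset.mem_singleton.1 hx]; exact Finset.mem_insert_self _ _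
    · rcases mem_liftVertex.1 hx with h | h
      · exact Finset.mem_insert_of_mem (ht.subset_of_mem D hD h)
      · rw [h.1]; exact Finset.mem_insert_self _ _
  · intro X hX Y hY
    rcases mem_insertBranch.1 hX with rfl | ⟨D, hD, rfl⟩
    · rcases singleton_subset_or_disjoint j Y with h | h
      · exact .inl h
      · exact .inr (.inr h)
    · rcases mem_insertBranch.1 hY with rfl | ⟨E, hE, rfl⟩
      · rcases singleton_subset_or_disjoint j (liftVertex C j D) with h | h
        · exact .inr (.inl h)
        · exact .inr (.inr h.symm)
      · exact ht.laminar_liftVertex hj hCt hD hE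

theorem IsTree.laminar_insertEdge (ht : IsTree A t) (hC : C ∈ t) {D : Finset ℕ}
    (hD : D ∈ t) : C ⊆ liftVertex C j D ∨ liftVertex C j D ⊆ C ∨
      Disjoint C (liftVertex C j D) := by
  by_cases hCD : C ⊆ D
  · exact .inl (hCD.trans (subset_liftVertex D))
  · rw [liftVertex_of_not_subset hCD]
    exact ht.laminar C hC D hD

theorem IsTree.insertEdge (ht : IsTree A t) (hj : j ∉ A) (hC : C ∈ t) :
    IsTree (insert j A) (insertEdge t C j) := by
  refine ⟨?_, ?_, ?_, ?_, ?_⟩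
  · exact (mem_insertEdge hC).2 (.inr (.inr ⟨A, ht.top_mem,
      liftVertex_of_subset (ht.subset_of_mem C hC)⟩))
  · intro i hi
    rcases Finset.mem_insert.1 hi with rfl | hi
    · exact (mem_insertEdge hC).2 (.inr (.inl rfl))
    · by_cases h : C = {i}
      · exact (mem_insertEdge hC).2 (.inl h.symm)
      · refine (mem_insertEdge hC).2 (.inr (.inr ⟨_, ht.singleton_mem i hi,
          liftVertex_of_not_subset fun h1 => h ?_⟩))
        exact (Finset.subset_singleton_iff.1 h1).resolve_left
          (ht.nonempty_of_mem C hC).ne_empty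
  · intro X hX
    rcases (mem_insertEdge hC).1 hX with rfl | rfl | ⟨D, hD, rfl⟩
    · exact ht.nonempty_of_mem _ hC
    · simp
    · exact liftVertex_nonempty (ht.nonempty_of_mem D hD)
  · intro X hX x hx
    rcases (mem_insertEdge hC).1 hX with rfl | rfl | ⟨D, hD, rfl⟩
    · exact Finset.mem_insert_of_mem (ht.subset_of_mem _ hC hx)
    · rw [Finset.mem_singleton.1 hx]; exact Finset.mem_insert_self _ _
    · rcases mem_liftVertex.1 hx with h | h
      · exact Finset.mem_insert_of_mem (ht.subset_of_mem D hD h)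
      · rw [h.1]; exact Finset.mem_insert_self _ _
  · have key : ∀ X ∈ AlphaGamma.insertEdge t C j, C ⊆ X ∨ X ⊆ C ∨ Disjoint C X := by
      intro X hX
      rcases (mem_insertEdge hC).1 hX with rfl | rfl | ⟨D, hD, rfl⟩
      · exact .inl subset_rfl
      · exact .inr (.inr (Finset.disjoint_singleton_right.2 (ht.notMem hj hC)))
      · exact ht.laminar_insertEdge hC hD
    intro X hX Y hY
    rcases (mem_insertEdge hC).1 hX with rfl | rfl | ⟨D, hD, rfl⟩
    · exact key Y hY
    · rcases singleton_subset_or_disjoint j Y with h | h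
      · exact .inl h
      · exact .inr (.inr h)
    · rcases (mem_insertEdge hC).1 hY with rfl | rfl | ⟨E, hE, rfl⟩
      · rcases key _ hX with h | h | h
        · exact .inr (.inl h)
        · exact .inl h
        · exact .inr (.inr h.symm)
      · rcases singleton_subset_or_disjoint j (liftVertex C j D) with h | h
        · exact .inr (.inl h)
        · exact .inr (.inr h.symm)
      · exact ht.laminar_liftVertex hj hC hD hE

theorem IsTree.liftVertex_not_ssubset_singleton (ht : IsTree A t) {D : Finset ℕ} (hD : D ∈ t) :
    ¬ liftVertex C j D ⊂ {j} := by
  rw [Finset.ssubset_singleton_iff]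
  exact (liftVertex_nonempty (ht.nonempty_of_mem D hD)).ne_empty

theorem IsTree.singleton_ssubset_insert (ht : IsTree A t) (hj : j ∉ A) (hC : C ∈ t) :
    {j} ⊂ insert j C := by
  refine (Finset.singleton_subset_iff.2 (Finset.mem_insert_self _ _)).ssubset_of_ne fun h => ?_
  obtain ⟨x, hx⟩ := ht.nonempty_of_mem C hC
  have h1 : x ∈ ({j} : Finset ℕ) := h ▸ Finset.mem_insert_of_mem hx
  exact ht.notMem hj hC (Finset.mem_singleton.1 h1 ▸ hx)

/-- After the insertion of leaf `j` at the branch point `C`, all vertices keep their children (up to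
the new label), and `C` gets the additional child `{j}`. -/
theorem IsTree.children_insertBranch (ht : IsTree A t) (hj : j ∉ A) (hC : C ∈ branchPoints t)
    {u : Finset ℕ} (hu : u ∈ t) : children (AlphaGamma.insertBranch t C j) (liftVertex C j u) =
      (children t u).image (liftVertex C j) ∪ (if u = C then {{j}} else ∅) := by
  have hs := ht.insertBranch hj hC
  have hCt := (mem_branchPoints.1 hC).1
  have hj' : ∀ {D}, D ∈ t → j ∉ D := fun hD => ht.notMem hj hD
  have hmem : ∀ {D}, D ∈ t → liftVertex C j D ∈ AlphaGamma.insertBranch t C j := fun hD =>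
    mem_insertBranch.2 (.inr ⟨_, hD, rfl⟩)
  -- `liftVertex C j` preserves and reflects strict inclusion, hence the covering relation.
  have hch : ∀ {D}, D ∈ t → (liftVertex C j D ∈ children (AlphaGamma.insertBranch t C j)
      (liftVertex C j u) ↔ D ∈ children t u) := by
    intro D hD
    rw [hs.mem_children_iff (hmem hu), ht.mem_children_iff hu]
    simp only [hmem hD, hD, true_and, liftVertex_ssubset_iff (hj' hD) (hj' hu)]
    refine and_congr_right fun _ => ⟨fun h E hE hDE => ?_, fun h E hE hDE => ?_⟩
    · exact (liftVertex_subset_iff (hj' hu)).1 (h _ (hmem hE)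
        ((liftVertex_ssubset_iff (hj' hD) (hj' hE)).2 hDE))
    · rcases mem_insertBranch.1 hE with rfl | ⟨E', hE', rfl⟩
      · exact absurd hDE (ht.liftVertex_not_ssubset_singleton hD)
      · exact (liftVertex_subset_iff (hj' hu)).2
          (h E' hE' ((liftVertex_ssubset_iff (hj' hD) (hj' hE')).1 hDE))
  have hnew : {j} ∈ children (AlphaGamma.insertBranch t C j) (liftVertex C j u) ↔ u = C := by
    rw [hs.mem_children_iff (hmem hu)]
    constructor
    · rintro ⟨-, h1, h2⟩
      have h3 : C ⊆ u :=
        (self_mem_liftVertex (hj' hu)).1 (h1.1 (Finset.mem_singleton_self j))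
      have h4 := h2 _ (hmem hCt) (by
        rw [liftVertex_self]; exact ht.singleton_ssubset_insert hj hCt)
      exact subset_antisymm ((liftVertex_subset_iff (hj' hu)).1 h4) h3
    · rintro rfl
      refine ⟨mem_insertBranch.2 (.inl rfl), ?_, fun E hE hjE => ?_⟩
      · rw [liftVertex_self]; exact ht.singleton_ssubset_insert hj hCt
      · rcases mem_insertBranch.1 hE with rfl | ⟨E', hE', rfl⟩
        · exact absurd subset_rfl hjE.2
        · exact (liftVertex_subset_iff (hj' hCt)).2
            ((self_mem_liftVertex (hj' hE')).1 (hjE.1 (Finset.mem_singleton_self j)))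
  ext X
  simp only [Finset.mem_union, Finset.mem_image]
  constructor
  · intro hX
    rcases mem_insertBranch.1 (children_subset _ _ hX) with rfl | ⟨D, hD, rfl⟩
    · right; simp [hnew.1 hX]
    · exact .inl ⟨D, (hch hD).1 hX, rfl⟩
  · rintro (⟨D, hD, rfl⟩ | h)
    · exact (hch (children_subset _ _ hD)).2 hD
    · split_ifs at h with huC
      · rw [Finset.mem_singleton.1 h]; exact hnew.2 huC
      · simp at h

/-- The vertex `u` of the old tree, as a vertex of the tree with leaf `j` inserted into the edge
above `C`. In contrast to `liftVertex`, the vertex `C` corresponds to itself and not to the new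
branch point above it. -/
def edgeLift (C : Finset ℕ) (j : ℕ) (u : Finset ℕ) : Finset ℕ := if C ⊂ u then insert j u else u

theorem edgeLift_of_ne {u : Finset ℕ} (h : u ≠ C) : edgeLift C j u = liftVertex C j u := by
  unfold edgeLift liftVertex
  by_cases h1 : C ⊆ u
  · rw [if_pos h1, if_pos (h1.ssubset_of_ne h.symm)]
  · rw [if_neg h1, if_neg fun h2 => h1 h2.1]

theorem edgeLift_self : edgeLift C j C = C := by simp [edgeLift]

theorem mem_edgeLift {u : Finset ℕ} {x : ℕ} : x ∈ edgeLift C j u ↔ x ∈ u ∨ x = j ∧ C ⊂ u := by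
  unfold edgeLift
  split_ifs with h <;> simp [h, or_comm]

theorem edgeLift_erase {u : Finset ℕ} (hj : j ∉ u) : (edgeLift C j u).erase j = u := by
  by_cases h : u = C
  · subst h; rw [edgeLift_self, Finset.erase_eq_of_notMem hj]
  · rw [edgeLift_of_ne h, liftVertex_erase hj]

theorem edgeLift_mem (hC : C ∈ t) {u : Finset ℕ} (hu : u ∈ t) :
    edgeLift C j u ∈ insertEdge t C j := by
  by_cases h : u = C
  · subst h; rw [edgeLift_self]; exact (mem_insertEdge hC).2 (.inl rfl)
  · rw [edgeLift_of_ne h]; exact (mem_insertEdge hC).2 (.inr (.inr ⟨u, hu, rfl⟩))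

/-- After the insertion of leaf `j` into the edge above `C`, all old vertices keep their children
(up to the new label); in the parent of `C`, the child `C` is replaced by the new branch point. -/
theorem IsTree.children_insertEdge (ht : IsTree A t) (hj : j ∉ A) (hC : C ∈ t)
    {u : Finset ℕ} (hu : u ∈ t) : children (AlphaGamma.insertEdge t C j) (edgeLift C j u) =
      (children t u).image (liftVertex C j) := by
  have hs := ht.insertEdge hj hC
  have hj' : ∀ {D}, D ∈ t → j ∉ D := fun hD => ht.notMem hj hD
  have hmem : ∀ {D}, D ∈ t → liftVertex C j D ∈ AlphaGamma.insertEdge t C j := fun hD =>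
    (mem_insertEdge hC).2 (.inr (.inr ⟨_, hD, rfl⟩))
  have hins : C ⊂ insert j C := Finset.ssubset_insert (hj' hC)
  have hlt : ∀ {D}, D ∈ t → (liftVertex C j D ⊂ C ↔ D ⊂ C) := by
    intro D hD
    constructor
    · intro h
      have h1 : ¬ C ⊆ D := fun h1 => h.2 (h1.trans (subset_liftVertex D))
      rwa [liftVertex_of_not_subset h1] at h
    · intro h
      rwa [liftVertex_of_not_subset h.2]
  have hsub : ∀ {E}, C ⊆ liftVertex C j E → C ⊆ E := by
    intro E h x hx
    rcases mem_liftVertex.1 (h hx) with h1 | h1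
    · exact h1
    · exact h1.2 hx
  have hedge : ∀ {D}, D ∈ t → (edgeLift C j u ⊆ liftVertex C j D ↔ u ⊆ D) := by
    intro D hD
    by_cases h : u = C
    · subst h
      rw [edgeLift_self]
      exact ⟨hsub, fun h => h.trans (subset_liftVertex D)⟩
    · rw [edgeLift_of_ne h, liftVertex_subset_iff (hj' hu)]
  have hedge' : ∀ {D}, D ∈ t → (liftVertex C j D ⊂ edgeLift C j u ↔ D ⊂ u) := by
    intro D hD
    by_cases h : u = C
    · subst h
      rw [edgeLift_self, hlt hD]
    · rw [edgeLift_of_ne h, liftVertex_ssubset_iff (hj' hD) (hj' hu)]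
  have hch : ∀ {D}, D ∈ t → (liftVertex C j D ∈ children (AlphaGamma.insertEdge t C j)
      (edgeLift C j u) ↔ D ∈ children t u) := by
    intro D hD
    rw [hs.mem_children_iff (edgeLift_mem hC hu), ht.mem_children_iff hu]
    simp only [hmem hD, hD, true_and, hedge' hD]
    refine and_congr_right fun _ => ⟨fun h E hE hDE => ?_, fun h E hE hDE => ?_⟩
    · exact (hedge hE).1 (h _ (hmem hE)
        ((liftVertex_ssubset_iff (hj' hD) (hj' hE)).2 hDE))
    · rcases (mem_insertEdge hC).1 hE with rfl | rfl | ⟨E', hE', rfl⟩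
      · have h1 := h _ hC ((hlt hD).1 hDE)
        by_cases h2 : u = E
        · subst h2; rw [edgeLift_self]
        · rw [edgeLift_of_ne h2, liftVertex_of_not_subset fun h3 => h2 (subset_antisymm h1 h3)]
          exact h1
      · exact absurd hDE (ht.liftVertex_not_ssubset_singleton hD)
      · exact (hedge hE').2 (h E' hE' ((liftVertex_ssubset_iff (hj' hD) (hj' hE')).1 hDE))
  ext X
  simp only [Finset.mem_image]
  constructor
  · intro hX
    have hX' := (hs.mem_children_iff (edgeLift_mem hC hu)).1 hX
    have hCl : insert j C ∈ AlphaGamma.insertEdge t C j := by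
      rw [← liftVertex_self]; exact hmem hC
    -- Neither `C` nor `{j}` is a child of an old vertex, as `insert j C` lies between.
    rcases (mem_insertEdge hC).1 (children_subset _ _ hX) with rfl | rfl | ⟨D, hD, rfl⟩
    · exfalso
      have h1 := hX'.2.2 _ hCl hins
      rw [← liftVertex_self, hedge hC] at h1
      by_cases h2 : u = X
      · subst h2
        rw [edgeLift_self] at hX'
        exact hX'.2.1.2 subset_rfl
      · have h3 := hX'.2.1.1
        rw [edgeLift_of_ne h2] at h3
        exact h2 (subset_antisymm h1 (hsub h3))
    · exfalso
      have h1 := hX'.2.2 _ hCl (ht.singleton_ssubset_insert hj hC)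
      rw [← liftVertex_self, hedge hC] at h1
      have h3 := mem_edgeLift.1 (hX'.2.1.1 (Finset.mem_singleton_self j))
      rcases h3 with h3 | h3
      · exact hj' hu h3
      · exact h3.2.2 h1
    · exact ⟨D, (hch hD).1 hX, rfl⟩
  · rintro ⟨D, hD, rfl⟩
    exact (hch (children_subset _ _ hD)).2 hD

theorem IsTree.children_insertEdge_new (ht : IsTree A t) (hj : j ∉ A) (hC : C ∈ t) :
    children (AlphaGamma.insertEdge t C j) (insert j C) = {C, {j}} := by
  have hs := ht.insertEdge hj hC
  have hj' : ∀ {D}, D ∈ t → j ∉ D := fun hD => ht.notMem hj hD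
  have hmem : ∀ {D}, D ∈ t → liftVertex C j D ∈ AlphaGamma.insertEdge t C j := fun hD =>
    (mem_insertEdge hC).2 (.inr (.inr ⟨_, hD, rfl⟩))
  have hins : C ⊂ insert j C := Finset.ssubset_insert (hj' hC)
  have hCl : insert j C ∈ AlphaGamma.insertEdge t C j := by
    rw [← liftVertex_self]; exact hmem hC
  ext X
  rw [hs.mem_children_iff hCl, Finset.mem_insert, Finset.mem_singleton]
  constructor
  · rintro ⟨h1, h2, h3⟩
    rcases (mem_insertEdge hC).1 h1 with h | h | ⟨D, hD, rfl⟩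
    · exact .inl h
    · exact .inr h
    · exfalso
      rw [← liftVertex_self, liftVertex_ssubset_iff (hj' hD) (hj' hC)] at h2
      rw [liftVertex_of_not_subset h2.2] at h3
      exact hins.2 (h3 C ((mem_insertEdge hC).2 (.inl rfl)) h2)
  · rintro (rfl | rfl)
    · refine ⟨(mem_insertEdge hC).2 (.inl rfl), hins, fun E hE h => ?_⟩
      rcases (mem_insertEdge hC).1 hE with rfl | rfl | ⟨D, hD, rfl⟩
      · exact absurd subset_rfl h.2
      · rw [Finset.ssubset_singleton_iff] at h
        exact absurd h (ht.nonempty_of_mem _ hC).ne_empty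
      · rw [← liftVertex_self, liftVertex_subset_iff (hj' hC)]
        intro x hx
        rcases mem_liftVertex.1 (h.1 hx) with h1 | h1
        · exact h1
        · exact h1.2 hx
    · refine ⟨(mem_insertEdge hC).2 (.inr (.inl rfl)), ht.singleton_ssubset_insert hj hC,
        fun E hE h => ?_⟩
      rcases (mem_insertEdge hC).1 hE with rfl | rfl | ⟨D, hD, rfl⟩
      · exact absurd (h.1 (Finset.mem_singleton_self j)) (hj' hC)
      · exact absurd subset_rfl h.2
      · rw [← liftVertex_self, liftVertex_subset_iff (hj' hC)]
        exact (self_mem_liftVertex (hj' hD)).1 (h.1 (Finset.mem_singleton_self j))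

theorem IsTree.card_image_liftVertex (ht : IsTree A t) (hj : j ∉ A) (u : Finset ℕ) :
    ((children t u).image (liftVertex C j)).card = (children t u).card :=
  Finset.card_image_of_injOn fun _ hD _ hE h =>
    liftVertex_inj (ht.notMem hj (children_subset _ _ hD)) (ht.notMem hj (children_subset _ _ hE)) h

theorem IsTree.card_children_insertEdge (ht : IsTree A t) (hj : j ∉ A) (hC : C ∈ t)
    {u : Finset ℕ} (hu : u ∈ t) :
    (children (AlphaGamma.insertEdge t C j) (edgeLift C j u)).card = (children t u).card := by
  rw [ht.children_insertEdge hj hC hu, ht.card_image_liftVertex hj]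

theorem IsTree.card_children_insertBranch (ht : IsTree A t) (hj : j ∉ A)
    (hC : C ∈ branchPoints t) {u : Finset ℕ} (hu : u ∈ t) :
    (children (AlphaGamma.insertBranch t C j) (liftVertex C j u)).card =
      (children t u).card + if u = C then 1 else 0 := by
  rw [ht.children_insertBranch hj hC hu, Finset.card_union_of_disjoint,
    ht.card_image_liftVertex hj]
  · split_ifs <;> simp
  · split_ifs
    · rw [Finset.disjoint_singleton_right, Finset.mem_image]
      rintro ⟨D, hD, h⟩
      obtain ⟨x, hx⟩ := ht.children_nonempty hD
      have h1 : x ∈ ({j} : Finset ℕ) := h ▸ subset_liftVertex D hx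
      rw [Finset.mem_singleton] at h1
      exact ht.notMem hj (children_subset _ _ hD) (h1 ▸ hx)
    · exact Finset.disjoint_empty_right _

theorem IsTree.liftVertex_injOn (ht : IsTree A t) (hj : j ∉ A) :
    Set.InjOn (liftVertex C j) (t : Set (Finset ℕ)) := fun _ hD _ hE h =>
  liftVertex_inj (ht.notMem hj hD) (ht.notMem hj hE) h

theorem IsTree.edgeLift_injOn (ht : IsTree A t) (hj : j ∉ A) :
    Set.InjOn (edgeLift C j) (t : Set (Finset ℕ)) := fun _ hD _ hE h => by
  rw [← edgeLift_erase (C := C) (ht.notMem hj hD), h, edgeLift_erase (ht.notMem hj hE)]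

theorem card_le_card_edgeLift (u : Finset ℕ) : u.card ≤ (edgeLift C j u).card :=
  Finset.card_le_card fun _ h => mem_edgeLift.2 (.inl h)

theorem card_le_card_liftVertex (u : Finset ℕ) : u.card ≤ (liftVertex C j u).card :=
  Finset.card_le_card (subset_liftVertex u)

theorem branchPoints_insertBranch (hC : C ∈ branchPoints t) :
    branchPoints (AlphaGamma.insertBranch t C j) = (branchPoints t).image (liftVertex C j) := by
  obtain ⟨hCt, hC2⟩ := mem_branchPoints.1 hC
  ext X
  simp only [mem_branchPoints, Finset.mem_image, mem_insertBranch]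
  constructor
  · rintro ⟨rfl | ⟨D, hD, rfl⟩, h2⟩
    · simp at h2
    · refine ⟨D, ⟨hD, ?_⟩, rfl⟩
      by_cases h : C ⊆ D
      · exact hC2.trans (Finset.card_le_card h)
      · rwa [liftVertex_of_not_subset h] at h2
  · rintro ⟨D, ⟨hD, h2⟩, rfl⟩
    exact ⟨.inr ⟨D, hD, rfl⟩, h2.trans (card_le_card_liftVertex D)⟩

theorem IsTree.branchPoints_insertEdge (ht : IsTree A t) (hj : j ∉ A) (hC : C ∈ t) :
    branchPoints (AlphaGamma.insertEdge t C j) =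
      insert (insert j C) ((branchPoints t).image (edgeLift C j)) := by
  ext X
  simp only [mem_branchPoints, Finset.mem_image, mem_insertEdge hC, Finset.mem_insert]
  constructor
  · rintro ⟨rfl | rfl | ⟨D, hD, rfl⟩, h2⟩
    · exact .inr ⟨X, ⟨hC, h2⟩, edgeLift_self⟩
    · simp at h2
    · by_cases h : D = C
      · left; rw [h, liftVertex_self]
      · right
        refine ⟨D, ⟨hD, ?_⟩, edgeLift_of_ne h⟩
        by_cases h1 : C ⊆ D
        · have h3 := Finset.card_lt_card (h1.ssubset_of_ne (Ne.symm h))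
          have h4 := Finset.card_pos.2 (ht.nonempty_of_mem C hC)
          omega
        · rwa [liftVertex_of_not_subset h1] at h2
  · rintro (rfl | ⟨D, ⟨hD, h2⟩, rfl⟩)
    · refine ⟨.inr (.inr ⟨C, hC, liftVertex_self⟩), ?_⟩
      have h4 := Finset.card_pos.2 (ht.nonempty_of_mem C hC)
      rw [Finset.card_insert_of_notMem (ht.notMem hj hC)]
      omega
    · exact ⟨(mem_insertEdge hC).1 (edgeLift_mem hC hD), h2.trans (card_le_card_edgeLift D)⟩

theorem IsTree.insert_notMem_image_edgeLift (ht : IsTree A t) (hj : j ∉ A) (hC : C ∈ t) :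
    insert j C ∉ (branchPoints t).image (edgeLift C j) := by
  rw [Finset.mem_image]
  rintro ⟨D, hD, h⟩
  have hDt := (mem_branchPoints.1 hD).1
  have h1 := congrArg (fun X => X.erase j) h
  simp only [edgeLift_erase (ht.notMem hj hDt), Finset.erase_insert (ht.notMem hj hC)] at h1
  rw [h1, edgeLift_self] at h
  exact ht.notMem hj hC (h ▸ Finset.mem_insert_self j C)

end Insert

/-! ### Deletion of a leaf -/

/-- The label of the old tree that becomes the label `y` after the labels `i` and `k` have been
swapped, the leaf labelled `k` has been deleted, and the other leaves have been relabelled. -/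
def upLabel (i k y : ℕ) : ℕ := Equiv.swap i k (if k ≤ y then y + 1 else y)

/-- The label after swapping `i` and `k`, deleting leaf `k`, and relabelling, of the leaf with old
label `x ≠ i`. -/
def downLabel (i k x : ℕ) : ℕ :=
  if k < Equiv.swap i k x then Equiv.swap i k x - 1 else Equiv.swap i k x

/-- The vertex of the tree after swapping `i` and `k`, deleting leaf `k`, and relabelling, that
comes from the vertex `D`. -/
def downVertex (i k : ℕ) (D : Finset ℕ) : Finset ℕ := relabelSet k ((swapSet i k D).erase k)

theorem upLabel_downLabel {i k x : ℕ} (hx : x ≠ i) : upLabel i k (downLabel i k x) = x := by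
  have h : Equiv.swap i k x ≠ k := fun h => hx (by
    rw [← Equiv.swap_apply_right i k] at h; exact (Equiv.swap i k).injective (by simpa using h))
  unfold upLabel downLabel
  rw [Equiv.swap_apply_eq_iff]
  split_ifs <;> omega

theorem downLabel_upLabel (i k y : ℕ) : downLabel i k (upLabel i k y) = y := by
  unfold upLabel downLabel
  simp only [Equiv.swap_apply_self]
  split_ifs <;> omega

theorem upLabel_ne (i k y : ℕ) : upLabel i k y ≠ i := by
  unfold upLabel
  rw [Ne, Equiv.swap_apply_eq_iff, Equiv.swap_apply_left]
  split_ifs <;> omega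

theorem upLabel_injective (i k : ℕ) : Function.Injective (upLabel i k) := fun a b h => by
  rw [← downLabel_upLabel i k a, h, downLabel_upLabel]

theorem downVertex_eq_image (i k : ℕ) (D : Finset ℕ) :
    downVertex i k D = (D.erase i).image (downLabel i k) := by
  have : (swapSet i k D).erase k = (D.erase i).image (Equiv.swap i k) := by
    rw [swapSet, Finset.image_erase (Equiv.swap i k).injective, Equiv.swap_apply_left]
  rw [downVertex, this, relabelSet, Finset.image_image]
  rfl

theorem mem_downVertex {i k y : ℕ} {D : Finset ℕ} :
    y ∈ downVertex i k D ↔ upLabel i k y ∈ D := by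
  rw [downVertex_eq_image, Finset.mem_image]
  constructor
  · rintro ⟨x, hx, rfl⟩
    rw [Finset.mem_erase] at hx
    rw [upLabel_downLabel hx.1]
    exact hx.2
  · intro h
    exact ⟨_, Finset.mem_erase.2 ⟨upLabel_ne i k y, h⟩, downLabel_upLabel i k y⟩

theorem downVertex_subset_iff {i k : ℕ} {D E : Finset ℕ} :
    downVertex i k D ⊆ downVertex i k E ↔ D.erase i ⊆ E.erase i := by
  constructor
  · intro h x hx
    rw [Finset.mem_erase] at hx ⊢
    refine ⟨hx.1, ?_⟩
    have h1 : downLabel i k x ∈ downVertex i k E := h (mem_downVertex.2 (by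
      rw [upLabel_downLabel hx.1]; exact hx.2))
    rwa [mem_downVertex, upLabel_downLabel hx.1] at h1
  · intro h y hy
    rw [mem_downVertex] at hy ⊢
    exact (Finset.mem_erase.1 (h (Finset.mem_erase.2 ⟨upLabel_ne i k y, hy⟩))).2

theorem downVertex_mono {i k : ℕ} {D E : Finset ℕ} (h : D ⊆ E) :
    downVertex i k D ⊆ downVertex i k E := fun y hy => by
  rw [mem_downVertex] at hy ⊢; exact h hy

theorem downVertex_eq_iff {i k : ℕ} {D E : Finset ℕ} :
    downVertex i k D = downVertex i k E ↔ D.erase i = E.erase i := by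
  rw [subset_antisymm_iff, subset_antisymm_iff, downVertex_subset_iff, downVertex_subset_iff]

theorem card_downVertex (i k : ℕ) (D : Finset ℕ) :
    (downVertex i k D).card = (D.erase i).card := by
  rw [downVertex_eq_image, Finset.card_image_of_injOn]
  intro x hx y hy h
  simp only [Finset.coe_erase, Set.mem_sdiff, Set.mem_singleton_iff] at hx hy
  rw [← upLabel_downLabel (k := k) hx.2, h, upLabel_downLabel hy.2]

theorem downVertex_eq_empty_iff {i k : ℕ} {D : Finset ℕ} (hD : D.Nonempty) :
    downVertex i k D = ∅ ↔ D = {i} := by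
  rw [← Finset.card_eq_zero, card_downVertex, Finset.card_eq_zero, Finset.erase_eq_empty_iff]
  exact or_iff_right hD.ne_empty

theorem downVertex_nonempty {i k : ℕ} {D : Finset ℕ} (hD : D.Nonempty) (h : D ≠ {i}) :
    (downVertex i k D).Nonempty :=
  Finset.nonempty_iff_ne_empty.2 fun h1 => h ((downVertex_eq_empty_iff hD).1 h1)

section Down

variable {A : Finset ℕ} {t : Finset (Finset ℕ)} {i k : ℕ}

theorem relabelSet_eq_empty {D : Finset ℕ} : relabelSet k D = ∅ ↔ D = ∅ := by
  simp [relabelSet]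

theorem mem_downTree {X : Finset ℕ} :
    X ∈ downTree t i k ↔ X ≠ ∅ ∧ ∃ D ∈ t, downVertex i k D = X := by
  unfold downTree relabelTree deleteTree swapTree
  simp only [Finset.mem_image, Finset.mem_erase]
  constructor
  · rintro ⟨_, ⟨h1, _, ⟨D, hD, rfl⟩, rfl⟩, rfl⟩
    exact ⟨fun h => h1 (relabelSet_eq_empty.1 h), D, hD, rfl⟩
  · rintro ⟨h1, D, hD, rfl⟩
    exact ⟨_, ⟨fun h => h1 (by rw [downVertex, h]; rfl), _, ⟨D, hD, rfl⟩, rfl⟩, rfl⟩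

theorem IsTree.mem_downTree (ht : IsTree A t) {X : Finset ℕ} :
    X ∈ downTree t i k ↔ ∃ D ∈ t, D ≠ {i} ∧ downVertex i k D = X := by
  rw [AlphaGamma.mem_downTree]
  constructor
  · rintro ⟨h, D, hD, rfl⟩
    exact ⟨D, hD, fun h1 => h ((downVertex_eq_empty_iff (ht.nonempty_of_mem D hD)).2 h1), rfl⟩
  · rintro ⟨D, hD, h, rfl⟩
    exact ⟨fun h1 => h ((downVertex_eq_empty_iff (ht.nonempty_of_mem D hD)).1 h1), D, hD, rfl⟩

theorem IsTree.downVertex_mem (ht : IsTree A t) {D : Finset ℕ} (hD : D ∈ t) (h : D ≠ {i}) :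
    downVertex i k D ∈ downTree t i k := ht.mem_downTree.2 ⟨D, hD, h, rfl⟩

theorem mem_Icc_iff_upLabel {m : ℕ} (hi : i ∈ Finset.Icc 1 (m + 1))
    (hk : k ∈ Finset.Icc 1 (m + 1)) (y : ℕ) :
    upLabel i k y ∈ Finset.Icc 1 (m + 1) ↔ y ∈ Finset.Icc 1 m := by
  simp only [Finset.mem_Icc] at *
  unfold upLabel
  rw [Equiv.swap_apply_def]
  split_ifs <;> omega

theorem downVertex_Icc {m : ℕ} (hi : i ∈ Finset.Icc 1 (m + 1)) (hk : k ∈ Finset.Icc 1 (m + 1)) :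
    downVertex i k (Finset.Icc 1 (m + 1)) = Finset.Icc 1 m := by
  ext y
  rw [mem_downVertex, mem_Icc_iff_upLabel hi hk]

theorem IsTree.downTree {m : ℕ} (hm : 1 ≤ m) (ht : IsTree (Finset.Icc 1 (m + 1)) t)
    (hi : i ∈ Finset.Icc 1 (m + 1)) (hk : k ∈ Finset.Icc 1 (m + 1)) :
    IsTree (Finset.Icc 1 m) (downTree t i k) := by
  refine ⟨?_, ?_, ?_, ?_, ?_⟩
  · rw [← downVertex_Icc hi hk]
    refine ht.downVertex_mem ht.top_mem fun h => ?_
    have := congrArg Finset.card h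
    simp at this
    omega
  · intro y hy
    refine ht.mem_downTree.2 ⟨{upLabel i k y}, ht.singleton_mem _
      ((mem_Icc_iff_upLabel hi hk y).2 hy), ?_, ?_⟩
    · rw [Ne, Finset.singleton_inj]; exact upLabel_ne i k y
    · ext z
      rw [mem_downVertex, Finset.mem_singleton, Finset.mem_singleton,
        (upLabel_injective i k).eq_iff]
  · intro X hX
    exact Finset.nonempty_iff_ne_empty.2 (AlphaGamma.mem_downTree.1 hX).1
  · intro X hX
    obtain ⟨D, hD, -, rfl⟩ := ht.mem_downTree.1 hX
    rw [← downVertex_Icc hi hk]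
    exact downVertex_mono (ht.subset_of_mem D hD)
  · intro X hX Y hY
    obtain ⟨D, hD, -, rfl⟩ := ht.mem_downTree.1 hX
    obtain ⟨E, hE, -, rfl⟩ := ht.mem_downTree.1 hY
    rcases ht.laminar D hD E hE with h | h | h
    · exact .inl (downVertex_mono h)
    · exact .inr (.inl (downVertex_mono h))
    · refine .inr (.inr (Finset.disjoint_left.2 fun y hy hy' => ?_))
      rw [mem_downVertex] at hy hy'
      exact Finset.disjoint_left.1 h hy hy'

/-- The vertex `u` of `t` disappears when leaf `i` is deleted, since it is the parent of `i` and has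
only one other child. -/
def Contracted (t : Finset (Finset ℕ)) (i : ℕ) (u : Finset ℕ) : Prop := i ∈ u ∧ u.erase i ∈ t

instance (t : Finset (Finset ℕ)) (i : ℕ) (u : Finset ℕ) : Decidable (Contracted t i u) :=
  inferInstanceAs (Decidable (_ ∧ _))

/-- A vertex is contracted by the deletion of leaf `i` iff it has exactly two children, one of which
is leaf `i`. -/
theorem IsTree.contracted_iff (ht : IsTree A t) {u : Finset ℕ} (hu : u ∈ t) :
    Contracted t i u ↔ {i} ∈ children t u ∧ (children t u).card = 2 := by
  constructor
  · rintro ⟨hiu, hS⟩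
    have hne := ht.nonempty_of_mem _ hS
    have hss : {i} ⊂ u := by
      refine (Finset.singleton_subset_iff.2 hiu).ssubset_of_ne fun h => ?_
      rw [← h] at hne
      simp at hne
    -- No vertex lies strictly between `{i}` and `u`, since it would have to be laminar with
    -- `u.erase i`.
    have h1 : ∀ E ∈ t, {i} ⊂ E → u ⊆ E := by
      intro E hE hiE
      have hi : i ∈ E := hiE.1 (Finset.mem_singleton_self i)
      rcases ht.laminar u hu E hE with h | h | h
      · exact h
      · rcases ht.laminar E hE _ hS with h' | h' | h'
        · exact absurd (h' hi) (Finset.notMem_erase i u)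
        · intro x hx
          by_cases hxi : x = i
          · rw [hxi]; exact hi
          · exact h' (Finset.mem_erase.2 ⟨hxi, hx⟩)
        · exfalso
          apply hiE.2
          intro x hx
          by_contra hxi
          exact Finset.disjoint_left.1 h' hx
            (Finset.mem_erase.2 ⟨fun h => hxi (Finset.mem_singleton.2 h), h hx⟩)
      · exact absurd hi (Finset.disjoint_left.1 h hiu)
    have hic : {i} ∈ children t u :=
      (ht.mem_children_iff hu).2 ⟨ht.singleton_mem i (ht.subset_of_mem u hu hiu), hss, h1⟩
    have hSc : u.erase i ∈ children t u := by
      refine (ht.mem_children_iff hu).2 ⟨hS, Finset.erase_ssubset hiu, fun E hE hSE => ?_⟩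
      rcases ht.laminar u hu E hE with h | h | h
      · exact h
      · intro x hx
        by_cases hxi : x = i
        · subst hxi
          by_contra hxE
          exact hSE.2 fun y hy => Finset.mem_erase.2 ⟨fun h' => hxE (h' ▸ hy), h hy⟩
        · exact hSE.1 (Finset.mem_erase.2 ⟨hxi, hx⟩)
      · obtain ⟨x, hx⟩ := hne
        exact absurd (hSE.1 hx) (Finset.disjoint_left.1 h (Finset.mem_of_mem_erase hx))
    -- The children partition `u`, so `{i}` and `u.erase i` are the only ones.
    refine ⟨hic, ?_⟩
    have : children t u = {{i}, u.erase i} := by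
      ext D
      rw [Finset.mem_insert, Finset.mem_singleton]
      constructor
      · intro hD
        obtain ⟨x, hx⟩ := ht.children_nonempty hD
        by_cases hxi : x = i
        · exact .inl (ht.child_eq_of_mem hD hic hx (Finset.mem_singleton.2 hxi))
        · exact .inr (ht.child_eq_of_mem hD hSc hx
            (Finset.mem_erase.2 ⟨hxi, (mem_children.1 hD).2.1.1 hx⟩))
      · rintro (rfl | rfl) <;> assumption
    rw [this, Finset.card_pair]
    intro h
    exact Finset.notMem_erase i u (h ▸ Finset.mem_singleton_self i)
  · rintro ⟨hic, hc⟩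
    obtain ⟨S, hS, hSi⟩ := Finset.exists_mem_ne (by omega : 1 < (children t u).card) {i}
    have h2 : children t u = {{i}, S} := by
      symm
      apply Finset.eq_of_subset_of_card_le
      · intro x hx
        rw [Finset.mem_insert, Finset.mem_singleton] at hx
        rcases hx with rfl | rfl <;> assumption
      · rw [hc, Finset.card_pair hSi.symm]
    have hiu : i ∈ u := (mem_children.1 hic).2.1.1 (Finset.mem_singleton_self i)
    refine ⟨hiu, ?_⟩
    have : u.erase i = S := by
      ext x
      rw [Finset.mem_erase]
      constructor
      · rintro ⟨hxi, hx⟩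
        obtain ⟨D, hD, hxD⟩ := ht.exists_child_of_mem (ht.mem_branchPoints_of_children hu hic) hx
        rw [h2, Finset.mem_insert, Finset.mem_singleton] at hD
        rcases hD with rfl | rfl
        · exact absurd (Finset.mem_singleton.1 hxD) hxi
        · exact hxD
      · intro hx
        refine ⟨?_, (mem_children.1 hS).2.1.1 hx⟩
        rintro rfl
        exact hSi (ht.child_eq_of_mem hS hic hx (Finset.mem_singleton_self x))
    rw [this]
    exact children_subset _ _ hS

/-- Inclusion of vertices is unaffected by the deletion of leaf `i`, apart from the identification
of a contracted vertex with its remaining child. -/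
theorem IsTree.erase_subset_erase_iff (ht : IsTree A t) {D E : Finset ℕ} (hD : D ∈ t) (hE : E ∈ t)
    (hDi : D ≠ {i}) : D.erase i ⊆ E.erase i ↔ D ⊆ E ∨ (i ∈ D ∧ D.erase i = E) := by
  constructor
  · intro h
    have hne : (D.erase i).Nonempty := by
      rw [Finset.nonempty_iff_ne_empty, Ne, Finset.erase_eq_empty_iff, not_or]
      exact ⟨(ht.nonempty_of_mem D hD).ne_empty, hDi⟩
    rcases ht.laminar D hD E hE with h1 | h1 | h1
    · exact .inl h1
    · by_cases hiE : i ∈ E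
      · left
        intro x hx
        by_cases hxi : x = i
        · rwa [hxi]
        · exact Finset.mem_of_mem_erase (h (Finset.mem_erase.2 ⟨hxi, hx⟩))
      · by_cases hiD : i ∈ D
        · refine .inr ⟨hiD, subset_antisymm (h.trans (Finset.erase_subset _ _)) fun x hx => ?_⟩
          exact Finset.mem_erase.2 ⟨fun h' => hiE (h' ▸ hx), h1 hx⟩
        · left
          rw [Finset.erase_eq_of_notMem hiD] at h
          exact h.trans (Finset.erase_subset _ _)
    · obtain ⟨x, hx⟩ := hne
      exact absurd (Finset.mem_of_mem_erase (h hx))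
        (Finset.disjoint_left.1 h1 (Finset.mem_of_mem_erase hx))
  · rintro (h | ⟨h1, h2⟩)
    · exact Finset.erase_subset_erase i h
    · rw [← h2]; simp

/-- Each vertex of the reduced tree comes from exactly one vertex that is not contracted. -/
theorem IsTree.downVertex_injOn (ht : IsTree A t) : Set.InjOn (downVertex i k)
    {D | D ∈ t ∧ D ≠ {i} ∧ ¬ Contracted t i D} := by
  rintro D ⟨hD, hDi, hDc⟩ E ⟨hE, hEi, hEc⟩ h
  rw [downVertex_eq_iff] at h
  rcases (ht.erase_subset_erase_iff hD hE hDi).1 h.le with h1 | h1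
  · rcases (ht.erase_subset_erase_iff hE hD hEi).1 h.ge with h2 | h2
    · exact subset_antisymm h1 h2
    · exact absurd ⟨h2.1, h2.2 ▸ hD⟩ hEc
  · exact absurd ⟨h1.1, h1.2 ▸ hE⟩ hDc

theorem IsTree.downTree_eq_image (ht : IsTree A t) : AlphaGamma.downTree t i k =
    (t.filter fun D => D ≠ {i} ∧ ¬ Contracted t i D).image (downVertex i k) := by
  ext X
  rw [ht.mem_downTree, Finset.mem_image]
  constructor
  · rintro ⟨D, hD, hDi, rfl⟩
    by_cases h : Contracted t i D
    · refine ⟨D.erase i, Finset.mem_filter.2 ⟨h.2, ?_, ?_⟩, ?_⟩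
      · intro h1
        exact Finset.notMem_erase i D (h1 ▸ Finset.mem_singleton_self i)
      · exact fun h1 => Finset.notMem_erase i D h1.1
      · rw [downVertex_eq_iff, Finset.erase_idem]
    · exact ⟨D, Finset.mem_filter.2 ⟨hD, hDi, h⟩, rfl⟩
  · rintro ⟨D, hD, rfl⟩
    rw [Finset.mem_filter] at hD
    exact ⟨D, hD.1, hD.2.1, rfl⟩

theorem IsTree.card_downVertex_eq_one_iff (ht : IsTree A t) {D : Finset ℕ} (hD : D ∈ t)
    (hc : ¬ Contracted t i D) (hDi : D ≠ {i}) : (downVertex i k D).card = 1 ↔ D.card = 1 := by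
  rw [card_downVertex]
  by_cases hi : i ∈ D
  · constructor
    · intro h
      obtain ⟨x, hx⟩ := Finset.card_eq_one.1 h
      refine absurd ⟨hi, ?_⟩ hc
      rw [hx]
      refine ht.singleton_mem x (ht.subset_of_mem D hD ?_)
      exact Finset.mem_of_mem_erase (hx.symm ▸ Finset.mem_singleton_self x)
    · intro h
      obtain ⟨x, rfl⟩ := Finset.card_eq_one.1 h
      rw [Finset.mem_singleton] at hi
      exact absurd (by rw [hi]) hDi
  · rw [Finset.erase_eq_of_notMem hi]

theorem IsTree.branchPoints_downTree {m : ℕ} (hm : 1 ≤ m) (ht : IsTree (Finset.Icc 1 (m + 1)) t)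
    (hi : i ∈ Finset.Icc 1 (m + 1)) (hk : k ∈ Finset.Icc 1 (m + 1)) :
    branchPoints (AlphaGamma.downTree t i k) =
      ((branchPoints t).filter fun D => ¬ Contracted t i D).image (downVertex i k) := by
  have htd := ht.downTree hm hi hk
  rw [← htd.filter_card_ne_one, ← ht.filter_card_ne_one]
  ext X
  simp only [Finset.mem_filter, ht.downTree_eq_image, Finset.mem_image]
  constructor
  · rintro ⟨⟨D, ⟨hD, hDi, hDc⟩, rfl⟩, h⟩
    rw [ht.card_downVertex_eq_one_iff hD hDc hDi] at h
    exact ⟨D, ⟨⟨hD, h⟩, hDc⟩, rfl⟩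
  · rintro ⟨D, ⟨⟨hD, h⟩, hDc⟩, rfl⟩
    have hDi : D ≠ {i} := by rintro rfl; simp at h
    refine ⟨⟨D, ⟨hD, hDi, hDc⟩, rfl⟩, ?_⟩
    rwa [ht.card_downVertex_eq_one_iff hD hDc hDi]

/-- The vertices that are not contracted keep their children, except for the deleted leaf. -/
theorem IsTree.children_downTree {m : ℕ} (hm : 1 ≤ m) (ht : IsTree (Finset.Icc 1 (m + 1)) t)
    (hi : i ∈ Finset.Icc 1 (m + 1)) (hk : k ∈ Finset.Icc 1 (m + 1)) {u : Finset ℕ} (hu : u ∈ t)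
    (hui : u ≠ {i}) (huc : ¬ Contracted t i u) :
    children (AlphaGamma.downTree t i k) (downVertex i k u) =
      ((children t u).erase {i}).image (downVertex i k) := by
  have htd := ht.downTree hm hi hk
  have hss : ∀ {D E}, D.erase i ≠ E.erase i → (D ⊆ E) →
      downVertex i k D ⊂ downVertex i k E := fun h1 h2 =>
    (downVertex_mono h2).ssubset_of_ne fun h => h1 (downVertex_eq_iff.1 h)
  ext X
  rw [htd.mem_children_iff (ht.downVertex_mem hu hui)]
  constructor
  · rintro ⟨h1, h2, h3⟩
    -- If two vertices have the same image, `D` is chosen to be the larger, contracted one: this is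
    -- the child of `u`.
    obtain ⟨D, hD, hDi, hDX, hDr⟩ : ∃ D ∈ t, D ≠ {i} ∧ downVertex i k D = X ∧
        (i ∉ D → insert i D ∉ t) := by
      obtain ⟨D, hD, hDi, rfl⟩ := ht.mem_downTree.1 h1
      by_cases h : i ∉ D ∧ insert i D ∈ t
      · refine ⟨insert i D, h.2, fun h' => ?_, ?_, fun h' => ?_⟩
        · obtain ⟨x, hx⟩ := ht.nonempty_of_mem D hD
          have h4 : x ∈ ({i} : Finset ℕ) := h' ▸ Finset.mem_insert_of_mem hx
          exact h.1 (Finset.mem_singleton.1 h4 ▸ hx)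
        · rw [downVertex_eq_iff, Finset.erase_insert h.1, Finset.erase_eq_of_notMem h.1]
        · exact absurd (Finset.mem_insert_self i D) h'
      · exact ⟨D, hD, hDi, rfl, fun h4 h5 => h ⟨h4, h5⟩⟩
    subst hDX
    refine Finset.mem_image.2 ⟨D, Finset.mem_erase.2 ⟨hDi, ?_⟩, rfl⟩
    rw [ht.mem_children_iff hu]
    have hDu : D ⊆ u := by
      rcases (ht.erase_subset_erase_iff hD hu hDi).1 (downVertex_subset_iff.1 h2.1) with h | h
      · exact h
      · exfalso
        apply h2.2
        rw [downVertex_subset_iff, ← h.2]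
        simp
    refine ⟨hD, hDu.ssubset_of_ne ?_, fun E hE hDE => ?_⟩
    · rintro rfl; exact h2.2 subset_rfl
    · have hEi : E ≠ {i} := by
        rintro rfl
        rw [Finset.ssubset_singleton_iff] at hDE
        exact (ht.nonempty_of_mem D hD).ne_empty hDE
      have h4 := h3 _ (ht.downVertex_mem hE hEi) (hss (fun h => ?_) hDE.1)
      · rcases (ht.erase_subset_erase_iff hu hE hui).1 (downVertex_subset_iff.1 h4) with h | h
        · exact h
        · exact absurd ⟨h.1, h.2 ▸ hE⟩ huc
      · by_cases hiE : i ∈ E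
        · by_cases hiD : i ∈ D
          · rw [← Finset.insert_erase hiD, h, Finset.insert_erase hiE] at hDE
            exact hDE.2 subset_rfl
          · rw [Finset.erase_eq_of_notMem hiD] at h
            apply hDr hiD
            rw [h, Finset.insert_erase hiE]
            exact hE
        · have hiD : i ∉ D := fun h' => hiE (hDE.1 h')
          rw [Finset.erase_eq_of_notMem hiD, Finset.erase_eq_of_notMem hiE] at h
          exact hDE.2 h.ge
  · intro hX
    obtain ⟨D, hD, rfl⟩ := Finset.mem_image.1 hX
    obtain ⟨hDi, hDc⟩ := Finset.mem_erase.1 hD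
    obtain ⟨hDt, hDu, hmin⟩ := (ht.mem_children_iff hu).1 hDc
    refine ⟨ht.downVertex_mem hDt hDi, hss (fun h => ?_) hDu.1, fun Y hY hDY => ?_⟩
    · by_cases hiu : i ∈ u
      · by_cases hiD : i ∈ D
        · rw [← Finset.insert_erase hiD, h, Finset.insert_erase hiu] at hDu
          exact hDu.2 subset_rfl
        · rw [Finset.erase_eq_of_notMem hiD] at h
          exact huc ⟨hiu, h ▸ hDt⟩
      · have hiD : i ∉ D := fun h' => hiu (hDu.1 h')
        rw [Finset.erase_eq_of_notMem hiD, Finset.erase_eq_of_notMem hiu] at h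
        exact hDu.2 h.ge
    · obtain ⟨E, hE, hEi, rfl⟩ := ht.mem_downTree.1 hY
      rcases (ht.erase_subset_erase_iff hDt hE hDi).1 (downVertex_subset_iff.1 hDY.1) with h | h
      · refine downVertex_mono (hmin E hE (h.ssubset_of_ne ?_))
        rintro rfl
        exact hDY.2 subset_rfl
      · exfalso
        apply hDY.2
        rw [downVertex_subset_iff, ← h.2]
        simp

theorem IsTree.downVertex_injOn_children (ht : IsTree A t) (u : Finset ℕ) :
    Set.InjOn (downVertex i k) ((children t u).erase {i} : Finset (Finset ℕ)) := by
  intro D hD E hE h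
  simp only [Finset.coe_erase, Set.mem_sdiff, Finset.mem_coe, Set.mem_singleton_iff] at hD hE
  obtain ⟨y, hy⟩ := downVertex_nonempty (k := k) (ht.children_nonempty hD.1) hD.2
  exact ht.child_eq_of_mem hD.1 hE.1 (mem_downVertex.1 hy) (mem_downVertex.1 (h ▸ hy))

theorem IsTree.card_children_downTree {m : ℕ} (hm : 1 ≤ m)
    (ht : IsTree (Finset.Icc 1 (m + 1)) t)
    (hi : i ∈ Finset.Icc 1 (m + 1)) (hk : k ∈ Finset.Icc 1 (m + 1)) {u : Finset ℕ} (hu : u ∈ t)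
    (hui : u ≠ {i}) (huc : ¬ Contracted t i u) :
    (children (AlphaGamma.downTree t i k) (downVertex i k u)).card =
      ((children t u).erase {i}).card := by
  rw [ht.children_downTree hm hi hk hu hui huc,
    Finset.card_image_of_injOn (ht.downVertex_injOn_children u)]

end Down

/-! ### Growth and deletion as functionals -/

/-- The sum of `f` over all trees obtained from `t` by inserting leaf `j`, with the insertion
weights of the `(α, γ)`-growth rule. -/
noncomputable def rawGrowth (α γ : ℝ) (t : Finset (Finset ℕ)) (j : ℕ)
    (f : Finset (Finset ℕ) → ℝ) : ℝ :=
  ∑ C ∈ t, edgeWeight α γ C * f (insertEdge t C j) +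
  ∑ C ∈ branchPoints t, ((((children t C).card : ℝ) - 1) * α - γ) * f (insertBranch t C j)

/-- The expectation of `f` at the tree that the down-step of the `(α, γ)`-chain produces from `t`
if leaf `i` has been selected. -/
noncomputable def downLaw (α γ : ℝ) (t : Finset (Finset ℕ)) (i : ℕ)
    (f : Finset (Finset ℕ) → ℝ) : ℝ :=
  if (children t (parent t {i})).card = 2 then
    f (downTree t i (max i (max (firstBushMin t i) (secondBushMin t i))))
  else
    ∑ D ∈ children t (parent t {i}),
      searchProb α γ (children t (parent t {i})).card
        (rank t (parent t {i}) {i}) (rank t (parent t {i}) D) * f (downTree t i (minLabel D))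

/-- The search probabilities in a branch point with one more child are proportional to the previous
ones, on the children already present; the factor is the ratio of the insertion weights. -/
theorem searchProb_succ {α γ : ℝ} (hγ : 0 ≤ γ) (hγα : γ ≤ α) {c r r' : ℕ} (hc : 3 ≤ c)
    (h1 : 1 ≤ r) (h2 : r ≤ c) (h3 : r' ≤ c) :
    (((c : ℝ) - 1) * α - γ) * searchProb α γ (c + 1) r r' =
      (((c : ℝ) - 2) * α - γ) * searchProb α γ c r r' := by
  rcases eq_or_lt_of_le (hγ.trans hγα) with h0 | h0
  · have : γ = 0 := le_antisymm (hγα.trans h0.ge) hγ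
    subst this
    subst h0
    simp
  have hcR : (3 : ℝ) ≤ c := by exact_mod_cast hc
  have hd1 : ((c : ℝ) - 1) * α - γ ≠ 0 := by nlinarith
  have e1 : (((c + 1 : ℕ) : ℝ) - 2) * α - γ = ((c : ℝ) - 1) * α - γ := by push_cast; ring
  unfold searchProb
  rw [if_neg (by omega), e1]
  by_cases hc3 : c = 3
  · subst hc3
    rw [if_pos rfl]
    by_cases hr' : r' = 3
    · subst hr'
      by_cases hr : r ≤ 2
      · rw [if_pos ⟨hr, rfl⟩, if_pos rfl, mul_div_cancel₀ _ hd1]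
        push_cast; ring
      · obtain rfl : r = 3 := by omega
        rw [if_neg (by omega), if_neg (by omega), if_neg (by omega), if_pos (by omega),
          mul_div_cancel₀ _ hd1]
        simp
    · rw [if_neg (by omega), if_neg (by omega), if_neg (by omega), if_neg (by omega),
        if_neg hr']
      simp
  · have hc4 : (4 : ℝ) ≤ c := by exact_mod_cast (show 4 ≤ c by omega)
    have hd2 : ((c : ℝ) - 2) * α - γ ≠ 0 := by nlinarith
    rw [if_neg hc3]
    split_ifs <;> first | rw [mul_div_cancel₀ _ hd1, mul_div_cancel₀ _ hd2] | simp

theorem searchProb_last {α γ : ℝ} (hγ : 0 ≤ γ) (hγα : γ ≤ α) {c r : ℕ} (hc : 3 ≤ c)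
    (h2 : r ≤ c) :
    (((c : ℝ) - 1) * α - γ) * searchProb α γ (c + 1) r (c + 1) = α := by
  rcases eq_or_lt_of_le (hγ.trans hγα) with h0 | h0
  · have : γ = 0 := le_antisymm (hγα.trans h0.ge) hγ
    subst this
    subst h0
    simp
  have hcR : (3 : ℝ) ≤ c := by exact_mod_cast hc
  have hd1 : ((c : ℝ) - 1) * α - γ ≠ 0 := by nlinarith
  have e1 : (((c + 1 : ℕ) : ℝ) - 2) * α - γ = ((c : ℝ) - 1) * α - γ := by push_cast; ring
  unfold searchProb
  rw [if_neg (by omega), e1, if_neg (by omega)]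
  by_cases hr : r ≤ 2
  · rw [if_pos (by omega), mul_div_cancel₀ _ hd1]
  · rw [if_neg (by omega), if_pos (by omega), mul_div_cancel₀ _ hd1]

theorem searchProb_nonneg {α γ : ℝ} (hγ : 0 ≤ γ) (hγα : γ ≤ α) {c r r' : ℕ} (hc : 3 ≤ c) :
    0 ≤ searchProb α γ c r r' := by
  have h0 : 0 ≤ α := hγ.trans hγα
  have hcR : (3 : ℝ) ≤ c := by exact_mod_cast hc
  have hd : 0 ≤ ((c : ℝ) - 2) * α - γ := by nlinarith
  unfold searchProb
  split_ifs with h1 h2 h3 h4 h5 h6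
  · exact zero_le_one
  · exact le_rfl
  · exact div_nonneg (by linarith) hd
  · exact div_nonneg h0 hd
  · exact div_nonneg h0 hd
  · have : (3 : ℝ) ≤ r := by exact_mod_cast h6.1
    exact div_nonneg (by nlinarith) hd
  · exact le_rfl

section RankImage

variable {A : Finset ℕ} {t s : Finset (Finset ℕ)} {v v' : Finset ℕ} {F : Finset ℕ → Finset ℕ}

theorem rank_image (h : children s v' = (children t v).image F)
    (hF : Set.InjOn F (children t v : Set (Finset ℕ)))
    (hmin : ∀ D ∈ children t v, minLabel (F D) = minLabel D) {D : Finset ℕ}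
    (hD : D ∈ children t v) : rank s v' (F D) = rank t v D := by
  unfold rank
  rw [h, Finset.filter_image, Finset.card_image_of_injOn]
  · congr 1
    refine Finset.filter_congr fun E hE => ?_
    rw [hmin D hD, hmin E hE]
  · exact hF.mono (by intro x hx; exact (Finset.mem_filter.1 hx).1)

theorem rank_image_insert {j : ℕ} (h : children s v' = insert {j} ((children t v).image F))
    (hF : Set.InjOn F (children t v : Set (Finset ℕ)))
    (hmin : ∀ D ∈ children t v, minLabel (F D) = minLabel D)
    (hj : ∀ D ∈ children t v, minLabel D < j) {D : Finset ℕ}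
    (hD : D ∈ children t v) : rank s v' (F D) = rank t v D := by
  unfold rank
  rw [h, Finset.filter_insert, if_neg, Finset.filter_image, Finset.card_image_of_injOn]
  · congr 1
    refine Finset.filter_congr fun E hE => ?_
    rw [hmin D hD, hmin E hE]
  · exact hF.mono (by intro x hx; exact (Finset.mem_filter.1 hx).1)
  · rw [minLabel_singleton, hmin D hD]
    exact not_le.2 (hj D hD)

theorem rank_singleton_of_lt {j : ℕ}
    (hj : ∀ D ∈ children s v', minLabel D ≤ j) :
    rank s v' {j} = (children s v').card := by
  unfold rank
  congr 1
  rw [Finset.filter_true_of_mem]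
  simpa using hj

end RankImage

theorem IsTree.minLabel_le_of_subset {n : ℕ} {S : Finset ℕ} (h : S ⊆ Finset.Icc 1 n) :
    minLabel S ≤ n := by
  rcases S.eq_empty_or_nonempty with rfl | h1
  · simp
  · exact (Finset.mem_Icc.1 (h (minLabel_mem h1))).2

theorem parent_subset {A : Finset ℕ} {t : Finset (Finset ℕ)} (ht : IsTree A t) (C : Finset ℕ) :
    parent t C ⊆ A := by
  rw [← ht.sup_eq]; exact Finset.filter_subset _ _

theorem secondBushMin_le {n : ℕ} {t : Finset (Finset ℕ)} (ht : IsTree (Finset.Icc 1 n) t) (i : ℕ) :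
    secondBushMin t i ≤ n :=
  IsTree.minLabel_le_of_subset (Finset.sdiff_subset.trans (parent_subset ht _))

theorem firstBushMin_le {n : ℕ} {t : Finset (Finset ℕ)} (ht : IsTree (Finset.Icc 1 n) t) (i : ℕ) :
    firstBushMin t i ≤ n :=
  IsTree.minLabel_le_of_subset (Finset.sdiff_subset.trans (parent_subset ht _))

theorem minLabel_eq_of_subset_insert {S T : Finset ℕ} {j : ℕ} (hS : S.Nonempty)
    (h1 : S ⊆ T) (h2 : T ⊆ insert j S) (hj : ∀ x ∈ S, x < j) : minLabel T = minLabel S := by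
  refine minLabel_eq (h1 (minLabel_mem hS)) fun y hy => ?_
  rcases Finset.mem_insert.1 (h2 hy) with rfl | h
  · exact (hj _ (minLabel_mem hS)).le
  · exact minLabel_le h

section Commute

variable {m i k : ℕ} {t : Finset (Finset ℕ)} {C : Finset ℕ}

theorem upLabel_eq_succ_iff (hi : i ∈ Finset.Icc 1 m) (hk : k ∈ Finset.Icc 1 m) (y : ℕ) :
    upLabel i k y = m + 1 ↔ y = m := by
  simp only [Finset.mem_Icc] at *
  unfold upLabel
  rw [Equiv.swap_apply_def]
  split_ifs <;> omega

theorem downVertex_singleton_succ (hi : i ∈ Finset.Icc 1 m) (hk : k ∈ Finset.Icc 1 m) :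
    downVertex i k {m + 1} = {m} := by
  ext y
  rw [mem_downVertex, Finset.mem_singleton, Finset.mem_singleton, upLabel_eq_succ_iff hi hk]

theorem downVertex_liftVertex (ht : IsTree (Finset.Icc 1 m) t) (hi : i ∈ Finset.Icc 1 m)
    (hk : k ∈ Finset.Icc 1 m) (hC : C ∈ t) (hCi : C ≠ {i}) (hCc : ¬ Contracted t i C)
    {D : Finset ℕ} (hD : D ∈ t) : downVertex i k (liftVertex C (m + 1) D) =
      liftVertex (downVertex i k C) m (downVertex i k D) := by
  have h : downVertex i k C ⊆ downVertex i k D ↔ C ⊆ D := by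
    rw [downVertex_subset_iff, ht.erase_subset_erase_iff hC hD hCi]
    exact or_iff_left fun h => hCc ⟨h.1, h.2 ▸ hD⟩
  ext y
  rw [mem_downVertex, mem_liftVertex, mem_liftVertex, mem_downVertex, h,
    upLabel_eq_succ_iff hi hk]

theorem downTree_insertBranch (ht : IsTree (Finset.Icc 1 m) t) (hi : i ∈ Finset.Icc 1 m)
    (hk : k ∈ Finset.Icc 1 m) (hC : C ∈ t) (hCi : C ≠ {i}) (hCc : ¬ Contracted t i C) :
    downTree (insertBranch t C (m + 1)) i k =
      insertBranch (downTree t i k) (downVertex i k C) m := by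
  ext X
  rw [mem_downTree, mem_insertBranch]
  constructor
  · rintro ⟨h, Y, hY, rfl⟩
    rcases mem_insertBranch.1 hY with rfl | ⟨D, hD, rfl⟩
    · exact .inl (downVertex_singleton_succ hi hk)
    · right
      refine ⟨downVertex i k D, ht.downVertex_mem hD ?_,
        (downVertex_liftVertex ht hi hk hC hCi hCc hD).symm⟩
      rintro rfl
      apply h
      rw [downVertex_liftVertex ht hi hk hC hCi hCc hD]
      have h1 : downVertex i k {i} = ∅ := (downVertex_eq_empty_iff (by simp)).2 rfl
      rw [h1, liftVertex_of_not_subset]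
      rw [Finset.subset_empty, downVertex_eq_empty_iff (ht.nonempty_of_mem C hC)]
      exact hCi
  · rintro (rfl | ⟨Y, hY, rfl⟩)
    · exact ⟨by simp, _, mem_insertBranch.2 (.inl rfl), downVertex_singleton_succ hi hk⟩
    · obtain ⟨hne, D, hD, rfl⟩ := mem_downTree.1 hY
      refine ⟨(liftVertex_nonempty (Finset.nonempty_iff_ne_empty.2 hne)).ne_empty, _,
        mem_insertBranch.2 (.inr ⟨D, hD, rfl⟩), downVertex_liftVertex ht hi hk hC hCi hCc hD⟩

theorem downTree_insert (Y : Finset ℕ) (hY : downVertex i k Y ≠ ∅) :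
    downTree (insert Y t) i k = insert (downVertex i k Y) (downTree t i k) := by
  ext X
  simp only [mem_downTree, Finset.mem_insert]
  constructor
  · rintro ⟨h, D, rfl | hD, rfl⟩
    · exact .inl rfl
    · exact .inr ⟨h, D, hD, rfl⟩
  · rintro (rfl | ⟨h, D, hD, rfl⟩)
    · exact ⟨hY, Y, .inl rfl, rfl⟩
    · exact ⟨h, D, .inr hD, rfl⟩

theorem downTree_insertEdge (ht : IsTree (Finset.Icc 1 m) t) (hi : i ∈ Finset.Icc 1 m)
    (hk : k ∈ Finset.Icc 1 m) (hC : C ∈ t) (hCi : C ≠ {i}) (hCc : ¬ Contracted t i C) :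
    downTree (insertEdge t C (m + 1)) i k =
      insertEdge (downTree t i k) (downVertex i k C) m := by
  rw [insertEdge_eq hC, insertEdge_eq (ht.downVertex_mem hC hCi), downTree_insert,
    downTree_insertBranch ht hi hk hC hCi hCc]
  exact (downVertex_nonempty (ht.nonempty_of_mem C hC) hCi).ne_empty

theorem mem_downVertex_last (hi : i ∈ Finset.Icc 1 m) {D : Finset ℕ}
    (hD : D ⊆ Finset.Icc 1 (m + 1)) {y : ℕ} :
    y ∈ downVertex i (m + 1) D ↔ (y ≠ i ∧ y ≠ m + 1 ∧ y ∈ D) ∨ (y = i ∧ m + 1 ∈ D) := by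
  rw [mem_downVertex]
  have hD' : ∀ z ∈ D, z ≤ m + 1 := fun z hz => (Finset.mem_Icc.1 (hD hz)).2
  unfold upLabel
  rw [Finset.mem_Icc] at hi
  rw [Equiv.swap_apply_def]
  split_ifs with h1 h2 h3 h4 h5
  · omega
  · omega
  · constructor
    · intro h; have := hD' _ h; omega
    · rintro (⟨-, h, h'⟩ | ⟨h, -⟩)
      · have := hD' _ h'; omega
      · omega
  · subst h4; simp
  · omega
  · have : y ≠ m + 1 := by omega
    simp [h4, this]

theorem downVertex_last_of_notMem (hi : i ∈ Finset.Icc 1 m) {D : Finset ℕ}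
    (hD : D ⊆ Finset.Icc 1 m) : downVertex i (m + 1) D = D.erase i := by
  have hD' : ∀ z ∈ D, z ≤ m := fun z hz => (Finset.mem_Icc.1 (hD hz)).2
  ext y
  rw [mem_downVertex_last hi (hD.trans (Finset.Icc_subset_Icc_right (by omega))), Finset.mem_erase]
  constructor
  · rintro (⟨h1, -, h2⟩ | ⟨-, h2⟩)
    · exact ⟨h1, h2⟩
    · have := hD' _ h2; omega
  · rintro ⟨h1, h2⟩
    exact .inl ⟨h1, by have := hD' _ h2; omega, h2⟩

theorem downVertex_last_insert (hi : i ∈ Finset.Icc 1 m) {D : Finset ℕ}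
    (hD : D ⊆ Finset.Icc 1 m) : downVertex i (m + 1) (insert (m + 1) D) = insert i D := by
  have hD' : ∀ z ∈ D, z ≤ m := fun z hz => (Finset.mem_Icc.1 (hD hz)).2
  ext y
  rw [mem_downVertex_last hi, Finset.mem_insert, Finset.mem_insert, Finset.mem_insert]
  · constructor
    · rintro (⟨h1, h2, h3 | h3⟩ | ⟨h1, -⟩)
      · exact absurd h3 h2
      · exact .inr h3
      · exact .inl h1
    · rintro (rfl | h)
      · exact .inr ⟨rfl, .inl rfl⟩
      · by_cases hyi : y = i
        · exact .inr ⟨hyi, .inl rfl⟩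
        · exact .inl ⟨hyi, by have := hD' _ h; omega, .inr h⟩
  · intro x hx
    rcases Finset.mem_insert.1 hx with rfl | hx
    · simp
    · exact Finset.Icc_subset_Icc_right (by omega) (hD hx)

/-- Inserting the leaf `m + 1` next to leaf `i` or as a child of a vertex `C` whose child is leaf
`i`, and then replacing leaf `i` by leaf `m + 1`, gives back the original tree. -/
theorem downTree_insertBranch_last (ht : IsTree (Finset.Icc 1 m) t) (hi : i ∈ Finset.Icc 1 m)
    (hiC : i ∈ C) (hmin : ∀ D ∈ t, i ∈ D → C ⊆ D ∨ D = {i}) :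
    downTree (insertBranch t C (m + 1)) i (m + 1) = t := by
  have hlift : ∀ D ∈ t, C ⊆ D → downVertex i (m + 1) (liftVertex C (m + 1) D) = D := by
    intro D hD h
    rw [liftVertex_of_subset h, downVertex_last_insert hi (ht.subset_of_mem D hD),
      Finset.insert_eq_of_mem (h hiC)]
  have hlift' : ∀ D ∈ t, ¬ C ⊆ D → downVertex i (m + 1) (liftVertex C (m + 1) D) = D.erase i := by
    intro D hD h
    rw [liftVertex_of_not_subset h, downVertex_last_of_notMem hi (ht.subset_of_mem D hD)]
  have hnew : downVertex i (m + 1) {m + 1} = {i} := by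
    simpa using downVertex_last_insert hi (Finset.empty_subset _)
  ext X
  rw [mem_downTree]
  constructor
  · rintro ⟨h, Y, hY, rfl⟩
    rcases mem_insertBranch.1 hY with rfl | ⟨D, hD, rfl⟩
    · rw [hnew]; exact ht.singleton_mem i hi
    · by_cases hCD : C ⊆ D
      · rwa [hlift D hD hCD]
      · rw [hlift' D hD hCD] at h ⊢
        by_cases hiD : i ∈ D
        · rcases hmin D hD hiD with h1 | rfl
          · exact absurd h1 hCD
          · simp at h
        · rwa [Finset.erase_eq_of_notMem hiD]
  · intro hX
    refine ⟨(ht.nonempty_of_mem X hX).ne_empty, ?_⟩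
    by_cases hXi : X = {i}
    · exact ⟨_, mem_insertBranch.2 (.inl rfl), hXi ▸ hnew⟩
    · refine ⟨_, mem_insertBranch.2 (.inr ⟨X, hX, rfl⟩), ?_⟩
      by_cases hCX : C ⊆ X
      · exact hlift X hX hCX
      · rw [hlift' X hX hCX, Finset.erase_eq_of_notMem]
        intro hiX
        exact (hmin X hX hiX).elim hCX hXi

theorem downTree_insertEdge_last (ht : IsTree (Finset.Icc 1 m) t) (hi : i ∈ Finset.Icc 1 m)
    (hC : C ∈ t) (hiC : i ∈ C) (hmin : ∀ D ∈ t, i ∈ D → C ⊆ D ∨ D = {i})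
    (hCi : C = {i} ∨ C.erase i ∈ t) :
    downTree (insertEdge t C (m + 1)) i (m + 1) = t := by
  rw [insertEdge_eq hC]
  have h1 := downVertex_last_of_notMem hi (ht.subset_of_mem C hC)
  rcases hCi with rfl | h
  · rw [← downTree_insertBranch_last ht hi hiC hmin]
    rw [show ({i} : Finset ℕ).erase i = ∅ by simp] at h1
    ext X
    simp only [mem_downTree, Finset.mem_insert]
    rw [downTree_insertBranch_last ht hi hiC hmin]
    constructor
    · rintro ⟨h2, D, rfl | hD, rfl⟩
      · exact absurd h1 h2
      · exact ⟨h2, D, hD, rfl⟩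
    · rintro ⟨h2, D, hD, rfl⟩
      exact ⟨h2, D, .inr hD, rfl⟩
  · rw [downTree_insert, downTree_insertBranch_last ht hi hiC hmin, h1,
      Finset.insert_eq_of_mem h]
    rw [h1]
    exact (ht.nonempty_of_mem _ h).ne_empty

end Commute

/-! ### The down-step after an insertion -/

theorem downLaw_eq {A : Finset ℕ} {t : Finset (Finset ℕ)} (ht : IsTree A t) {i : ℕ}
    {v : Finset ℕ} (hv : v ∈ t) (hiv : {i} ∈ children t v) (α γ : ℝ)
    (f : Finset (Finset ℕ) → ℝ) : downLaw α γ t i f =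
    if (children t v).card = 2 then
      f (downTree t i (max i (max (firstBushMin t i) (secondBushMin t i))))
    else ∑ D ∈ children t v, searchProb α γ (children t v).card (rank t v {i}) (rank t v D) *
      f (downTree t i (minLabel D)) := by
  rw [downLaw, ht.parent_eq hv hiv]

section Down

variable {m i : ℕ} {t : Finset (Finset ℕ)} {v : Finset ℕ} {α γ : ℝ}

theorem succ_notMem_Icc (m : ℕ) : m + 1 ∉ Finset.Icc 1 m := by simp

theorem insert_succ_Icc (m : ℕ) : insert (m + 1) (Finset.Icc 1 m) = Finset.Icc 1 (m + 1) := by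
  ext x; simp only [Finset.mem_insert, Finset.mem_Icc]; omega

theorem IsTree.insertEdge_succ (ht : IsTree (Finset.Icc 1 m) t) {C : Finset ℕ} (hC : C ∈ t) :
    IsTree (Finset.Icc 1 (m + 1)) (AlphaGamma.insertEdge t C (m + 1)) := by
  rw [← insert_succ_Icc]; exact ht.insertEdge (succ_notMem_Icc m) hC

theorem IsTree.insertBranch_succ (ht : IsTree (Finset.Icc 1 m) t) {C : Finset ℕ}
    (hC : C ∈ branchPoints t) :
    IsTree (Finset.Icc 1 (m + 1)) (AlphaGamma.insertBranch t C (m + 1)) := by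
  rw [← insert_succ_Icc]; exact ht.insertBranch (succ_notMem_Icc m) hC

theorem IsTree.lt_succ (ht : IsTree (Finset.Icc 1 m) t) {D : Finset ℕ} (hD : D ∈ t) {x : ℕ}
    (hx : x ∈ D) : x < m + 1 :=
  Nat.lt_succ_of_le (Finset.mem_Icc.1 (ht.subset_of_mem D hD hx)).2

theorem IsTree.minLabel_lt_succ (ht : IsTree (Finset.Icc 1 m) t) {D : Finset ℕ} (hD : D ∈ t) :
    minLabel D < m + 1 := ht.lt_succ hD (minLabel_mem (ht.nonempty_of_mem D hD))

theorem IsTree.minLabel_mem_Icc (ht : IsTree (Finset.Icc 1 m) t) {D : Finset ℕ} (hD : D ∈ t) :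
    minLabel D ∈ Finset.Icc 1 m := ht.subset_of_mem D hD (minLabel_mem (ht.nonempty_of_mem D hD))

theorem IsTree.minLabel_liftVertex (ht : IsTree (Finset.Icc 1 m) t) {C D : Finset ℕ}
    (hD : D ∈ t) : minLabel (liftVertex C (m + 1) D) = minLabel D :=
  AlphaGamma.minLabel_liftVertex (ht.nonempty_of_mem D hD) fun _ hx => ht.lt_succ hD hx

theorem IsTree.sibling_mem_of_leaf (ht : IsTree (Finset.Icc 1 m) t) (hv : v ∈ t)
    (hiv : {i} ∈ children t v) {D : Finset ℕ} (hD : D ∈ t) (hi : i ∈ D) : v ⊆ D ∨ D = {i} := by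
  by_cases h : D = {i}
  · exact .inr h
  · exact .inl (((ht.mem_children_iff hv).1 hiv).2.2 D hD
      ((Finset.singleton_subset_iff.2 hi).ssubset_of_ne (Ne.symm h)))

/-- If leaf `m + 1` is inserted at the leaf edge of `i`, the down-step from leaf `i` removes it. -/
theorem downLaw_insertEdge_leaf (ht : IsTree (Finset.Icc 1 m) t) (hi : i ∈ Finset.Icc 1 m)
    (f : Finset (Finset ℕ) → ℝ) :
    downLaw α γ (insertEdge t {i} (m + 1)) i f = f t := by
  have hit := ht.singleton_mem i hi
  have hs := ht.insertEdge_succ hit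
  have hch := ht.children_insertEdge_new (succ_notMem_Icc m) hit
  have him : i ≠ m + 1 := by simp at hi; omega
  have hmem : insert (m + 1) {i} ∈ insertEdge t {i} (m + 1) := by
    rw [← liftVertex_self]; exact (mem_insertEdge hit).2 (.inr (.inr ⟨_, hit, rfl⟩))
  have hic : {i} ∈ children (insertEdge t {i} (m + 1)) (insert (m + 1) {i}) := by
    rw [hch]; simp
  rw [downLaw_eq hs hmem hic, if_pos]
  · have h1 : firstBushMin (insertEdge t {i} (m + 1)) i = m + 1 := by
      rw [firstBushMin, hs.parent_eq hmem hic, Finset.insert_sdiff_of_notMem, Finset.sdiff_self]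
      · simp
      · simp [him.symm]
    have h2 := secondBushMin_le hs i
    have h3 := (Finset.mem_Icc.1 hi).2
    rw [h1, max_eq_left h2, max_eq_right (by omega),
      downTree_insertEdge_last ht hi hit (by simp) _ (.inl rfl)]
    intro D _ hiD
    exact .inl (Finset.singleton_subset_iff.2 hiD)
  · rw [hch, Finset.card_pair]
    simpa using him

/-- If leaf `m + 1` is inserted at the edge above the parent of leaf `i`, and this parent has two
children, the down-step from leaf `i` removes leaf `m + 1`. -/
theorem downLaw_insertEdge_parent (ht : IsTree (Finset.Icc 1 m) t) (hi : i ∈ Finset.Icc 1 m)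
    (hv : v ∈ t) (hiv : {i} ∈ children t v) (hc : (children t v).card = 2)
    (f : Finset (Finset ℕ) → ℝ) :
    downLaw α γ (insertEdge t v (m + 1)) i f = f t := by
  have hs := ht.insertEdge_succ hv
  have hj := succ_notMem_Icc m
  have hch := ht.children_insertEdge_new hj hv
  have hch' := ht.children_insertEdge hj hv hv
  rw [edgeLift_self] at hch'
  have hvs : v ∈ insertEdge t v (m + 1) := (mem_insertEdge hv).2 (.inl rfl)
  have hmem : insert (m + 1) v ∈ insertEdge t v (m + 1) := by
    rw [← liftVertex_self]; exact (mem_insertEdge hv).2 (.inr (.inr ⟨_, hv, rfl⟩))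
  have hiv' := mem_children.1 hiv
  have hic : {i} ∈ children (insertEdge t v (m + 1)) v := by
    rw [hch']
    exact Finset.mem_image.2 ⟨_, hiv, liftVertex_of_not_subset hiv'.2.1.2⟩
  have hvc : v ∈ children (insertEdge t v (m + 1)) (insert (m + 1) v) := by
    rw [hch]; simp
  rw [downLaw_eq hs hvs hic, if_pos]
  · have h1 : secondBushMin (insertEdge t v (m + 1)) i = m + 1 := by
      rw [secondBushMin, hs.parent_eq hvs hic, hs.parent_eq hmem hvc,
        Finset.insert_sdiff_of_notMem _ (ht.notMem hj hv), Finset.sdiff_self]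
      simp
    have h2 := firstBushMin_le hs i
    have h3 := (Finset.mem_Icc.1 hi).2
    rw [h1, max_eq_right h2, max_eq_right (by omega), downTree_insertEdge_last ht hi hv
      (hiv'.2.1.1 (by simp)) (fun D hD hiD => ht.sibling_mem_of_leaf hv hiv hD hiD)
      (.inr ((ht.contracted_iff hv).2 ⟨hiv, hc⟩).2)]
  · rw [hch', ht.card_image_liftVertex hj, hc]

/-- If leaf `m + 1` is inserted at the parent of leaf `i`, the down-step from leaf `i` removes leaf
`m + 1` or finds the same leaves as before, with modified probabilities. -/
theorem downLaw_insertBranch_parent (ht : IsTree (Finset.Icc 1 m) t) (hi : i ∈ Finset.Icc 1 m)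
    (hv : v ∈ t) (hiv : {i} ∈ children t v) (f : Finset (Finset ℕ) → ℝ) :
    downLaw α γ (insertBranch t v (m + 1)) i f =
      ∑ D ∈ children t v, searchProb α γ ((children t v).card + 1) (rank t v {i}) (rank t v D) *
        f (downTree (insertBranch t v (m + 1)) i (minLabel D)) +
      searchProb α γ ((children t v).card + 1) (rank t v {i}) ((children t v).card + 1) * f t := by
  have hvb := ht.mem_branchPoints_of_children hv hiv
  have hs := ht.insertBranch_succ hvb
  have hj := succ_notMem_Icc m
  have hch := ht.children_insertBranch hj hvb hv
  have hcard := ht.card_children_insertBranch hj hvb hv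
  have hiv' := mem_children.1 hiv
  rw [liftVertex_self] at hch hcard
  rw [if_pos rfl] at hch hcard
  rw [image_liftVertex_children, Finset.union_comm, ← Finset.insert_eq] at hch
  have hnew : {m + 1} ∉ children t v := fun h =>
    ht.notMem hj (children_subset _ _ h) (Finset.mem_singleton_self _)
  have hmem : insert (m + 1) v ∈ insertBranch t v (m + 1) := by
    rw [← liftVertex_self]; exact mem_insertBranch.2 (.inr ⟨_, hv, rfl⟩)
  have hic : {i} ∈ children (insertBranch t v (m + 1)) (insert (m + 1) v) := by
    rw [hch]; exact Finset.mem_insert_of_mem hiv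
  have h2c := ht.two_le_card_children hvb
  have hlt : ∀ D ∈ children t v, minLabel D < m + 1 := fun D hD =>
    ht.minLabel_lt_succ (children_subset _ _ hD)
  have hrank : ∀ D ∈ children t v,
      rank (insertBranch t v (m + 1)) (insert (m + 1) v) D = rank t v D := fun D hD =>
    rank_image_insert (F := id) (by rw [Finset.image_id]; exact hch) Function.injective_id.injOn
      (fun _ _ => rfl) hlt hD
  -- The new leaf has the largest label, hence the last rank.
  have hrank' : rank (insertBranch t v (m + 1)) (insert (m + 1) v) {m + 1} =
      (children t v).card + 1 := by
    rw [← hcard]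
    apply rank_singleton_of_lt
    intro D hD
    rw [hch] at hD
    rcases Finset.mem_insert.1 hD with rfl | hD
    · simp
    · exact (hlt D hD).le
  rw [downLaw_eq hs hmem hic, hcard, if_neg (by omega)]
  rw [hch, Finset.sum_insert hnew, add_comm, hrank', hrank _ hiv, minLabel_singleton,
    downTree_insertBranch_last ht hi (hiv'.2.1.1 (by simp))
      (fun D hD hiD => ht.sibling_mem_of_leaf hv hiv hD hiD)]
  congr 1
  exact Finset.sum_congr rfl fun D hD => by rw [hrank D hD]

/-- If leaf `m + 1` is inserted away from the parent `v` of leaf `i`, the down-step from leaf `i`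
finds the same leaves as before, with the same probabilities. -/
theorem downLaw_of_children_eq {s : Finset (Finset ℕ)} {C : Finset ℕ} {ψ : Finset ℕ → Finset ℕ}
    (ht : IsTree (Finset.Icc 1 m) t) (hs : IsTree (Finset.Icc 1 (m + 1)) s)
    (hv : v ∈ t) (hiv : {i} ∈ children t v)
    (hCi : C ≠ {i}) (hC : C ∈ t) (hψ : ∀ u ∈ t, ψ u ∈ s)
    (hψv : ψ v = liftVertex C (m + 1) v)
    (hψ' : ∀ u ∈ t, ∀ x, x ∈ ψ u → x ∈ u ∨ x = m + 1) (hψ'' : ∀ u ∈ t, u ⊆ ψ u)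
    (hch : ∀ u ∈ t,
      (children t u).image (liftVertex C (m + 1)) ⊆ children s (ψ u))
    (hch' : children s (ψ v) = (children t v).image (liftVertex C (m + 1)))
    (f : Finset (Finset ℕ) → ℝ) :
    downLaw α γ s i f = if (children t v).card = 2 then
      f (downTree s i (max i (max (firstBushMin t i) (secondBushMin t i))))
    else ∑ D ∈ children t v, searchProb α γ (children t v).card (rank t v {i}) (rank t v D) *
      f (downTree s i (minLabel D)) := by
  have hj := succ_notMem_Icc m
  have hiv' := mem_children.1 hiv
  have hli : liftVertex C (m + 1) {i} = {i} := by
    refine liftVertex_of_not_subset fun h => hCi ?_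
    exact (Finset.subset_singleton_iff.1 h).resolve_left (ht.nonempty_of_mem C hC).ne_empty
  have hic : {i} ∈ children s (ψ v) := by
    rw [hch']; exact Finset.mem_image.2 ⟨_, hiv, hli⟩
  have hinj : Set.InjOn (liftVertex C (m + 1)) (children t v : Set (Finset ℕ)) :=
    (ht.liftVertex_injOn hj).mono fun D hD => children_subset _ _ hD
  have hmin : ∀ D ∈ children t v, minLabel (liftVertex C (m + 1) D) = minLabel D := fun D hD =>
    ht.minLabel_liftVertex (children_subset _ _ hD)
  have hrank : ∀ D ∈ children t v, rank s (ψ v) (liftVertex C (m + 1) D) = rank t v D :=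
    fun D hD => rank_image hch' hinj hmin hD
  have hranki : rank s (ψ v) {i} = rank t v {i} := by
    have := hrank _ hiv; rwa [hli] at this
  have hcard : (children s (ψ v)).card = (children t v).card := by
    rw [hch', Finset.card_image_of_injOn hinj]
  -- A spinal bush gains at most the label `m + 1`, which does not change its least label.
  have hdiff : ∀ u ∈ t, ∀ w ∈ t, u ⊂ w →
      minLabel (ψ w \ ψ u) = minLabel (w \ u) := by
    intro u hu w hw huw
    apply minLabel_eq_of_subset_insert (j := m + 1)
    · exact Finset.sdiff_nonempty.2 huw.2
    · intro x hx
      rw [Finset.mem_sdiff] at hx ⊢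
      refine ⟨hψ'' w hw hx.1, fun h => ?_⟩
      rcases hψ' u hu x h with h | rfl
      · exact hx.2 h
      · exact ht.notMem hj hw hx.1
    · intro x hx
      rw [Finset.mem_sdiff] at hx
      rcases hψ' w hw x hx.1 with h | rfl
      · exact Finset.mem_insert_of_mem (Finset.mem_sdiff.2 ⟨h, fun h' => hx.2 (hψ'' u hu h')⟩)
      · exact Finset.mem_insert_self _ _
    · intro x hx
      exact ht.lt_succ hw (Finset.mem_sdiff.1 hx).1
  have hfirst : firstBushMin s i = firstBushMin t i := by
    rw [firstBushMin, firstBushMin, hs.parent_eq (hψ v hv) hic, ht.parent_eq hv hiv]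
    apply minLabel_eq_of_subset_insert (j := m + 1)
    · exact Finset.sdiff_nonempty.2 hiv'.2.1.2
    · exact Finset.sdiff_subset_sdiff (hψ'' v hv) subset_rfl
    · intro x hx
      rw [Finset.mem_sdiff] at hx
      rcases hψ' v hv x hx.1 with h | rfl
      · exact Finset.mem_insert_of_mem (Finset.mem_sdiff.2 ⟨h, hx.2⟩)
      · exact Finset.mem_insert_self _ _
    · intro x hx
      exact ht.lt_succ hv (Finset.mem_sdiff.1 hx).1
  have hsecond : secondBushMin s i = secondBushMin t i := by
    rw [secondBushMin, secondBushMin, hs.parent_eq (hψ v hv) hic, ht.parent_eq hv hiv]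
    by_cases hvA : v = Finset.Icc 1 m
    · have h1 : ψ v = Finset.Icc 1 (m + 1) := by
        rw [hψv, hvA, liftVertex_of_subset (ht.subset_of_mem C hC), insert_succ_Icc]
      rw [h1, hs.parent_top, hvA, ht.parent_top]
      simp
    · obtain ⟨hw, hvw⟩ := ht.parent_mem hv hvA
      have h1 : ψ v ∈ children s (ψ (parent t v)) := by
        apply hch _ hw
        rw [hψv]
        exact Finset.mem_image_of_mem _ hvw
      rw [hs.parent_eq (hψ _ hw) h1]
      exact hdiff v hv _ hw (mem_children.1 hvw).2.1
  rw [downLaw_eq hs (hψ v hv) hic, hcard, hfirst, hsecond]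
  congr 1
  rw [hch', Finset.sum_image hinj]
  refine Finset.sum_congr rfl fun D hD => ?_
  rw [hranki, hrank D hD, hmin D hD]

theorem downLaw_insertEdge (ht : IsTree (Finset.Icc 1 m) t)
    (hv : v ∈ t) (hiv : {i} ∈ children t v) {C : Finset ℕ} (hC : C ∈ t) (hCi : C ≠ {i})
    (hCv : C ≠ v ∨ (children t v).card ≠ 2) (f : Finset (Finset ℕ) → ℝ) :
    downLaw α γ (insertEdge t C (m + 1)) i f = if (children t v).card = 2 then
      f (downTree (insertEdge t C (m + 1)) i
        (max i (max (firstBushMin t i) (secondBushMin t i))))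
    else ∑ D ∈ children t v, searchProb α γ (children t v).card (rank t v {i}) (rank t v D) *
      f (downTree (insertEdge t C (m + 1)) i (minLabel D)) := by
  have hj := succ_notMem_Icc m
  have hs := ht.insertEdge_succ hC
  by_cases hCv' : C = v
  · subst hCv'
    have hc := hCv.resolve_left (by simp)
    have hiv' := mem_children.1 hiv
    have hch' := ht.children_insertEdge hj hC hC
    rw [edgeLift_self] at hch'
    have hvs : C ∈ insertEdge t C (m + 1) := (mem_insertEdge hC).2 (.inl rfl)
    rw [image_liftVertex_children] at hch'
    rw [downLaw_eq hs hvs (by rw [hch']; exact hiv), hch', if_neg hc, if_neg hc]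
    refine Finset.sum_congr rfl fun D hD => ?_
    unfold rank
    rw [hch']
  · refine downLaw_of_children_eq (ψ := edgeLift C (m + 1)) ht hs hv hiv hCi hC
      (fun u hu => edgeLift_mem hC hu) (edgeLift_of_ne (Ne.symm hCv')) ?_ ?_ ?_
      (ht.children_insertEdge hj hC hv) f
    · intro u _ x hx
      exact (mem_edgeLift.1 hx).imp_right And.left
    · intro u _ x hx
      exact mem_edgeLift.2 (.inl hx)
    · intro u hu
      exact (ht.children_insertEdge hj hC hu).ge

theorem downLaw_insertBranch (ht : IsTree (Finset.Icc 1 m) t)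
    (hv : v ∈ t) (hiv : {i} ∈ children t v) {C : Finset ℕ} (hC : C ∈ branchPoints t)
    (hCv : C ≠ v) (f : Finset (Finset ℕ) → ℝ) :
    downLaw α γ (insertBranch t C (m + 1)) i f = if (children t v).card = 2 then
      f (downTree (insertBranch t C (m + 1)) i
        (max i (max (firstBushMin t i) (secondBushMin t i))))
    else ∑ D ∈ children t v, searchProb α γ (children t v).card (rank t v {i}) (rank t v D) *
      f (downTree (insertBranch t C (m + 1)) i (minLabel D)) := by
  have hj := succ_notMem_Icc m
  have hs := ht.insertBranch_succ hC
  obtain ⟨hCt, hC2⟩ := mem_branchPoints.1 hC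
  refine downLaw_of_children_eq (ψ := liftVertex C (m + 1)) ht hs hv hiv ?_ hCt
    (fun u hu => mem_insertBranch.2 (.inr ⟨u, hu, rfl⟩)) rfl ?_ ?_ ?_ ?_ f
  · rintro rfl; simp at hC2
  · intro u _ x hx
    exact (mem_liftVertex.1 hx).imp_right And.left
  · intro u _
    exact subset_liftVertex u
  · intro u hu
    rw [ht.children_insertBranch hj hC hu]
    exact Finset.subset_union_left
  · rw [ht.children_insertBranch hj hC hv, if_neg (Ne.symm hCv), Finset.union_empty]

/-- The growth functional at the reduced tree, as a sum over the vertices of the original tree. -/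
theorem rawGrowth_downTree {k : ℕ} {t : Finset (Finset ℕ)} (hm : 1 ≤ m)
    (ht : IsTree (Finset.Icc 1 (m + 1)) t)
    (hi : i ∈ Finset.Icc 1 (m + 1)) (hk : k ∈ Finset.Icc 1 (m + 1)) (f : Finset (Finset ℕ) → ℝ) :
    rawGrowth α γ (downTree t i k) (m + 1) f =
      ∑ C ∈ t with C ≠ {i} ∧ ¬ Contracted t i C, edgeWeight α γ C *
        f (downTree (insertEdge t C (m + 2)) i k) +
      ∑ C ∈ branchPoints t with ¬ Contracted t i C,
        (((((children t C).erase {i}).card : ℝ) - 1) * α - γ) *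
          f (downTree (insertBranch t C (m + 2)) i k) := by
  have hne : ∀ C ∈ branchPoints t, C ≠ {i} := by
    rintro C hC rfl
    simpa using (mem_branchPoints.1 hC).2
  unfold rawGrowth
  rw [ht.branchPoints_downTree hm hi hk]
  conv_lhs => arg 1; rw [ht.downTree_eq_image]
  rw [Finset.sum_image, Finset.sum_image]
  · congr 1
    · refine Finset.sum_congr rfl fun C hC => ?_
      simp only [Finset.mem_filter] at hC
      rw [← ht.downTree_eq_image, downTree_insertEdge ht hi hk hC.1 hC.2.1 hC.2.2]
      unfold edgeWeight
      simp only [ht.card_downVertex_eq_one_iff hC.1 hC.2.2 hC.2.1]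
    · refine Finset.sum_congr rfl fun C hC => ?_
      simp only [Finset.mem_filter] at hC
      have hCt := (mem_branchPoints.1 hC.1).1
      rw [downTree_insertBranch ht hi hk hCt (hne C hC.1) hC.2,
        ht.card_children_downTree hm hi hk hCt (hne C hC.1) hC.2]
  · refine ht.downVertex_injOn.mono fun C hC => ?_
    simp only [Finset.coe_filter, Set.mem_ofPred_eq] at hC
    exact ⟨(mem_branchPoints.1 hC.1).1, hne C hC.1, hC.2⟩
  · refine ht.downVertex_injOn.mono fun C hC => ?_
    simpa using hC

/-- Growing and then deleting from leaf `i` either undoes the growth step, with total weight one,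
or amounts to deleting from leaf `i` first and growing afterwards. -/
theorem rawGrowth_downLaw (hγ : 0 ≤ γ) (hγα : γ ≤ α) {t : Finset (Finset ℕ)} (hm : 1 ≤ m)
    (ht : IsTree (Finset.Icc 1 (m + 1)) t) (hi : i ∈ Finset.Icc 1 (m + 1))
    (f : Finset (Finset ℕ) → ℝ) :
    rawGrowth α γ t (m + 2) (fun s => downLaw α γ s i f) =
      f t + downLaw α γ t i (fun r => rawGrowth α γ r (m + 1) f) := by
  have hit := ht.singleton_mem i hi
  have hiA : {i} ≠ Finset.Icc 1 (m + 1) := by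
    intro h
    have := congrArg Finset.card h
    simp at this
    omega
  obtain ⟨hv, hiv⟩ := ht.parent_mem hit hiA
  set v := parent t {i} with hvdef
  have hvb := ht.mem_branchPoints_of_children hv hiv
  have hvi : v ≠ {i} := (mem_children.1 hiv).2.1.ne'
  -- Only the parent `v` of leaf `i` can be contracted, and only if it has two children.
  have hcontr : ∀ u ∈ t, Contracted t i u ↔ u = v ∧ (children t v).card = 2 := by
    intro u hu
    rw [ht.contracted_iff hu]
    constructor
    · rintro ⟨h1, h2⟩
      obtain rfl : u = v := (ht.parent_eq hu h1).symm
      exact ⟨rfl, h2⟩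
    · rintro ⟨rfl, h⟩
      exact ⟨hiv, h⟩
  have hne : ∀ C ∈ branchPoints t, C ≠ {i} := by
    rintro C hC rfl
    simpa using (mem_branchPoints.1 hC).2
  have hcard : ∀ C ∈ t, C ≠ v → ((children t C).erase {i}).card = (children t C).card := by
    intro C hC hCv
    rw [Finset.erase_eq_of_notMem]
    exact fun h => hCv (ht.parent_eq hC h).symm
  have hwi : edgeWeight α γ {i} = 1 - α := by simp [edgeWeight]
  have hwv : edgeWeight α γ v = γ := by
    have := (mem_branchPoints.1 hvb).2
    rw [edgeWeight, if_neg (by omega)]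
  rw [downLaw_eq ht hv hiv, rawGrowth, ← Finset.add_sum_erase t _ hit,
    ← Finset.add_sum_erase (branchPoints t) _ hvb, hwi, downLaw_insertEdge_leaf ht hi]
  -- If `v` has two children, the weights `1 - α` of the leaf edge `i`, `γ` of the edge above `v`,
  -- and `α - γ` of the branch point `v`, for which the growth step is undone, add up to one. All
  -- other insertions commute with the deletion.
  by_cases hc : (children t v).card = 2
  · have hK : max i (max (firstBushMin t i) (secondBushMin t i)) ∈ Finset.Icc 1 (m + 1) := by
      have h1 := firstBushMin_le ht i
      have h2 := secondBushMin_le ht i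
      rw [Finset.mem_Icc] at hi ⊢
      omega
    rw [if_pos hc, rawGrowth_downTree hm ht hi hK,
      ← Finset.add_sum_erase (t.erase {i}) _ (Finset.mem_erase.2 ⟨hvi, hv⟩), hwv,
      downLaw_insertEdge_parent ht hi hv hiv hc, downLaw_insertBranch_parent ht hi hv hiv, hc]
    have hF : (t.erase {i}).erase v = t.filter fun C => C ≠ {i} ∧ ¬ Contracted t i C := by
      ext C
      simp only [Finset.mem_erase, Finset.mem_filter]
      constructor
      · rintro ⟨h1, h2, h3⟩
        exact ⟨h3, h2, fun h => h1 ((hcontr C h3).1 h).1⟩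
      · rintro ⟨h1, h2, h3⟩
        exact ⟨fun h => h3 ((hcontr C h1).2 ⟨h, hc⟩), h2, h1⟩
    have hB : (branchPoints t).erase v = (branchPoints t).filter fun C => ¬ Contracted t i C := by
      ext C
      simp only [Finset.mem_erase, Finset.mem_filter]
      constructor
      · rintro ⟨h1, h2⟩
        exact ⟨h2, fun h => h1 ((hcontr C (mem_branchPoints.1 h2).1).1 h).1⟩
      · rintro ⟨h1, h2⟩
        exact ⟨fun h => h2 ((hcontr C (mem_branchPoints.1 h1).1).2 ⟨h, hc⟩), h1⟩
    -- After an insertion at `v`, the search always ends in the new leaf, which has rank three.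
    have hlast : searchProb α γ (2 + 1) (rank t v {i}) (2 + 1) = 1 := by simp [searchProb]
    have hzero : ∀ D ∈ children t v, searchProb α γ (2 + 1) (rank t v {i}) (rank t v D) = 0 := by
      intro D hD
      have : rank t v D ≤ 2 := hc ▸ Finset.card_le_card (Finset.filter_subset _ _)
      rw [searchProb, if_pos rfl, if_neg (by omega)]
    rw [Finset.sum_eq_zero (s := children t v) fun D hD => by rw [hzero D hD, zero_mul], hlast,
      ← hF, ← hB]
    rw [Finset.sum_congr rfl (g := fun C => edgeWeight α γ C * f (downTree
      (insertEdge t C (m + 2)) i (max i (max (firstBushMin t i) (secondBushMin t i)))))]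
    · rw [Finset.sum_congr rfl (s₁ := (branchPoints t).erase v)
        (g := fun C => (((((children t C).erase {i}).card : ℝ) - 1) * α - γ) * f (downTree
        (insertBranch t C (m + 2)) i (max i (max (firstBushMin t i) (secondBushMin t i)))))]
      · push_cast
        ring
      · intro C hC
        rw [Finset.mem_erase] at hC
        rw [downLaw_insertBranch ht hv hiv hC.2 hC.1, if_pos hc,
          hcard C (mem_branchPoints.1 hC.2).1 hC.1]
    · intro C hC
      simp only [Finset.mem_erase] at hC
      rw [downLaw_insertEdge ht hv hiv hC.2.2 hC.2.1 (.inl hC.1), if_pos hc]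
  -- If `v` has more children, the growth step is undone by the leaf edge `i` with weight `1 - α`,
  -- and by the branch point `v` with weight `α`, its weight `(c - 1) α - γ` multiplied by the
  -- probability `α / ((c - 1) α - γ)` that the search ends in the new leaf. The rest of the weight
  -- of `v` is the weight of a branch point with `c - 1` children, as is needed after the deletion
  -- of leaf `i`.
  · have h3 : 3 ≤ (children t v).card := by
      have := ht.two_le_card_children hvb
      omega
    have hF : t.erase {i} = t.filter fun C => C ≠ {i} ∧ ¬ Contracted t i C := by
      ext C
      simp only [Finset.mem_erase, Finset.mem_filter]
      constructor
      · rintro ⟨h1, h2⟩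
        exact ⟨h2, h1, fun h => hc ((hcontr C h2).1 h).2⟩
      · rintro ⟨h1, h2, -⟩
        exact ⟨h2, h1⟩
    have hB : branchPoints t = (branchPoints t).filter fun C => ¬ Contracted t i C := by
      rw [Finset.filter_true_of_mem]
      exact fun C hC h => hc ((hcontr C (mem_branchPoints.1 hC).1).1 h).2
    have hrank : ∀ D, rank t v D ≤ (children t v).card := fun D =>
      Finset.card_le_card (Finset.filter_subset _ _)
    have hrank1 : 1 ≤ rank t v {i} :=
      Finset.card_pos.2 ⟨{i}, Finset.mem_filter.2 ⟨hiv, le_rfl⟩⟩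
    have hev : (((children t v).erase {i}).card : ℝ) = (children t v).card - 1 := by
      rw [Finset.card_erase_of_mem hiv, Nat.cast_sub (by omega), Nat.cast_one]
    rw [if_neg hc, downLaw_insertBranch_parent ht hi hv hiv]
    set q : Finset ℕ → ℝ := fun D => searchProb α γ (children t v).card (rank t v {i})
      (rank t v D) with hq
    have hedges : ∑ C ∈ t.erase {i}, edgeWeight α γ C *
        downLaw α γ (insertEdge t C (m + 2)) i f = ∑ D ∈ children t v, q D *
        ∑ C ∈ t.erase {i}, edgeWeight α γ C *
          f (downTree (insertEdge t C (m + 2)) i (minLabel D)) := by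
      simp only [Finset.mul_sum]
      rw [Finset.sum_comm]
      refine Finset.sum_congr rfl fun C hC => ?_
      rw [Finset.mem_erase] at hC
      rw [downLaw_insertEdge ht hv hiv hC.2 hC.1 (.inr hc), if_neg hc, Finset.mul_sum]
      exact Finset.sum_congr rfl fun D _ => by ring
    have hbranches : ∑ C ∈ (branchPoints t).erase v, ((((children t C).card : ℝ) - 1) * α - γ) *
        downLaw α γ (insertBranch t C (m + 2)) i f = ∑ D ∈ children t v, q D *
        ∑ C ∈ (branchPoints t).erase v,
          (((((children t C).erase {i}).card : ℝ) - 1) * α - γ) *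
          f (downTree (insertBranch t C (m + 2)) i (minLabel D)) := by
      simp only [Finset.mul_sum]
      rw [Finset.sum_comm]
      refine Finset.sum_congr rfl fun C hC => ?_
      rw [Finset.mem_erase] at hC
      rw [downLaw_insertBranch ht hv hiv hC.2 hC.1, if_neg hc, Finset.mul_sum,
        hcard C (mem_branchPoints.1 hC.2).1 hC.1]
      exact Finset.sum_congr rfl fun D _ => by ring
    have hmain : ((((children t v).card : ℝ) - 1) * α - γ) *
        ∑ D ∈ children t v, searchProb α γ ((children t v).card + 1) (rank t v {i})
          (rank t v D) * f (downTree (insertBranch t v (m + 2)) i (minLabel D)) =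
        ∑ D ∈ children t v, q D * ((((((children t v).erase {i}).card : ℝ) - 1) * α - γ) *
          f (downTree (insertBranch t v (m + 2)) i (minLabel D))) := by
      rw [Finset.mul_sum]
      refine Finset.sum_congr rfl fun D _ => ?_
      rw [← mul_assoc, searchProb_succ hγ hγα h3 hrank1 (hrank _) (hrank _), hev]
      ring
    have hlast := searchProb_last hγ hγα h3 (hrank {i})
    have hRHS : ∑ D ∈ children t v, q D *
        rawGrowth α γ (downTree t i (minLabel D)) (m + 1) f = ∑ D ∈ children t v, q D *
        (∑ C ∈ t.erase {i}, edgeWeight α γ C *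
          f (downTree (insertEdge t C (m + 2)) i (minLabel D)) +
        ((((((children t v).erase {i}).card : ℝ) - 1) * α - γ) *
          f (downTree (insertBranch t v (m + 2)) i (minLabel D)) +
        ∑ C ∈ (branchPoints t).erase v,
          (((((children t C).erase {i}).card : ℝ) - 1) * α - γ) *
          f (downTree (insertBranch t C (m + 2)) i (minLabel D)))) := by
      refine Finset.sum_congr rfl fun D hD => ?_
      rw [rawGrowth_downTree hm ht hi (ht.minLabel_mem_Icc (children_subset _ _ hD)), ← hF, ← hB,
        Finset.add_sum_erase (branchPoints t) (fun C =>
          (((((children t C).erase {i}).card : ℝ) - 1) * α - γ) *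
          f (downTree (insertBranch t C (m + 2)) i (minLabel D))) hvb]
    simp only [mul_add, Finset.sum_add_distrib] at hRHS
    rw [hRHS, hedges, hbranches, mul_add, hmain, ← mul_assoc, hlast]
    ring

end Down

/-! ### Transition matrices and the commutation relation -/

/-- The indicator function of `s`. -/
noncomputable def treeIndicator (s r : Finset (Finset ℕ)) : ℝ := if r = s then 1 else 0

/-- The transition matrix of the growth step from trees with `m` to trees with `m + 1` leaves. -/
noncomputable def growthMatrix (α γ : ℝ) (m : ℕ) : Matrix (Tree m) (Tree (m + 1)) ℝ := fun t s =>
  growthRule α γ m t.1 s.1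

/-- The transition matrix of the down-step of the `(α, γ)`-chain from trees with `m + 1` to trees
with `m` leaves. -/
noncomputable def downMatrix (α γ : ℝ) (m : ℕ) : Matrix (Tree (m + 1)) (Tree m) ℝ := fun t s =>
  ∑ i ∈ Finset.Icc 1 (m + 1), (1 / ((m + 1 : ℕ) : ℝ)) * downLaw α γ t.1 i (treeIndicator s.1)

section Functionals

variable {α γ : ℝ} {m i : ℕ} {t : Finset (Finset ℕ)}

theorem sum_treeIndicator {r : Finset (Finset ℕ)} (hr : IsTree (Finset.Icc 1 m) r)
    (f : Finset (Finset ℕ) → ℝ) : ∑ s : Tree m, treeIndicator s.1 r * f s.1 = f r := by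
  obtain ⟨r', rfl⟩ : ∃ r' : Tree m, r'.1 = r := ⟨⟨r, hr⟩, rfl⟩
  rw [Finset.sum_eq_single r']
  · simp [treeIndicator]
  · intro s _ hs
    rw [treeIndicator, if_neg, zero_mul]
    exact fun h => hs (Subtype.ext h.symm)
  · exact fun h => absurd (Finset.mem_univ _) h

theorem downLaw_congr (ht : IsTree (Finset.Icc 1 (m + 1)) t)
    (hi : i ∈ Finset.Icc 1 (m + 1)) {f g : Finset (Finset ℕ) → ℝ}
    (h : ∀ k ∈ Finset.Icc 1 (m + 1), f (downTree t i k) = g (downTree t i k)) :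
    downLaw α γ t i f = downLaw α γ t i g := by
  unfold downLaw
  split_ifs
  · apply h
    have h1 := firstBushMin_le ht i
    have h2 := secondBushMin_le ht i
    rw [Finset.mem_Icc] at hi ⊢
    omega
  · refine Finset.sum_congr rfl fun D hD => ?_
    rw [h _ (ht.minLabel_mem_Icc (children_subset _ _ hD))]

theorem downLaw_sum {ι : Type*} (S : Finset ι) (f : ι → Finset (Finset ℕ) → ℝ) :
    downLaw α γ t i (fun r => ∑ x ∈ S, f x r) = ∑ x ∈ S, downLaw α γ t i (f x) := by
  unfold downLaw
  split_ifs
  · rfl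
  · simp only [Finset.mul_sum]
    exact Finset.sum_comm

theorem downLaw_mul_const (f : Finset (Finset ℕ) → ℝ) (c : ℝ) :
    downLaw α γ t i (fun r => f r * c) = downLaw α γ t i f * c := by
  unfold downLaw
  split_ifs
  · rfl
  · simp only [Finset.sum_mul, mul_assoc]

theorem downLaw_eq_sum (hm : 1 ≤ m) (ht : IsTree (Finset.Icc 1 (m + 1)) t)
    (hi : i ∈ Finset.Icc 1 (m + 1)) (f : Finset (Finset ℕ) → ℝ) : downLaw α γ t i f =
      ∑ s : Tree m, downLaw α γ t i (treeIndicator s.1) * f s.1 := by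
  simp only [← downLaw_mul_const]
  rw [← downLaw_sum]
  exact downLaw_congr ht hi fun k hk => (sum_treeIndicator (ht.downTree hm hi hk) f).symm

theorem downLaw_nonneg (hγ : 0 ≤ γ) (hγα : γ ≤ α) (hm : 1 ≤ m)
    (ht : IsTree (Finset.Icc 1 (m + 1)) t) (hi : i ∈ Finset.Icc 1 (m + 1))
    {f : Finset (Finset ℕ) → ℝ} (hf : ∀ r, 0 ≤ f r) : 0 ≤ downLaw α γ t i f := by
  unfold downLaw
  split_ifs with h
  · exact hf _
  · refine Finset.sum_nonneg fun D hD => mul_nonneg (searchProb_nonneg hγ hγα ?_) (hf _)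
    have hiA : {i} ≠ Finset.Icc 1 (m + 1) := by
      intro h
      have := congrArg Finset.card h
      simp at this
      omega
    obtain ⟨hv, hiv⟩ := ht.parent_mem (ht.singleton_mem i hi) hiA
    have := ht.two_le_card_children (ht.mem_branchPoints_of_children hv hiv)
    omega

theorem growthRule_eq (hm : m ≠ 1) (s : Finset (Finset ℕ)) :
    growthRule α γ m t s = (m - α)⁻¹ * rawGrowth α γ t (m + 1) (treeIndicator s) := by
  unfold growthRule rawGrowth insertionProb treeIndicator
  rw [mul_add, Finset.mul_sum, Finset.mul_sum]
  congr 1 <;>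
  · refine Finset.sum_congr rfl fun C _ => ?_
    rw [if_neg hm]
    split_ifs
    · rw [div_eq_inv_mul, mul_one]
    · simp

theorem rawGrowth_congr {f g : Finset (Finset ℕ) → ℝ}
    (h1 : ∀ C ∈ t, f (insertEdge t C (m + 1)) = g (insertEdge t C (m + 1)))
    (h2 : ∀ C ∈ branchPoints t, f (insertBranch t C (m + 1)) = g (insertBranch t C (m + 1))) :
    rawGrowth α γ t (m + 1) f = rawGrowth α γ t (m + 1) g := by
  unfold rawGrowth
  congr 1
  · exact Finset.sum_congr rfl fun C hC => by rw [h1 C hC]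
  · exact Finset.sum_congr rfl fun C hC => by rw [h2 C hC]

theorem rawGrowth_sum {ι : Type*} (S : Finset ι) (j : ℕ) (f : ι → Finset (Finset ℕ) → ℝ) :
    rawGrowth α γ t j (fun r => ∑ x ∈ S, f x r) = ∑ x ∈ S, rawGrowth α γ t j (f x) := by
  simp only [rawGrowth, Finset.mul_sum, Finset.sum_add_distrib]
  congr 1 <;> exact Finset.sum_comm

theorem rawGrowth_mul_const (j : ℕ) (f : Finset (Finset ℕ) → ℝ) (c : ℝ) :
    rawGrowth α γ t j (fun r => f r * c) = rawGrowth α γ t j f * c := by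
  simp only [rawGrowth, Finset.sum_mul, mul_assoc, add_mul]

theorem rawGrowth_eq_sum (ht : IsTree (Finset.Icc 1 m) t) (f : Finset (Finset ℕ) → ℝ) :
    rawGrowth α γ t (m + 1) f =
      ∑ s : Tree (m + 1), rawGrowth α γ t (m + 1) (treeIndicator s.1) * f s.1 := by
  simp only [← rawGrowth_mul_const]
  rw [← rawGrowth_sum]
  exact rawGrowth_congr
    (fun C hC => (sum_treeIndicator (ht.insertEdge_succ hC) f).symm)
    (fun C hC => (sum_treeIndicator (ht.insertBranch_succ hC) f).symm)

/-- A set of labels has only one tree if there are at most two labels. -/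
theorem IsTree.eq_powerset_erase (hm : m ≤ 2) (ht : IsTree (Finset.Icc 1 m) t) :
    t = (Finset.Icc 1 m).powerset.erase ∅ := by
  ext C
  rw [Finset.mem_erase, Finset.mem_powerset]
  constructor
  · exact fun hC => ⟨(ht.nonempty_of_mem C hC).ne_empty, ht.subset_of_mem C hC⟩
  · rintro ⟨h1, h2⟩
    have h3 := Finset.card_le_card h2
    have h4 := Finset.card_pos.2 (Finset.nonempty_iff_ne_empty.2 h1)
    rw [Nat.card_Icc] at h3
    by_cases h5 : C.card = 1
    · obtain ⟨x, rfl⟩ := Finset.card_eq_one.1 h5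
      exact ht.singleton_mem x (h2 (Finset.mem_singleton_self x))
    · rw [Finset.eq_of_subset_of_card_le h2 (by rw [Nat.card_Icc]; omega)]
      exact ht.top_mem

theorem subsingleton_tree (hm : m ≤ 2) : Subsingleton (Tree m) :=
  ⟨fun s t => Subtype.ext ((s.2.eq_powerset_erase hm).trans (t.2.eq_powerset_erase hm).symm)⟩

theorem IsTree.eq_singleton (ht : IsTree (Finset.Icc 1 1) t) : t = {{1}} := by
  rw [ht.eq_powerset_erase (by omega)]; decide

theorem isTree_one : IsTree (Finset.Icc 1 1) {{1}} where
  top_mem := by simp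
  singleton_mem := by simp
  nonempty_of_mem := by simp
  subset_of_mem := by simp
  laminar := by simp

theorem sub_pos_of_two_le (hα : α ≤ 1) (hm : 2 ≤ m) : 0 < (m : ℝ) - α := by
  have : (2 : ℝ) ≤ m := by exact_mod_cast hm
  linarith

theorem rawGrowth_eq_growthMatrix (hα : α ≤ 1) (hm : 1 ≤ m) (ht : IsTree (Finset.Icc 1 m) t)
    (f : Finset (Finset ℕ) → ℝ) : rawGrowth α γ t (m + 1) f =
      (m - α) * ∑ s : Tree (m + 1), growthRule α γ m t s.1 * f s.1 := by
  by_cases h : m = 1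
  · subst h
    obtain rfl := ht.eq_singleton
    have hb : branchPoints {{1}} = ∅ := by decide
    have h1 := ht.insertEdge_succ (C := {1}) (by simp)
    simp only [rawGrowth, growthRule, hb, Finset.sum_singleton, Finset.sum_empty, add_zero,
      insertionProb, if_true]
    rw [← sum_treeIndicator h1 f]
    simp only [edgeWeight, Finset.card_singleton, if_true, treeIndicator]
    norm_num
  · have h2 : (m : ℝ) - α ≠ 0 := (sub_pos_of_two_le hα (by omega)).ne'
    rw [rawGrowth_eq_sum ht, Finset.mul_sum]
    refine Finset.sum_congr rfl fun s _ => ?_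
    rw [growthRule_eq h, ← mul_assoc, ← mul_assoc, mul_inv_cancel₀ h2, one_mul]

theorem growthRule_nonneg (hγ : 0 ≤ γ) (hγα : γ ≤ α) (hα : α ≤ 1)
    (ht : IsTree (Finset.Icc 1 m) t) (s : Finset (Finset ℕ)) : 0 ≤ growthRule α γ m t s := by
  have hprob : ∀ w : ℝ, 0 ≤ w → 0 ≤ insertionProb α m w := by
    intro w hw
    unfold insertionProb
    split_ifs with h
    · exact zero_le_one
    · rcases Nat.eq_zero_or_pos m with rfl | h0
      · exfalso
        have := (ht.nonempty_of_mem _ ht.top_mem)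
        simp at this
      · exact div_nonneg hw (sub_pos_of_two_le hα (by omega)).le
  refine add_nonneg (Finset.sum_nonneg fun C hC => ?_) (Finset.sum_nonneg fun C hC => ?_)
  · split_ifs
    · apply hprob
      unfold edgeWeight
      split_ifs <;> linarith
    · exact le_rfl
  · split_ifs
    · apply hprob
      have h2 : (2 : ℝ) ≤ (children t C).card := by exact_mod_cast ht.two_le_card_children hC
      nlinarith
    · exact le_rfl

theorem sum_growthRule (hα : α ≤ 1) (hm : 1 ≤ m) (ht : IsTree (Finset.Icc 1 m) t) :
    ∑ s : Tree (m + 1), growthRule α γ m t s.1 = 1 := by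
  by_cases h : m = 1
  · subst h
    obtain rfl := ht.eq_singleton
    have hb : branchPoints {{1}} = ∅ := by decide
    have h1 := ht.insertEdge_succ (C := {1}) (by simp)
    simp only [growthRule, hb, Finset.sum_singleton, Finset.sum_empty, add_zero,
      insertionProb, if_true]
    simpa [treeIndicator] using sum_treeIndicator h1 (fun _ => 1)
  · have h2 : (m : ℝ) - α ≠ 0 := (sub_pos_of_two_le hα (by omega)).ne'
    have h3 := rawGrowth_eq_growthMatrix (γ := γ) hα hm ht (fun _ => 1)
    have h4 := ht.sum_weights α γ
    simp only [rawGrowth, mul_one] at h3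
    rw [h3, Nat.card_Icc, Nat.add_sub_cancel] at h4
    exact mul_left_cancel₀ h2 (h4.trans (mul_one _).symm)

theorem chainKernel_eq_sum (t s : Tree (m + 1)) : chainKernel α γ (m + 1) t s =
    ∑ i ∈ Finset.Icc 1 (m + 1), (1 / ((m + 1 : ℕ) : ℝ)) *
      downLaw α γ t.1 i (fun r => growthRule α γ m r s.1) := rfl

theorem chainKernel_eq_mul (hm : 1 ≤ m) :
    chainKernel α γ (m + 1) = downMatrix α γ m * growthMatrix α γ m := by
  ext t s
  rw [chainKernel_eq_sum, Matrix.mul_apply]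
  simp only [downMatrix, growthMatrix, Finset.sum_mul]
  rw [Finset.sum_comm]
  refine Finset.sum_congr rfl fun i hi => ?_
  rw [downLaw_eq_sum hm t.2 hi, Finset.mul_sum]
  exact Finset.sum_congr rfl fun r _ => by ring

theorem IsTree.downTree_insertBranch_self (ht : IsTree (Finset.Icc 1 m) t) (C : Finset ℕ) :
    AlphaGamma.downTree (AlphaGamma.insertBranch t C (m + 1)) (m + 1) (m + 1) = t := by
  have h : ∀ D ∈ t, downVertex (m + 1) (m + 1) (liftVertex C (m + 1) D) = D := by
    intro D hD
    ext y
    rw [mem_downVertex, mem_liftVertex, upLabel, Equiv.swap_self, Equiv.refl_apply]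
    have hD' : ∀ z ∈ D, z < m + 1 := fun z hz => ht.lt_succ hD hz
    split_ifs with hy
    · constructor
      · rintro (h | h)
        · have := hD' _ h; omega
        · omega
      · intro h; have := hD' _ h; omega
    · exact or_iff_left fun h => by omega
  have h0 : downVertex (m + 1) (m + 1) {m + 1} = ∅ := (downVertex_eq_empty_iff (by simp)).2 rfl
  ext X
  rw [AlphaGamma.mem_downTree]
  constructor
  · rintro ⟨hX, Y, hY, rfl⟩
    rcases mem_insertBranch.1 hY with rfl | ⟨D, hD, rfl⟩
    · exact absurd h0 hX
    · rwa [h D hD]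
  · intro hX
    exact ⟨(ht.nonempty_of_mem X hX).ne_empty, _, mem_insertBranch.2 (.inr ⟨X, hX, rfl⟩), h X hX⟩

/-- Deletion of the leaf with the largest label undoes its insertion into an edge. -/
theorem IsTree.downTree_insertEdge_self (ht : IsTree (Finset.Icc 1 m) t) {C : Finset ℕ}
    (hC : C ∈ t) :
    AlphaGamma.downTree (AlphaGamma.insertEdge t C (m + 1)) (m + 1) (m + 1) = t := by
  have h : downVertex (m + 1) (m + 1) C = C := by
    ext y
    rw [mem_downVertex, upLabel, Equiv.swap_self, Equiv.refl_apply]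
    have hD' : ∀ z ∈ C, z < m + 1 := fun z hz => ht.lt_succ hC hz
    split_ifs with hy
    · constructor
      · intro h; have := hD' _ h; omega
      · intro h; have := hD' _ h; omega
    · rfl
  rw [insertEdge_eq hC, downTree_insert, h, ht.downTree_insertBranch_self,
    Finset.insert_eq_of_mem hC]
  rw [h]
  exact (ht.nonempty_of_mem C hC).ne_empty

/-- The down-step from the leaf with the largest label undoes the last growth step. -/
theorem rawGrowth_downLaw_self (ht : IsTree (Finset.Icc 1 m) t)
    (f : Finset (Finset ℕ) → ℝ) :
    rawGrowth α γ t (m + 1) (fun s => downLaw α γ s (m + 1) f) = (m - α) * f t := by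
  have hj := succ_notMem_Icc m
  have hE : ∀ C ∈ t, downLaw α γ (insertEdge t C (m + 1)) (m + 1) f = f t := by
    intro C hC
    have hs := ht.insertEdge_succ hC
    have hch := ht.children_insertEdge_new hj hC
    have hmem : insert (m + 1) C ∈ insertEdge t C (m + 1) := by
      rw [← liftVertex_self]; exact (mem_insertEdge hC).2 (.inr (.inr ⟨_, hC, rfl⟩))
    have hic : {m + 1} ∈ children (insertEdge t C (m + 1)) (insert (m + 1) C) := by
      rw [hch]; simp
    have h1 := firstBushMin_le hs (m + 1)
    have h2 := secondBushMin_le hs (m + 1)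
    -- The selected leaf has the largest label, so the search ends there.
    rw [downLaw_eq hs hmem hic, if_pos, max_eq_left (max_le h1 h2),
      ht.downTree_insertEdge_self hC]
    rw [hch, Finset.card_pair]
    rintro rfl
    exact ht.notMem hj hC (Finset.mem_singleton_self _)
  have hB : ∀ C ∈ branchPoints t, ((((children t C).card : ℝ) - 1) * α - γ) *
      downLaw α γ (insertBranch t C (m + 1)) (m + 1) f =
      ((((children t C).card : ℝ) - 1) * α - γ) * f t := by
    intro C hC
    have hCt := (mem_branchPoints.1 hC).1
    have hs := ht.insertBranch_succ hC
    have hch := ht.children_insertBranch hj hC hCt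
    have hcard := ht.card_children_insertBranch hj hC hCt
    rw [liftVertex_self, if_pos rfl] at hch hcard
    have hmem : insert (m + 1) C ∈ insertBranch t C (m + 1) := by
      rw [← liftVertex_self]; exact mem_insertBranch.2 (.inr ⟨_, hCt, rfl⟩)
    have hic : {m + 1} ∈ children (insertBranch t C (m + 1)) (insert (m + 1) C) := by
      rw [hch]; simp
    have hrank : rank (insertBranch t C (m + 1)) (insert (m + 1) C) {m + 1} =
        (children t C).card + 1 := by
      rw [← hcard]
      apply rank_singleton_of_lt
      intro D hD
      have := hs.minLabel_lt_succ (children_subset _ _ hD)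
      omega
    have h2 := ht.two_le_card_children hC
    rw [downLaw_eq hs hmem hic, hcard, if_neg (by omega), Finset.sum_eq_single {m + 1}, hrank,
      minLabel_singleton, ht.downTree_insertBranch_self, ← mul_assoc]
    -- The selected leaf has the last rank and the search ends there, with probability one unless
    -- the insertion weight vanishes.
    · congr 1
      unfold searchProb
      split_ifs with h3 h4 h5 h6 h7
      · rw [mul_one]
      · omega
      · omega
      · omega
      · have e1 : (((children t C).card + 1 : ℕ) : ℝ) - 2 = (children t C).card - 1 := by
          push_cast; ring
        rw [e1]
        by_cases h0 : (((children t C).card : ℝ) - 1) * α - γ = 0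
        · rw [h0, zero_mul]
        · rw [div_self h0, mul_one]
      · omega
    · intro D hD hDi
      have hlt : rank (insertBranch t C (m + 1)) (insert (m + 1) C) D <
          (children t C).card + 1 := by
        rw [← hrank, IsTree.rank_lt_rank_iff hic]
        refine lt_of_le_of_ne ?_ fun h => hDi (hs.minLabel_injOn _ hD hic h)
        have := hs.minLabel_lt_succ (children_subset _ _ hD)
        rw [minLabel_singleton]
        omega
      rw [hrank]
      unfold searchProb
      split_ifs <;> first | omega | simp
    · exact fun h => absurd hic h
  unfold rawGrowth
  rw [Finset.sum_congr rfl fun C hC => congrArg (edgeWeight α γ C * ·) (hE C hC),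
    Finset.sum_congr rfl hB, ← Finset.sum_mul, ← Finset.sum_mul, ← add_mul,
    ht.sum_weights α γ, Nat.card_Icc,
    Nat.add_sub_cancel]

/-- The commutation relation between growth and deletion: up to the identity matrix, "grow, then
delete" is a multiple of "delete, then grow". -/
theorem growthMatrix_mul_downMatrix (hγ : 0 ≤ γ) (hγα : γ ≤ α) (hα : α ≤ 1) (hm : 1 ≤ m) :
    (((m : ℝ) + 2) * (m + 1 - α)) • (growthMatrix α γ (m + 1) * downMatrix α γ (m + 1)) =
      (2 * (m : ℝ) + 2 - α) • (1 : Matrix (Tree (m + 1)) (Tree (m + 1)) ℝ) +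
      (((m : ℝ) + 1) * (m - α)) • (downMatrix α γ m * growthMatrix α γ m) := by
  ext t u
  rw [Matrix.smul_apply, Matrix.add_apply, Matrix.smul_apply, Matrix.smul_apply,
    ← chainKernel_eq_mul hm, chainKernel_eq_sum, Matrix.mul_apply, Matrix.one_apply]
  have hm2 : ((m : ℝ) + 2) ≠ 0 := by positivity
  have hm1 : ((m : ℝ) + 1) ≠ 0 := by positivity
  -- Sum the relation for the functionals over all `m + 2` leaves: the first `m + 1` leaves give
  -- `rawGrowth_downLaw`, and the last one gives `rawGrowth_downLaw_self`.
  have h1 := rawGrowth_eq_growthMatrix (γ := γ) hα (by omega : 1 ≤ m + 1) t.2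
    (fun s => ∑ i ∈ Finset.Icc 1 (m + 2), downLaw α γ s i (treeIndicator u.1))
  rw [rawGrowth_sum, Finset.sum_Icc_succ_top (by omega), rawGrowth_downLaw_self t.2,
    Finset.sum_congr rfl fun i hi => rawGrowth_downLaw hγ hγα hm t.2 hi _,
    Finset.sum_add_distrib, Finset.sum_const, Nat.card_Icc] at h1
  have h2 : ∀ i ∈ Finset.Icc 1 (m + 1), downLaw α γ t.1 i
      (fun r => rawGrowth α γ r (m + 1) (treeIndicator u.1)) =
      downLaw α γ t.1 i (fun r => growthRule α γ m r u.1) * (m - α) := by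
    intro i hi
    rw [← downLaw_mul_const]
    refine downLaw_congr t.2 hi fun k hk => ?_
    rw [rawGrowth_eq_growthMatrix hα hm (t.2.downTree hm hi hk), mul_comm]
    congr 1
    simp only [mul_comm (growthRule _ _ _ _ _)]
    rw [Finset.sum_eq_single u]
    · simp [treeIndicator]
    · intro s _ hs
      rw [treeIndicator, if_neg fun h => hs (Subtype.ext h), zero_mul]
    · exact fun h => absurd (Finset.mem_univ _) h
  rw [Finset.sum_congr rfl h2, ← Finset.sum_mul] at h1
  have h3 : treeIndicator u.1 t.1 = if t = u then 1 else 0 := by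
    rw [treeIndicator]
    exact if_congr Subtype.ext_iff.symm rfl rfl
  rw [h3] at h1
  have h4 : ∑ s : Tree (m + 1 + 1), growthMatrix α γ (m + 1) t s * downMatrix α γ (m + 1) s u =
      (1 / ((m : ℝ) + 2)) * ∑ s : Tree (m + 1 + 1), growthRule α γ (m + 1) t.1 s.1 *
        ∑ i ∈ Finset.Icc 1 (m + 2), downLaw α γ s.1 i (treeIndicator u.1) := by
    rw [Finset.mul_sum]
    refine Finset.sum_congr rfl fun s _ => ?_
    rw [growthMatrix, downMatrix, ← Finset.mul_sum]
    push_cast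
    ring
  rw [h4, ← Finset.mul_sum]
  simp only [smul_eq_mul]
  push_cast at h1 ⊢
  simp only [nsmul_eq_mul] at h1
  field_simp
  rw [← h1]
  push_cast
  ring

end Functionals

/-! ### Stationarity, uniqueness, admissible trees -/

section Stationary

variable {α γ : ℝ} {m : ℕ}

theorem growthLaw_succ (hm : 1 ≤ m) :
    growthLaw α γ (m + 1) = Matrix.vecMul (growthLaw α γ m) (growthMatrix α γ m) := by
  obtain ⟨m, rfl⟩ := Nat.exists_eq_add_of_le' hm
  rfl

theorem sum_vecMul_growthMatrix (hα : α ≤ 1) (hm : 1 ≤ m) (μ : Tree m → ℝ) :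
    ∑ s, Matrix.vecMul μ (growthMatrix α γ m) s = ∑ t, μ t := by
  simp only [Matrix.vecMul, dotProduct]
  rw [Finset.sum_comm]
  refine Finset.sum_congr rfl fun t _ => ?_
  rw [← Finset.mul_sum]
  have := sum_growthRule (γ := γ) hα hm t.2
  simp only [growthMatrix]
  rw [this, mul_one]

theorem growthLaw_mem_stdSimplex (hγ : 0 ≤ γ) (hγα : γ ≤ α) (hα : α ≤ 1) (hm : 1 ≤ m) :
    growthLaw α γ m ∈ stdSimplex ℝ (Tree m) := by
  induction m, hm using Nat.le_induction with
  | base =>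
    refine ⟨fun t => zero_le_one, ?_⟩
    have h := subsingleton_tree (m := 1) (by omega)
    have t₀ : Tree 1 := ⟨_, isTree_one⟩
    have h1 : (Finset.univ : Finset (Tree 1)) = {t₀} := by
      ext t
      simp only [Finset.mem_univ, Finset.mem_singleton, true_iff]
      exact Subsingleton.elim _ _
    rw [h1, Finset.sum_singleton]
    rfl
  | succ m hm ih =>
    rw [growthLaw_succ hm]
    refine ⟨fun s => Finset.sum_nonneg fun t _ => mul_nonneg (ih.1 t)
      (growthRule_nonneg hγ hγα hα t.2 _), ?_⟩
    rw [sum_vecMul_growthMatrix hα hm, ih.2]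

theorem eq_of_subsingleton_of_mem_stdSimplex {ι : Type*} [Fintype ι] [Subsingleton ι]
    {μ ν : ι → ℝ} (hμ : μ ∈ stdSimplex ℝ ι) (hν : ν ∈ stdSimplex ℝ ι) : μ = ν := by
  ext x
  have h : (Finset.univ : Finset ι) = {x} := by
    ext y
    simp only [Finset.mem_univ, Finset.mem_singleton, true_iff]
    exact Subsingleton.elim _ _
  have h1 := hμ.2
  have h2 := hν.2
  rw [h, Finset.sum_singleton] at h1 h2
  rw [h1, h2]

/-- The down-step undoes the last growth step in distribution. -/
theorem growthLaw_vecMul_downMatrix (hγ : 0 ≤ γ) (hγα : γ ≤ α) (hα : α ≤ 1) (hm : 1 ≤ m) :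
    Matrix.vecMul (growthLaw α γ (m + 1)) (downMatrix α γ m) = growthLaw α γ m := by
  induction m, hm using Nat.le_induction with
  -- There is only one tree with a single leaf, so it suffices that the total mass is preserved.
  | base =>
    have h1 := subsingleton_tree (m := 1) (by omega)
    have h2 := subsingleton_tree (m := 2) (by omega)
    apply eq_of_subsingleton_of_mem_stdSimplex _ (growthLaw_mem_stdSimplex hγ hγα hα le_rfl)
    have hdown : ∀ t : Tree 2, ∀ i ∈ Finset.Icc 1 2, ∑ s : Tree 1,
        downLaw α γ t.1 i (treeIndicator s.1) = 1 := by
      intro t i hi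
      have h3 := downLaw_eq_sum (α := α) (γ := γ) le_rfl t.2 hi (fun _ => 1)
      simp only [mul_one] at h3
      have hiA : {i} ≠ Finset.Icc 1 (1 + 1) := by
        intro h
        have := congrArg Finset.card h
        simp at this
      obtain ⟨hv, hiv⟩ := t.2.parent_mem (t.2.singleton_mem i hi) hiA
      have hvb := t.2.mem_branchPoints_of_children hv hiv
      have h4 := t.2.two_le_card_children hvb
      have h5 : (children t.1 (parent t.1 {i})).card ≤ 2 := by
        have : Set.MapsTo minLabel (children t.1 (parent t.1 {i}) : Set (Finset ℕ))
            (Finset.Icc 1 2 : Finset ℕ) := fun D hD =>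
          t.2.minLabel_mem_Icc (children_subset _ _ hD)
        simpa using Finset.card_le_card_of_injOn _ this (t.2.minLabel_injOn _)
      rw [← h3, downLaw, if_pos (by omega)]
    have hnn := (growthLaw_mem_stdSimplex (m := 1 + 1) hγ hγα hα (by omega))
    refine ⟨fun s => Finset.sum_nonneg fun t _ => mul_nonneg (hnn.1 t)
      (Finset.sum_nonneg fun i hi => mul_nonneg (by positivity)
        (downLaw_nonneg hγ hγα le_rfl t.2 hi fun r => ?_)), ?_⟩
    · unfold treeIndicator; split_ifs <;> norm_num
    · simp only [Matrix.vecMul, dotProduct]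
      rw [Finset.sum_comm, ← hnn.2]
      refine Finset.sum_congr rfl fun t _ => ?_
      rw [← Finset.mul_sum]
      simp only [downMatrix]
      rw [Finset.sum_comm, Finset.sum_congr rfl fun i hi => by
        rw [← Finset.mul_sum, hdown t i hi]]
      simp
  | succ m hm ih =>
    -- Apply the commutation relation to `growthLaw α γ (m + 1)`; the coefficients on its right-hand
    -- side add up to the one on the left.
    have hrel := growthMatrix_mul_downMatrix hγ hγα hα hm
    have h0 : (((m : ℝ) + 2) * (m + 1 - α)) ≠ 0 := by
      have : 0 < (m : ℝ) := by exact_mod_cast hm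
      have : 0 < (m : ℝ) + 1 - α := by linarith
      positivity
    rw [growthLaw_succ (by omega), Matrix.vecMul_vecMul]
    apply smul_right_injective _ h0
    simp only
    rw [← Matrix.vecMul_smul, hrel, Matrix.vecMul_add, Matrix.vecMul_smul, Matrix.vecMul_smul,
      Matrix.vecMul_one, ← Matrix.vecMul_vecMul, ih, ← growthLaw_succ hm, ← add_smul]
    congr 1
    ring

theorem growthLaw_vecMul_chainKernel (hγ : 0 ≤ γ) (hγα : γ ≤ α) (hα : α ≤ 1) (hm : 1 ≤ m) :
    Matrix.vecMul (growthLaw α γ (m + 1)) (chainKernel α γ (m + 1)) = growthLaw α γ (m + 1) := by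
  rw [chainKernel_eq_mul hm, ← Matrix.vecMul_vecMul, growthLaw_vecMul_downMatrix hγ hγα hα hm,
    ← growthLaw_succ hm]

/-- The stationary distribution is unique: if `μ` is stationary, so is, by the commutation relation,
the law on trees with one leaf less obtained by one down-step, from which `μ` is recovered by one
growth step. -/
theorem eq_growthLaw_of_stationary (hγ : 0 ≤ γ) (hγα : γ ≤ α) (hα : α ≤ 1) (hm : 1 ≤ m) :
    ∀ μ ∈ stdSimplex ℝ (Tree (m + 1)),
      Matrix.vecMul μ (chainKernel α γ (m + 1)) = μ → μ = growthLaw α γ (m + 1) := by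
  induction m, hm using Nat.le_induction with
  | base =>
    intro μ hμ _
    have h2 := subsingleton_tree (m := 1 + 1) (by omega)
    exact eq_of_subsingleton_of_mem_stdSimplex hμ (growthLaw_mem_stdSimplex hγ hγα hα (by omega))
  | succ m hm ih =>
    intro μ hμ hst
    rw [chainKernel_eq_mul (by omega), ← Matrix.vecMul_vecMul] at hst
    set ν := Matrix.vecMul μ (downMatrix α γ (m + 1)) with hν
    have hνs : ν ∈ stdSimplex ℝ (Tree (m + 1)) := by
      refine ⟨fun s => Finset.sum_nonneg fun t _ => mul_nonneg (hμ.1 t)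
        (Finset.sum_nonneg fun i hi => mul_nonneg (by positivity)
          (downLaw_nonneg hγ hγα (by omega) t.2 hi fun r => ?_)), ?_⟩
      · unfold treeIndicator; split_ifs <;> norm_num
      · rw [← sum_vecMul_growthMatrix (γ := γ) hα (by omega) ν, hst, hμ.2]
    have hν' : ν = growthLaw α γ (m + 1) := by
      -- For `m = 1` the coefficient `m - α` may vanish, but there is only one tree with two leaves.
      by_cases h1 : m = 1
      · subst h1
        have h2 := subsingleton_tree (m := 1 + 1) (by omega)
        exact eq_of_subsingleton_of_mem_stdSimplex hνs
          (growthLaw_mem_stdSimplex hγ hγα hα (by omega))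
      · apply ih ν hνs
        have h3 : Matrix.vecMul ν (growthMatrix α γ (m + 1) * downMatrix α γ (m + 1)) = ν := by
          rw [← Matrix.vecMul_vecMul, hst]
        have hm0 := sub_pos_of_two_le hα (by omega : 2 ≤ m)
        have h0 : (((m : ℝ) + 1) * (m - α)) ≠ 0 := by positivity
        have h4 := congrArg (Matrix.vecMul ν) (growthMatrix_mul_downMatrix hγ hγα hα hm)
        rw [Matrix.vecMul_smul, h3, Matrix.vecMul_add, Matrix.vecMul_smul, Matrix.vecMul_smul,
          Matrix.vecMul_one, ← chainKernel_eq_mul hm] at h4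
        apply smul_right_injective _ h0
        simp only
        rw [← sub_eq_iff_eq_add', ← sub_smul] at h4
        rw [← h4]
        congr 1
        ring
    rw [← hst, hν', ← growthLaw_succ (by omega)]

end Stationary

/-- Every branch point of `t` has at most three children. -/
def AtMostTernary (t : Finset (Finset ℕ)) : Prop := ∀ v ∈ branchPoints t, (children t v).card ≤ 3

section Admissible

variable {m : ℕ} {t : Finset (Finset ℕ)}

theorem AtMostTernary.insertEdge (h : AtMostTernary t) (ht : IsTree (Finset.Icc 1 m) t)
    {C : Finset ℕ} (hC : C ∈ t) : AtMostTernary (insertEdge t C (m + 1)) := by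
  intro u hu
  have hj := succ_notMem_Icc m
  rw [ht.branchPoints_insertEdge hj hC, Finset.mem_insert, Finset.mem_image] at hu
  rcases hu with rfl | ⟨u, hu, rfl⟩
  · rw [ht.children_insertEdge_new hj hC]
    exact (Finset.card_le_two).trans (by omega)
  · rw [ht.card_children_insertEdge hj hC (mem_branchPoints.1 hu).1]
    exact h u hu

theorem AtMostTernary.downTree (h : AtMostTernary t) (hm : 1 ≤ m)
    (ht : IsTree (Finset.Icc 1 (m + 1)) t) {i k : ℕ} (hi : i ∈ Finset.Icc 1 (m + 1))
    (hk : k ∈ Finset.Icc 1 (m + 1)) : AtMostTernary (downTree t i k) := by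
  intro u hu
  rw [ht.branchPoints_downTree hm hi hk, Finset.mem_image] at hu
  obtain ⟨u, hu, rfl⟩ := hu
  rw [Finset.mem_filter] at hu
  have hui : u ≠ {i} := by
    rintro rfl
    simpa using (mem_branchPoints.1 hu.1).2
  rw [ht.card_children_downTree hm hi hk (mem_branchPoints.1 hu.1).1 hui hu.2]
  exact (Finset.card_le_card (Finset.erase_subset _ _)).trans (h u hu.1)

/-- For `α = γ = 0`, leaves are only inserted into leaf edges. -/
theorem AtMostTernary.of_growthRule_ne_zero (h : AtMostTernary t)
    (ht : IsTree (Finset.Icc 1 m) t) {s : Finset (Finset ℕ)}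
    (hs : growthRule 0 0 m t s ≠ 0) : AtMostTernary s := by
  by_contra hns
  apply hs
  unfold growthRule
  rw [Finset.sum_eq_zero, Finset.sum_eq_zero, add_zero]
  · intro C hC
    rw [ite_eq_right_iff]
    intro _
    by_cases hm : m = 1
    · subst hm
      rw [ht.eq_singleton] at hC
      exact absurd hC (by rw [show branchPoints {{1}} = ∅ by decide]; simp)
    · rw [insertionProb, if_neg hm]
      simp
  · intro C hC
    rw [ite_eq_right_iff]
    rintro rfl
    exact absurd (h.insertEdge ht hC) hns

theorem admissible_iff {α : ℝ} {n : ℕ} (t : Tree n) :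
    Admissible α t ↔ (α = 0 → AtMostTernary t.1) := Iff.rfl

theorem admissible_of_growthLaw_ne_zero {α γ : ℝ} (hγ : 0 ≤ γ) (hγα : γ ≤ α) (hm : 1 ≤ m)
    (t : Tree m) (h : growthLaw α γ m t ≠ 0) : Admissible α t := by
  rw [admissible_iff]
  rintro rfl
  obtain rfl : γ = 0 := le_antisymm hγα hγ
  induction m, hm using Nat.le_induction with
  | base =>
    intro v hv
    rw [t.2.eq_singleton] at hv
    exact absurd hv (by rw [show branchPoints {{1}} = ∅ by decide]; simp)
  | succ m hm ih =>
    rw [growthLaw_succ hm] at h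
    obtain ⟨s, -, hs⟩ := Finset.exists_ne_zero_of_sum_ne_zero h
    exact (ih s (left_ne_zero_of_mul hs)).of_growthRule_ne_zero s.2 (right_ne_zero_of_mul hs)

theorem admissible_of_chainKernel_ne_zero {α γ : ℝ} (hγ : 0 ≤ γ) (hγα : γ ≤ α) (hm : 1 ≤ m)
    {t s : Tree (m + 1)} (ht : Admissible α t) (h : chainKernel α γ (m + 1) t s ≠ 0) :
    Admissible α s := by
  rw [admissible_iff] at ht ⊢
  rintro rfl
  obtain rfl : γ = 0 := le_antisymm hγα hγ
  by_contra hs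
  apply h
  rw [chainKernel_eq_sum]
  refine Finset.sum_eq_zero fun i hi => ?_
  rw [downLaw_congr (g := fun _ => 0 * 0) t.2 hi, downLaw_mul_const]
  · simp
  · intro k hk
    rw [mul_zero]
    by_contra h1
    exact hs (((ht rfl).downTree hm t.2 hi hk).of_growthRule_ne_zero
      (t.2.downTree hm hi hk) h1)

end Admissible

/-! ### Orderings of a finite set -/

section Orderings

variable {β : Type*} [DecidableEq β]

/-- The finite set of all lists that enumerate `S` without repetition. -/
noncomputable def orderings (S : Finset β) : Finset (List β) := S.toList.permutations.toFinset

theorem mem_orderings {S : Finset β} {l : List β} :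
    l ∈ orderings S ↔ l.Nodup ∧ ∀ x, x ∈ l ↔ x ∈ S := by
  rw [orderings, List.mem_toFinset, List.mem_permutations]
  constructor
  · intro h
    exact ⟨h.nodup_iff.2 S.nodup_toList, fun x => by rw [h.mem_iff, Finset.mem_toList]⟩
  · rintro ⟨h1, h2⟩
    rw [List.perm_ext_iff_of_nodup h1 S.nodup_toList]
    intro x
    rw [h2, Finset.mem_toList]

theorem length_of_mem_orderings {S : Finset β} {l : List β} (h : l ∈ orderings S) :
    l.length = S.card := by
  obtain ⟨h1, h2⟩ := mem_orderings.1 h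
  rw [← List.toFinset_card_of_nodup h1]
  congr 1
  ext x
  rw [List.mem_toFinset, h2]

theorem orderings_empty : orderings (∅ : Finset β) = {[]} := by
  ext l
  rw [mem_orderings, Finset.mem_singleton]
  constructor
  · rintro ⟨-, h⟩
    exact List.eq_nil_iff_forall_not_mem.2 fun x hx => by simpa using (h x).1 hx
  · rintro rfl
    simp

theorem idxOf_insertIdx_self {l : List β} {x : β} (hx : x ∉ l) {p : ℕ} (hp : p ≤ l.length) :
    (l.insertIdx p x).idxOf x = p := by
  induction l generalizing p with
  | nil =>
    obtain rfl : p = 0 := by simpa using hp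
    simp
  | cons a l ih =>
    rw [List.mem_cons, not_or] at hx
    cases p with
    | zero => simp
    | succ p =>
      rw [List.insertIdx_succ_cons, List.idxOf_cons_ne _ (Ne.symm hx.1),
        ih hx.2 (by simpa using hp)]

theorem erase_insertIdx_self {l : List β} {x : β} (hx : x ∉ l) {p : ℕ} (hp : p ≤ l.length) :
    (l.insertIdx p x).erase x = l := by
  induction l generalizing p with
  | nil =>
    obtain rfl : p = 0 := by simpa using hp
    simp
  | cons a l ih =>
    rw [List.mem_cons, not_or] at hx
    cases p with
    | zero => simp
    | succ p =>
      rw [List.insertIdx_succ_cons, List.erase_cons_tail (by simpa using Ne.symm hx.1),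
        ih hx.2 (by simpa using hp)]

theorem insertIdx_idxOf_erase {l : List β} {x : β} (hx : x ∈ l) :
    (l.erase x).insertIdx (l.idxOf x) x = l := by
  induction l with
  | nil => simp at hx
  | cons a l ih =>
    by_cases h : a = x
    · subst h; simp
    · have hx' : x ∈ l := (List.mem_cons.1 hx).resolve_left (Ne.symm h)
      rw [List.erase_cons_tail (by simpa using h), List.idxOf_cons_ne _ h,
        List.insertIdx_succ_cons, ih hx']

/-- An ordering of `insert x S` is an ordering of `S` into which `x` has been inserted. -/
theorem sum_orderings_insert {S : Finset β} {x : β} (hx : x ∉ S) (f : List β → ℝ) :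
    ∑ l ∈ orderings (insert x S), f l =
      ∑ l ∈ orderings S, ∑ p ∈ Finset.range (S.card + 1), f (l.insertIdx p x) := by
  rw [Finset.sum_sigma']
  refine Finset.sum_bij' (fun l _ => (⟨l.erase x, l.idxOf x⟩ : Σ _ : List β, ℕ))
    (fun y _ => y.1.insertIdx y.2 x) ?_ ?_ ?_ ?_ ?_
  · intro l hl
    have hlen := length_of_mem_orderings hl
    obtain ⟨h1, h2⟩ := mem_orderings.1 hl
    rw [Finset.mem_sigma, mem_orderings, Finset.mem_range]
    refine ⟨⟨h1.erase x, fun y => ?_⟩, ?_⟩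
    · rw [h1.mem_erase_iff, h2, Finset.mem_insert]
      constructor
      · rintro ⟨h3, h4 | h4⟩
        · exact absurd h4 h3
        · exact h4
      · exact fun h => ⟨fun h' => hx (h' ▸ h), .inr h⟩
    · rw [← Finset.card_insert_of_notMem hx, ← hlen]
      exact List.idxOf_lt_length_iff.2 ((h2 x).2 (Finset.mem_insert_self _ _))
  · rintro ⟨l, p⟩ hy
    rw [Finset.mem_sigma, Finset.mem_range] at hy
    have hlen := length_of_mem_orderings hy.1
    obtain ⟨h1, h2⟩ := mem_orderings.1 hy.1
    have hp : p ≤ l.length := by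
      have h3 : p < S.card + 1 := hy.2
      have h4 : l.length = S.card := hlen
      omega
    have hperm := List.perm_insertIdx x l hp
    rw [mem_orderings]
    refine ⟨hperm.nodup_iff.2 (List.nodup_cons.2 ⟨fun h => hx ((h2 x).1 h), h1⟩), fun y => ?_⟩
    rw [hperm.mem_iff, List.mem_cons, Finset.mem_insert, h2]
  · intro l hl
    exact insertIdx_idxOf_erase (((mem_orderings.1 hl).2 x).2 (Finset.mem_insert_self _ _))
  · rintro ⟨l, p⟩ hy
    rw [Finset.mem_sigma, Finset.mem_range] at hy
    have hlen := length_of_mem_orderings hy.1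
    have hxl : x ∉ l := fun h => hx (((mem_orderings.1 hy.1).2 x).1 h)
    have hp : p ≤ l.length := by
      have h3 : p < S.card + 1 := hy.2
      have h4 : l.length = S.card := hlen
      omega
    simp only [erase_insertIdx_self hxl hp, idxOf_insertIdx_self hxl hp]
  · intro l hl
    rw [insertIdx_idxOf_erase (((mem_orderings.1 hl).2 x).2 (Finset.mem_insert_self _ _))]

end Orderings

/-! ### Ordered Chinese restaurants -/

section Ocrp

variable {α θ : ℝ}

theorem idxOf_append_cons_lt_iff {l₁ l₂ : List ℕ} {M p q : ℕ} (hp : p ≠ M) (hq : q ≠ M) :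
    (l₁ ++ M :: l₂).idxOf q < (l₁ ++ M :: l₂).idxOf p ↔
      (l₁ ++ l₂).idxOf q < (l₁ ++ l₂).idxOf p := by
  have hb : ∀ x ∈ l₁, l₁.idxOf x < l₁.length := fun x hx => List.idxOf_lt_length_iff.2 hx
  rw [List.idxOf_append, List.idxOf_append, List.idxOf_append, List.idxOf_append,
    List.idxOf_cons_ne _ hp.symm, List.idxOf_cons_ne _ hq.symm]
  split_ifs with h1 h2 h2
  · rfl
  · have := hb _ h1; omega
  · have := hb _ h2; omega
  · omega

@[simp] theorem ocrpProb_nil : ocrpProb α θ [] = 1 := by simp [ocrpProb]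

@[simp] theorem ocrpProb_singleton (a : ℕ) : ocrpProb α θ [a] = 1 := by simp [ocrpProb]

/-- The last step of an ordered Chinese restaurant process. -/
theorem ocrpProb_append_max {l₁ l₂ : List ℕ} {M : ℕ} (hnd : (l₁ ++ l₂).Nodup)
    (hM : ∀ q ∈ l₁ ++ l₂, q < M) :
    ocrpProb α θ (l₁ ++ M :: l₂) = if l₁ ++ l₂ = [] then 1 else
      ocrpProb α θ (l₁ ++ l₂) *
        ((if l₂ = [] then θ else α) / (((l₁ ++ l₂).length : ℝ) * α + θ)) := by
  by_cases h0 : l₁ ++ l₂ = []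
  · obtain ⟨rfl, rfl⟩ := List.append_eq_nil_iff.1 h0
    simp
  rw [if_neg h0]
  have hM' : M ∉ (l₁ ++ l₂).toFinset := fun h => lt_irrefl M (hM M (List.mem_toFinset.1 h))
  have hmem : ∀ q, q ∈ l₁ ++ M :: l₂ ↔ q = M ∨ q ∈ l₁ ++ l₂ := by
    intro q; simp only [List.mem_append, List.mem_cons]; tauto
  have hset : (l₁ ++ M :: l₂).toFinset = insert M (l₁ ++ l₂).toFinset := by
    ext q; rw [List.mem_toFinset, hmem, Finset.mem_insert, List.mem_toFinset]
  have hMl₁ : M ∉ l₁ := fun h => lt_irrefl M (hM M (List.mem_append_left _ h))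
  -- The youngest table does not affect the factors of the other tables.
  rw [ocrpProb, hset, Finset.prod_insert hM', mul_comm, ocrpProb]
  congr 1
  · refine Finset.prod_congr rfl fun p hp => ?_
    have hpM := hM p (List.mem_toFinset.1 hp)
    have e1 : (∀ q ∈ l₁ ++ M :: l₂, p ≤ q) ↔ ∀ q ∈ l₁ ++ l₂, p ≤ q := by
      simp only [hmem, forall_eq_or_imp, hpM.le, true_and]
    have e2 : (∀ q ∈ l₁ ++ M :: l₂, q < p →
        (l₁ ++ M :: l₂).idxOf q < (l₁ ++ M :: l₂).idxOf p) ↔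
        ∀ q ∈ l₁ ++ l₂, q < p → (l₁ ++ l₂).idxOf q < (l₁ ++ l₂).idxOf p := by
      simp only [hmem, forall_eq_or_imp, not_lt.2 hpM.le, false_imp_iff, true_and]
      exact forall₂_congr fun q hq => by
        rw [idxOf_append_cons_lt_iff hpM.ne (hM q hq).ne]
    have e3 : (l₁ ++ M :: l₂).filter (fun q => q < p) = (l₁ ++ l₂).filter (fun q => q < p) := by
      simp [not_lt.2 hpM.le]
    simp only [e1, e2, e3]
  · have e3 : (l₁ ++ M :: l₂).filter (fun q => q < M) = l₁ ++ l₂ := by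
      rw [List.filter_append, List.filter_cons_of_neg (by simp), ← List.filter_append,
        List.filter_eq_self.2 (fun q hq => by simpa using hM q hq)]
    have e2 : (∀ q ∈ l₁ ++ M :: l₂, q < M →
        (l₁ ++ M :: l₂).idxOf q < (l₁ ++ M :: l₂).idxOf M) ↔ l₂ = [] := by
      have hidx : (l₁ ++ M :: l₂).idxOf M = l₁.length := by
        rw [List.idxOf_append, if_neg hMl₁]; simp
      rw [hidx]
      constructor
      · intro h
        rw [List.eq_nil_iff_forall_not_mem]
        intro x hx
        have hxM := hM x (List.mem_append_right _ hx)
        have h1 := h x ((hmem x).2 (.inr (List.mem_append_right _ hx))) hxM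
        have hx1 : x ∉ l₁ := fun h => (List.disjoint_of_nodup_append hnd) h hx
        rw [List.idxOf_append, if_neg hx1] at h1
        omega
      · rintro rfl q hq hqM
        rw [hmem, List.append_nil] at hq
        have hql := hq.resolve_left hqM.ne
        rw [List.idxOf_append, if_pos hql]
        exact List.idxOf_lt_length_iff.2 hql
    rw [if_neg, e3]
    · simp only [e2]
    · intro h
      obtain ⟨x, hx⟩ := List.exists_mem_of_ne_nil _ h0
      exact absurd (h x ((hmem x).2 (.inr hx))) (not_le.2 (hM x hx))

/-- A table order, decomposed at its youngest table. -/
theorem exists_append_max {l : List ℕ} (hl : l ≠ []) (hnd : l.Nodup) :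
    ∃ l₁ M l₂, l = l₁ ++ M :: l₂ ∧ (∀ q ∈ l₁ ++ l₂, q < M) ∧ (l₁ ++ l₂).Nodup := by
  obtain ⟨M, hM⟩ : ∃ M, l.max? = some M := by
    cases h : l.max? with
    | none => exact absurd (List.max?_eq_none_iff.1 h) hl
    | some M => exact ⟨M, rfl⟩
  obtain ⟨hMl, hmax⟩ := List.max?_eq_some_iff.1 hM
  obtain ⟨l₁, l₂, rfl⟩ := List.append_of_mem hMl
  rw [List.nodup_middle, List.nodup_cons] at hnd
  refine ⟨l₁, M, l₂, rfl, fun q hq => lt_of_le_of_ne (hmax q ?_) fun h => hnd.1 (h ▸ hq), hnd.2⟩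
  rw [List.mem_append] at hq
  rw [List.mem_append, List.mem_cons]
  tauto

/-- The law of an ordered Chinese restaurant process depends on the labels of the tables only
through their order. -/
theorem ocrpProb_map {f : ℕ → ℕ} {l : List ℕ} (hnd : l.Nodup)
    (hf : ∀ a ∈ l, ∀ b ∈ l, a < b → f a < f b) :
    ocrpProb α θ (l.map f) = ocrpProb α θ l := by
  induction h : l.length using Nat.strong_induction_on generalizing l with
  | _ n ih =>
    by_cases hl : l = []
    · rw [hl]; rfl
    obtain ⟨l₁, M, l₂, rfl, hM, hnd'⟩ := exists_append_max hl hnd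
    have hsub : ∀ a ∈ l₁ ++ l₂, a ∈ l₁ ++ M :: l₂ := by
      intro a; simp only [List.mem_append, List.mem_cons]; tauto
    have hfM : ∀ q ∈ l₁.map f ++ l₂.map f, q < f M := by
      rw [← List.map_append]
      intro q hq
      obtain ⟨a, ha, rfl⟩ := List.mem_map.1 hq
      exact hf a (hsub a ha) M (by simp) (hM a ha)
    have hnd'' : (l₁.map f ++ l₂.map f).Nodup := by
      rw [← List.map_append]
      refine hnd'.map_on fun a ha b hb hab => ?_
      rcases lt_trichotomy a b with h1 | h1 | h1
      · exact absurd hab (hf a (hsub a ha) b (hsub b hb) h1).ne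
      · exact h1
      · exact absurd hab (hf b (hsub b hb) a (hsub a ha) h1).ne'
    have := ih (l₁ ++ l₂).length (by rw [← h]; simp) hnd'
      (fun a ha b hb => hf a (hsub a ha) b (hsub b hb)) rfl
    rw [List.map_append, List.map_cons, ocrpProb_append_max hnd'' hfM,
      ocrpProb_append_max hnd' hM, ← List.map_append, this]
    simp

/-- Insertion of a table `s` which is leftmost or has an older neighbour. The younger tables have
one more place to choose from, of weight `α`, so their normalizing constants are shifted by one, and
only the last of these constants does not cancel. The table `s` itself contributes the weight of the
place where it is opened. -/
theorem ocrpProb_insert (hα : 0 < α) (hθ : 0 ≤ θ) {l₁ l₂ : List ℕ} {s : ℕ}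
    (hnd : (l₁ ++ s :: l₂).Nodup) (hne : l₁ ++ l₂ ≠ [])
    (hs : l₁ = [] ∨ (∃ l q, l₁ = l ++ [q] ∧ q < s) ∨ ∃ q l, l₂ = q :: l ∧ q < s) :
    ocrpProb α θ (l₁ ++ s :: l₂) * (((l₁ ++ l₂).length : ℝ) * α + θ) =
      (if ∃ q ∈ l₂, q < s then α else θ) * ocrpProb α θ (l₁ ++ l₂) := by
  have hpos : ∀ n : ℕ, n ≠ 0 → (n : ℝ) * α + θ ≠ 0 := by
    intro n hn
    have : (0 : ℝ) < n := by exact_mod_cast Nat.pos_of_ne_zero hn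
    positivity
  have hlen : ∀ {l : List ℕ}, l ≠ [] → ((l.length : ℝ) * α + θ) ≠ 0 := fun h =>
    hpos _ (by simpa using h)
  -- Induction on the number of tables, by removing the youngest one: if this is not the new table,
  -- then the property `hs` of the new table is preserved.
  induction h : (l₁ ++ l₂).length using Nat.strong_induction_on generalizing l₁ l₂ with
  | _ n ih =>
    subst h
    obtain ⟨a, M, b, hab, hM, hnd'⟩ := exists_append_max (by simp) hnd
    have hd := hpos _ (show (l₁ ++ l₂).length ≠ 0 by simpa using hne)
    -- the new table is the youngest one
    have hcase : (∀ q ∈ l₁ ++ l₂, q < s) → (l₁ ++ l₂).Nodup →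
        ocrpProb α θ (l₁ ++ s :: l₂) * (((l₁ ++ l₂).length : ℝ) * α + θ) =
        (if ∃ q ∈ l₂, q < s then α else θ) * ocrpProb α θ (l₁ ++ l₂) := by
      intro hM hnd'
      rw [ocrpProb_append_max hnd' hM, if_neg hne]
      have e : (∃ q ∈ l₂, q < s) ↔ ¬ l₂ = [] := by
        constructor
        · rintro ⟨q, hq, -⟩ rfl
          simp at hq
        · intro h
          obtain ⟨q, hq⟩ := List.exists_mem_of_ne_nil _ h
          exact ⟨q, hq, hM q (List.mem_append_right _ hq)⟩
      by_cases h2 : l₂ = []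
      · rw [if_pos h2, if_neg (by rw [e]; exact not_not.2 h2), mul_assoc, div_mul_cancel₀ _ hd,
          mul_comm]
      · rw [if_neg h2, if_pos (e.2 h2), mul_assoc, div_mul_cancel₀ _ hd, mul_comm]
    rcases List.append_eq_append_iff.1 hab with ⟨c, rfl, hc⟩ | ⟨c, rfl, hc⟩
    · cases c with
      | nil =>
        simp only [List.nil_append, List.cons.injEq] at hc
        obtain ⟨rfl, rfl⟩ := hc
        simp only [List.append_nil] at hM hnd'
        exact hcase hM hnd'
      | cons s' c =>
        -- the youngest table `M` is to the right of the new table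
        simp only [List.cons_append, List.cons.injEq] at hc
        obtain ⟨rfl, rfl⟩ := hc
        have hsM : s < M := hM s (by simp)
        simp only [List.append_assoc, List.cons_append] at hM hnd' ⊢
        have hMs : ¬ M < s := hsM.not_gt
        rw [← List.cons_append, ← List.append_assoc, ocrpProb_append_max (by simpa using hnd')
          (by simpa using hM), if_neg (by simp), ← List.append_assoc l₁ c (M :: b)]
        have hM2 : ∀ q ∈ (l₁ ++ c) ++ b, q < M := fun q hq => hM q (by
          simp only [List.mem_append, List.mem_cons] at hq ⊢; tauto)
        have hnd2 : ((l₁ ++ c) ++ b).Nodup := by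
          have := List.nodup_middle.1 hnd'
          rw [List.nodup_cons] at this
          simpa using this.2
        rw [ocrpProb_append_max hnd2 hM2]
        by_cases h0 : (l₁ ++ c) ++ b = []
        · simp only [List.append_eq_nil_iff] at h0
          obtain ⟨⟨rfl, rfl⟩, rfl⟩ := h0
          have h1 := hpos 1 one_ne_zero
          simp [hMs] at h1 ⊢
          field_simp
        · rw [if_neg h0]
          have hs' : l₁ = [] ∨ (∃ l q, l₁ = l ++ [q] ∧ q < s) ∨
              ∃ q l, c ++ b = q :: l ∧ q < s := by
            rcases hs with h | h | ⟨q, l, h, hq⟩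
            · exact .inl h
            · exact .inr (.inl h)
            · cases c with
              | nil =>
                simp only [List.nil_append, List.cons.injEq] at h
                exact absurd (h.1 ▸ hq) hMs
              | cons q' c =>
                simp only [List.cons_append, List.cons.injEq] at h
                exact .inr (.inr ⟨q', c ++ b, rfl, h.1 ▸ hq⟩)
          have := ih (l₁ ++ (c ++ b)).length (by simp) hnd'
            (by simpa using h0) hs' rfl
          have e : (∃ q ∈ c ++ M :: b, q < s) ↔ ∃ q ∈ c ++ b, q < s := by
            simp only [List.mem_append, List.mem_cons, or_and_right, exists_or,
              exists_eq_left, hMs, false_or]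
          have hd1 := hlen h0
          have hd2 : (((l₁ ++ s :: c) ++ b).length : ℝ) * α + θ ≠ 0 := hlen (by simp)
          simp only [e]
          simp only [List.append_assoc, List.cons_append] at this hd1 hd2 ⊢
          have e2 : (l₁ ++ (c ++ M :: b)).length = (l₁ ++ s :: (c ++ b)).length := by
            simp; omega
          rw [e2]
          rw [← mul_assoc, mul_assoc (ocrpProb α θ (l₁ ++ s :: (c ++ b))), div_mul_cancel₀ _ hd2,
            ← this]
          field_simp
    · cases c with
      | nil =>
        simp only [List.nil_append, List.cons.injEq] at hc
        obtain ⟨rfl, rfl⟩ := hc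
        simp only [List.append_nil] at hcase ⊢
        exact hcase hM hnd'
      | cons M' c =>
        -- the youngest table `M` is to the left of the new table
        simp only [List.cons_append, List.cons.injEq] at hc
        obtain ⟨rfl, rfl⟩ := hc
        have hsM : s < M := hM s (by simp)
        have hMs : ¬ M < s := hsM.not_gt
        simp only [List.append_assoc, List.cons_append] at hM hnd' hs hd ⊢
        have hs' : a ++ c = [] ∨ (∃ l q, a ++ c = l ++ [q] ∧ q < s) ∨
            ∃ q l, l₂ = q :: l ∧ q < s := by
          rcases hs with h | ⟨l, q, h, hq⟩ | h
          · simp at h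
          · right; left
            rcases List.eq_nil_or_concat c with rfl | ⟨c, x, rfl⟩
            · have := (List.append_inj' h (by simp)).2
              simp only [List.cons.injEq, and_true] at this
              exact absurd (this ▸ hq) hMs
            · refine ⟨a ++ c, x, by simp, ?_⟩
              have h' : (a ++ M :: c) ++ [x] = l ++ [q] := by rw [← h]; simp
              have := (List.append_inj' h' (by simp)).2
              simp only [List.cons.injEq, and_true] at this
              exact this ▸ hq
          · exact .inr (.inr h)
        have hcl : c ++ l₂ ≠ [] := by
          intro h
          obtain ⟨rfl, rfl⟩ := List.append_eq_nil_iff.1 h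
          rcases hs with h | ⟨l, q, h, hq⟩ | ⟨q, l, h, -⟩
          · simp at h
          · have := (List.append_inj' h (by simp)).2
            simp only [List.cons.injEq, and_true] at this
            exact absurd (this ▸ hq) hMs
          · simp at h
        have h0 : a ++ (c ++ l₂) ≠ [] := fun h => hcl (List.append_eq_nil_iff.1 h).2
        have hM2 : ∀ q ∈ a ++ (c ++ l₂), q < M := fun q hq => hM q (by
          simp only [List.mem_append, List.mem_cons] at hq ⊢; tauto)
        have hnd2 : (a ++ (c ++ l₂)).Nodup := by
          rw [← List.append_assoc] at hnd' ⊢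
          have := List.nodup_middle.1 hnd'
          rw [List.nodup_cons] at this
          exact this.2
        have := ih (a ++ (c ++ l₂)).length (by simp) (by simpa using hnd')
          (by simpa using h0) hs' (by simp)
        rw [ocrpProb_append_max hnd' hM, if_neg (by simp), ocrpProb_append_max hnd2 hM2,
          if_neg h0, if_neg (by simp), if_neg hcl]
        have hd1 := hlen h0
        have hd2 : (((a ++ (c ++ s :: l₂)).length : ℝ)) * α + θ ≠ 0 := hlen (by simp)
        simp only [List.append_assoc] at this
        have e2 : (a ++ M :: (c ++ l₂)).length = (a ++ (c ++ s :: l₂)).length := by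
          simp; omega
        rw [e2, ← mul_assoc, mul_assoc (ocrpProb α θ (a ++ (c ++ s :: l₂))),
          div_mul_cancel₀ _ hd2, (eq_div_iff hd1).2 this]
        ring

end Ocrp

section OcrpSums

variable {β : Type*} {α θ : ℝ}

theorem insertIdx_eq_take_append_cons_drop {l : List β} {p : ℕ} (hp : p ≤ l.length) (x : β) :
    l.insertIdx p x = l.take p ++ x :: l.drop p := by
  induction l generalizing p with
  | nil =>
    obtain rfl : p = 0 := by simpa using hp
    simp
  | cons a l ih =>
    cases p with
    | zero => simp
    | succ p => simp [List.insertIdx_succ_cons, ih (by simpa using hp)]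

/-- The tables older than `i`, together with a virtual table `d` to the left of all tables, each
have exactly one place to their right, and the rightmost of these places has weight `θ`, the others
have weight `α`. -/
theorem sum_insertion_weights (i : ℕ) (l : List ℕ) (d : ℕ) :
    ∑ p ∈ Finset.range (l.length + 1),
      (if (l.take p).getLastD d < i then (if ∃ q ∈ l.drop p, q < i then α else θ) else 0) =
    if ∃ q ∈ d :: l, q < i then
      ((((d :: l).filter (fun q => q < i)).length : ℝ) - 1) * α + θ else 0 := by
  induction l generalizing d with
  | nil => by_cases h : d < i <;> simp [h]
  | cons a l ih =>
    rw [List.length_cons, Finset.sum_range_succ']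
    have h1 : ∀ p, ((a :: l).take (p + 1)).getLastD d = (l.take p).getLastD a := fun p => by
      rw [List.take_succ_cons, List.getLastD_cons]
    simp only [h1, List.drop_succ_cons, ih a, List.take_zero, List.getLastD_nil, List.drop_zero]
    by_cases hd : d < i
    · by_cases ha : ∃ q ∈ a :: l, q < i
      · rw [if_pos ha, if_pos hd, if_pos ha,
          if_pos ⟨d, List.mem_cons_self, hd⟩,
          List.filter_cons_of_pos (p := fun q => decide (q < i)) (a := d) (by simpa using hd),
          List.length_cons (a := d)]
        push_cast
        ring
      · rw [if_neg ha, if_pos hd, if_neg ha, if_pos ⟨d, List.mem_cons_self, hd⟩,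
          List.filter_cons_of_pos (p := fun q => decide (q < i)) (a := d) (by simpa using hd),
          List.filter_eq_nil_iff.2]
        · simp
        · intro q hq
          simpa using fun h => ha ⟨q, hq, h⟩
    · have e : (∃ q ∈ d :: a :: l, q < i) ↔ ∃ q ∈ a :: l, q < i := by
        rw [List.exists_mem_cons_iff]
        simp only [hd, false_or]
      rw [if_neg hd, add_zero,
        List.filter_cons_of_neg (p := fun q => decide (q < i)) (a := d) (by simpa using hd)]
      simp only [e]

/-- The total probability of the table orders that arise from `l` by inserting the table `i`
leftmost or immediately to the right of an older table. -/
theorem sum_ocrpProb_insertIdx (hα : 0 < α) (hθ : 0 ≤ θ) {i : ℕ} (hi : 0 < i) {l : List ℕ}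
    (hl : l ≠ []) (hnd : l.Nodup) (hil : i ∉ l) :
    (∑ p ∈ Finset.range (l.length + 1),
      if (l.take p).getLastD 0 < i then ocrpProb α θ (l.insertIdx p i) else 0) *
        ((l.length : ℝ) * α + θ) =
      (((l.filter (fun q => q < i)).length : ℝ) * α + θ) * ocrpProb α θ l := by
  -- The virtual table to the left of all others gets the label `0`, which is less than `i`.
  have key := sum_insertion_weights (α := α) (θ := θ) i l 0
  rw [if_pos ⟨0, List.mem_cons_self, hi⟩, List.filter_cons_of_pos (by simpa using hi),
    List.length_cons] at key
  push_cast at key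
  rw [add_sub_cancel_right] at key
  rw [← key, Finset.sum_mul, Finset.sum_mul]
  refine Finset.sum_congr rfl fun p hp => ?_
  have hp' : p ≤ l.length := Nat.lt_succ_iff.1 (Finset.mem_range.1 hp)
  split_ifs with h1 h2
  all_goals try simp only [zero_mul]
  all_goals
    have hperm := List.perm_insertIdx i l hp'
    have hnd' := hperm.nodup_iff.2 (List.nodup_cons.2 ⟨hil, hnd⟩)
    rw [insertIdx_eq_take_append_cons_drop hp'] at hnd' ⊢
    have := ocrpProb_insert hα hθ hnd' (by simpa using hl) (by
      rcases List.eq_nil_or_concat (l.take p) with h | ⟨a, q, h⟩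
      · exact .inl h
      · refine .inr (.inl ⟨a, q, by simpa using h, ?_⟩)
        rw [h] at h1
        simpa using h1)
    rw [List.take_append_drop] at this
    rw [this]
  · rw [if_pos h2]
  · rw [if_neg h2]

/-- The probabilities of the table orders add up to one. -/
theorem sum_orderings_ocrpProb [DecidableEq β] (hθ : 0 ≤ θ) (S : Finset β) (f : β → ℕ)
    (hf : Set.InjOn f S) (h : 0 < α ∨ S.card ≤ 1) :
    ∑ L ∈ orderings S, ocrpProb α θ (L.map f) = 1 := by
  -- The element with the largest label is the table opened last.
  induction S using Finset.induction_on_max_value f with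
  | empty => simp [orderings_empty]
  | insert x S hx hmax ih =>
    have hmax' : ∀ y ∈ S, f y < f x := fun y hy => lt_of_le_of_ne (hmax y hy) fun e =>
      hx (hf (by simp [hy]) (by simp) e ▸ hy)
    rw [sum_orderings_insert hx]
    have ih' := ih (hf.mono (by simp)) (h.imp id fun h' => by
      rw [Finset.card_insert_of_notMem hx] at h'; omega)
    rw [← ih']
    refine Finset.sum_congr rfl fun L hL => ?_
    have hlen := length_of_mem_orderings hL
    obtain ⟨hnd, hmem⟩ := mem_orderings.1 hL
    have hnd' : (L.map f).Nodup := hnd.map_on fun a ha b hb hab =>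
      hf (by simp [(hmem a).1 ha]) (by simp [(hmem b).1 hb]) hab
    have hstep : ∀ p ∈ Finset.range (S.card + 1), ocrpProb α θ ((L.insertIdx p x).map f) =
        if L = [] then 1 else ocrpProb α θ (L.map f) *
          ((if L.drop p = [] then θ else α) / ((L.length : ℝ) * α + θ)) := by
      intro p hp
      have hp' : p ≤ L.length := by rw [hlen]; exact Nat.lt_succ_iff.1 (Finset.mem_range.1 hp)
      have e : (L.take p).map f ++ (L.drop p).map f = L.map f := by
        rw [← List.map_append, List.take_append_drop]
      rw [insertIdx_eq_take_append_cons_drop hp', List.map_append, List.map_cons,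
        ocrpProb_append_max (by rwa [e]), e]
      · simp only [List.map_eq_nil_iff, List.length_map]
      · rw [e]
        intro q hq
        obtain ⟨y, hy, rfl⟩ := List.mem_map.1 hq
        exact hmax' y ((hmem y).1 hy)
    rw [Finset.sum_congr rfl hstep]
    by_cases hL0 : L = []
    · subst hL0
      have h0 : S.card = 0 := by rw [← hlen]; rfl
      simp [h0]
    · have hS : S.card ≠ 0 := by rw [← hlen]; simpa using hL0
      have hα : 0 < α := h.resolve_right fun h' => by
        rw [Finset.card_insert_of_notMem hx] at h'; omega
      have hpos : (L.length : ℝ) * α + θ ≠ 0 := by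
        have : (0 : ℝ) < L.length := by rw [hlen]; exact_mod_cast Nat.pos_of_ne_zero hS
        positivity
      simp only [if_neg hL0]
      rw [← Finset.mul_sum, ← Finset.sum_div, Finset.sum_range_succ]
      have h1 : ∀ p ∈ Finset.range S.card, (if L.drop p = [] then θ else α) = α := by
        intro p hp
        rw [if_neg]
        rw [List.drop_eq_nil_iff, hlen, not_le]
        exact Finset.mem_range.1 hp
      rw [Finset.sum_congr rfl h1, if_pos (by rw [List.drop_eq_nil_iff, hlen]), Finset.sum_const,
        Finset.card_range, nsmul_eq_mul, ← hlen, div_self hpos, mul_one]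

end OcrpSums

/-! ### The subtrees that are ordered in a semi-planar tree -/

/-- The children of `u` of rank at least three. -/
def bigChildren (t : Finset (Finset ℕ)) (u : Finset ℕ) : Finset (Finset ℕ) :=
  (children t u).filter fun D => 3 ≤ rank t u D

/-- The children of `u` of rank one and two. -/
def smallChildren (t : Finset (Finset ℕ)) (u : Finset ℕ) : Finset (Finset ℕ) :=
  (children t u).filter fun D => ¬ 3 ≤ rank t u D

section BigChildren

variable {A : Finset ℕ} {t s : Finset (Finset ℕ)} {u w : Finset ℕ}

theorem mem_bigChildren {D : Finset ℕ} :
    D ∈ bigChildren t u ↔ D ∈ children t u ∧ 3 ≤ rank t u D := Finset.mem_filter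

theorem mem_smallChildren {D : Finset ℕ} :
    D ∈ smallChildren t u ↔ D ∈ children t u ∧ ¬ 3 ≤ rank t u D := Finset.mem_filter

theorem children_eq_small_union_big (t : Finset (Finset ℕ)) (u : Finset ℕ) :
    children t u = smallChildren t u ∪ bigChildren t u := by
  rw [Finset.union_comm]
  exact (Finset.filter_union_filter_not_eq _ _).symm

theorem minLabel_lt_of_small_of_big {D E : Finset ℕ} (hD : D ∈ smallChildren t u)
    (hE : E ∈ bigChildren t u) : minLabel D < minLabel E := by
  rw [mem_smallChildren] at hD
  rw [mem_bigChildren] at hE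
  exact (IsTree.rank_lt_rank_iff hE.1).1 (by omega)

theorem one_le_rank {D : Finset ℕ} (hD : D ∈ children t u) : 1 ≤ rank t u D :=
  Finset.card_pos.2 ⟨D, Finset.mem_filter.2 ⟨hD, le_rfl⟩⟩

theorem IsTree.card_smallChildren (ht : IsTree A t) (hu : u ∈ branchPoints t) :
    (smallChildren t u).card = 2 := by
  have h2 := ht.two_le_card_children hu
  have h : (smallChildren t u).image (rank t u) = {1, 2} := by
    ext r
    rw [Finset.mem_image, Finset.mem_insert, Finset.mem_singleton]
    constructor
    · rintro ⟨D, hD, rfl⟩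
      rw [mem_smallChildren] at hD
      have := one_le_rank hD.1
      omega
    · intro hr
      obtain ⟨D, hD, rfl⟩ := ht.exists_rank_eq (u := u) (r := r) (by omega) (by omega)
      exact ⟨D, mem_smallChildren.2 ⟨hD, by omega⟩, rfl⟩
  rw [← Finset.card_image_of_injOn ((ht.rank_injOn u).mono (by
    intro D hD; exact (mem_smallChildren.1 hD).1)), h]
  rfl

theorem IsTree.card_bigChildren (ht : IsTree A t) (hu : u ∈ branchPoints t) :
    (children t u).card = (bigChildren t u).card + 2 := by
  rw [← ht.card_smallChildren hu, bigChildren, smallChildren,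
    Finset.card_filter_add_card_filter_not]

/-- A way to recognize the two children of rank one and two, and hence all others. -/
theorem bigChildren_eq_of_union {S B : Finset (Finset ℕ)} (h : children s w = S ∪ B)
    (hS : S.card = 2) (hmin : ∀ D ∈ S, ∀ E ∈ B, minLabel D < minLabel E) :
    bigChildren s w = B := by
  ext D
  rw [mem_bigChildren, rank, h]
  constructor
  · rintro ⟨hD, hr⟩
    refine (Finset.mem_union.1 hD).resolve_left fun hDS => ?_
    have : ((S ∪ B).filter fun E => minLabel E ≤ minLabel D) ⊆ S := by
      intro E hE
      rw [Finset.mem_filter, Finset.mem_union] at hE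
      exact hE.1.resolve_right fun hEB => absurd hE.2 (not_le.2 (hmin D hDS E hEB))
    have := Finset.card_le_card this
    omega
  · intro hD
    refine ⟨Finset.mem_union_right _ hD, ?_⟩
    have hDS : D ∉ S := fun h => lt_irrefl _ (hmin D h D hD)
    rw [show 3 = (insert D S).card by rw [Finset.card_insert_of_notMem hDS, hS]]
    refine Finset.card_le_card fun E hE => ?_
    rw [Finset.mem_filter, Finset.mem_union]
    rcases Finset.mem_insert.1 hE with rfl | hE
    · exact ⟨.inr hD, le_rfl⟩
    · exact ⟨.inl hE, (hmin E hE D hD).le⟩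

theorem IsTree.bigChildren_eq_image (ht : IsTree A t) (hu : u ∈ branchPoints t)
    {F : Finset ℕ → Finset ℕ} (h : children s w = (children t u).image F)
    (hF : Set.InjOn F (children t u))
    (hmin : ∀ D ∈ smallChildren t u, ∀ E ∈ bigChildren t u, minLabel (F D) < minLabel (F E)) :
    bigChildren s w = (bigChildren t u).image F := by
  refine bigChildren_eq_of_union (S := (smallChildren t u).image F) ?_ ?_ ?_
  · rw [h, children_eq_small_union_big, Finset.image_union]
  · rw [Finset.card_image_of_injOn (hF.mono fun D hD => (mem_smallChildren.1 hD).1),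
      ht.card_smallChildren hu]
  · simp only [Finset.mem_image]
    rintro _ ⟨D, hD, rfl⟩ _ ⟨E, hE, rfl⟩
    exact hmin D hD E hE

end BigChildren

/-! ### Transport of orderings -/

section Transport

variable {β : Type*}

theorem map_mem_orderings {δ : Type*} [DecidableEq β] [DecidableEq δ] {S : Finset β} {F : β → δ}
    (hF : Set.InjOn F S) {L : List β}
    (hL : L ∈ orderings S) : L.map F ∈ orderings (S.image F) := by
  obtain ⟨h1, h2⟩ := mem_orderings.1 hL
  refine mem_orderings.2 ⟨h1.map_on fun a ha b hb => hF ((h2 a).1 ha) ((h2 b).1 hb), fun x => ?_⟩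
  rw [List.mem_map, Finset.mem_image]
  simp only [h2]

theorem exists_orderings_map_eq {δ : Type*} [DecidableEq β] [DecidableEq δ] [Nonempty β]
    {S : Finset β} {F : β → δ}
    (hF : Set.InjOn F S) {Z : List δ} (hZ : Z ∈ orderings (S.image F)) :
    ∃ L₀ ∈ orderings S, L₀.map F = Z ∧ ∀ L ∈ orderings S, L.map F = Z → L = L₀ := by
  obtain ⟨h1, h2⟩ := mem_orderings.1 hZ
  set G := Function.invFunOn F (S : Set β) with hG
  have hGF : ∀ D ∈ S, G (F D) = D := fun D hD => hF.leftInvOn_invFunOn hD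
  have hFG : ∀ X ∈ Z, G X ∈ S ∧ F (G X) = X := by
    intro X hX
    obtain ⟨D, hD, rfl⟩ := Finset.mem_image.1 ((h2 X).1 hX)
    rw [hGF D hD]
    exact ⟨hD, rfl⟩
  refine ⟨Z.map G, mem_orderings.2 ⟨?_, fun D => ?_⟩, ?_, ?_⟩
  · refine h1.map_on fun a ha b hb hab => ?_
    rw [← (hFG a ha).2, ← (hFG b hb).2, hab]
  · rw [List.mem_map]
    constructor
    · rintro ⟨X, hX, rfl⟩
      exact (hFG X hX).1
    · exact fun hD => ⟨F D, (h2 _).2 (Finset.mem_image_of_mem F hD), hGF D hD⟩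
  · rw [List.map_map]
    conv_rhs => rw [← List.map_id Z]
    exact List.map_congr_left fun X hX => (hFG X hX).2
  · rintro L hL rfl
    rw [List.map_map]
    conv_lhs => rw [← List.map_id L]
    exact List.map_congr_left fun D hD => (hGF D (((mem_orderings.1 hL).2 D).1 hD)).symm

theorem ocrpProb_map_congr {α θ : ℝ} [Nonempty β] {L : List β} {f g : β → ℕ} (hf : (L.map f).Nodup)
    (hfg : ∀ a ∈ L, ∀ b ∈ L, f a < f b → g a < g b) :
    ocrpProb α θ (L.map g) = ocrpProb α θ (L.map f) := by
  have hinj : Set.InjOn f {a | a ∈ L} := fun a ha b hb hab =>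
    List.inj_on_of_nodup_map hf ha hb hab
  have h : ∀ a ∈ L, g (Function.invFunOn f {a | a ∈ L} (f a)) = g a := fun a ha => by
    rw [hinj.leftInvOn_invFunOn ha]
  rw [← ocrpProb_map (f := fun n => g (Function.invFunOn f {a | a ∈ L} n)) hf, List.map_map]
  · congr 1
    exact List.map_congr_left fun a ha => (h a ha).symm
  · intro x hx y hy hxy
    obtain ⟨a, ha, rfl⟩ := List.mem_map.1 hx
    obtain ⟨b, hb, rfl⟩ := List.mem_map.1 hy
    simp only [h a ha, h b hb]
    exact hfg a ha b hb hxy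

/-- Relabelling the subtrees by a map that respects the order of the least labels does not change
the law of their positions. -/
theorem sum_orderings_map {α θ : ℝ} {S : Finset (Finset ℕ)} {F : Finset ℕ → Finset ℕ}
    (hF : Set.InjOn F S) (hmin : Set.InjOn minLabel (S : Set (Finset ℕ)))
    (hmono : ∀ D ∈ S, ∀ E ∈ S, minLabel D < minLabel E → minLabel (F D) < minLabel (F E))
    {Z : List (Finset ℕ)} (hZ : Z ∈ orderings (S.image F)) :
    ∑ L ∈ orderings S, (if L.map F = Z then ocrpProb α θ (L.map minLabel) else 0) =
      ocrpProb α θ (Z.map minLabel) := by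
  obtain ⟨L₀, hL₀, rfl, huniq⟩ := exists_orderings_map_eq hF hZ
  rw [Finset.sum_eq_single_of_mem L₀ hL₀ fun L hL hne => if_neg fun h => hne (huniq L hL h),
    if_pos rfl, List.map_map]
  obtain ⟨h1, h2⟩ := mem_orderings.1 hL₀
  refine (ocrpProb_map_congr (h1.map_on fun a ha b hb =>
    hmin ((h2 a).1 ha) ((h2 b).1 hb)) fun a ha b hb => ?_).symm
  exact hmono a ((h2 a).1 ha) b ((h2 b).1 hb)

end Transport

/-! ### Semi-planar trees -/

section SemiPlanar

variable {A : Finset ℕ} {n : ℕ}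

theorem isSemiPlanar_iff {x : OrderedTree} : IsSemiPlanar A x ↔ IsTree A x.shape ∧
    (∀ v ∈ branchPoints x.shape, x.order v ∈ orderings (bigChildren x.shape v)) ∧
    ∀ v ∉ branchPoints x.shape, x.order v = [] := by
  constructor
  · intro h
    exact ⟨h.isTree, fun v hv => mem_orderings.2 ⟨h.nodup v hv, fun D => by
      rw [h.mem_order v hv, mem_bigChildren]⟩, h.order_eq_nil⟩
  · rintro ⟨h1, h2, h3⟩
    exact ⟨h1, fun v hv => (mem_orderings.1 (h2 v hv)).1, fun v hv D => by
      rw [(mem_orderings.1 (h2 v hv)).2, mem_bigChildren], h3⟩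

theorem IsSemiPlanar.order_mem {x : OrderedTree} (hx : IsSemiPlanar A x) {v : Finset ℕ}
    (hv : v ∈ branchPoints x.shape) : x.order v ∈ orderings (bigChildren x.shape v) :=
  (isSemiPlanar_iff.1 hx).2.1 v hv

theorem IsSemiPlanar.ext_iff {x y : OrderedTree} (hx : IsSemiPlanar A x) (hy : IsSemiPlanar A y) :
    x = y ↔ x.shape = y.shape ∧ ∀ v ∈ branchPoints x.shape, x.order v = y.order v := by
  constructor
  · rintro rfl
    exact ⟨rfl, fun _ _ => rfl⟩
  · rintro ⟨h1, h2⟩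
    refine OrderedTree.ext h1 (funext fun v => ?_)
    by_cases hv : v ∈ branchPoints x.shape
    · exact h2 v hv
    · rw [hx.order_eq_nil v hv, hy.order_eq_nil v (h1 ▸ hv)]

/-- The lists of subtrees at the different branch points can be chosen independently. -/
theorem sum_prod_order (t : Tree n) (F : Finset ℕ → List (Finset ℕ) → ℝ) :
    ∑ x : SemiPlanarTree n,
      (if proj x = t then ∏ u ∈ branchPoints t.1, F u (x.1.order u) else 0) =
    ∏ u ∈ branchPoints t.1, ∑ L ∈ orderings (bigChildren t.1 u), F u L := by
  rw [← Finset.sum_filter, Finset.prod_sum]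
  have hsp : ∀ p ∈ (branchPoints t.1).pi fun u => orderings (bigChildren t.1 u),
      IsSemiPlanar (Finset.Icc 1 n)
        ⟨t.1, fun u => if h : u ∈ branchPoints t.1 then p u h else []⟩ := by
    intro p hp
    rw [isSemiPlanar_iff]
    refine ⟨t.2, fun v hv => ?_, fun v hv => dif_neg hv⟩
    simp only [dif_pos hv]
    exact Finset.mem_pi.1 hp v hv
  refine Finset.sum_bij' (fun x _ => fun u _ => x.1.order u) (fun p hp => ⟨_, hsp p hp⟩)
    ?_ ?_ ?_ ?_ ?_
  · intro x hx
    obtain rfl := (Finset.mem_filter.1 hx).2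
    exact Finset.mem_pi.2 fun u hu => x.2.order_mem hu
  · intro p hp
    exact Finset.mem_filter.2 ⟨Finset.mem_univ _, rfl⟩
  · intro x hx
    obtain rfl := (Finset.mem_filter.1 hx).2
    refine Subtype.ext (((hsp _ ?_).ext_iff x.2).2 ⟨rfl, fun v hv => dif_pos hv⟩)
    exact Finset.mem_pi.2 fun u hu => x.2.order_mem hu
  · intro p hp
    funext u hu
    exact dif_pos hu
  · intro x hx
    exact (Finset.prod_attach (branchPoints t.1) fun u => F u (x.1.order u)).symm

/-- The probability of the orders of the subtrees in a semi-planar tree. -/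
noncomputable def orderProb (α γ : ℝ) (x : OrderedTree) : ℝ :=
  ∏ v ∈ branchPoints x.shape, ocrpProb α (α - γ) ((x.order v).map minLabel)

theorem liftKernel_eq (α γ : ℝ) (t : Tree n) (x : SemiPlanarTree n) :
    liftKernel α γ n t x = if proj x = t then orderProb α γ x.1 else 0 := by
  rw [liftKernel]
  split_ifs with h
  · rw [← h]; rfl
  · rfl

theorem ocrpProb_nonneg {α θ : ℝ} (hα : 0 ≤ α) (hθ : 0 ≤ θ) (l : List ℕ) : 0 ≤ ocrpProb α θ l := by
  refine Finset.prod_nonneg fun p _ => ?_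
  split_ifs <;> positivity

theorem card_bigChildren_of_admissible {α : ℝ} (hα : 0 ≤ α) {t : Tree n} (ht : Admissible α t)
    {u : Finset ℕ} (hu : u ∈ branchPoints t.1) : 0 < α ∨ (bigChildren t.1 u).card ≤ 1 := by
  rcases hα.lt_or_eq with h | h
  · exact .inl h
  · have := ht h.symm u hu
    have := t.2.card_bigChildren hu
    right; omega

theorem liftKernel_mem_stdSimplex {α γ : ℝ} (hγ : 0 ≤ γ) (hγα : γ ≤ α) {t : Tree n}
    (ht : Admissible α t) : liftKernel α γ n t ∈ stdSimplex ℝ (SemiPlanarTree n) := by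
  have hα := hγ.trans hγα
  constructor
  · intro x
    rw [liftKernel]
    split_ifs
    · exact Finset.prod_nonneg fun v _ => ocrpProb_nonneg hα (sub_nonneg.2 hγα) _
    · exact le_rfl
  · simp only [liftKernel]
    rw [sum_prod_order t fun v L => ocrpProb α (α - γ) (L.map minLabel)]
    refine Finset.prod_eq_one fun u hu => ?_
    refine sum_orderings_ocrpProb (sub_nonneg.2 hγα) _ _ ?_
      (card_bigChildren_of_admissible hα ht hu)
    exact (t.2.minLabel_injOn u).mono fun D hD => (mem_bigChildren.1 hD).1

end SemiPlanar

/-! ### Growth of semi-planar trees -/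

section GrowthSP

variable {m : ℕ} {x : OrderedTree} {C u : Finset ℕ} {t : Finset (Finset ℕ)}

theorem liftVertex_eq_self_of_child {t : Finset (Finset ℕ)} {j : ℕ} {D : Finset ℕ}
    (h : ¬ C ⊂ u) (hD : D ∈ children t u) : liftVertex C j D = D :=
  liftVertex_of_not_subset fun hCD => h (lt_of_le_of_lt hCD (mem_children.1 hD).2.1)

theorem IsTree.minLabel_lt_minLabel_liftVertex (ht : IsTree (Finset.Icc 1 m) t) {D E : Finset ℕ}
    (hD : D ∈ children t u) (hE : E ∈ children t u) (h : minLabel D < minLabel E) :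
    minLabel (liftVertex C (m + 1) D) < minLabel (liftVertex C (m + 1) E) := by
  rwa [ht.minLabel_liftVertex (children_subset _ _ hD),
    ht.minLabel_liftVertex (children_subset _ _ hE)]

theorem IsTree.bigChildren_insertEdge (ht : IsTree (Finset.Icc 1 m) t) (hC : C ∈ t)
    (hu : u ∈ branchPoints t) :
    bigChildren (AlphaGamma.insertEdge t C (m + 1)) (edgeLift C (m + 1) u) =
      (bigChildren t u).image (liftVertex C (m + 1)) := by
  refine ht.bigChildren_eq_image hu (ht.children_insertEdge (succ_notMem_Icc m) hC
    (mem_branchPoints.1 hu).1) ((ht.liftVertex_injOn (succ_notMem_Icc m)).mono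
      (Finset.coe_subset.2 (children_subset _ _))) fun D hD E hE => ?_
  exact ht.minLabel_lt_minLabel_liftVertex (mem_smallChildren.1 hD).1 (mem_bigChildren.1 hE).1
    (minLabel_lt_of_small_of_big hD hE)

theorem IsTree.bigChildren_insertEdge_new (ht : IsTree (Finset.Icc 1 m) t) (hC : C ∈ t) :
    bigChildren (AlphaGamma.insertEdge t C (m + 1)) (insert (m + 1) C) = ∅ := by
  refine bigChildren_eq_of_union (S := {C, {m + 1}}) ?_ ?_ (by simp)
  · rw [ht.children_insertEdge_new (succ_notMem_Icc m) hC, Finset.union_empty]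
  · refine Finset.card_pair fun h => ht.notMem (succ_notMem_Icc m) hC ?_
    rw [h]
    exact Finset.mem_singleton_self _

theorem IsTree.bigChildren_insertBranch_of_ne (ht : IsTree (Finset.Icc 1 m) t)
    (hC : C ∈ branchPoints t) (hu : u ∈ branchPoints t) (hne : u ≠ C) :
    bigChildren (AlphaGamma.insertBranch t C (m + 1)) (liftVertex C (m + 1) u) =
      (bigChildren t u).image (liftVertex C (m + 1)) := by
  refine ht.bigChildren_eq_image hu ?_ ((ht.liftVertex_injOn (succ_notMem_Icc m)).mono
      (Finset.coe_subset.2 (children_subset _ _))) fun D hD E hE => ?_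
  · rw [ht.children_insertBranch (succ_notMem_Icc m) hC (mem_branchPoints.1 hu).1, if_neg hne,
      Finset.union_empty]
  exact ht.minLabel_lt_minLabel_liftVertex (mem_smallChildren.1 hD).1 (mem_bigChildren.1 hE).1
    (minLabel_lt_of_small_of_big hD hE)

/-- The new leaf has the largest label, hence a rank of at least three in the branch point where it
is inserted. -/
theorem IsTree.bigChildren_insertBranch_self (ht : IsTree (Finset.Icc 1 m) t)
    (hC : C ∈ branchPoints t) :
    bigChildren (AlphaGamma.insertBranch t C (m + 1)) (insert (m + 1) C) =
      insert {m + 1} (bigChildren t C) := by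
  refine bigChildren_eq_of_union (S := smallChildren t C) ?_ (ht.card_smallChildren hC) ?_
  · have := ht.children_insertBranch (succ_notMem_Icc m) hC (mem_branchPoints.1 hC).1
    rw [liftVertex_self, image_liftVertex_children, if_pos rfl] at this
    rw [this, children_eq_small_union_big, Finset.union_assoc, Finset.insert_eq,
      Finset.union_comm {{m + 1}}]
  · intro D hD E hE
    rcases Finset.mem_insert.1 hE with rfl | hE
    · rw [minLabel_singleton]
      exact ht.minLabel_lt_succ (children_subset _ _ (mem_smallChildren.1 hD).1)
    · exact minLabel_lt_of_small_of_big hD hE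

theorem singleton_notMem_bigChildren (ht : IsTree (Finset.Icc 1 m) t) :
    {m + 1} ∉ bigChildren t C := fun h =>
  ht.notMem (succ_notMem_Icc m) (children_subset _ _ (mem_bigChildren.1 h).1)
    (Finset.mem_singleton_self _)

theorem IsSemiPlanar.map_liftVertex_order (hx : IsSemiPlanar (Finset.Icc 1 m) x)
    (hu : u ∈ branchPoints x.shape) (h : ¬ C ⊂ u) :
    (x.order u).map (liftVertex C (m + 1)) = x.order u := by
  conv_rhs => rw [← List.map_id (x.order u)]
  refine List.map_congr_left fun D hD => ?_
  exact liftVertex_eq_self_of_child h ((hx.mem_order u hu D).1 hD).1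

theorem IsSemiPlanar.order_insertEdgeSP (hx : IsSemiPlanar (Finset.Icc 1 m) x) (hC : C ∈ x.shape)
    (hu : u ∈ branchPoints x.shape) :
    (insertEdgeSP x C (m + 1)).order (edgeLift C (m + 1) u) =
      (x.order u).map (liftVertex C (m + 1)) := by
  have ht := hx.isTree
  have hj := succ_notMem_Icc m
  have hju := ht.notMem hj (mem_branchPoints.1 hu).1
  have hmem : edgeLift C (m + 1) u ∈ (branchPoints x.shape).image (edgeLift C (m + 1)) :=
    Finset.mem_image_of_mem _ hu
  rw [insertEdgeSP]
  simp only
  have hne : edgeLift C (m + 1) u ≠ insert (m + 1) C := fun h =>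
    ht.insert_notMem_image_edgeLift hj hC (h ▸ hmem)
  rw [if_neg, if_neg hne]
  · by_cases h : C ⊂ u
    · rw [if_pos (mem_edgeLift.2 (.inr ⟨rfl, h⟩)), edgeLift_erase hju]
    · rw [if_neg (by rw [mem_edgeLift]; tauto), hx.map_liftVertex_order hu h, edgeLift, if_neg h]
  · rw [not_not, ht.branchPoints_insertEdge hj hC]
    exact Finset.mem_insert_of_mem hmem

theorem order_insertEdgeSP_new : (insertEdgeSP x C (m + 1)).order (insert (m + 1) C) = [] := by
  rw [insertEdgeSP]
  simp

theorem IsSemiPlanar.order_insertBranchSP (hx : IsSemiPlanar (Finset.Icc 1 m) x)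
    (hC : C ∈ branchPoints x.shape) (hu : u ∈ branchPoints x.shape) (l : ℕ) :
    (insertBranchSP x C l (m + 1)).order (liftVertex C (m + 1) u) =
      if u = C then (x.order u).insertIdx (l - 1) {m + 1}
      else (x.order u).map (liftVertex C (m + 1)) := by
  have ht := hx.isTree
  have hj := succ_notMem_Icc m
  have hju := ht.notMem hj (mem_branchPoints.1 hu).1
  have hjC := ht.notMem hj (mem_branchPoints.1 hC).1
  have hmem : liftVertex C (m + 1) u ∈ branchPoints (insertBranch x.shape C (m + 1)) := by
    rw [branchPoints_insertBranch hC]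
    exact Finset.mem_image_of_mem _ hu
  rw [insertBranchSP]
  simp only
  rw [if_neg (not_not.2 hmem), ← liftVertex_self (C := C) (j := m + 1)]
  by_cases huC : u = C
  · subst huC
    rw [if_pos rfl, if_pos rfl]
  · rw [if_neg fun h => huC (liftVertex_inj hju hjC h), if_neg huC]
    by_cases h : C ⊆ u
    · rw [if_pos ((self_mem_liftVertex hju).2 h), liftVertex_erase hju]
    · rw [if_neg fun h' => h ((self_mem_liftVertex hju).1 h'), liftVertex_of_not_subset h,
        hx.map_liftVertex_order hu fun h' => h h'.1]

theorem IsSemiPlanar.insertEdgeSP (hx : IsSemiPlanar (Finset.Icc 1 m) x) (hC : C ∈ x.shape) :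
    IsSemiPlanar (Finset.Icc 1 (m + 1)) (insertEdgeSP x C (m + 1)) := by
  have ht := hx.isTree
  have hj := succ_notMem_Icc m
  refine isSemiPlanar_iff.2 ⟨ht.insertEdge_succ hC, fun v hv => ?_, fun v hv => if_pos hv⟩
  have hv' : v ∈ branchPoints (AlphaGamma.insertEdge x.shape C (m + 1)) := hv
  rw [ht.branchPoints_insertEdge hj hC] at hv'
  rcases Finset.mem_insert.1 hv' with rfl | hv'
  · rw [order_insertEdgeSP_new]
    change [] ∈ orderings (bigChildren (AlphaGamma.insertEdge x.shape C (m + 1)) _)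
    rw [ht.bigChildren_insertEdge_new hC, orderings_empty]
    exact Finset.mem_singleton_self _
  · obtain ⟨u, hu, rfl⟩ := Finset.mem_image.1 hv'
    rw [hx.order_insertEdgeSP hC hu]
    change _ ∈ orderings (bigChildren (AlphaGamma.insertEdge x.shape C (m + 1)) _)
    rw [ht.bigChildren_insertEdge hC hu]
    refine map_mem_orderings ((ht.liftVertex_injOn hj).mono fun D hD => ?_) (hx.order_mem hu)
    exact children_subset _ _ (mem_bigChildren.1 hD).1

theorem insertIdx_mem_orderings {β : Type*} [DecidableEq β] {S : Finset β} {a : β} (ha : a ∉ S)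
    {L : List β} (hL : L ∈ orderings S) {p : ℕ} (hp : p ≤ S.card) :
    L.insertIdx p a ∈ orderings (insert a S) := by
  obtain ⟨h1, h2⟩ := mem_orderings.1 hL
  have hperm := List.perm_insertIdx a L (i := p) (by rwa [length_of_mem_orderings hL])
  refine mem_orderings.2 ⟨hperm.nodup_iff.2 (List.nodup_cons.2 ⟨fun h => ha ((h2 a).1 h), h1⟩),
    fun b => ?_⟩
  rw [hperm.mem_iff, List.mem_cons, Finset.mem_insert, h2]

theorem IsSemiPlanar.insertBranchSP (hx : IsSemiPlanar (Finset.Icc 1 m) x)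
    (hC : C ∈ branchPoints x.shape) {l : ℕ}
    (hl : l ∈ Finset.Icc 1 ((children x.shape C).card - 1)) :
    IsSemiPlanar (Finset.Icc 1 (m + 1)) (insertBranchSP x C l (m + 1)) := by
  have ht := hx.isTree
  have hj := succ_notMem_Icc m
  refine isSemiPlanar_iff.2 ⟨ht.insertBranch_succ hC, fun v hv => ?_, fun v hv => if_pos hv⟩
  have hv' : v ∈ branchPoints (AlphaGamma.insertBranch x.shape C (m + 1)) := hv
  rw [branchPoints_insertBranch hC] at hv'
  obtain ⟨u, hu, rfl⟩ := Finset.mem_image.1 hv'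
  rw [hx.order_insertBranchSP hC hu]
  change _ ∈ orderings (bigChildren (AlphaGamma.insertBranch x.shape C (m + 1)) _)
  split_ifs with huC
  · subst huC
    rw [liftVertex_self, ht.bigChildren_insertBranch_self hC]
    refine insertIdx_mem_orderings (singleton_notMem_bigChildren ht) (hx.order_mem hu) ?_
    have := ht.card_bigChildren hC
    rw [Finset.mem_Icc] at hl
    omega
  · rw [ht.bigChildren_insertBranch_of_ne hC hu huC]
    refine map_mem_orderings ((ht.liftVertex_injOn hj).mono fun D hD => ?_) (hx.order_mem hu)
    exact children_subset _ _ (mem_bigChildren.1 hD).1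

end GrowthSP

section GrowthRuleSP

variable {m : ℕ} {α γ : ℝ} {x : OrderedTree}

theorem sum_ite_eq_semiPlanar (c : ℝ) (hx : IsSemiPlanar (Finset.Icc 1 m) x) :
    (∑ y : SemiPlanarTree m, open Classical in if x = y.1 then c else 0) = c := by
  classical
  obtain ⟨y₀, rfl⟩ : ∃ y₀ : SemiPlanarTree m, y₀.1 = x := ⟨⟨x, hx⟩, rfl⟩
  rw [Finset.sum_eq_single_of_mem y₀ (Finset.mem_univ _)]
  · rw [if_pos rfl]
  · intro y _ hne
    exact if_neg fun h => hne (Subtype.ext h.symm)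

theorem sum_ite_eq_tree (c : ℝ) {t : Finset (Finset ℕ)} (ht : IsTree (Finset.Icc 1 m) t) :
    (∑ s : Tree m, if t = s.1 then c else 0) = c := by
  obtain ⟨s₀, rfl⟩ : ∃ s₀ : Tree m, s₀.1 = t := ⟨⟨t, ht⟩, rfl⟩
  rw [Finset.sum_eq_single_of_mem s₀ (Finset.mem_univ _)]
  · rw [if_pos rfl]
  · intro y _ hne
    exact if_neg fun h => hne (Subtype.ext h.symm)

theorem ne_one_of_mem_branchPoints {t : Finset (Finset ℕ)} (ht : IsTree (Finset.Icc 1 m) t)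
    {C : Finset ℕ} (hC : C ∈ branchPoints t) : m ≠ 1 := by
  rw [mem_branchPoints] at hC
  have := Finset.card_le_card (ht.subset_of_mem C hC.1)
  rw [Nat.card_Icc] at this
  omega

/-- Splitting the insertion weight of a branch point among the locations. -/
theorem sum_location_weights {c : ℕ} (hc : 2 ≤ c) :
    (∑ l ∈ Finset.Icc 1 (c - 1), if l ≤ c - 2 then α else α - γ) = ((c : ℝ) - 1) * α - γ := by
  obtain ⟨d, rfl⟩ := Nat.exists_eq_add_of_le' hc
  have h1 : d + 2 - 1 = d + 1 := rfl
  have h2 : d + 2 - 2 = d := rfl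
  rw [h1, h2, Finset.sum_Icc_succ_top (by omega), if_neg (by omega),
    Finset.sum_congr rfl fun l hl => if_pos (Finset.mem_Icc.1 hl).2]
  rw [Finset.sum_const, Nat.card_Icc]
  push_cast
  simp only [nsmul_eq_mul]
  ring

theorem sum_growthRuleSP (hα : α ≤ 1) (hm : 1 ≤ m) (hx : IsSemiPlanar (Finset.Icc 1 m) x) :
    ∑ y : SemiPlanarTree (m + 1), growthRuleSP α γ m x y.1 = 1 := by
  have ht := hx.isTree
  rw [← sum_growthRule (γ := γ) hα hm ht]
  simp only [growthRuleSP, growthRule]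
  rw [Finset.sum_add_distrib, Finset.sum_add_distrib, Finset.sum_comm,
    Finset.sum_comm (t := branchPoints x.shape), Finset.sum_comm (t := x.shape),
    Finset.sum_comm (t := branchPoints x.shape)]
  congr 1
  · refine Finset.sum_congr rfl fun C hC => ?_
    rw [sum_ite_eq_semiPlanar _ (hx.insertEdgeSP hC), sum_ite_eq_tree _ (ht.insertEdge_succ hC)]
  · refine Finset.sum_congr rfl fun C hC => ?_
    rw [Finset.sum_comm, sum_ite_eq_tree _ (ht.insertBranch_succ hC),
      Finset.sum_congr rfl fun l hl => sum_ite_eq_semiPlanar _ (hx.insertBranchSP hC hl)]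
    have hm1 := ne_one_of_mem_branchPoints ht hC
    simp only [insertionProb, if_neg hm1]
    rw [← Finset.sum_div, sum_location_weights (ht.two_le_card_children hC)]

theorem insertionProb_nonneg (hα : α ≤ 1) (hm : 1 ≤ m) {w : ℝ} (hw : 0 ≤ w) :
    0 ≤ insertionProb α m w := by
  rw [insertionProb]
  split_ifs with h
  · exact zero_le_one
  · exact div_nonneg hw (sub_pos_of_two_le hα (by omega)).le

theorem growthRuleSP_nonneg (hγ : 0 ≤ γ) (hγα : γ ≤ α) (hα : α ≤ 1) (hm : 1 ≤ m)
    (y : OrderedTree) : 0 ≤ growthRuleSP α γ m x y := by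
  refine add_nonneg (Finset.sum_nonneg fun C _ => ?_)
    (Finset.sum_nonneg fun C _ => Finset.sum_nonneg fun l _ => ?_)
  · split_ifs
    · refine insertionProb_nonneg hα hm ?_
      rw [edgeWeight]
      split_ifs
      · exact sub_nonneg.2 hα
      · exact hγ
    · exact le_rfl
  · split_ifs
    · exact insertionProb_nonneg hα hm (hγ.trans hγα)
    · exact insertionProb_nonneg hα hm (sub_nonneg.2 hγα)
    · exact le_rfl

end GrowthRuleSP

/-! ### Growth and the kernel of ordered Chinese restaurants -/

section LiftGrowth

variable {m : ℕ} {α γ : ℝ}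

/-- The step of the ordered Chinese restaurant process that places a new youngest table, with the
locations numbered from left to right. -/
theorem sum_location_mul_sum_orderings (hγ : 0 ≤ γ) (hγα : γ ≤ α) {S : Finset (Finset ℕ)} {j : ℕ}
    (hjS : {j} ∉ S) (hj : ∀ D ∈ S, minLabel D < j)
    (hinj : Set.InjOn minLabel (S : Set (Finset ℕ))) {Y : List (Finset ℕ)}
    (hY : Y ∈ orderings (insert {j} S)) :
    ∑ l ∈ Finset.Icc 1 (S.card + 1), (if l ≤ S.card then α else α - γ) *
      ∑ L ∈ orderings S, (if L.insertIdx (l - 1) {j} = Y then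
        ocrpProb α (α - γ) (L.map minLabel) else 0) =
    (((S.card : ℝ) + 1) * α - γ) * ocrpProb α (α - γ) (Y.map minLabel) := by
  have e1 : (((S.card : ℝ) + 1) * α - γ) * ocrpProb α (α - γ) (Y.map minLabel) =
      ∑ Y' ∈ orderings (insert {j} S), if Y' = Y then
        (((S.card : ℝ) + 1) * α - γ) * ocrpProb α (α - γ) (Y'.map minLabel) else 0 := by
    rw [Finset.sum_ite_eq', if_pos hY]
  -- The ordering `Y` arises from exactly one pair of an ordering of `S` and a location.
  rw [e1, sum_orderings_insert hjS, Finset.sum_comm]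
  rw [show Finset.Icc 1 (S.card + 1) = Finset.Ico 1 (S.card + 2) from rfl,
    Finset.sum_Ico_eq_sum_range]
  rw [show S.card + 2 - 1 = S.card + 1 from rfl]
  refine Finset.sum_congr rfl fun p hp => ?_
  rw [Finset.mul_sum]
  refine Finset.sum_congr rfl fun L hL => ?_
  rw [show 1 + p - 1 = p by omega]
  by_cases h : L.insertIdx p {j} = Y
  swap
  · rw [if_neg h, if_neg h, mul_zero]
  rw [if_pos h, if_pos h]
  have hlen := length_of_mem_orderings hL
  obtain ⟨h1, h2⟩ := mem_orderings.1 hL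
  have hp' : p ≤ L.length := by rw [hlen]; exact Nat.lt_succ_iff.1 (Finset.mem_range.1 hp)
  have e : (L.take p).map minLabel ++ (L.drop p).map minLabel = L.map minLabel := by
    rw [← List.map_append, List.take_append_drop]
  rw [insertIdx_eq_take_append_cons_drop hp', List.map_append, List.map_cons, minLabel_singleton,
    ocrpProb_append_max, e]
  · by_cases hL0 : L = []
    · subst hL0
      have h0 : S.card = 0 := by rw [← hlen]; rfl
      have hp0 : p = 0 := by simpa using hp'
      subst hp0
      simp [h0]
    · have hd : (p = L.length) ↔ (L.drop p = []) := by
        rw [List.drop_eq_nil_iff]; omega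
      simp only [List.map_eq_nil_iff, List.length_map, if_neg hL0, ← hd]
      rcases (hγ.trans hγα).eq_or_lt with h0 | hα
      · have hγ0 : γ = 0 := le_antisymm (h0 ▸ hγα) hγ
        simp [← h0, hγ0]
      · have hpos : (S.card : ℝ) * α + (α - γ) ≠ 0 := by
          have : (0 : ℝ) < S.card := by
            rw [← hlen]; exact_mod_cast List.length_pos_iff.2 hL0
          have := mul_pos this hα
          have := sub_nonneg.2 hγα
          positivity
        have hw : (if 1 + p ≤ S.card then α else α - γ) =
            if p = L.length then α - γ else α := by
          rw [hlen] at hp' ⊢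
          split_ifs <;> first | rfl | omega
        have hW : ((S.card : ℝ) + 1) * α - γ = S.card * α + (α - γ) := by ring
        rw [hw, hlen, hW]
        generalize (if p = S.card then α - γ else α) = a
        generalize (S.card : ℝ) * α + (α - γ) = b at hpos
        field_simp
  · rw [e]
    exact h1.map_on fun a ha b hb => hinj ((h2 a).1 ha) ((h2 b).1 hb)
  · rw [e]
    intro q hq
    obtain ⟨D, hD, rfl⟩ := List.mem_map.1 hq
    exact hj D ((h2 D).1 hD)

theorem IsTree.bigChildren_minLabel_injOn {A : Finset ℕ} {t : Finset (Finset ℕ)} (ht : IsTree A t)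
    (u : Finset ℕ) : Set.InjOn minLabel (bigChildren t u : Set (Finset ℕ)) :=
  (ht.minLabel_injOn u).mono fun _ hD => (mem_bigChildren.1 hD).1

theorem sum_orderings_map_liftVertex {t : Finset (Finset ℕ)} (ht : IsTree (Finset.Icc 1 m) t)
    {C u : Finset ℕ} {θ : ℝ} {Z : List (Finset ℕ)}
    (hZ : Z ∈ orderings ((bigChildren t u).image (liftVertex C (m + 1)))) :
    ∑ L ∈ orderings (bigChildren t u), (if L.map (liftVertex C (m + 1)) = Z then
      ocrpProb α θ (L.map minLabel) else 0) = ocrpProb α θ (Z.map minLabel) := by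
  have hsub : ∀ D ∈ bigChildren t u, D ∈ t := fun D hD =>
    children_subset _ _ (mem_bigChildren.1 hD).1
  refine sum_orderings_map ((ht.liftVertex_injOn (succ_notMem_Icc m)).mono hsub)
    (ht.bigChildren_minLabel_injOn u) (fun D hD E hE h => ?_) hZ
  rwa [ht.minLabel_liftVertex (hsub D hD), ht.minLabel_liftVertex (hsub E hE)]

/-- Insertion of a new leaf into an edge of a tree with randomly ordered subtrees: the orders at the
old branch points are transported, and nothing is to be ordered at the new one. -/
theorem sum_orderProb_insertEdgeSP (r : Tree m) {C : Finset ℕ} (hC : C ∈ r.1)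
    (y : SemiPlanarTree (m + 1)) (c : ℝ) :
    (∑ x : SemiPlanarTree m, if proj x = r then orderProb α γ x.1 *
      (open Classical in if insertEdgeSP x.1 C (m + 1) = y.1 then c else 0) else 0) =
    (if insertEdge r.1 C (m + 1) = y.1.shape then c else 0) * orderProb α γ y.1 := by
  have ht := r.2
  have hj := succ_notMem_Icc m
  by_cases hs : insertEdge r.1 C (m + 1) = y.1.shape
  swap
  · rw [if_neg hs, zero_mul]
    refine Finset.sum_eq_zero fun x _ => ?_
    split_ifs with h1 h2
    · subst h1
      exact absurd (congrArg OrderedTree.shape h2) hs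
    · rw [mul_zero]
    · rfl
  rw [if_pos hs]
  have hbp := ht.branchPoints_insertEdge hj hC
  have hnew := ht.insert_notMem_image_edgeLift hj hC
  have hynew : y.1.order (insert (m + 1) C) = [] := by
    have := y.2.order_mem (v := insert (m + 1) C) (by
      rw [← hs, hbp]; exact Finset.mem_insert_self _ _)
    rw [← hs, ht.bigChildren_insertEdge_new hC, orderings_empty] at this
    exact Finset.mem_singleton.1 this
  -- `G u L` is the contribution of the order `L` at `u` to the event that the outcome is `y`.
  set G : Finset ℕ → List (Finset ℕ) → ℝ := fun u L =>
    if L.map (liftVertex C (m + 1)) = y.1.order (edgeLift C (m + 1) u) then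
      ocrpProb α (α - γ) (L.map minLabel) else 0 with hG
  have hterm : ∀ x : SemiPlanarTree m, (if proj x = r then orderProb α γ x.1 *
      (open Classical in if insertEdgeSP x.1 C (m + 1) = y.1 then c else 0) else 0) =
      c * if proj x = r then ∏ u ∈ branchPoints r.1, G u (x.1.order u) else 0 := by
    intro x
    simp only [hG]
    split_ifs with h1 h2
    · subst h1
      rw [mul_comm]
      congr 1
      rw [Finset.prod_ite_zero, if_pos]
      · rfl
      · intro u hu
        rw [← x.2.order_insertEdgeSP hC hu, h2]
    · subst h1
      rw [Finset.prod_ite_zero, if_neg]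
      · rw [mul_zero, mul_zero]
      · intro h
        refine h2 (((x.2.insertEdgeSP hC).ext_iff y.2).2 ⟨hs, fun v hv => ?_⟩)
        have hv' : v ∈ branchPoints (insertEdge (proj x).1 C (m + 1)) := hv
        rw [hbp] at hv'
        rcases Finset.mem_insert.1 hv' with rfl | hv'
        · rw [hynew, order_insertEdgeSP_new]
        · obtain ⟨u, hu, rfl⟩ := Finset.mem_image.1 hv'
          rw [x.2.order_insertEdgeSP hC hu, h u hu]
    · rw [mul_zero]
  rw [Finset.sum_congr rfl fun x _ => hterm x, ← Finset.mul_sum]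
  refine congrArg (c * ·) ?_
  rw [sum_prod_order r G, orderProb, ← hs, hbp, Finset.prod_insert hnew, hynew, List.map_nil,
    ocrpProb_nil, one_mul, Finset.prod_image]
  · refine Finset.prod_congr rfl fun u hu => sum_orderings_map_liftVertex ht ?_
    rw [← ht.bigChildren_insertEdge hC hu, hs]
    refine y.2.order_mem ?_
    rw [← hs, hbp]
    exact Finset.mem_insert_of_mem (Finset.mem_image_of_mem _ hu)
  · exact (ht.edgeLift_injOn hj).mono fun u hu => (mem_branchPoints.1 hu).1

/-- Insertion of a new leaf into a branch point `C` of a tree with randomly ordered subtrees: the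
orders at the other branch points are transported, and at `C` the step is that of an ordered Chinese
restaurant process with a new table. -/
theorem sum_orderProb_insertBranchSP (hγ : 0 ≤ γ) (hγα : γ ≤ α) (r : Tree m) {C : Finset ℕ}
    (hC : C ∈ branchPoints r.1) (y : SemiPlanarTree (m + 1)) :
    (∑ x : SemiPlanarTree m, if proj x = r then orderProb α γ x.1 *
      ∑ l ∈ Finset.Icc 1 ((children r.1 C).card - 1),
        (open Classical in if insertBranchSP x.1 C l (m + 1) = y.1 then
          insertionProb α m (if l ≤ (children r.1 C).card - 2 then α else α - γ) else 0) else 0) =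
    (if insertBranch r.1 C (m + 1) = y.1.shape then
      insertionProb α m ((((children r.1 C).card : ℝ) - 1) * α - γ) else 0) *
        orderProb α γ y.1 := by
  have ht := r.2
  have hj := succ_notMem_Icc m
  by_cases hs : insertBranch r.1 C (m + 1) = y.1.shape
  swap
  · rw [if_neg hs, zero_mul]
    refine Finset.sum_eq_zero fun x _ => ?_
    split_ifs with h1
    · subst h1
      rw [Finset.sum_eq_zero, mul_zero]
      intro l _
      exact if_neg fun h2 => hs (congrArg OrderedTree.shape h2)
    · rfl
  rw [if_pos hs]
  have hm1 := ne_one_of_mem_branchPoints ht hC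
  have hbp := branchPoints_insertBranch (j := m + 1) hC
  have hcard := ht.card_bigChildren hC
  set w : ℕ → ℝ := fun l => if l ≤ (children r.1 C).card - 2 then α else α - γ with hw
  -- `G l u L` is the contribution of the order `L` at `u` to the event that the insertion at
  -- location `l` yields `y`.
  set G : ℕ → Finset ℕ → List (Finset ℕ) → ℝ := fun l u L =>
    if (if u = C then L.insertIdx (l - 1) {m + 1} else L.map (liftVertex C (m + 1))) =
        y.1.order (liftVertex C (m + 1) u) then
      ocrpProb α (α - γ) (L.map minLabel) else 0 with hG
  have hterm : ∀ x : SemiPlanarTree m, (if proj x = r then orderProb α γ x.1 *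
      ∑ l ∈ Finset.Icc 1 ((children r.1 C).card - 1),
        (open Classical in if insertBranchSP x.1 C l (m + 1) = y.1 then
          insertionProb α m (w l) else 0) else 0) =
      ∑ l ∈ Finset.Icc 1 ((children r.1 C).card - 1), insertionProb α m (w l) *
        if proj x = r then ∏ u ∈ branchPoints r.1, G l u (x.1.order u) else 0 := by
    intro x
    split_ifs with h1
    · subst h1
      rw [Finset.mul_sum]
      refine Finset.sum_congr rfl fun l hl => ?_
      simp only [hG]
      rw [Finset.prod_ite_zero]
      have hiff : insertBranchSP x.1 C l (m + 1) = y.1 ↔ ∀ u ∈ branchPoints (proj x).1,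
          (if u = C then (x.1.order u).insertIdx (l - 1) {m + 1}
            else (x.1.order u).map (liftVertex C (m + 1))) =
          y.1.order (liftVertex C (m + 1) u) := by
        rw [(x.2.insertBranchSP hC hl).ext_iff y.2]
        have e : ∀ u ∈ branchPoints (proj x).1,
            (insertBranchSP x.1 C l (m + 1)).order (liftVertex C (m + 1) u) = _ := fun u hu =>
          x.2.order_insertBranchSP hC hu l
        constructor
        · rintro ⟨-, h⟩ u hu
          rw [← e u hu, h]
          change _ ∈ branchPoints (insertBranch (proj x).1 C (m + 1))
          rw [hbp]
          exact Finset.mem_image_of_mem _ hu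
        · intro h
          refine ⟨hs, fun v hv => ?_⟩
          have hv' : v ∈ branchPoints (insertBranch (proj x).1 C (m + 1)) := hv
          rw [hbp] at hv'
          obtain ⟨u, hu, rfl⟩ := Finset.mem_image.1 hv'
          rw [e u hu, h u hu]
      by_cases h : insertBranchSP x.1 C l (m + 1) = y.1
      · rw [if_pos h, if_pos (hiff.1 h), mul_comm]; rfl
      · rw [if_neg h, if_neg fun h' => h (hiff.2 h'), mul_zero, mul_zero]
    · simp
  rw [Finset.sum_congr rfl fun x _ => hterm x, Finset.sum_comm]
  have hyo : ∀ u ∈ branchPoints r.1, y.1.order (liftVertex C (m + 1) u) ∈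
      orderings (bigChildren (insertBranch r.1 C (m + 1)) (liftVertex C (m + 1) u)) := by
    intro u hu
    rw [hs]
    refine y.2.order_mem ?_
    rw [← hs, hbp]
    exact Finset.mem_image_of_mem _ hu
  have hprod : ∀ l, ∏ u ∈ branchPoints r.1, ∑ L ∈ orderings (bigChildren r.1 u), G l u L =
      (∑ L ∈ orderings (bigChildren r.1 C), G l C L) * ∏ u ∈ (branchPoints r.1).erase C,
        ocrpProb α (α - γ) ((y.1.order (liftVertex C (m + 1) u)).map minLabel) := by
    intro l
    rw [← Finset.mul_prod_erase _ _ hC]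
    refine congrArg _ (Finset.prod_congr rfl fun u hu => ?_)
    obtain ⟨huC, hu⟩ := Finset.mem_erase.1 hu
    simp only [hG, if_neg huC]
    refine sum_orderings_map_liftVertex ht ?_
    rw [← ht.bigChildren_insertBranch_of_ne hC hu huC]
    exact hyo u hu
  have hy : orderProb α γ y.1 = ocrpProb α (α - γ)
      ((y.1.order (insert (m + 1) C)).map minLabel) * ∏ u ∈ (branchPoints r.1).erase C,
        ocrpProb α (α - γ) ((y.1.order (liftVertex C (m + 1) u)).map minLabel) := by
    rw [orderProb, ← hs, hbp, Finset.prod_image ((ht.liftVertex_injOn hj).mono fun u hu =>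
      (mem_branchPoints.1 hu).1), ← Finset.mul_prod_erase _ _ hC, liftVertex_self]
  have hsum : ∀ l, (∑ x : SemiPlanarTree m,
      if proj x = r then ∏ u ∈ branchPoints r.1, G l u (x.1.order u) else 0) = _ := fun l =>
    (sum_prod_order r (G l)).trans (hprod l)
  simp only [← Finset.mul_sum, hsum]
  rw [hy, ← mul_assoc]
  simp only [← mul_assoc]
  rw [← Finset.sum_mul]
  congr 1
  have hYC := hyo C hC
  rw [liftVertex_self, ht.bigChildren_insertBranch_self hC] at hYC
  have key := sum_location_mul_sum_orderings hγ hγα (singleton_notMem_bigChildren ht)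
    (fun D hD => ht.minLabel_lt_succ (children_subset _ _ (mem_bigChildren.1 hD).1))
    (ht.bigChildren_minLabel_injOn C) hYC
  have e1 : (children r.1 C).card - 1 = (bigChildren r.1 C).card + 1 := by omega
  have e2 : (children r.1 C).card - 2 = (bigChildren r.1 C).card := by omega
  have e3 : ((children r.1 C).card : ℝ) - 1 = (bigChildren r.1 C).card + 1 := by
    rw [hcard]; push_cast; ring
  simp only [insertionProb, if_neg hm1, hw, hG, liftVertex_self, if_true, e1, e2, e3]
  rw [div_mul_eq_mul_div, ← key, Finset.sum_div]
  exact Finset.sum_congr rfl fun l _ => div_mul_eq_mul_div _ _ _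

/-- Ordering the subtrees and growing a semi-planar tree is the same as growing a tree and ordering
the subtrees afterwards. -/
theorem sum_liftKernel_mul_growthRuleSP (hγ : 0 ≤ γ) (hγα : γ ≤ α) (r : Tree m)
    (y : SemiPlanarTree (m + 1)) :
    ∑ x : SemiPlanarTree m, liftKernel α γ m r x * growthRuleSP α γ m x.1 y.1 =
      growthRule α γ m r.1 y.1.shape * orderProb α γ y.1 := by
  have hterm : ∀ x : SemiPlanarTree m, liftKernel α γ m r x * growthRuleSP α γ m x.1 y.1 =
      ∑ C ∈ r.1, (if proj x = r then orderProb α γ x.1 *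
        (open Classical in if insertEdgeSP x.1 C (m + 1) = y.1 then
          insertionProb α m (edgeWeight α γ C) else 0) else 0) +
      ∑ C ∈ branchPoints r.1, (if proj x = r then orderProb α γ x.1 *
        ∑ l ∈ Finset.Icc 1 ((children r.1 C).card - 1),
          (open Classical in if insertBranchSP x.1 C l (m + 1) = y.1 then
            insertionProb α m (if l ≤ (children r.1 C).card - 2 then α else α - γ)
              else 0) else 0) := by
    intro x
    rw [liftKernel_eq]
    by_cases h : proj x = r
    · subst h
      simp only [if_true]
      rw [← Finset.mul_sum, ← Finset.mul_sum, ← mul_add]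
      rfl
    · simp only [if_neg h, zero_mul, Finset.sum_const_zero, add_zero]
  rw [Finset.sum_congr rfl fun x _ => hterm x, Finset.sum_add_distrib, Finset.sum_comm,
    Finset.sum_comm (t := branchPoints r.1), growthRule, add_mul, Finset.sum_mul, Finset.sum_mul]
  congr 1
  · exact Finset.sum_congr rfl fun C hC => sum_orderProb_insertEdgeSP r hC y _
  · exact Finset.sum_congr rfl fun C hC => sum_orderProb_insertBranchSP hγ hγα r hC y

end LiftGrowth

/-! ### The effect of the down-step on least labels -/

/-- The increasing relabelling of the labels other than `k`. -/
def relabel (k x : ℕ) : ℕ := if k < x then x - 1 else x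

theorem relabel_of_lt {k x : ℕ} (h : x < k) : relabel k x = x := if_neg h.not_gt

theorem relabel_lt_relabel {k x y : ℕ} (hx : x ≠ k) (hy : y ≠ k) (h : x < y) :
    relabel k x < relabel k y := by
  unfold relabel
  split_ifs <;> omega

theorem lt_relabel {k x y : ℕ} (hx : x < k) (h : x < y) : x < relabel k y := by
  unfold relabel
  split_ifs <;> omega

theorem le_relabel {k x : ℕ} (h : k < x) : k ≤ relabel k x := by
  unfold relabel
  split_ifs; omega

/-- If `i ≤ k`, the leaf with new label `i` is the one with old label `k`. -/
theorem upLabel_eq {i k : ℕ} (hik : i ≤ k) (y : ℕ) :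
    upLabel i k y = if y < k then (if y = i then k else y) else y + 1 := by
  unfold upLabel
  by_cases h : y < k
  · rw [if_neg (not_le.2 h), if_pos h]
    by_cases h2 : y = i
    · rw [if_pos h2, h2, Equiv.swap_apply_left]
    · rw [if_neg h2, Equiv.swap_apply_of_ne_of_ne h2 h.ne]
  · rw [if_pos (not_lt.1 h), if_neg h, Equiv.swap_apply_of_ne_of_ne] <;> omega

/-- The properties of an outcome `k` of the local search from leaf `i` by which the down-step
respects the ranks of subtrees away from the parent of `i`. The label `k` is least in each subtree
that contains it but not `i`. A subtree other than the leaf `i` that contains `i` but not `k` also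
contains another label less than `k`, and `k` is the least label in the other subtrees of its
parent; so it has rank at most two, before and after the swap. If leaf `i` itself is deleted, it
does not have the least label in any larger subtree. -/
structure Searched (t : Finset (Finset ℕ)) (i k : ℕ) : Prop where
  le : i ≤ k
  minLabel_of_notMem : ∀ D ∈ t, k ∈ D → i ∉ D → minLabel D = k
  minLabel_of_mem : ∀ D ∈ t, D ≠ {i} → i ∈ D → k ∉ D →
    (∃ x ∈ D, x ≠ i ∧ x < k) ∧ k = minLabel (parent t D \ D)
  minLabel_lt : i = k → ∀ D ∈ t, i ∈ D → D ≠ {i} → minLabel D < i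

section Labels

variable {A : Finset ℕ} {t : Finset (Finset ℕ)} {i k : ℕ} {D : Finset ℕ}

theorem minLabel_downVertex_of_notMem (hik : i ≤ k) (hD : D.Nonempty) (hi : i ∉ D) (hk : k ∉ D) :
    minLabel (downVertex i k D) = relabel k (minLabel D) ∧ minLabel D ≠ k := by
  have hm := minLabel_mem hD
  have hmk : minLabel D ≠ k := fun h => hk (h ▸ hm)
  have hmi : minLabel D ≠ i := fun h => hi (h ▸ hm)
  refine ⟨minLabel_eq ?_ fun y hy => ?_, hmk⟩
  · have : upLabel i k (relabel k (minLabel D)) = minLabel D := by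
      rw [upLabel_eq hik]
      unfold relabel
      split_ifs <;> omega
    rw [mem_downVertex, this]
    exact hm
  · rw [mem_downVertex, upLabel_eq hik] at hy
    split_ifs at hy with h1 h2
    · exact absurd hy hk
    · have := minLabel_le hy
      unfold relabel
      split_ifs <;> omega
    · have := minLabel_le hy
      unfold relabel
      split_ifs <;> omega

/-- A subtree that contains both labels keeps its least label. -/
theorem Searched.minLabel_downVertex_of_mem_of_mem (h : Searched t i k) (hD : D ∈ t)
    (hDi : D ≠ {i}) (hi : i ∈ D) (hk : k ∈ D) :
    minLabel (downVertex i k D) = relabel k (minLabel D) ∧ minLabel D ≠ k := by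
  have hm := minLabel_mem ⟨i, hi⟩
  have hle := minLabel_le hi
  have hlt : minLabel D < k := by
    rcases h.le.eq_or_lt with h1 | h1
    · exact h1 ▸ h.minLabel_lt h1 D hD hi hDi
    · exact hle.trans_lt h1
  refine ⟨?_, hlt.ne⟩
  rw [relabel_of_lt hlt]
  refine minLabel_eq ?_ fun y hy => ?_
  · rw [mem_downVertex, upLabel_eq h.le, if_pos hlt]
    split_ifs
    · exact hk
    · exact hm
  · rw [mem_downVertex, upLabel_eq h.le] at hy
    split_ifs at hy with h1 h2
    · omega
    · exact minLabel_le hy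
    · omega

/-- A subtree that contains `k` but not `i` has least label `k` before the swap, and `i` after it.
-/
theorem Searched.minLabel_downVertex_of_mem (h : Searched t i k) (hD : D ∈ t)
    (hi : i ∉ D) (hk : k ∈ D) : minLabel (downVertex i k D) = i ∧ minLabel D = k ∧ i < k := by
  have hm := h.minLabel_of_notMem D hD hk hi
  have hlt : i < k := lt_of_le_of_ne h.le fun e => hi (e ▸ hk)
  refine ⟨minLabel_eq ?_ fun y hy => ?_, hm, hlt⟩
  · rw [mem_downVertex, upLabel_eq h.le, if_pos hlt, if_pos rfl]
    exact hk
  · rw [mem_downVertex, upLabel_eq h.le] at hy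
    split_ifs at hy with h1 h2
    · exact h2.ge
    · have := minLabel_le hy; omega
    · omega

theorem Searched.minLabel_downVertex_lt (h : Searched t i k) (hD : D ∈ t) (hDi : D ≠ {i})
    (hi : i ∈ D) (hk : k ∉ D) : minLabel (downVertex i k D) < k ∧ minLabel D < k := by
  obtain ⟨⟨x, hx, hxi, hxk⟩, -⟩ := h.minLabel_of_mem D hD hDi hi hk
  refine ⟨(minLabel_le ?_).trans_lt hxk, (minLabel_le hx).trans_lt hxk⟩
  rw [mem_downVertex, upLabel_eq h.le, if_pos hxk, if_neg hxi]
  exact hx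

theorem rank_le_two_of_forall {u E₀ : Finset ℕ}
    (h : ∀ E ∈ children t u, minLabel E ≤ minLabel D → E = E₀ ∨ E = D) : rank t u D ≤ 2 := by
  refine (Finset.card_le_card fun E hE => ?_).trans (Finset.card_le_two (a := E₀) (b := D))
  rw [Finset.mem_filter] at hE
  rw [Finset.mem_insert, Finset.mem_singleton]
  exact h E hE.1 hE.2

theorem IsTree.subset_sdiff_of_children (ht : IsTree A t) {u E : Finset ℕ} (hD : D ∈ children t u)
    (hE : E ∈ children t u) (hne : E ≠ D) : E ⊆ u \ D := by
  rw [Finset.subset_sdiff]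
  exact ⟨(mem_children.1 hE).2.1.1, ht.children_disjoint hE hD hne⟩

theorem IsTree.le_minLabel_of_subset {S E : Finset ℕ} (hE : E.Nonempty) (h : E ⊆ S) :
    minLabel S ≤ minLabel E := minLabel_le (h (minLabel_mem hE))

/-- In a subtree of rank at least three of a branch point that is not the parent of leaf `i`, the
down-step changes the least label only by the increasing relabelling. -/
theorem Searched.minLabel_downVertex_of_big (h : Searched t i k) (ht : IsTree A t)
    {u : Finset ℕ} (hu : u ∈ t) (hui : {i} ∉ children t u) (hD : D ∈ bigChildren t u) :
    minLabel (downVertex i k D) = relabel k (minLabel D) ∧ minLabel D ≠ k := by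
  obtain ⟨hDc, hr⟩ := mem_bigChildren.1 hD
  have hDt := children_subset _ _ hDc
  have hDi : D ≠ {i} := fun e => hui (e ▸ hDc)
  by_cases hi : i ∈ D
  · by_cases hk : k ∈ D
    · exact h.minLabel_downVertex_of_mem_of_mem hDt hDi hi hk
    · exfalso
      have hlt := (h.minLabel_downVertex_lt hDt hDi hi hk).2
      have hpar := (h.minLabel_of_mem D hDt hDi hi hk).2
      rw [ht.parent_eq hu hDc] at hpar
      have := rank_le_two_of_forall (t := t) (u := u) (D := D) (E₀ := D) fun E hE hle => by
        refine .inr (by_contra fun hne => ?_)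
        have := IsTree.le_minLabel_of_subset (ht.children_nonempty hE)
          (ht.subset_sdiff_of_children hDc hE hne)
        omega
      omega
  · by_cases hk : k ∈ D
    · exfalso
      have hmD := h.minLabel_of_notMem D hDt hk hi
      have hku : k ∈ u := (mem_children.1 hDc).2.1.1 hk
      have hinj := ht.minLabel_injOn u
      by_cases hiu : i ∈ u
      · obtain ⟨D₀, hD₀, hi₀⟩ := ht.exists_child_of_mem (ht.mem_branchPoints_of_children hu hDc) hiu
        have hne : D₀ ≠ D := fun e => hi (e ▸ hi₀)
        have hk₀ : k ∉ D₀ := fun hk₀ => hne (ht.child_eq_of_mem hD₀ hDc hk₀ hk)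
        have hpar := (h.minLabel_of_mem D₀ (children_subset _ _ hD₀) (fun e => hui (e ▸ hD₀))
          hi₀ hk₀).2
        rw [ht.parent_eq hu hD₀] at hpar
        have := rank_le_two_of_forall (t := t) (u := u) (D := D) (E₀ := D₀) fun E hE hle => by
          refine or_iff_not_imp_left.2 fun hne => hinj hE hDc (le_antisymm hle ?_)
          rw [hmD, hpar]
          exact IsTree.le_minLabel_of_subset (ht.children_nonempty hE)
            (ht.subset_sdiff_of_children hD₀ hE hne)
        omega
      · have hmu := h.minLabel_of_notMem u hu hku hiu
        have := rank_le_two_of_forall (t := t) (u := u) (D := D) (E₀ := D) fun E hE hle => by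
          refine .inr (hinj hE hDc (le_antisymm hle ?_))
          rw [hmD, ← hmu]
          exact IsTree.le_minLabel_of_subset (ht.children_nonempty hE) (mem_children.1 hE).2.1.1
        omega
    · exact minLabel_downVertex_of_notMem h.le (ht.nonempty_of_mem D hDt) hi hk

theorem Searched.minLabel_downVertex_lt_of_big (h : Searched t i k) (ht : IsTree A t)
    {u E : Finset ℕ} (hu : u ∈ t) (hui : {i} ∉ children t u) (hD : D ∈ children t u)
    (hE : E ∈ bigChildren t u) (hlt : minLabel D < minLabel E) :
    minLabel (downVertex i k D) < minLabel (downVertex i k E) := by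
  obtain ⟨hE1, hE2⟩ := h.minLabel_downVertex_of_big ht hu hui hE
  have hDt := children_subset _ _ hD
  have hDi : D ≠ {i} := fun e => hui (e ▸ hD)
  rw [hE1]
  by_cases hi : i ∈ D
  · by_cases hk : k ∈ D
    · obtain ⟨h1, h2⟩ := h.minLabel_downVertex_of_mem_of_mem hDt hDi hi hk
      rw [h1]
      exact relabel_lt_relabel h2 hE2 hlt
    · have hpar := (h.minLabel_of_mem D hDt hDi hi hk).2
      rw [ht.parent_eq hu hD] at hpar
      have hEc := (mem_bigChildren.1 hE).1
      have := IsTree.le_minLabel_of_subset (ht.children_nonempty hEc)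
        (ht.subset_sdiff_of_children hD hEc fun e => hlt.ne (e ▸ rfl))
      exact (h.minLabel_downVertex_lt hDt hDi hi hk).1.trans_le
        (le_relabel (lt_of_le_of_ne (hpar ▸ this) (Ne.symm hE2)))
  · by_cases hk : k ∈ D
    · obtain ⟨h1, h2, h3⟩ := h.minLabel_downVertex_of_mem hDt hi hk
      rw [h1]
      exact h3.trans_le (le_relabel (h2 ▸ hlt))
    · obtain ⟨h1, h2⟩ :=
        minLabel_downVertex_of_notMem h.le (ht.nonempty_of_mem D hDt) hi hk
      rw [h1]
      exact relabel_lt_relabel h2 hE2 hlt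

theorem Searched.bigChildren_downTree {m : ℕ} (h : Searched t i k) (hm : 1 ≤ m)
    (ht : IsTree (Finset.Icc 1 (m + 1)) t) (hi : i ∈ Finset.Icc 1 (m + 1))
    (hk : k ∈ Finset.Icc 1 (m + 1)) {u : Finset ℕ} (hu : u ∈ branchPoints t)
    (hui : {i} ∉ children t u) :
    bigChildren (downTree t i k) (downVertex i k u) =
      (bigChildren t u).image (downVertex i k) := by
  obtain ⟨hut, hcard⟩ := mem_branchPoints.1 hu
  have hinj := ht.downVertex_injOn_children (i := i) (k := k) u
  have hc := ht.children_downTree hm hi hk hut (fun e => by rw [e] at hcard; simp at hcard)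
    (fun e => hui ((ht.contracted_iff hut).1 e).1)
  rw [Finset.erase_eq_of_notMem hui] at hinj hc
  exact ht.bigChildren_eq_image hu hc hinj fun D hD E hE =>
    h.minLabel_downVertex_lt_of_big ht hut hui (mem_smallChildren.1 hD).1 hE
      (minLabel_lt_of_small_of_big hD hE)

end Labels

section SearchedInstances

variable {m : ℕ} {t : Finset (Finset ℕ)} {i : ℕ} {v : Finset ℕ}

/-- The local search at a branch point with two children. -/
theorem IsTree.searched_of_card_eq_two (ht : IsTree (Finset.Icc 1 m) t)
    (hi : i ∈ Finset.Icc 1 m) (hv : v ∈ t) (hiv : {i} ∈ children t v) :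
    Searched t i (max i (max (firstBushMin t i) (secondBushMin t i))) := by
  have hiv' := (mem_children.1 hiv).2.1
  have hiv1 : i ∈ v := hiv'.1 (Finset.mem_singleton_self i)
  have ha : firstBushMin t i = minLabel (v \ {i}) := by rw [firstBushMin, ht.parent_eq hv hiv]
  have hb : secondBushMin t i = minLabel (parent t v \ v) := by
    rw [secondBushMin, ht.parent_eq hv hiv]
  have hne : (v \ {i}).Nonempty := Finset.sdiff_nonempty.2 hiv'.2
  have ham := minLabel_mem hne
  rw [← ha, Finset.mem_sdiff, Finset.mem_singleton] at ham
  have hi0 := (Finset.mem_Icc.1 hi).1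
  set a := firstBushMin t i with ha'
  set b := secondBushMin t i with hb'
  set k := max i (max a b) with hk
  -- the second spinal bush, if it supplies the label `k`
  have hbv : b ≠ 0 → parent t v ∈ t ∧ v ∈ children t (parent t v) ∧ b ∈ parent t v \ v := by
    intro h0
    have hvA : v ≠ Finset.Icc 1 m := by
      intro h
      apply h0
      rw [hb, h, ht.parent_top, Finset.sdiff_self, minLabel_empty]
    obtain ⟨h1, h2⟩ := ht.parent_mem hv hvA
    refine ⟨h1, h2, ?_⟩
    rw [hb]
    exact minLabel_mem (Finset.sdiff_nonempty.2 (mem_children.1 h2).2.1.2)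
  refine ⟨le_max_left _ _, fun D hD hkD hiD => ?_, fun D hD hDi hiD hkD => ?_,
    fun hik D hD hiD hDi => ?_⟩
  -- A subtree with the label `k` but not `i` is contained in the spinal bush with least label `k`.
  · have hki : k ≠ i := fun e => hiD (e ▸ hkD)
    have hvD : ¬ v ⊆ D := fun hvD => hiD (hvD hiv1)
    by_cases hka : k = a
    · rw [hka] at hkD ⊢
      refine minLabel_eq hkD fun y hy => ?_
      rw [ha]
      refine minLabel_le ?_
      rcases ht.laminar v hv D hD with h | h | h
      · exact absurd h hvD
      · exact Finset.mem_sdiff.2 ⟨h hy, fun e => hiD (Finset.mem_singleton.1 e ▸ hy)⟩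
      · exact absurd hkD (Finset.disjoint_left.1 h ham.1)
    · have hkb : k = b := by omega
      obtain ⟨hp1, hp2, hp3⟩ := hbv (by omega)
      rw [Finset.mem_sdiff] at hp3
      rw [hkb] at hkD ⊢
      refine minLabel_eq hkD fun y hy => ?_
      rw [hb]
      refine minLabel_le (Finset.mem_sdiff.2 ⟨?_, ?_⟩)
      · rcases ht.laminar _ hp1 D hD with h | h | h
        · exact absurd (h ((mem_children.1 hp2).2.1.1 hiv1)) hiD
        · exact h hy
        · exact absurd hkD (Finset.disjoint_left.1 h hp3.1)
      · rcases ht.laminar v hv D hD with h | h | h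
        · exact absurd h hvD
        · exact absurd (h hkD) hp3.2
        · exact Finset.disjoint_right.1 h hy
  -- A subtree other than `{i}` with the label `i` contains `v`; if it does not contain `k`, then
  -- `k` is in the second spinal bush and the subtree is `v`.
  · have hvD := (ht.sibling_mem_of_leaf hv hiv hD hiD).resolve_right hDi
    have hki : k ≠ i := fun e => hkD (e ▸ hiD)
    have hka : k ≠ a := fun e => hkD (e ▸ hvD ham.1)
    have hkb : k = b := by omega
    obtain ⟨hp1, hp2, hp3⟩ := hbv (by omega)
    have hDv : D = v := by
      by_contra hne
      have := ((ht.mem_children_iff hp1).1 hp2).2.2 D hD (lt_of_le_of_ne hvD (Ne.symm hne))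
      exact hkD (hkb ▸ this (Finset.mem_sdiff.1 hp3).1)
    subst hDv
    exact ⟨⟨a, ham.1, ham.2, by omega⟩, hkb.trans hb⟩
  · have hvD := (ht.sibling_mem_of_leaf hv hiv hD hiD).resolve_right hDi
    have := minLabel_le (hvD ham.1)
    omega

/-- The local search at a branch point with at least three children. -/
theorem IsTree.searched_of_big (ht : IsTree (Finset.Icc 1 m) t) (hv : v ∈ t)
    (hiv : {i} ∈ children t v) {E : Finset ℕ} (hE : E ∈ bigChildren t v) (hiE : i ≤ minLabel E) :
    Searched t i (minLabel E) := by
  obtain ⟨hEc, hr⟩ := mem_bigChildren.1 hE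
  have hEt := children_subset _ _ hEc
  have hkE := minLabel_mem (ht.nonempty_of_mem E hEt)
  have hiv1 : i ∈ v := (mem_children.1 hiv).2.1.1 (Finset.mem_singleton_self i)
  refine ⟨hiE, fun D hD hkD hiD => minLabel_eq hkD fun y hy => ?_, fun D hD hDi hiD hkD => ?_,
    fun hik D hD hiD hDi => ?_⟩
  · refine minLabel_le ?_
    rcases ht.laminar E hEt D hD with h | h | h
    · rcases h.eq_or_ssubset with h | h
      · rwa [h]
      · exact absurd (((ht.mem_children_iff hv).1 hEc).2.2 D hD h hiv1) hiD
    · exact h hy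
    · exact absurd hkD (Finset.disjoint_left.1 h hkE)
  · have hvD := (ht.sibling_mem_of_leaf hv hiv hD hiD).resolve_right hDi
    exact absurd (hvD ((mem_children.1 hEc).2.1.1 hkE)) hkD
  · have hvD := (ht.sibling_mem_of_leaf hv hiv hD hiD).resolve_right hDi
    obtain ⟨D₁, hD₁, hr₁⟩ := ht.exists_rank_eq (u := v) (r := 1) le_rfl
      (Finset.card_pos.2 ⟨E, hEc⟩)
    have h1 : minLabel D₁ < minLabel E := (IsTree.rank_lt_rank_iff hEc).1 (by omega)
    have h2 := minLabel_mem (ht.children_nonempty hD₁)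
    have := minLabel_le (hvD ((mem_children.1 hD₁).2.1.1 h2))
    omega

end SearchedInstances

section BigAtParent

variable {m : ℕ} {t : Finset (Finset ℕ)} {i : ℕ} {v : Finset ℕ}

theorem IsTree.minLabel_downVertex_sibling (ht : IsTree (Finset.Icc 1 m) t)
    (hiv : {i} ∈ children t v) {E : Finset ℕ} (hE : E ∈ children t v) (hiE : i ≤ minLabel E)
    {D : Finset ℕ} (hD : D ∈ children t v) (hDi : D ≠ {i}) (hDE : D ≠ E) :
    minLabel (downVertex i (minLabel E) D) = relabel (minLabel E) (minLabel D) ∧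
      minLabel D ≠ minLabel E := by
  refine minLabel_downVertex_of_notMem hiE (ht.children_nonempty hD) (fun h => hDi ?_)
    fun h => hDE ?_
  · exact ht.child_eq_of_mem hD hiv h (Finset.mem_singleton_self i)
  · exact ht.child_eq_of_mem hD hE h (minLabel_mem (ht.children_nonempty hE))

theorem IsTree.minLabel_downVertex_searched (ht : IsTree (Finset.Icc 1 m) t) (hv : v ∈ t)
    (hiv : {i} ∈ children t v) {E : Finset ℕ} (hE : E ∈ bigChildren t v) (hiE : i ≤ minLabel E)
    (hEi : E ≠ {i}) : minLabel (downVertex i (minLabel E) E) = i ∧ i < minLabel E := by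
  have hEc := (mem_bigChildren.1 hE).1
  obtain ⟨h1, -, h3⟩ := (ht.searched_of_big hv hiv hE hiE).minLabel_downVertex_of_mem
    (children_subset _ _ hEc)
    (fun h => hEi (ht.child_eq_of_mem hEc hiv h (Finset.mem_singleton_self i)))
    (minLabel_mem (ht.children_nonempty hEc))
  exact ⟨h1, h3⟩

theorem IsTree.not_contracted_of_big (ht : IsTree (Finset.Icc 1 m) t) (hv : v ∈ branchPoints t)
    {E : Finset ℕ} (hE : E ∈ bigChildren t v) : ¬ Contracted t i v := by
  intro h
  have h1 := ((ht.contracted_iff (mem_branchPoints.1 hv).1).1 h).2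
  have h2 := ht.card_bigChildren hv
  have := Finset.card_pos.2 ⟨E, hE⟩
  omega

theorem IsTree.children_downTree_parent (ht : IsTree (Finset.Icc 1 (m + 1)) t) (hm : 1 ≤ m)
    (hi : i ∈ Finset.Icc 1 (m + 1)) {k : ℕ} (hk : k ∈ Finset.Icc 1 (m + 1))
    (hv : v ∈ branchPoints t) {E : Finset ℕ} (hE : E ∈ bigChildren t v) :
    children (AlphaGamma.downTree t i k) (downVertex i k v) =
      ((children t v).erase {i}).image (downVertex i k) := by
  obtain ⟨hvt, hcard⟩ := mem_branchPoints.1 hv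
  exact ht.children_downTree hm hi hk hvt (fun e => by rw [e] at hcard; simp at hcard)
    (ht.not_contracted_of_big hv hE)

/-- If leaf `i` has rank at most two in its parent, then the subtree `E`, which gets the label `i`,
takes its place among the subtrees of rank at most two. -/
theorem IsTree.big_downTree_of_small (ht : IsTree (Finset.Icc 1 (m + 1)) t) (hm : 1 ≤ m)
    (hi : i ∈ Finset.Icc 1 (m + 1)) (hv : v ∈ branchPoints t) (hiv : {i} ∈ smallChildren t v)
    {E : Finset ℕ} (hE : E ∈ bigChildren t v) :
    bigChildren (AlphaGamma.downTree t i (minLabel E)) (downVertex i (minLabel E) v) =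
      ((bigChildren t v).erase E).image (downVertex i (minLabel E)) := by
  obtain ⟨hvt, hcard⟩ := mem_branchPoints.1 hv
  have hEc := (mem_bigChildren.1 hE).1
  have hic := (mem_smallChildren.1 hiv).1
  have hlt := minLabel_lt_of_small_of_big hiv hE
  rw [minLabel_singleton] at hlt
  have hEi : E ≠ {i} := fun e => by rw [e, minLabel_singleton] at hlt; exact lt_irrefl _ hlt
  have hk := ht.minLabel_mem_Icc (children_subset _ _ hEc)
  have hinj := ht.downVertex_injOn_children (i := i) (k := minLabel E) v
  have hib : {i} ∉ bigChildren t v := fun h =>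
    (mem_smallChildren.1 hiv).2 (mem_bigChildren.1 h).2
  have hEs : E ∉ smallChildren t v := fun h =>
    (mem_smallChildren.1 h).2 (mem_bigChildren.1 hE).2
  have hS : insert E ((smallChildren t v).erase {i}) ⊆ (children t v).erase {i} := by
    intro D hD
    rcases Finset.mem_insert.1 hD with rfl | hD
    · exact Finset.mem_erase.2 ⟨hEi, hEc⟩
    · rw [Finset.mem_erase] at hD
      exact Finset.mem_erase.2 ⟨hD.1, (mem_smallChildren.1 hD.2).1⟩
  refine bigChildren_eq_of_union
    (S := (insert E ((smallChildren t v).erase {i})).image (downVertex i (minLabel E))) ?_ ?_ ?_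
  · rw [ht.children_downTree_parent hm hi hk hv hE, ← Finset.image_union]
    congr 1
    rw [children_eq_small_union_big, Finset.erase_union_distrib, Finset.erase_eq_of_notMem hib,
      Finset.insert_union, ← Finset.union_insert, Finset.insert_erase hE]
  · rw [Finset.card_image_of_injOn (hinj.mono (Finset.coe_subset.2 hS)),
      Finset.card_insert_of_notMem fun h => hEs (Finset.mem_of_mem_erase h),
      Finset.card_erase_of_mem hiv, ht.card_smallChildren hv]
  · simp only [Finset.mem_image]
    rintro _ ⟨D, hD, rfl⟩ _ ⟨D', hDm, rfl⟩
    obtain ⟨hD'E, hD'⟩ := Finset.mem_erase.1 hDm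
    obtain ⟨h1, h2⟩ := ht.minLabel_downVertex_sibling hic hEc hlt.le (mem_bigChildren.1 hD').1
      (fun e => hib (e ▸ hD')) hD'E
    rw [h1]
    rcases Finset.mem_insert.1 hD with rfl | hD
    · rw [(ht.minLabel_downVertex_searched hvt hic hE hlt.le hEi).1]
      have := minLabel_lt_of_small_of_big hiv hD'
      rw [minLabel_singleton] at this
      exact lt_relabel hlt this
    · obtain ⟨hDi, hD⟩ := Finset.mem_erase.1 hD
      obtain ⟨h3, h4⟩ := ht.minLabel_downVertex_sibling hic hEc hlt.le
        (mem_smallChildren.1 hD).1 hDi (fun e => hEs (e ▸ hD))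
      rw [h3]
      exact relabel_lt_relabel h4 h2 (minLabel_lt_of_small_of_big hD hD')

/-- If leaf `i` has rank at least three in its parent, the subtrees of rank at most two stay the
same. -/
theorem IsTree.big_downTree_of_big (ht : IsTree (Finset.Icc 1 (m + 1)) t) (hm : 1 ≤ m)
    (hi : i ∈ Finset.Icc 1 (m + 1)) (hv : v ∈ branchPoints t) (hiv : {i} ∈ bigChildren t v)
    {E : Finset ℕ} (hE : E ∈ bigChildren t v) (hiE : i ≤ minLabel E) :
    bigChildren (AlphaGamma.downTree t i (minLabel E)) (downVertex i (minLabel E) v) =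
      ((bigChildren t v).erase {i}).image (downVertex i (minLabel E)) := by
  obtain ⟨hvt, hcard⟩ := mem_branchPoints.1 hv
  have hEc := (mem_bigChildren.1 hE).1
  have hic := (mem_bigChildren.1 hiv).1
  have hk := ht.minLabel_mem_Icc (children_subset _ _ hEc)
  have hinj := ht.downVertex_injOn_children (i := i) (k := minLabel E) v
  have his : {i} ∉ smallChildren t v := fun h =>
    (mem_smallChildren.1 h).2 (mem_bigChildren.1 hiv).2
  refine bigChildren_eq_of_union
    (S := (smallChildren t v).image (downVertex i (minLabel E))) ?_ ?_ ?_
  · rw [ht.children_downTree_parent hm hi hk hv hE, ← Finset.image_union]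
    congr 1
    rw [children_eq_small_union_big, Finset.erase_union_distrib, Finset.erase_eq_of_notMem his]
  · rw [Finset.card_image_of_injOn (hinj.mono fun D hD => ?_), ht.card_smallChildren hv]
    exact Finset.mem_coe.2 (Finset.mem_erase.2 ⟨fun e => his (e ▸ hD), (mem_smallChildren.1 hD).1⟩)
  · simp only [Finset.mem_image]
    rintro _ ⟨D, hD, rfl⟩ _ ⟨D', hD', rfl⟩
    obtain ⟨hD'i, hD'⟩ := Finset.mem_erase.1 hD'
    have hDi : D ≠ {i} := fun e => his (e ▸ hD)
    have hDE : D ≠ E := fun e => (mem_smallChildren.1 hD).2 (e ▸ (mem_bigChildren.1 hE).2)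
    obtain ⟨h1, h2⟩ := ht.minLabel_downVertex_sibling hic hEc hiE (mem_smallChildren.1 hD).1 hDi hDE
    rw [h1]
    by_cases hD'E : D' = E
    · subst hD'E
      have := minLabel_lt_of_small_of_big hD hiv
      rw [minLabel_singleton] at this
      rw [(ht.minLabel_downVertex_searched hvt hic hE hiE hD'i).1,
        relabel_of_lt (this.trans_le hiE)]
      exact this
    · obtain ⟨h3, h4⟩ := ht.minLabel_downVertex_sibling hic hEc hiE
        (mem_bigChildren.1 hD').1 hD'i hD'E
      rw [h3]
      exact relabel_lt_relabel h2 h4 (minLabel_lt_of_small_of_big hD hD')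

end BigAtParent

/-! ### The semi-planar down-step -/

section DownSP

variable {A : Finset ℕ} {m : ℕ} {x : OrderedTree} {i : ℕ} {u v : Finset ℕ}

/-- The planar order at a branch point starts with the subtrees of rank one and two. -/
theorem exists_toPlanar_order (ht : IsTree A x.shape) (hu : u ∈ branchPoints x.shape) :
    ∃ D₁ ∈ children x.shape u, ∃ D₂ ∈ children x.shape u, rank x.shape u D₁ = 1 ∧
      rank x.shape u D₂ = 2 ∧ (toPlanar x).order u = D₁ :: D₂ :: x.order u := by
  have h2 := ht.two_le_card_children hu
  obtain ⟨D₁, hD₁, hr₁⟩ := ht.exists_rank_eq (u := u) (r := 1) le_rfl (by omega)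
  obtain ⟨D₂, hD₂, hr₂⟩ := ht.exists_rank_eq (u := u) (r := 2) (by omega) h2
  have hinj := ht.rank_injOn u
  refine ⟨D₁, hD₁, D₂, hD₂, hr₁, hr₂, ?_⟩
  have e : ∀ D ∈ children x.shape u, ∀ r, rank x.shape u D = r →
      (children x.shape u).filter (fun E => rank x.shape u E = r) = {D} := by
    rintro D hD r rfl
    ext E
    rw [Finset.mem_filter, Finset.mem_singleton]
    exact ⟨fun h => hinj h.1 hD h.2, by rintro rfl; exact ⟨hD, rfl⟩⟩
  simp only [toPlanar, if_pos hu]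
  rw [e D₁ hD₁ 1 hr₁, e D₂ hD₂ 2 hr₂, Finset.toList_singleton, Finset.toList_singleton]
  rfl

theorem swapSet_swapSet (i k : ℕ) (D : Finset ℕ) : swapSet i k (swapSet i k D) = D := by
  rw [swapSet, swapSet, Finset.image_image]
  conv_rhs => rw [← Finset.image_id (s := D)]
  exact Finset.image_congr fun y _ => Equiv.swap_apply_self i k y

theorem mem_swapSet_right {i k : ℕ} {D : Finset ℕ} : k ∈ swapSet i k D ↔ i ∈ D := by
  rw [swapSet, Finset.mem_image]
  constructor
  · rintro ⟨y, hy, h⟩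
    rw [Equiv.swap_apply_eq_iff, Equiv.swap_apply_right] at h
    exact h ▸ hy
  · exact fun h => ⟨i, h, Equiv.swap_apply_left i k⟩

theorem unrelabelSet_relabelSet {k : ℕ} {D : Finset ℕ} (h : k ∉ D) :
    unrelabelSet k (relabelSet k D) = D := by
  rw [unrelabelSet, relabelSet, Finset.image_image]
  conv_rhs => rw [← Finset.image_id (s := D)]
  refine Finset.image_congr fun y hy => ?_
  have : y ≠ k := fun e => h (e ▸ hy)
  simp only [Function.comp_apply, id]
  split_ifs <;> omega

/-- The planar order at a vertex after deletion and relabelling is the old planar order without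
the deleted leaf. -/
theorem order_relabelPlanar (hu : u ∈ branchPoints x.shape) {k : ℕ}
    (hc : ¬ Contracted x.shape i u) (l : List (Finset ℕ)) (hl : ∀ D ∈ l, D.Nonempty ∧ D ⊆ u)
    (y : OrderedTree) (hy : y.shape = x.shape) (hyo : y.order u = l) :
    (relabelPlanar (deletePlanar (swapPlanar y i k) k) k).order (downVertex i k u) =
      (l.map (downVertex i k)).filter fun D => D ≠ ∅ := by
  have hut := (mem_branchPoints.1 hu).1
  subst hyo
  have hmem : (swapSet i k u).erase k ∈ swapTree x.shape i k ↔ u.erase i ∈ x.shape := by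
    have e : swapSet i k (u.erase i) = (swapSet i k u).erase k := by
      rw [swapSet, swapSet, Finset.image_erase (Equiv.swap i k).injective, Equiv.swap_apply_left]
    rw [swapTree, Finset.mem_image]
    constructor
    · rintro ⟨D, hD, h⟩
      rw [← e] at h
      have := congrArg (swapSet i k) h
      rw [swapSet_swapSet, swapSet_swapSet] at this
      exact this ▸ hD
    · exact fun h => ⟨_, h, e⟩
  have hun : unrelabelSet k (downVertex i k u) = (swapSet i k u).erase k :=
    unrelabelSet_relabelSet (Finset.notMem_erase _ _)
  have hshape : (swapPlanar y i k).shape = swapTree x.shape i k := by rw [← hy]; rfl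
  simp only [relabelPlanar, deletePlanar, hun]
  by_cases hiu : i ∈ u
  · rw [if_neg (by rw [hshape, hmem]; exact fun h => hc ⟨hiu, h⟩),
      Finset.insert_erase (mem_swapSet_right.2 hiu)]
    simp only [swapPlanar, swapSet_swapSet, List.map_map, List.filter_map]
    have e1 : (relabelSet k ∘ (fun D => D.erase k) ∘ swapSet i k) = downVertex i k := rfl
    rw [e1]
    congr 2
    funext D
    simp [downVertex, relabelSet_eq_empty]
  · have e0 : (swapSet i k u).erase k = swapSet i k u :=
      Finset.erase_eq_of_notMem fun h => hiu (mem_swapSet_right.1 h)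
    rw [e0] at hmem ⊢
    rw [if_pos (by rw [hshape, hmem, Finset.erase_eq_of_notMem hiu]; exact hut)]
    simp only [swapPlanar, swapSet_swapSet, List.map_map]
    have hiD : ∀ D ∈ y.order u, i ∉ D := fun D hD hi => hiu ((hl D hD).2 hi)
    rw [List.filter_eq_self.2]
    · refine List.map_congr_left fun D hD => ?_
      rw [Function.comp_apply, downVertex,
        Finset.erase_eq_of_notMem fun h => hiD D hD (mem_swapSet_right.1 h)]
    · intro X hX
      obtain ⟨D, hD, rfl⟩ := List.mem_map.1 hX
      simpa using (downVertex_nonempty (k := k) (hl D hD).1 fun e => hiD D hD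
        (e ▸ Finset.mem_singleton_self i)).ne_empty

theorem downSP_shape (x : OrderedTree) (i : ℕ) :
    (downSP x i).shape = downTree x.shape i (searchLabel x i) := rfl

variable (hx : IsSemiPlanar (Finset.Icc 1 (m + 1)) x)
include hx

theorem IsSemiPlanar.order_downSP (hm : 1 ≤ m) (hi : i ∈ Finset.Icc 1 (m + 1))
    (hk : searchLabel x i ∈ Finset.Icc 1 (m + 1)) (hu : u ∈ branchPoints x.shape)
    (hc : ¬ Contracted x.shape i u) :
    (downSP x i).order (downVertex i (searchLabel x i) u) =
      ((((toPlanar x).order u).map (downVertex i (searchLabel x i))).filter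
        fun D => D ≠ ∅).drop 2 := by
  have ht := hx.isTree
  set k := searchLabel x i with hkdef
  have hbp : downVertex i k u ∈ branchPoints (downTree x.shape i k) := by
    rw [ht.branchPoints_downTree hm hi hk]
    exact Finset.mem_image_of_mem _ (Finset.mem_filter.2 ⟨hu, hc⟩)
  rw [downSP, toSemiPlanar, ← hkdef]
  refine (if_pos hbp).trans ?_
  congr 1
  refine order_relabelPlanar hu hc _ (fun D hD => ?_) (toPlanar x) rfl rfl
  obtain ⟨D₁, hD₁, D₂, hD₂, -, -, e⟩ := exists_toPlanar_order ht hu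
  have hDc : D ∈ children x.shape u := by
    rw [e, List.mem_cons, List.mem_cons] at hD
    rcases hD with rfl | rfl | hD
    · exact hD₁
    · exact hD₂
    · exact ((hx.mem_order u hu D).1 hD).1
  exact ⟨ht.children_nonempty hDc, (mem_children.1 hDc).2.1.1⟩

theorem IsSemiPlanar.filter_map_downVertex {k : ℕ} {l : List (Finset ℕ)}
    (hl : ∀ D ∈ l, D ∈ children x.shape u) (hi : {i} ∉ l) :
    (l.map (downVertex i k)).filter (fun D => D ≠ ∅) = l.map (downVertex i k) := by
  refine List.filter_eq_self.2 fun X hX => ?_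
  obtain ⟨D, hD, rfl⟩ := List.mem_map.1 hX
  simpa using (downVertex_nonempty (k := k) (hx.isTree.children_nonempty (hl D hD))
    fun e => hi (e ▸ hD)).ne_empty

theorem IsSemiPlanar.order_downSP_of_notMem (hm : 1 ≤ m) (hi : i ∈ Finset.Icc 1 (m + 1))
    (hk : searchLabel x i ∈ Finset.Icc 1 (m + 1)) (hu : u ∈ branchPoints x.shape)
    (hui : {i} ∉ children x.shape u) :
    (downSP x i).order (downVertex i (searchLabel x i) u) =
      (x.order u).map (downVertex i (searchLabel x i)) := by
  have ht := hx.isTree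
  rw [hx.order_downSP hm hi hk hu fun e =>
    hui ((ht.contracted_iff (mem_branchPoints.1 hu).1).1 e).1]
  obtain ⟨D₁, hD₁, D₂, hD₂, -, -, e⟩ := exists_toPlanar_order ht hu
  have hl : ∀ D ∈ D₁ :: D₂ :: x.order u, D ∈ children x.shape u := by
    intro D hD
    rw [List.mem_cons, List.mem_cons] at hD
    rcases hD with rfl | rfl | hD
    · exact hD₁
    · exact hD₂
    · exact ((hx.mem_order u hu D).1 hD).1
  rw [e, hx.filter_map_downVertex hl fun h => hui (hl _ h)]
  rfl

/-- If the selected leaf has rank at most two, its place is filled by the first of the other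
subtrees. -/
theorem IsSemiPlanar.order_downSP_of_small (hm : 1 ≤ m) (hi : i ∈ Finset.Icc 1 (m + 1))
    (hk : searchLabel x i ∈ Finset.Icc 1 (m + 1)) (hv : v ∈ branchPoints x.shape)
    (hiv : {i} ∈ smallChildren x.shape v) (hne : (bigChildren x.shape v).Nonempty) :
    (downSP x i).order (downVertex i (searchLabel x i) v) =
      (x.order v).tail.map (downVertex i (searchLabel x i)) := by
  have ht := hx.isTree
  obtain ⟨E, hE⟩ := hne
  rw [hx.order_downSP hm hi hk hv (ht.not_contracted_of_big hv hE)]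
  set k := searchLabel x i
  obtain ⟨D₁, hD₁, D₂, hD₂, hr₁, hr₂, e⟩ := exists_toPlanar_order ht hv
  obtain ⟨hic, hir⟩ := mem_smallChildren.1 hiv
  have hinj := ht.rank_injOn v
  have hi0 : downVertex i k {i} = ∅ := (downVertex_eq_empty_iff ⟨i, by simp⟩).2 rfl
  have hdrop : ∀ D ∈ children x.shape v, D ≠ {i} →
      (((D :: x.order v).map (downVertex i k)).filter (fun D => D ≠ ∅)).drop 2 =
        (x.order v).tail.map (downVertex i k) := by
    intro D hD hDi
    rw [hx.filter_map_downVertex (u := v)]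
    · rw [List.map_cons, List.drop_succ_cons, List.drop_one, List.map_tail]
    · intro D' hD'
      rcases List.mem_cons.1 hD' with rfl | hD'
      · exact hD
      · exact ((hx.mem_order v hv D').1 hD').1
    · intro h
      rcases List.mem_cons.1 h with h | h
      · exact hDi h.symm
      · exact hir ((hx.mem_order v hv _).1 h).2
  rw [e]
  have h1 := one_le_rank hic
  have h12 : D₁ ≠ D₂ := fun h => by rw [h, hr₂] at hr₁; omega
  rcases (show rank x.shape v {i} = 1 ∨ rank x.shape v {i} = 2 by omega) with h | h
  · have hD : D₁ = {i} := hinj hD₁ hic (hr₁.trans h.symm)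
    rw [List.map_cons, hD, hi0, List.filter_cons_of_neg (by simp)]
    exact hdrop D₂ hD₂ fun h' => h12 (hD.trans h'.symm)
  · have hD : D₂ = {i} := hinj hD₂ hic (hr₂.trans h.symm)
    have hD₁i : D₁ ≠ {i} := fun h' => h12 (h'.trans hD.symm)
    rw [← hdrop D₁ hD₁ hD₁i]
    simp only [List.map_cons, List.filter_cons, hD, hi0]
    simp

theorem IsSemiPlanar.order_downSP_of_big (hm : 1 ≤ m) (hi : i ∈ Finset.Icc 1 (m + 1))
    (hk : searchLabel x i ∈ Finset.Icc 1 (m + 1)) (hv : v ∈ branchPoints x.shape)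
    (hiv : {i} ∈ bigChildren x.shape v) :
    (downSP x i).order (downVertex i (searchLabel x i) v) =
      ((x.order v).erase {i}).map (downVertex i (searchLabel x i)) := by
  have ht := hx.isTree
  rw [hx.order_downSP hm hi hk hv (ht.not_contracted_of_big hv hiv)]
  set k := searchLabel x i
  obtain ⟨D₁, hD₁, D₂, hD₂, hr₁, hr₂, e⟩ := exists_toPlanar_order ht hv
  obtain ⟨hic, hir⟩ := mem_bigChildren.1 hiv
  have hi0 : downVertex i k {i} = ∅ := (downVertex_eq_empty_iff ⟨i, by simp⟩).2 rfl
  have hnd := hx.nodup v hv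
  have hmem : {i} ∈ x.order v := (hx.mem_order v hv _).2 ⟨hic, hir⟩
  have hD₁i : {i} ≠ D₁ := fun h => by rw [h] at hir; omega
  have hD₂i : {i} ≠ D₂ := fun h => by rw [h] at hir; omega
  have key : ((x.order v).map (downVertex i k)).filter (fun D => D ≠ ∅) =
      ((x.order v).erase {i}).map (downVertex i k) := by
    rw [← hx.filter_map_downVertex (u := v) (l := (x.order v).erase {i})
      (fun D hD => ((hx.mem_order v hv D).1 (List.mem_of_mem_erase hD)).1)
      (fun h => (hnd.mem_erase_iff.1 h).1 rfl)]
    obtain ⟨l₁, l₂, h⟩ := List.append_of_mem hmem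
    have hl₁ : {i} ∉ l₁ := by
      rw [h, List.nodup_middle, List.nodup_cons] at hnd
      exact fun h' => hnd.1 (List.mem_append_left _ h')
    rw [h, List.erase_append_right _ hl₁, List.erase_cons_head]
    simp only [List.map_append, List.map_cons, List.filter_append, hi0]
    rw [List.filter_cons_of_neg (by simp)]
  have hd : ∀ D ∈ children x.shape v, {i} ≠ D → downVertex i k D ≠ ∅ := fun D hD hDi =>
    (downVertex_nonempty (ht.children_nonempty hD) (Ne.symm hDi)).ne_empty
  rw [e, List.map_cons, List.map_cons,
    List.filter_cons_of_pos (by simpa using hd D₁ hD₁ hD₁i),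
    List.filter_cons_of_pos (by simpa using hd D₂ hD₂ hD₂i), key]
  rfl

end DownSP

/-! ### The outcome of the local search -/

section Search

variable {A : Finset ℕ} {m : ℕ} {x : OrderedTree} {i : ℕ} {v : Finset ℕ}

theorem IsTree.firstBushMin_eq {t : Finset (Finset ℕ)} (ht : IsTree A t) (hv : v ∈ t)
    (hiv : {i} ∈ children t v) {D : Finset ℕ} (hD : D ∈ children t v) (hDi : D ≠ {i})
    (h : ∀ F ∈ children t v, F ≠ {i} → rank t v D ≤ rank t v F) :
    firstBushMin t i = minLabel D := by
  rw [firstBushMin, ht.parent_eq hv hiv]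
  refine minLabel_eq ?_ fun y hy => ?_
  · exact ht.subset_sdiff_of_children hiv hD hDi (minLabel_mem (ht.children_nonempty hD))
  · rw [Finset.mem_sdiff, Finset.mem_singleton] at hy
    obtain ⟨F, hF, hyF⟩ := ht.exists_child_of_mem (ht.mem_branchPoints_of_children hv hiv) hy.1
    have hFi : F ≠ {i} := fun e => hy.2 (Finset.mem_singleton.1 (e ▸ hyF))
    exact ((IsTree.rank_le_rank_iff hD).1 (h F hF hFi)).trans (minLabel_le hyF)

theorem searchLabel_of_card_eq_two (ht : IsTree A x.shape) (hv : v ∈ x.shape)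
    (hiv : {i} ∈ children x.shape v) (hc : (children x.shape v).card = 2) :
    searchLabel x i = max i (max (firstBushMin x.shape i) (secondBushMin x.shape i)) := by
  rw [searchLabel, secondSearchLabel]
  simp only [ht.parent_eq hv hiv, if_pos hc]

/-- From a leaf of rank at most two, the local search leads to the leftmost of the subtrees of rank
at least three: the label `a` belongs to the other one of the two leftmost subtrees, which is thus
skipped. -/
theorem IsSemiPlanar.searchLabel_of_small (hx : IsSemiPlanar A x) (hv : v ∈ branchPoints x.shape)
    (hiv : {i} ∈ smallChildren x.shape v) {E : Finset ℕ} {L : List (Finset ℕ)}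
    (h : x.order v = E :: L) : searchLabel x i = minLabel E := by
  have ht := hx.isTree
  have hvt := (mem_branchPoints.1 hv).1
  obtain ⟨hic, hir⟩ := mem_smallChildren.1 hiv
  have hE : E ∈ bigChildren x.shape v := mem_bigChildren.2
    ((hx.mem_order v hv E).1 (by rw [h]; exact List.mem_cons_self))
  obtain ⟨hEc, hEr⟩ := mem_bigChildren.1 hE
  have hcard : (children x.shape v).card ≠ 2 := by
    have := ht.card_bigChildren hv
    have := Finset.card_pos.2 ⟨E, hE⟩
    omega
  obtain ⟨D₁, hD₁, D₂, hD₂, hr₁, hr₂, e⟩ := exists_toPlanar_order ht hv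
  have hinj := ht.rank_injOn v
  have h1 := one_le_rank hic
  have h12 : D₁ ≠ D₂ := fun h => by rw [h, hr₂] at hr₁; omega
  have hiE : i < minLabel E := by
    have := minLabel_lt_of_small_of_big hiv hE
    rwa [minLabel_singleton] at this
  -- `D` is the other one of the two leftmost subtrees
  have key : ∀ D ∈ children x.shape v, D ≠ E → D ∈ smallChildren x.shape v →
      firstBushMin x.shape i = minLabel D → minLabel
        ((((D₁ :: D₂ :: x.order v).drop ((D₁ :: D₂ :: x.order v).idxOf {i} + 1)).find?
          (fun D' => minLabel D ∉ D')).getD ∅) = minLabel E →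
      searchLabel x i = minLabel E := by
    intro D hD hDE hDs ha hb
    rw [searchLabel, secondSearchLabel]
    simp only [ht.parent_eq hvt hic, if_neg hcard, if_pos (show rank x.shape v {i} ≤ 2 by omega),
      e, ha, hb]
    have := minLabel_lt_of_small_of_big hDs hE
    omega
  have hnotE : ∀ D ∈ children x.shape v, rank x.shape v D ≤ 2 → D ≠ E ∧ minLabel D ∉ E := by
    intro D hD hr
    have hne : D ≠ E := fun e => by rw [e] at hr; omega
    exact ⟨hne, fun h => hne (ht.child_eq_of_mem hD hEc (minLabel_mem (ht.children_nonempty hD)) h)⟩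
  rcases (show rank x.shape v {i} = 1 ∨ rank x.shape v {i} = 2 by omega) with h3 | h3
  · have hD : D₁ = {i} := hinj hD₁ hic (hr₁.trans h3.symm)
    have hDi : D₂ ≠ {i} := fun h' => h12 (hD.trans h'.symm)
    obtain ⟨h4, h5⟩ := hnotE D₂ hD₂ hr₂.le
    refine key D₂ hD₂ h4 (mem_smallChildren.2 ⟨hD₂, by omega⟩)
      (ht.firstBushMin_eq hvt hic hD₂ hDi fun F hF hFi => ?_) ?_
    -- Leaf `i` has rank one, so the least label of the other subtrees is that of the subtree of
    -- rank two.
    · have := one_le_rank hF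
      have : rank x.shape v F ≠ 1 := fun h' => hFi (hinj hF hic (h'.trans h3.symm))
      omega
    · rw [hD, h]
      simp [minLabel_mem (ht.children_nonempty hD₂), h5]
  · have hD : D₂ = {i} := hinj hD₂ hic (hr₂.trans h3.symm)
    have hDi : D₁ ≠ {i} := fun h' => h12 (h'.trans hD.symm)
    obtain ⟨h4, h5⟩ := hnotE D₁ hD₁ (by omega)
    refine key D₁ hD₁ h4 (mem_smallChildren.2 ⟨hD₁, by omega⟩)
      (ht.firstBushMin_eq hvt hic hD₁ hDi fun F hF _ => ?_) ?_
    · rw [hr₁]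
      exact one_le_rank hF
    · rw [hD, h, List.idxOf_cons_ne _ hDi]
      simp [h5]

/-- From a leaf of rank at least three, the local search compares the leaf with its left neighbour.
If the leaf is leftmost among the subtrees of rank at least three, its left neighbour has rank two
and a smaller least label. -/
theorem IsSemiPlanar.searchLabel_of_big (hx : IsSemiPlanar A x) (hv : v ∈ branchPoints x.shape)
    (hiv : {i} ∈ bigChildren x.shape v) {L₁ L₂ : List (Finset ℕ)}
    (h : x.order v = L₁ ++ {i} :: L₂) :
    searchLabel x i = max i (minLabel (L₁.getLastD {i})) := by
  have ht := hx.isTree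
  have hvt := (mem_branchPoints.1 hv).1
  obtain ⟨hic, hir⟩ := mem_bigChildren.1 hiv
  have hcard : (children x.shape v).card ≠ 2 := by
    have := ht.card_bigChildren hv
    have := Finset.card_pos.2 ⟨_, hiv⟩
    omega
  obtain ⟨D₁, hD₁, D₂, hD₂, hr₁, hr₂, e⟩ := exists_toPlanar_order ht hv
  have h12 : D₁ ≠ D₂ := fun h => by rw [h, hr₂] at hr₁; omega
  have hD₁i : D₁ ≠ {i} := fun h => by rw [← h] at hir; omega
  have hD₂i : D₂ ≠ {i} := fun h => by rw [← h] at hir; omega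
  have ha := ht.firstBushMin_eq hvt hic hD₁ hD₁i fun F hF _ => by
    rw [hr₁]; exact one_le_rank hF
  have hmD₁ := minLabel_mem (ht.children_nonempty hD₁)
  have hlt₁ : minLabel D₁ < i := by
    have := minLabel_lt_of_small_of_big (mem_smallChildren.2 ⟨hD₁, by omega⟩) hiv
    rwa [minLabel_singleton] at this
  have hlt₂ : minLabel D₂ < i := by
    have := minLabel_lt_of_small_of_big (mem_smallChildren.2 ⟨hD₂, by omega⟩) hiv
    rwa [minLabel_singleton] at this
  have hnd := hx.nodup v hv
  rw [h, List.nodup_middle, List.nodup_cons] at hnd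
  have hiL₁ : {i} ∉ L₁ := fun h' => hnd.1 (List.mem_append_left _ h')
  have hidx : (D₁ :: D₂ :: (L₁ ++ {i} :: L₂)).idxOf {i} = L₁.length + 2 := by
    rw [List.idxOf_cons_ne _ hD₁i, List.idxOf_cons_ne _ hD₂i, List.idxOf_append, if_neg hiL₁]
    simp
  have htake : (D₁ :: D₂ :: (L₁ ++ {i} :: L₂)).take (L₁.length + 2) = D₁ :: D₂ :: L₁ := by
    simp
  rw [searchLabel, secondSearchLabel]
  simp only [ht.parent_eq hvt hic, if_neg hcard, if_neg (show ¬ rank x.shape v {i} ≤ 2 by omega),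
    e, ha, h, hidx, htake]
  rcases List.eq_nil_or_concat L₁ with rfl | ⟨L, E, rfl⟩
  · have h5 : minLabel D₁ ∉ D₂ := fun h' => h12 (ht.child_eq_of_mem hD₁ hD₂ hmD₁ h')
    simp only [List.reverse_cons, List.reverse_nil, List.nil_append, List.singleton_append]
    rw [List.find?_cons_of_pos (by simpa using h5)]
    simp
    omega
  · have hE := (hx.mem_order v hv E).1 (by rw [h]; simp)
    have hE₁ : D₁ ≠ E := fun h => by have := hE.2; rw [← h] at this; omega
    have h5 : minLabel D₁ ∉ E := fun h' => hE₁ (ht.child_eq_of_mem hD₁ hE.1 hmD₁ h')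
    simp only [List.concat_eq_append, List.reverse_cons, List.reverse_append, List.reverse_nil,
      List.nil_append, List.cons_append]
    rw [List.find?_cons_of_pos (by simpa using h5)]
    simp
    omega

end Search

/-! ### The transition matrix of the semi-planar chain -/

section DownSemiPlanar

variable {m : ℕ} {x : OrderedTree} {i : ℕ} {u v : Finset ℕ}

theorem erase_mem_orderings {β : Type*} [DecidableEq β] {S : Finset β} {L : List β}
    (hL : L ∈ orderings S) (a : β) : L.erase a ∈ orderings (S.erase a) := by
  obtain ⟨h1, h2⟩ := mem_orderings.1 hL
  refine mem_orderings.2 ⟨h1.erase a, fun b => ?_⟩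
  rw [h1.mem_erase_iff, Finset.mem_erase, h2]

theorem IsTree.exists_parent_leaf {t : Finset (Finset ℕ)} (hm : 1 ≤ m)
    (ht : IsTree (Finset.Icc 1 (m + 1)) t) (hi : i ∈ Finset.Icc 1 (m + 1)) :
    ∃ v ∈ branchPoints t, {i} ∈ children t v := by
  obtain ⟨v, hv, hiv⟩ := ht.exists_mem_children (ht.singleton_mem i hi) fun h => by
    have := congrArg Finset.card h
    rw [Finset.card_singleton, Nat.card_Icc] at this
    omega
  exact ⟨v, ht.mem_branchPoints_of_children hv hiv, hiv⟩

/-- Apart from the case of two children, the outcome of the local search is the least label of a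
subtree of rank at least three. -/
theorem IsSemiPlanar.exists_searchLabel_eq (hx : IsSemiPlanar (Finset.Icc 1 m) x)
    (hv : v ∈ branchPoints x.shape) (hiv : {i} ∈ children x.shape v)
    (hc : (children x.shape v).card ≠ 2) :
    ∃ E ∈ bigChildren x.shape v, searchLabel x i = minLabel E ∧ i ≤ minLabel E := by
  have ht := hx.isTree
  have hbig : (bigChildren x.shape v).Nonempty := by
    rw [← Finset.card_pos]
    have := ht.card_bigChildren hv
    omega
  have hmem := (mem_orderings.1 (hx.order_mem hv)).2
  by_cases hi : {i} ∈ bigChildren x.shape v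
  · obtain ⟨L₁, L₂, h⟩ := List.append_of_mem ((hmem _).2 hi)
    rw [hx.searchLabel_of_big hv hi h]
    rcases le_total (minLabel (L₁.getLastD {i})) i with hle | hle
    · exact ⟨{i}, hi, by rw [minLabel_singleton, max_eq_left hle], by rw [minLabel_singleton]⟩
    · rw [max_eq_right hle]
      refine ⟨L₁.getLastD {i}, ?_, rfl, hle⟩
      rcases List.eq_nil_or_concat L₁ with rfl | ⟨L, E, rfl⟩
      · exact hi
      · rw [List.concat_eq_append, List.getLastD_concat]
        exact (hmem _).1 (by rw [h]; simp)
  · have his : {i} ∈ smallChildren x.shape v :=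
      mem_smallChildren.2 ⟨hiv, fun h => hi (mem_bigChildren.2 ⟨hiv, h⟩)⟩
    obtain ⟨D, hD⟩ := hbig
    obtain ⟨E, L, h⟩ := List.exists_cons_of_ne_nil (List.ne_nil_of_mem ((hmem D).2 hD))
    have hE : E ∈ bigChildren x.shape v := (hmem E).1 (by rw [h]; exact List.mem_cons_self)
    refine ⟨E, hE, hx.searchLabel_of_small hv his h, ?_⟩
    have := minLabel_lt_of_small_of_big his hE
    rw [minLabel_singleton] at this
    exact this.le

theorem IsTree.searchLabel_two_mem {t : Finset (Finset ℕ)} (ht : IsTree (Finset.Icc 1 m) t)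
    (hi : i ∈ Finset.Icc 1 m) :
    max i (max (firstBushMin t i) (secondBushMin t i)) ∈ Finset.Icc 1 m := by
  have h1 := Finset.mem_Icc.1 hi
  exact Finset.mem_Icc.2 ⟨h1.1.trans (le_max_left _ _),
    max_le h1.2 (max_le (firstBushMin_le ht i) (secondBushMin_le ht i))⟩

theorem IsSemiPlanar.searched (hx : IsSemiPlanar (Finset.Icc 1 m) x) (hi : i ∈ Finset.Icc 1 m)
    (hv : v ∈ branchPoints x.shape) (hiv : {i} ∈ children x.shape v) :
    Searched x.shape i (searchLabel x i) ∧ searchLabel x i ∈ Finset.Icc 1 m := by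
  have ht := hx.isTree
  have hvt := (mem_branchPoints.1 hv).1
  by_cases hc : (children x.shape v).card = 2
  · rw [searchLabel_of_card_eq_two ht hvt hiv hc]
    exact ⟨ht.searched_of_card_eq_two hi hvt hiv, ht.searchLabel_two_mem hi⟩
  · obtain ⟨E, hE, h, hiE⟩ := hx.exists_searchLabel_eq hv hiv hc
    rw [h]
    exact ⟨ht.searched_of_big hvt hiv hE hiE,
      ht.minLabel_mem_Icc (children_subset _ _ (mem_bigChildren.1 hE).1)⟩

theorem IsTree.bigChildren_downVertex_injOn {A : Finset ℕ} {t : Finset (Finset ℕ)}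
    (ht : IsTree A t) (k : ℕ) {S : Finset (Finset ℕ)} (hS : S ⊆ bigChildren t u) (hiS : {i} ∉ S) :
    Set.InjOn (downVertex i k) (S : Set (Finset ℕ)) :=
  (ht.downVertex_injOn_children (i := i) (k := k) u).mono fun D hD => Finset.mem_coe.2
    (Finset.mem_erase.2 ⟨fun e : D = {i} => hiS (e ▸ hD), (mem_bigChildren.1 (hS hD)).1⟩)

theorem IsSemiPlanar.downSP (hm : 1 ≤ m) (hx : IsSemiPlanar (Finset.Icc 1 (m + 1)) x)
    (hi : i ∈ Finset.Icc 1 (m + 1)) : IsSemiPlanar (Finset.Icc 1 m) (downSP x i) := by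
  have ht := hx.isTree
  obtain ⟨v, hv, hiv⟩ := ht.exists_parent_leaf hm hi
  have hvt := (mem_branchPoints.1 hv).1
  obtain ⟨hs, hk⟩ := hx.searched hi hv hiv
  refine isSemiPlanar_iff.2 ⟨ht.downTree hm hi hk, fun w hw => ?_, fun w hw => if_neg hw⟩
  rw [downSP_shape] at hw ⊢
  rw [ht.branchPoints_downTree hm hi hk] at hw
  obtain ⟨u, hu, rfl⟩ := Finset.mem_image.1 hw
  obtain ⟨hu, huc⟩ := Finset.mem_filter.1 hu
  by_cases hui : {i} ∈ children x.shape u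
  · have hut := (mem_branchPoints.1 hu).1
    have hc : (children x.shape u).card ≠ 2 := fun h => huc ((ht.contracted_iff hut).2 ⟨hui, h⟩)
    obtain ⟨E, hE, h, hiE⟩ := hx.exists_searchLabel_eq hu hui hc
    by_cases hib : {i} ∈ bigChildren x.shape u
    · rw [hx.order_downSP_of_big hm hi hk hu hib, h, ht.big_downTree_of_big hm hi hu hib hE hiE]
      exact map_mem_orderings (ht.bigChildren_downVertex_injOn _ (Finset.erase_subset _ _)
        (Finset.notMem_erase _ _)) (erase_mem_orderings (hx.order_mem hu) _)
    · have his : {i} ∈ smallChildren x.shape u :=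
        mem_smallChildren.2 ⟨hui, fun h => hib (mem_bigChildren.2 ⟨hui, h⟩)⟩
      obtain ⟨E', L, hL⟩ := List.exists_cons_of_ne_nil (List.ne_nil_of_mem
        (((mem_orderings.1 (hx.order_mem hu)).2 E).2 hE))
      have hE' : E' ∈ bigChildren x.shape u :=
        ((mem_orderings.1 (hx.order_mem hu)).2 E').1 (by rw [hL]; exact List.mem_cons_self)
      rw [hx.order_downSP_of_small hm hi hk hu his ⟨E, hE⟩, hx.searchLabel_of_small hu his hL,
        ht.big_downTree_of_small hm hi hu his hE']
      have htail : (x.order u).tail = (x.order u).erase E' := by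
        rw [hL, List.tail_cons, List.erase_cons_head]
      rw [htail]
      exact map_mem_orderings (ht.bigChildren_downVertex_injOn _ (Finset.erase_subset _ _)
        fun h => hib (Finset.mem_of_mem_erase h)) (erase_mem_orderings (hx.order_mem hu) _)
  · rw [hx.order_downSP_of_notMem hm hi hk hu hui, hs.bigChildren_downTree hm ht hi hk hu hui]
    exact map_mem_orderings (ht.bigChildren_downVertex_injOn _ (Finset.Subset.refl _)
      fun h => hui (mem_bigChildren.1 h).1) (hx.order_mem hu)

theorem semiPlanarKernel_mem_stdSimplex {α γ : ℝ} (hγ : 0 ≤ γ) (hγα : γ ≤ α) (hα : α ≤ 1)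
    (hm : 1 ≤ m) (x : SemiPlanarTree (m + 1)) :
    semiPlanarKernel α γ (m + 1) x ∈ stdSimplex ℝ (SemiPlanarTree (m + 1)) := by
  constructor
  · intro y
    exact Finset.sum_nonneg fun i _ => mul_nonneg (by positivity)
      (growthRuleSP_nonneg hγ hγα hα hm _)
  · simp only [semiPlanarKernel, Nat.add_sub_cancel]
    rw [Finset.sum_comm]
    simp only [← Finset.mul_sum]
    rw [Finset.sum_congr rfl fun i hi => sum_growthRuleSP hα hm (x.2.downSP hm hi),
      Finset.sum_const, Nat.card_Icc, nsmul_eq_mul, mul_one, Nat.add_sub_cancel]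
    exact one_div_mul_cancel (by positivity)

end DownSemiPlanar

/-! ### The local search in an ordered Chinese restaurant -/

section LocalSearch

variable {m : ℕ} {α γ : ℝ} {t : Finset (Finset ℕ)} {i : ℕ} {v : Finset ℕ}

/-- The rank counts the subtree itself, the two subtrees of rank one and two, and the subtrees of
rank at least three with a smaller least label. -/
theorem IsTree.rank_eq_of_big (ht : IsTree (Finset.Icc 1 m) t) (hv : v ∈ branchPoints t)
    {E : Finset ℕ} (hE : E ∈ bigChildren t v) :
    rank t v E = ((bigChildren t v).filter fun D => minLabel D < minLabel E).card + 3 := by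
  have e : (children t v).filter (fun D => minLabel D ≤ minLabel E) =
      insert E (smallChildren t v ∪ (bigChildren t v).filter fun D => minLabel D < minLabel E) := by
    ext D
    rw [children_eq_small_union_big]
    simp only [Finset.mem_filter, Finset.mem_union, Finset.mem_insert]
    constructor
    · rintro ⟨hD | hD, hle⟩
      · exact .inr (.inl hD)
      · rcases hle.eq_or_lt with h | h
        · exact .inl (ht.bigChildren_minLabel_injOn v hD hE h)
        · exact .inr (.inr ⟨hD, h⟩)
    · rintro (rfl | hD | ⟨hD, hlt⟩)
      · exact ⟨.inr hE, le_rfl⟩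
      · exact ⟨.inl hD, (minLabel_lt_of_small_of_big hD hE).le⟩
      · exact ⟨.inr hD, hlt.le⟩
  have hdisj : Disjoint (smallChildren t v)
      ((bigChildren t v).filter fun D => minLabel D < minLabel E) :=
    Finset.disjoint_left.2 fun D hD hD' =>
      (mem_smallChildren.1 hD).2 (mem_bigChildren.1 (Finset.mem_filter.1 hD').1).2
  rw [rank, e, Finset.card_insert_of_notMem, Finset.card_union_of_disjoint hdisj,
    ht.card_smallChildren hv]
  · ring
  · intro h
    rcases Finset.mem_union.1 h with h | h
    · exact (mem_smallChildren.1 h).2 (mem_bigChildren.1 hE).2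
    · exact lt_irrefl _ (Finset.mem_filter.1 h).2

/-- The event that the local search from a leaf of rank at most two leads to the subtree `E`, and
that `Z` is the order of the other subtrees. -/
theorem IsTree.sum_orderings_of_small (hγα : γ ≤ α)
    (ht : IsTree (Finset.Icc 1 m) t) (hv : v ∈ branchPoints t) (hiv : {i} ∈ smallChildren t v)
    (hα : 0 < α ∨ (bigChildren t v).card ≤ 1) {E : Finset ℕ} (hE : E ∈ bigChildren t v)
    {Z : List (Finset ℕ)}
    (hZ : Z ∈ orderings (((bigChildren t v).erase E).image (downVertex i (minLabel E)))) :
    (∑ L ∈ orderings (bigChildren t v), open Classical in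
      if L.head? = some E ∧ L.tail.map (downVertex i (minLabel E)) = Z then
        ocrpProb α (α - γ) (L.map minLabel) else 0) =
    searchProb α γ (children t v).card (rank t v {i}) (rank t v E) *
      ocrpProb α (α - γ) (Z.map minLabel) := by
  classical
  obtain ⟨hic, hir⟩ := mem_smallChildren.1 hiv
  have hib : {i} ∉ bigChildren t v := fun h => hir (mem_bigChildren.1 h).2
  have hEc := (mem_bigChildren.1 hE).1
  have hiE := minLabel_lt_of_small_of_big hiv hE
  rw [minLabel_singleton] at hiE
  have hinj := ht.bigChildren_downVertex_injOn (i := i) (minLabel E)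
    (Finset.erase_subset E (bigChildren t v)) fun h => hib (Finset.mem_of_mem_erase h)
  obtain ⟨L₀, hL₀, hL₀Z, huniq⟩ := exists_orderings_map_eq hinj hZ
  obtain ⟨hnd, hmem⟩ := mem_orderings.1 hL₀
  have hEL₀ : E ∉ L₀ := fun h => Finset.notMem_erase E _ ((hmem E).1 h)
  have hcons : E :: L₀ ∈ orderings (bigChildren t v) := by
    refine mem_orderings.2 ⟨List.nodup_cons.2 ⟨hEL₀, hnd⟩, fun D => ?_⟩
    rw [List.mem_cons, hmem, Finset.mem_erase]
    constructor
    · rintro (rfl | h)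
      · exact hE
      · exact h.2
    · intro h
      by_cases hD : D = E
      · exact .inl hD
      · exact .inr ⟨hD, h⟩
  -- The event determines the order: `E`, followed by the order `L₀` that is mapped to `Z`.
  rw [Finset.sum_eq_single_of_mem _ hcons, if_pos ⟨rfl, hL₀Z⟩]
  swap
  · intro L hL hne
    refine if_neg ?_
    rintro ⟨h1, h2⟩
    obtain ⟨L', rfl⟩ : ∃ L', L = E :: L' := by
      cases L with
      | nil => simp at h1
      | cons a L' => exact ⟨L', by simp at h1; rw [h1]⟩
    refine hne (congrArg _ (huniq L' ?_ h2))
    have := erase_mem_orderings hL E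
    rwa [List.erase_cons_head] at this
  have hmininj : ∀ a ∈ E :: L₀, ∀ b ∈ E :: L₀, minLabel a = minLabel b → a = b := fun a ha b hb =>
    ht.bigChildren_minLabel_injOn v (((mem_orderings.1 hcons).2 a).1 ha)
      (((mem_orderings.1 hcons).2 b).1 hb)
  have hZmin : ocrpProb α (α - γ) (Z.map minLabel) = ocrpProb α (α - γ) (L₀.map minLabel) := by
    rw [← hL₀Z, List.map_map]
    have hsib : ∀ D ∈ L₀, _ := fun D hD => ht.minLabel_downVertex_sibling hic hEc hiE.le
      (mem_bigChildren.1 (Finset.mem_of_mem_erase ((hmem D).1 hD))).1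
      (fun e => hib (e ▸ Finset.mem_of_mem_erase ((hmem D).1 hD))) fun e => hEL₀ (e ▸ hD)
    refine ocrpProb_map_congr (hnd.map_on fun a ha b hb => hmininj a (List.mem_cons_of_mem _ ha) b
      (List.mem_cons_of_mem _ hb)) fun a ha b hb hab => ?_
    rw [Function.comp_apply, Function.comp_apply, (hsib a ha).1, (hsib b hb).1]
    exact relabel_lt_relabel (hsib a ha).2 (hsib b hb).2 hab
  rw [hZmin, List.map_cons]
  have hlen := length_of_mem_orderings hL₀
  have hbig : (bigChildren t v).card = L₀.length + 1 := by
    rw [hlen, Finset.card_erase_of_mem hE]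
    have := Finset.card_pos.2 ⟨E, hE⟩
    omega
  have hcard := ht.card_bigChildren hv
  have hrank := ht.rank_eq_of_big hv hE
  -- If `E` is the only subtree of rank at least three, then the branch point has three children.
  by_cases hL0 : L₀ = []
  · subst hL0
    have hr : rank t v E = 3 := by
      rw [hrank, Finset.card_eq_zero.2]
      refine Finset.filter_false_of_mem fun D hD hlt => ?_
      have := ((mem_orderings.1 hcons).2 D).2 hD
      rw [List.mem_singleton] at this
      exact hlt.ne (this ▸ rfl)
    rw [searchProb, if_pos (by rw [hcard, hbig]; rfl), if_pos hr]
    simp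
  · have hpos : L₀.length ≠ 0 := by simpa using hL0
    have hα' : 0 < α := hα.resolve_right (by omega)
    -- Otherwise `E` is inserted leftmost, with weight `α`, unless it is the oldest of the ordered
    -- subtrees, in which case the weight is `α - γ`.
    have hins := ocrpProb_insert hα' (sub_nonneg.2 hγα) (l₁ := []) (s := minLabel E)
      (l₂ := L₀.map minLabel) (by
        rw [List.nil_append, ← List.map_cons]
        exact (mem_orderings.1 hcons).1.map_on hmininj) (by simpa using hL0) (.inl rfl)
    simp only [List.nil_append, List.length_map] at hins
    have hden : (((children t v).card : ℝ) - 2) * α - γ = L₀.length * α + (α - γ) := by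
      rw [hcard, hbig]; push_cast; ring
    have hden0 : (L₀.length : ℝ) * α + (α - γ) ≠ 0 := by
      have h1 : (0 : ℝ) < L₀.length := by exact_mod_cast Nat.pos_of_ne_zero hpos
      have h2 := sub_nonneg.2 hγα
      positivity
    have hexists : (∃ q ∈ L₀.map minLabel, q < minLabel E) ↔ 3 < rank t v E := by
      rw [hrank]
      constructor
      · rintro ⟨q, hq, hlt⟩
        obtain ⟨D, hD, rfl⟩ := List.mem_map.1 hq
        have : 0 < ((bigChildren t v).filter fun D => minLabel D < minLabel E).card :=
          Finset.card_pos.2 ⟨D, Finset.mem_filter.2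
            ⟨Finset.mem_of_mem_erase ((hmem D).1 hD), hlt⟩⟩
        omega
      · intro h
        obtain ⟨D, hD⟩ := Finset.card_pos.1 (show 0 < ((bigChildren t v).filter
          fun D => minLabel D < minLabel E).card by omega)
        obtain ⟨hD, hlt⟩ := Finset.mem_filter.1 hD
        exact ⟨_, List.mem_map_of_mem ((hmem D).2 (Finset.mem_erase.2
          ⟨fun e => hlt.ne (e ▸ rfl), hD⟩)), hlt⟩
    have hsearch : searchProb α γ (children t v).card (rank t v {i}) (rank t v E) =
        (if ∃ q ∈ L₀.map minLabel, q < minLabel E then α else α - γ) /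
          (L₀.length * α + (α - γ)) := by
      have h3 := (mem_bigChildren.1 hE).2
      rw [searchProb, hden, if_neg (by omega)]
      by_cases h : 3 < rank t v E
      · rw [if_pos (hexists.2 h), if_neg (by omega), if_pos ⟨by omega, h⟩]
      · rw [if_neg (mt hexists.1 h), if_pos ⟨by omega, by omega⟩]
    rw [hsearch, div_mul_eq_mul_div, eq_div_iff hden0, hins]

end LocalSearch

section LocalSearchBig

variable {m : ℕ} {α γ : ℝ} {t : Finset (Finset ℕ)} {i : ℕ} {v : Finset ℕ}

/-- The local search from a leaf of rank at least three leads to a subtree `E` with a larger least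
label if and only if `E` is the left neighbour of the leaf. -/
theorem IsTree.sum_orderings_of_big_of_ne (hγα : γ ≤ α)
    (ht : IsTree (Finset.Icc 1 m) t) (hv : v ∈ branchPoints t) (hiv : {i} ∈ bigChildren t v)
    (hα : 0 < α ∨ (bigChildren t v).card ≤ 1) {E : Finset ℕ} (hE : E ∈ bigChildren t v)
    (hEi : E ≠ {i}) (hiE : i < minLabel E) {Z : List (Finset ℕ)}
    (hZ : Z ∈ orderings (((bigChildren t v).erase {i}).image (downVertex i (minLabel E)))) :
    (∑ L ∈ orderings (bigChildren t v), open Classical in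
      if max i (minLabel ((L.take (L.idxOf {i})).getLastD {i})) = minLabel E ∧
          (L.erase {i}).map (downVertex i (minLabel E)) = Z then
        ocrpProb α (α - γ) (L.map minLabel) else 0) =
    searchProb α γ (children t v).card (rank t v {i}) (rank t v E) *
      ocrpProb α (α - γ) (Z.map minLabel) := by
  classical
  obtain ⟨hic, hir⟩ := mem_bigChildren.1 hiv
  obtain ⟨hvt, -⟩ := mem_branchPoints.1 hv
  have hEc := (mem_bigChildren.1 hE).1
  have hinj := ht.bigChildren_downVertex_injOn (i := i) (minLabel E)
    (Finset.erase_subset {i} (bigChildren t v)) (Finset.notMem_erase _ _)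
  have hmin := ht.bigChildren_minLabel_injOn v
  obtain ⟨L₀, hL₀, hL₀Z, huniq⟩ := exists_orderings_map_eq hinj hZ
  obtain ⟨hnd, hmem⟩ := mem_orderings.1 hL₀
  have hiL₀ : {i} ∉ L₀ := fun h => Finset.notMem_erase _ _ ((hmem _).1 h)
  obtain ⟨A, B, rfl⟩ := List.append_of_mem ((hmem E).2 (Finset.mem_erase.2 ⟨hEi, hE⟩))
  have hbigmem : ∀ D ∈ A ++ E :: B, D ∈ bigChildren t v := fun D hD =>
    Finset.mem_of_mem_erase ((hmem D).1 hD)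
  -- The event determines the order: `{i}` is inserted immediately to the right of `E`.
  have hins : (A ++ E :: B).insertIdx (A.length + 1) {i} = A ++ E :: {i} :: B := by
    rw [insertIdx_eq_take_append_cons_drop (by simp), show A ++ E :: B = (A ++ [E]) ++ B by simp,
      List.take_left' (by simp), List.drop_left' (by simp)]
    simp
  have hcard' : A.length + 1 ≤ ((bigChildren t v).erase {i}).card := by
    rw [← length_of_mem_orderings hL₀]; simp
  have hL₁ : A ++ E :: {i} :: B ∈ orderings (bigChildren t v) := by
    rw [← hins, ← Finset.insert_erase hiv]
    exact insertIdx_mem_orderings (Finset.notMem_erase _ _) hL₀ hcard'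
  have hidx : (A ++ E :: {i} :: B).idxOf {i} = A.length + 1 := by
    rw [← hins]
    exact idxOf_insertIdx_self hiL₀ (by simp)
  have herase : (A ++ E :: {i} :: B).erase {i} = A ++ E :: B := by
    rw [← hins]
    exact erase_insertIdx_self hiL₀ (by simp)
  rw [Finset.sum_eq_single_of_mem _ hL₁, if_pos]
  rotate_left
  · refine ⟨?_, by rw [herase, hL₀Z]⟩
    rw [hidx]
    have : (A ++ E :: {i} :: B).take (A.length + 1) = A ++ [E] := by
      rw [show A ++ E :: {i} :: B = (A ++ [E]) ++ {i} :: B by simp, List.take_left' (by simp)]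
    rw [this, List.getLastD_concat, max_eq_right hiE.le]
  · intro L hL hne
    refine if_neg ?_
    rintro ⟨h1, h2⟩
    refine hne ?_
    have h3 := huniq _ (erase_mem_orderings hL {i}) h2
    obtain ⟨hLnd, hLmem⟩ := mem_orderings.1 hL
    obtain ⟨L₁, L₂, rfl⟩ := List.append_of_mem ((hLmem _).2 hiv)
    have hiL₁ : {i} ∉ L₁ := by
      rw [List.nodup_middle, List.nodup_cons] at hLnd
      exact fun h' => hLnd.1 (List.mem_append_left _ h')
    rw [List.erase_append_right _ hiL₁, List.erase_cons_head] at h3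
    have hidx' : (L₁ ++ {i} :: L₂).idxOf {i} = L₁.length := by
      rw [List.idxOf_append, if_neg hiL₁]; simp
    rw [hidx', List.take_left] at h1
    rcases List.eq_nil_or_concat L₁ with rfl | ⟨L₁, F, rfl⟩
    · simp at h1; omega
    · rw [List.concat_eq_append] at h1 h3 ⊢
      rw [List.getLastD_concat] at h1
      have hF : F = E := by
        refine hmin ((hLmem F).1 (by simp)) hE ?_
        omega
      subst hF
      rw [List.append_assoc, List.singleton_append] at h3
      have hFL₁ : F ∉ L₁ := by
        have : (L₁ ++ F :: L₂).Nodup := by rw [h3]; exact hnd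
        rw [List.nodup_middle, List.nodup_cons] at this
        exact fun h' => this.1 (List.mem_append_left _ h')
      have hFA : F ∉ A := by
        rw [List.nodup_middle, List.nodup_cons] at hnd
        exact fun h' => hnd.1 (List.mem_append_left _ h')
      have hlen : L₁.length = A.length := by
        have h4 := congrArg (List.idxOf F) h3
        rw [List.idxOf_append, List.idxOf_append, if_neg hFL₁, if_neg hFA] at h4
        simpa using h4
      obtain ⟨h5, h6⟩ := List.append_inj h3 hlen
      rw [List.cons.injEq] at h6
      rw [h5, h6.2]
      simp
  -- in the new tree, the label of `E` is `i`
  have hZmin : ocrpProb α (α - γ) (Z.map minLabel) =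
      ocrpProb α (α - γ) (A.map minLabel ++ i :: B.map minLabel) := by
    have hne : ∀ D ∈ A ++ B, D ≠ E := by
      rw [List.nodup_middle, List.nodup_cons] at hnd
      exact fun D hD e => hnd.1 (e ▸ hD)
    have e1 : A.map minLabel ++ i :: B.map minLabel =
        (A ++ E :: B).map fun D => if D = E then i else minLabel D := by
      rw [List.map_append, List.map_cons, if_pos rfl]
      congr 1
      · exact List.map_congr_left fun D hD => (if_neg (hne D (List.mem_append_left _ hD))).symm
      · congr 1
        exact List.map_congr_left fun D hD => (if_neg (hne D (List.mem_append_right _ hD))).symm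
    have hsib : ∀ D ∈ A ++ E :: B, D ≠ E → minLabel D ≠ i ∧
        minLabel (downVertex i (minLabel E) D) = relabel (minLabel E) (minLabel D) ∧
        minLabel D ≠ minLabel E := by
      intro D hD hDE
      have hDi : D ≠ {i} := fun e => hiL₀ (e ▸ hD)
      refine ⟨fun h => hDi (hmin (hbigmem D hD) hiv (h.trans (minLabel_singleton i).symm)), ?_⟩
      exact ht.minLabel_downVertex_sibling hic hEc hiE.le (mem_bigChildren.1 (hbigmem D hD)).1
        hDi hDE
    have hEmin := (ht.minLabel_downVertex_searched hvt hic hE hiE.le hEi).1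
    rw [← hL₀Z, List.map_map, e1]
    refine ocrpProb_map_congr (hnd.map_on fun a ha b hb hab => ?_) fun a ha b hb hab => ?_
    · by_cases haE : a = E <;> by_cases hbE : b = E
      · rw [haE, hbE]
      · rw [if_pos haE, if_neg hbE] at hab
        exact absurd hab.symm (hsib b hb hbE).1
      · rw [if_neg haE, if_pos hbE] at hab
        exact absurd hab (hsib a ha haE).1
      · rw [if_neg haE, if_neg hbE] at hab
        exact hmin (hbigmem a ha) (hbigmem b hb) hab
    · rw [Function.comp_apply, Function.comp_apply]
      by_cases haE : a = E <;> by_cases hbE : b = E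
      · rw [if_pos haE, if_pos hbE] at hab
        exact absurd hab (lt_irrefl _)
      · rw [if_pos haE, if_neg hbE] at hab
        rw [haE, hEmin, (hsib b hb hbE).2.1]
        exact lt_relabel hiE hab
      · rw [if_neg haE, if_pos hbE] at hab
        rw [hbE, hEmin, (hsib a ha haE).2.1, relabel_of_lt (hab.trans hiE)]
        exact hab
      · rw [if_neg haE, if_neg hbE] at hab
        rw [(hsib a ha haE).2.1, (hsib b hb hbE).2.1]
        exact relabel_lt_relabel (hsib a ha haE).2.2 (hsib b hb hbE).2.2 hab
  have hbig : (bigChildren t v).card = A.length + B.length + 2 := by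
    rw [← length_of_mem_orderings hL₁]
    simp only [List.length_append, List.length_cons]
    omega
  have hα' : 0 < α := hα.resolve_right (by omega)
  -- With the labels before the swap, `E` is inserted immediately to the left of the older leaf `i`;
  -- this gives the weight `α`.
  have hkey := ocrpProb_insert hα' (sub_nonneg.2 hγα) (l₁ := A.map minLabel) (s := minLabel E)
    (l₂ := i :: B.map minLabel) (by
      have := (mem_orderings.1 hL₁).1.map_on (f := minLabel) fun a ha b hb hab =>
        hmin (((mem_orderings.1 hL₁).2 a).1 ha) (((mem_orderings.1 hL₁).2 b).1 hb) hab
      simpa using this) (by simp) (.inr (.inr ⟨i, _, rfl, hiE⟩))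
  rw [if_pos ⟨i, List.mem_cons_self, hiE⟩] at hkey
  have hcard := ht.card_bigChildren hv
  have hlt : rank t v {i} < rank t v E :=
    (IsTree.rank_lt_rank_iff hEc).2 (by rwa [minLabel_singleton])
  have hsearch : searchProb α γ (children t v).card (rank t v {i}) (rank t v E) =
      α / (((A.length : ℝ) + B.length + 1) * α + (α - γ)) := by
    rw [searchProb, if_neg (by omega), if_neg (by omega), if_neg (by omega),
      if_pos ⟨by omega, hlt⟩, hcard, hbig]
    congr 1
    push_cast
    ring
  have hden0 : ((A.length : ℝ) + B.length + 1) * α + (α - γ) ≠ 0 := by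
    have h2 := sub_nonneg.2 hγα
    positivity
  rw [hsearch, hZmin, div_mul_eq_mul_div, eq_div_iff hden0, ← hkey]
  simp only [List.map_append, List.map_cons, minLabel_singleton, List.length_append,
    List.length_map, List.length_cons]
  push_cast
  ring

/-- The local search from a leaf of rank at least three leads to the leaf itself if and only if the
leaf is leftmost or its left neighbour has a smaller least label. -/
theorem IsTree.sum_orderings_of_big_self (hγα : γ ≤ α)
    (ht : IsTree (Finset.Icc 1 m) t) (hv : v ∈ branchPoints t) (hiv : {i} ∈ bigChildren t v)
    (hi : 0 < i) (hα : 0 < α ∨ (bigChildren t v).card ≤ 1) {Z : List (Finset ℕ)}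
    (hZ : Z ∈ orderings (((bigChildren t v).erase {i}).image (downVertex i i))) :
    (∑ L ∈ orderings (bigChildren t v), open Classical in
      if max i (minLabel ((L.take (L.idxOf {i})).getLastD {i})) = i ∧
          (L.erase {i}).map (downVertex i i) = Z then
        ocrpProb α (α - γ) (L.map minLabel) else 0) =
    searchProb α γ (children t v).card (rank t v {i}) (rank t v {i}) *
      ocrpProb α (α - γ) (Z.map minLabel) := by
  classical
  obtain ⟨hic, hir⟩ := mem_bigChildren.1 hiv
  have hinj := ht.bigChildren_downVertex_injOn (i := i) i
    (Finset.erase_subset {i} (bigChildren t v)) (Finset.notMem_erase _ _)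
  have hmin := ht.bigChildren_minLabel_injOn v
  obtain ⟨L₀, hL₀, hL₀Z, huniq⟩ := exists_orderings_map_eq hinj hZ
  obtain ⟨hnd, hmem⟩ := mem_orderings.1 hL₀
  have hiL₀ : {i} ∉ L₀ := fun h => Finset.notMem_erase _ _ ((hmem _).1 h)
  have hbigmem : ∀ D ∈ L₀, D ∈ bigChildren t v := fun D hD =>
    Finset.mem_of_mem_erase ((hmem D).1 hD)
  have hmini : ∀ D ∈ L₀, minLabel D ≠ i := fun D hD h =>
    hiL₀ (hmin (hbigmem D hD) hiv (h.trans (minLabel_singleton i).symm) ▸ hD)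
  have hcard := ht.card_bigChildren hv
  have hlen := length_of_mem_orderings hL₀
  have hbig : (bigChildren t v).card = L₀.length + 1 := by
    rw [hlen, Finset.card_erase_of_mem hiv]
    have := Finset.card_pos.2 ⟨_, hiv⟩
    omega
  have hndmin : (L₀.map minLabel).Nodup := hnd.map_on fun a ha b hb hab =>
    hmin (hbigmem a ha) (hbigmem b hb) hab
  have hsum : (∑ L ∈ orderings (bigChildren t v),
      if max i (minLabel ((L.take (L.idxOf {i})).getLastD {i})) = i ∧
          (L.erase {i}).map (downVertex i i) = Z then
        ocrpProb α (α - γ) (L.map minLabel) else 0) =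
      ∑ p ∈ Finset.range ((L₀.map minLabel).length + 1),
        if ((L₀.map minLabel).take p).getLastD 0 < i then
          ocrpProb α (α - γ) ((L₀.map minLabel).insertIdx p i) else 0 := by
    rw [← Finset.insert_erase hiv, sum_orderings_insert (Finset.notMem_erase _ _),
      Finset.sum_eq_single_of_mem _ hL₀]
    · rw [List.length_map, hlen]
      refine Finset.sum_congr rfl fun p hp => ?_
      have hp' : p ≤ L₀.length := by rw [hlen]; exact Nat.lt_succ_iff.1 (Finset.mem_range.1 hp)
      have htake : (L₀.insertIdx p {i}).take p = L₀.take p := by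
        rw [insertIdx_eq_take_append_cons_drop hp', List.take_left' (by simpa using hp')]
      rw [idxOf_insertIdx_self hiL₀ hp', erase_insertIdx_self hiL₀ hp', htake, List.map_insertIdx,
        minLabel_singleton]
      refine if_congr ?_ rfl rfl
      rw [and_iff_left hL₀Z, ← List.map_take]
      rcases List.eq_nil_or_concat (L₀.take p) with h | ⟨L, F, h⟩
      · simp [h, hi]
      · have hF : F ∈ L₀ := List.mem_of_mem_take (i := p) (by rw [h]; simp)
        have := hmini F hF
        rw [h, List.concat_eq_append, List.getLastD_concat, List.map_append, List.map_singleton,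
          List.getLastD_concat]
        omega
    · intro L hL hne
      refine Finset.sum_eq_zero fun p hp => if_neg ?_
      rintro ⟨-, h⟩
      rw [erase_insertIdx_self] at h
      · exact hne (huniq L hL h)
      · exact fun h' => Finset.notMem_erase _ _ (((mem_orderings.1 hL).2 _).1 h')
      · rw [length_of_mem_orderings hL]
        exact Nat.lt_succ_iff.1 (Finset.mem_range.1 hp)
  have hZmin : ocrpProb α (α - γ) (Z.map minLabel) = ocrpProb α (α - γ) (L₀.map minLabel) := by
    have hsib : ∀ D ∈ L₀, minLabel (downVertex i i D) = relabel i (minLabel D) ∧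
        minLabel D ≠ i := by
      intro D hD
      have hDi : D ≠ {i} := fun e => hiL₀ (e ▸ hD)
      have := ht.minLabel_downVertex_sibling hic hic (minLabel_singleton i).ge
        (mem_bigChildren.1 (hbigmem D hD)).1 hDi hDi
      rwa [minLabel_singleton] at this
    rw [← hL₀Z, List.map_map]
    refine ocrpProb_map_congr hndmin fun a ha b hb hab => ?_
    rw [Function.comp_apply, Function.comp_apply, (hsib a ha).1, (hsib b hb).1]
    exact relabel_lt_relabel (hsib a ha).2 (hsib b hb).2 hab
  refine hsum.trans ?_
  rw [hZmin]
  have hrank : rank t v {i} = ((L₀.map minLabel).filter fun q => q < i).length + 3 := by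
    rw [ht.rank_eq_of_big hv hiv, minLabel_singleton, List.filter_map, List.length_map,
      ← List.toFinset_card_of_nodup (hnd.filter _)]
    congr 2
    ext D
    simp only [Finset.mem_filter, List.mem_toFinset, List.mem_filter, hmem, Finset.mem_erase,
      Function.comp_apply, decide_eq_true_eq]
    constructor
    · rintro ⟨h1, h2⟩
      exact ⟨⟨fun e => by rw [e, minLabel_singleton] at h2; exact lt_irrefl _ h2, h1⟩, h2⟩
    · rintro ⟨⟨-, h1⟩, h2⟩
      exact ⟨h1, h2⟩
  by_cases hL0 : L₀ = []
  · subst hL0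
    rw [searchProb, if_pos (by rw [hcard, hbig]; rfl), if_pos (by rw [hrank]; rfl)]
    simp [hi]
  · have hpos : L₀.length ≠ 0 := by simpa using hL0
    have hα' : 0 < α := hα.resolve_right (by omega)
    have hkey := sum_ocrpProb_insertIdx hα' (sub_nonneg.2 hγα) hi (l := L₀.map minLabel)
      (by simpa using hL0) hndmin (fun h => by
        obtain ⟨D, hD, h⟩ := List.mem_map.1 h
        exact hmini D hD h)
    have hden0 : ((L₀.map minLabel).length : ℝ) * α + (α - γ) ≠ 0 := by
      have h1 : (0 : ℝ) < (L₀.map minLabel).length := by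
        rw [List.length_map]; exact_mod_cast Nat.pos_of_ne_zero hpos
      have h2 := sub_nonneg.2 hγα
      positivity
    have hsearch : searchProb α γ (children t v).card (rank t v {i}) (rank t v {i}) =
        ((((L₀.map minLabel).filter fun q => q < i).length : ℝ) * α + (α - γ)) /
          ((L₀.map minLabel).length * α + (α - γ)) := by
      rw [searchProb, if_neg (by omega), if_neg (by omega), if_neg (by omega),
        if_neg (by omega), if_pos ⟨by omega, rfl⟩, hcard, hbig, hrank, List.length_map]
      congr 1 <;> push_cast <;> ring
    rw [hsearch, div_mul_eq_mul_div, eq_div_iff hden0, hkey]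

end LocalSearchBig

/-! ### The down-step and the kernel of ordered Chinese restaurants -/

section DownLift

variable {m n : ℕ} {α γ : ℝ} {i : ℕ} {v : Finset ℕ}

/-- The probability of an event that is described by separate conditions on the orders of subtrees
at the different branch points. -/
theorem sum_liftKernel_mul_ite (t : Tree n) (hv : v ∈ branchPoints t.1)
    {P : SemiPlanarTree n → Prop} {Q : List (Finset ℕ) → Prop} [DecidablePred P] [DecidablePred Q]
    {F : Finset ℕ → Finset ℕ} {W : Finset ℕ → List (Finset ℕ)}
    (hP : ∀ x, proj x = t → (P x ↔ Q (x.1.order v) ∧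
      ∀ u ∈ (branchPoints t.1).erase v, (x.1.order u).map F = W u)) :
    ∑ x : SemiPlanarTree n, liftKernel α γ n t x * (if P x then 1 else 0) =
      (∑ L ∈ orderings (bigChildren t.1 v),
        if Q L then ocrpProb α (α - γ) (L.map minLabel) else 0) *
      ∏ u ∈ (branchPoints t.1).erase v, ∑ L ∈ orderings (bigChildren t.1 u),
        if L.map F = W u then ocrpProb α (α - γ) (L.map minLabel) else 0 := by
  set G : Finset ℕ → List (Finset ℕ) → ℝ := fun u L =>
    if (if u = v then Q L else L.map F = W u) then ocrpProb α (α - γ) (L.map minLabel) else 0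
    with hG
  have hterm : ∀ x : SemiPlanarTree n, liftKernel α γ n t x * (if P x then 1 else 0) =
      if proj x = t then ∏ u ∈ branchPoints t.1, G u (x.1.order u) else 0 := by
    intro x
    rw [liftKernel_eq]
    by_cases h : proj x = t
    swap
    · rw [if_neg h, if_neg h, zero_mul]
    rw [if_pos h, if_pos h]
    simp only [hG]
    rw [Finset.prod_ite_zero]
    have hiff : P x ↔ ∀ u ∈ branchPoints t.1,
        if u = v then Q (x.1.order u) else (x.1.order u).map F = W u := by
      rw [hP x h]
      constructor
      · rintro ⟨h1, h2⟩ u hu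
        split_ifs with huv
        · rwa [huv]
        · exact h2 u (Finset.mem_erase.2 ⟨huv, hu⟩)
      · intro h1
        refine ⟨by simpa using h1 v hv, fun u hu => ?_⟩
        obtain ⟨huv, hu⟩ := Finset.mem_erase.1 hu
        simpa [huv] using h1 u hu
    by_cases hPx : P x
    · rw [if_pos hPx, if_pos (hiff.1 hPx), mul_one, ← h]
      rfl
    · rw [if_neg hPx, if_neg (mt hiff.2 hPx), mul_zero]
  rw [Finset.sum_congr rfl fun x _ => hterm x, sum_prod_order t G, ← Finset.mul_prod_erase _ _ hv]
  congr 1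
  · simp only [hG, if_true]
  · refine Finset.prod_congr rfl fun u hu => ?_
    simp only [hG, if_neg (Finset.ne_of_mem_erase hu)]

/-- Away from the parent of leaf `i`, the down-step transports the law of the order of the
subtrees. -/
theorem sum_orderings_map_downVertex {t : Finset (Finset ℕ)} {k : ℕ} (hs : Searched t i k)
    (hm : 1 ≤ m) (ht : IsTree (Finset.Icc 1 (m + 1)) t) (hi : i ∈ Finset.Icc 1 (m + 1))
    (hk : k ∈ Finset.Icc 1 (m + 1)) {u : Finset ℕ} (hu : u ∈ branchPoints t)
    (hui : {i} ∉ children t u) {θ : ℝ} {Z : List (Finset ℕ)}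
    (hZ : Z ∈ orderings (bigChildren (downTree t i k) (downVertex i k u))) :
    ∑ L ∈ orderings (bigChildren t u), (if L.map (downVertex i k) = Z then
      ocrpProb α θ (L.map minLabel) else 0) = ocrpProb α θ (Z.map minLabel) := by
  have hut := (mem_branchPoints.1 hu).1
  rw [hs.bigChildren_downTree hm ht hi hk hu hui] at hZ
  refine sum_orderings_map (ht.bigChildren_downVertex_injOn k (Finset.Subset.refl _)
    fun h => hui (mem_bigChildren.1 h).1) (ht.bigChildren_minLabel_injOn u)
    (fun D hD E hE hlt => ?_) hZ
  exact hs.minLabel_downVertex_lt_of_big ht hut hui (mem_bigChildren.1 hD).1 hE hlt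

theorem IsTree.notMem_children_of_ne {A : Finset ℕ} {t : Finset (Finset ℕ)} (ht : IsTree A t)
    (hv : v ∈ branchPoints t) (hiv : {i} ∈ children t v) {u : Finset ℕ}
    (hu : u ∈ (branchPoints t).erase v) : {i} ∉ children t u := by
  obtain ⟨huv, hu⟩ := Finset.mem_erase.1 hu
  exact fun h => huv ((ht.parent_eq (mem_branchPoints.1 hu).1 h).symm.trans
    (ht.parent_eq (mem_branchPoints.1 hv).1 hiv))

theorem IsTree.filter_not_contracted {A : Finset ℕ} {t : Finset (Finset ℕ)} (ht : IsTree A t)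
    (hv : v ∈ branchPoints t) (hiv : {i} ∈ children t v) :
    (branchPoints t).filter (fun u => ¬ Contracted t i u) =
      if (children t v).card = 2 then (branchPoints t).erase v else branchPoints t := by
  have h : ∀ u ∈ branchPoints t, Contracted t i u ↔ u = v ∧ (children t v).card = 2 := by
    intro u hu
    rw [ht.contracted_iff (mem_branchPoints.1 hu).1]
    constructor
    · rintro ⟨h1, h2⟩
      have huv : u = v := by_contra fun huv =>
        ht.notMem_children_of_ne hv hiv (Finset.mem_erase.2 ⟨huv, hu⟩) h1
      exact ⟨huv, huv ▸ h2⟩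
    · rintro ⟨rfl, h2⟩
      exact ⟨hiv, h2⟩
  ext u
  split_ifs with hc
  · rw [Finset.mem_filter, Finset.mem_erase, and_comm]
    refine and_congr_left fun hu => ?_
    rw [h u hu, and_iff_left hc]
  · rw [Finset.mem_filter]
    refine and_iff_left_of_imp fun hu => ?_
    rw [h u hu]
    exact fun h' => hc h'.2

/-- The outcome `z` of the semi-planar down-step imposes separate conditions on the orders at the
different branch points. -/
theorem IsSemiPlanar.downSP_eq_iff {x z : OrderedTree} (hm : 1 ≤ m)
    (hx : IsSemiPlanar (Finset.Icc 1 (m + 1)) x) (hi : i ∈ Finset.Icc 1 (m + 1))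
    (hv : v ∈ branchPoints x.shape) (hiv : {i} ∈ children x.shape v)
    (hz : IsSemiPlanar (Finset.Icc 1 m) z) {k : ℕ} (hk : searchLabel x i = k)
    (hs : AlphaGamma.downTree x.shape i k = z.shape) :
    AlphaGamma.downSP x i = z ↔
      ((children x.shape v).card ≠ 2 →
        (AlphaGamma.downSP x i).order (downVertex i k v) = z.order (downVertex i k v)) ∧
      ∀ u ∈ (branchPoints x.shape).erase v,
        (x.order u).map (downVertex i k) = z.order (downVertex i k u) := by
  subst hk
  have ht := hx.isTree
  have hk := (hx.searched hi hv hiv).2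
  have hord : ∀ u ∈ (branchPoints x.shape).erase v, _ := fun u hu =>
    hx.order_downSP_of_notMem hm hi hk (Finset.mem_of_mem_erase hu)
      (ht.notMem_children_of_ne hv hiv hu)
  rw [(hx.downSP hm hi).ext_iff hz, downSP_shape, ht.branchPoints_downTree hm hi hk,
    ht.filter_not_contracted hv hiv, and_iff_right hs]
  constructor
  · intro h
    refine ⟨fun hc => h _ (Finset.mem_image_of_mem _ (by rwa [if_neg hc])), fun u hu => ?_⟩
    rw [← hord u hu]
    refine h _ (Finset.mem_image_of_mem _ ?_)
    split_ifs
    · exact hu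
    · exact Finset.mem_of_mem_erase hu
  · rintro ⟨h1, h2⟩ w hw
    obtain ⟨u, hu, rfl⟩ := Finset.mem_image.1 hw
    by_cases huv : u = v
    · subst huv
      split_ifs at hu with hc
      · exact absurd rfl (Finset.ne_of_mem_erase hu)
      · exact h1 hc
    · have hu' : u ∈ (branchPoints x.shape).erase v := by
        split_ifs at hu with hc
        · exact hu
        · exact Finset.mem_erase.2 ⟨huv, hu⟩
      rw [hord u hu', h2 u hu']

theorem orderProb_of_downTree_eq {t : Finset (Finset ℕ)} (hm : 1 ≤ m)
    (ht : IsTree (Finset.Icc 1 (m + 1)) t) (hi : i ∈ Finset.Icc 1 (m + 1))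
    (hv : v ∈ branchPoints t) (hiv : {i} ∈ children t v) {k : ℕ}
    (hk : k ∈ Finset.Icc 1 (m + 1)) {z : OrderedTree} (hs : downTree t i k = z.shape) :
    orderProb α γ z = (if (children t v).card = 2 then 1 else
        ocrpProb α (α - γ) ((z.order (downVertex i k v)).map minLabel)) *
      ∏ u ∈ (branchPoints t).erase v,
        ocrpProb α (α - γ) ((z.order (downVertex i k u)).map minLabel) := by
  rw [orderProb, ← hs, ht.branchPoints_downTree hm hi hk, Finset.prod_image]
  · rw [ht.filter_not_contracted hv hiv]
    split_ifs
    · rw [one_mul]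
    · rw [Finset.mul_prod_erase _ (fun u =>
        ocrpProb α (α - γ) ((z.order (downVertex i k u)).map minLabel)) hv]
  · refine ht.downVertex_injOn.mono fun u hu => ?_
    obtain ⟨hu, hc⟩ := Finset.mem_filter.1 hu
    obtain ⟨hut, hcard⟩ := mem_branchPoints.1 hu
    exact ⟨hut, fun e => by rw [e] at hcard; simp at hcard, hc⟩

/-- The contribution of one outcome `k` of the local search to `sum_liftKernel_downSP`. -/
theorem sum_liftKernel_of_searched (t : Tree (m + 1)) (hm : 1 ≤ m)
    (hi : i ∈ Finset.Icc 1 (m + 1)) (hv : v ∈ branchPoints t.1) (hiv : {i} ∈ children t.1 v)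
    {k : ℕ} (hk : k ∈ Finset.Icc 1 (m + 1)) (hs : Searched t.1 i k) (z : SemiPlanarTree m)
    (hz : downTree t.1 i k = z.1.shape) {P : SemiPlanarTree (m + 1) → Prop}
    {Q : List (Finset ℕ) → Prop} [DecidablePred P] [DecidablePred Q] {c : ℝ}
    (hP : ∀ x, proj x = t → (P x ↔ Q (x.1.order v) ∧
      ∀ u ∈ (branchPoints t.1).erase v,
        (x.1.order u).map (downVertex i k) = z.1.order (downVertex i k u)))
    (hQ : (∑ L ∈ orderings (bigChildren t.1 v),
      if Q L then ocrpProb α (α - γ) (L.map minLabel) else 0) =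
      c * if (children t.1 v).card = 2 then 1 else
        ocrpProb α (α - γ) ((z.1.order (downVertex i k v)).map minLabel)) :
    ∑ x : SemiPlanarTree (m + 1), liftKernel α γ (m + 1) t x * (if P x then 1 else 0) =
      c * orderProb α γ z.1 := by
  rw [sum_liftKernel_mul_ite t hv hP, hQ, orderProb_of_downTree_eq hm t.2 hi hv hiv hk hz,
    mul_assoc]
  refine congrArg _ (congrArg _ (Finset.prod_congr rfl fun u hu => ?_))
  refine sum_orderings_map_downVertex hs hm t.2 hi hk (Finset.mem_of_mem_erase hu)
    (t.2.notMem_children_of_ne hv hiv hu) ?_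
  rw [hz]
  refine z.2.order_mem ?_
  rw [← hz, t.2.branchPoints_downTree hm hi hk, t.2.filter_not_contracted hv hiv]
  refine Finset.mem_image_of_mem _ ?_
  split_ifs
  · exact hu
  · exact Finset.mem_of_mem_erase hu

theorem searchProb_of_le_two {c j j' : ℕ} (h : j' ≤ 2) : searchProb α γ c j j' = 0 := by
  rw [searchProb]
  split_ifs <;> first | rfl | omega

theorem searchProb_of_lt {c j j' : ℕ} (hc : c ≠ 3) (h2 : j' < j) :
    searchProb α γ c j j' = 0 := by
  rw [searchProb]
  split_ifs <;> first | rfl | omega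

open Classical in
/-- Ordering the subtrees and performing the semi-planar down-step is the same as performing the
down-step of the `(α, γ)`-chain and ordering the subtrees afterwards. -/
theorem sum_liftKernel_downSP (hγ : 0 ≤ γ) (hγα : γ ≤ α) (hm : 1 ≤ m) {t : Tree (m + 1)}
    (hadm : Admissible α t) (hi : i ∈ Finset.Icc 1 (m + 1)) (z : SemiPlanarTree m) :
    ∑ x : SemiPlanarTree (m + 1), liftKernel α γ (m + 1) t x *
      (if downSP x.1 i = z.1 then 1 else 0) =
    downLaw α γ t.1 i (treeIndicator z.1.shape) * orderProb α γ z.1 := by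
  have ht := t.2
  obtain ⟨v, hv, hiv⟩ := ht.exists_parent_leaf hm hi
  have hvt := (mem_branchPoints.1 hv).1
  have hi0 : 0 < i := (Finset.mem_Icc.1 hi).1
  have hα := card_bigChildren_of_admissible (hγ.trans hγα) hadm hv
  rw [downLaw_eq ht hvt hiv]
  by_cases hc : (children t.1 v).card = 2
  · rw [if_pos hc, treeIndicator]
    have hk := ht.searchLabel_two_mem hi
    set k := max i (max (firstBushMin t.1 i) (secondBushMin t.1 i)) with hkdef
    have hsl : ∀ x : SemiPlanarTree (m + 1), proj x = t → searchLabel x.1 i = k := by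
      rintro x rfl
      exact searchLabel_of_card_eq_two ht hvt hiv hc
    by_cases hz : downTree t.1 i k = z.1.shape
    · rw [if_pos hz]
      refine sum_liftKernel_of_searched t hm hi hv hiv hk
        (ht.searched_of_card_eq_two hi hvt hiv) z hz (Q := fun _ => True) (fun x hx => ?_) ?_
      · have hsx := hsl x hx
        subst hx
        rw [x.2.downSP_eq_iff hm hi hv hiv z.2 hsx hz, true_and]
        exact and_iff_right fun h => absurd hc h
      · have hb : bigChildren t.1 v = ∅ := by
          rw [← Finset.card_eq_zero]
          have := ht.card_bigChildren hv
          omega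
        rw [hb, orderings_empty]
        simp [hc]
    · rw [if_neg hz, zero_mul]
      refine Finset.sum_eq_zero fun x _ => ?_
      rw [liftKernel_eq]
      by_cases hx : proj x = t
      · rw [if_pos hx, if_neg, mul_zero]
        intro h
        apply hz
        have h' := congrArg OrderedTree.shape h
        rwa [downSP_shape, hsl x hx, ← show (proj x).1 = x.1.shape from rfl, hx] at h'
      · rw [if_neg hx, zero_mul]
  rw [if_neg hc]
  -- only subtrees of rank at least three supply the label of the leaf to be deleted
  have hbigsum : ∑ D ∈ children t.1 v, searchProb α γ (children t.1 v).card (rank t.1 v {i})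
      (rank t.1 v D) * treeIndicator z.1.shape (downTree t.1 i (minLabel D)) =
      ∑ E ∈ bigChildren t.1 v, searchProb α γ (children t.1 v).card (rank t.1 v {i})
      (rank t.1 v E) * treeIndicator z.1.shape (downTree t.1 i (minLabel E)) := by
    refine (Finset.sum_subset (Finset.filter_subset _ _) fun D hD hD' => ?_).symm
    rw [searchProb_of_le_two, zero_mul]
    have : ¬ 3 ≤ rank t.1 v D := fun h => hD' (mem_bigChildren.2 ⟨hD, h⟩)
    omega
  rw [hbigsum, Finset.sum_mul]
  -- Decompose according to the outcome `minLabel E` of the local search.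
  have hsplit : ∀ x : SemiPlanarTree (m + 1), liftKernel α γ (m + 1) t x *
      (if downSP x.1 i = z.1 then 1 else 0) = ∑ E ∈ bigChildren t.1 v,
        liftKernel α γ (m + 1) t x *
          (if searchLabel x.1 i = minLabel E ∧ downSP x.1 i = z.1 then 1 else 0) := by
    intro x
    by_cases hx : proj x = t
    swap
    · rw [liftKernel_eq, if_neg hx]
      simp
    subst hx
    obtain ⟨E, hE, hsE, -⟩ : ∃ E ∈ bigChildren (proj x).1 v,
        searchLabel x.1 i = minLabel E ∧ i ≤ minLabel E := x.2.exists_searchLabel_eq hv hiv hc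
    rw [Finset.sum_eq_single_of_mem E hE]
    · simp only [hsE, true_and]
    · intro E' hE' hne
      rw [if_neg, mul_zero]
      rintro ⟨h, -⟩
      exact hne (ht.bigChildren_minLabel_injOn v hE' hE (h.symm.trans hsE))
  rw [Finset.sum_congr rfl fun x _ => hsplit x, Finset.sum_comm]
  refine Finset.sum_congr rfl fun E hE => ?_
  obtain ⟨hEc, hEr⟩ := mem_bigChildren.1 hE
  have hk := ht.minLabel_mem_Icc (children_subset _ _ hEc)
  by_cases hiE : i ≤ minLabel E
  swap
  · -- a subtree with a least label less than `i` never supplies the label of the deleted leaf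
    rw [searchProb_of_lt, zero_mul, zero_mul]
    · refine Finset.sum_eq_zero fun x _ => ?_
      rw [liftKernel_eq]
      by_cases hx : proj x = t
      · subst hx
        rw [if_neg (c := _ ∧ _), mul_zero]
        rintro ⟨h, -⟩
        have := (x.2.searched hi hv hiv).1.le
        omega
      · rw [if_neg hx, zero_mul]
    · intro h3
      have := ht.card_bigChildren hv
      have hlt : rank t.1 v E < rank t.1 v {i} :=
        (IsTree.rank_lt_rank_iff hiv).2 (by rw [minLabel_singleton]; omega)
      have hib : {i} ∈ bigChildren t.1 v := mem_bigChildren.2 ⟨hiv, by omega⟩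
      have h4 : E = {i} := Finset.card_le_one.1 (by omega) _ hE _ hib
      rw [h4] at hlt
      exact lt_irrefl _ hlt
    · exact (IsTree.rank_lt_rank_iff hiv).2 (by rw [minLabel_singleton]; omega)
  rw [treeIndicator]
  by_cases hz : downTree t.1 i (minLabel E) = z.1.shape
  swap
  · rw [if_neg hz, mul_zero, zero_mul]
    refine Finset.sum_eq_zero fun x _ => ?_
    rw [liftKernel_eq]
    by_cases hx : proj x = t
    · rw [if_neg (c := _ ∧ _), mul_zero]
      rintro ⟨h1, h2⟩
      apply hz
      have h' := congrArg OrderedTree.shape h2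
      rwa [downSP_shape, h1, ← show (proj x).1 = x.1.shape from rfl, hx] at h'
    · rw [if_neg hx, zero_mul]
  rw [if_pos hz, mul_one]
  have hzv : z.1.order (downVertex i (minLabel E) v) ∈
      orderings (bigChildren (downTree t.1 i (minLabel E)) (downVertex i (minLabel E) v)) := by
    rw [hz]
    refine z.2.order_mem ?_
    rw [← hz, ht.branchPoints_downTree hm hi hk, ht.filter_not_contracted hv hiv, if_neg hc]
    exact Finset.mem_image_of_mem _ hv
  by_cases hib : {i} ∈ bigChildren t.1 v
  · rw [ht.big_downTree_of_big hm hi hv hib hE hiE] at hzv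
    -- The search leads to `E` and leaf `i` is deleted from the order at `v`; see
    -- `searchLabel_of_big`.
    refine sum_liftKernel_of_searched t hm hi hv hiv hk (ht.searched_of_big hvt hiv hE hiE) z hz
      (Q := fun L => max i (minLabel ((L.take (L.idxOf {i})).getLastD {i})) = minLabel E ∧
          (L.erase {i}).map (downVertex i (minLabel E)) =
            z.1.order (downVertex i (minLabel E) v)) (fun x hx => ?_) ?_
    · subst hx
      have hsx : searchLabel x.1 i =
          max i (minLabel (((x.1.order v).take ((x.1.order v).idxOf {i})).getLastD {i})) := by
        obtain ⟨L₁, L₂, h⟩ := List.append_of_mem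
          (((mem_orderings.1 (x.2.order_mem hv)).2 _).2 hib)
        have hnd := x.2.nodup v hv
        rw [h, List.nodup_middle, List.nodup_cons] at hnd
        rw [x.2.searchLabel_of_big hv hib h, h, List.idxOf_append,
          if_neg fun h' => hnd.1 (List.mem_append_left _ h')]
        simp
      rw [← hsx, and_assoc]
      refine and_congr_right fun hsE => ?_
      have hord := x.2.order_downSP_of_big hm hi (x.2.searched hi hv hiv).2 hv hib
      rw [hsE] at hord
      rw [x.2.downSP_eq_iff hm hi hv hiv z.2 hsE hz, hord]
      exact and_congr_left fun _ => ⟨fun h => h hc, fun h _ => h⟩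
    · rw [if_neg hc]
      by_cases hEi : E = {i}
      · subst hEi
        simp only [minLabel_singleton] at hzv ⊢
        exact ht.sum_orderings_of_big_self hγα hv hib hi0 hα hzv
      · refine ht.sum_orderings_of_big_of_ne hγα hv hib hα hE hEi (lt_of_le_of_ne hiE ?_) hzv
        intro h
        exact hEi (ht.bigChildren_minLabel_injOn v hE hib
          (h.symm.trans (minLabel_singleton i).symm))
  · have his : {i} ∈ smallChildren t.1 v :=
      mem_smallChildren.2 ⟨hiv, fun h => hib (mem_bigChildren.2 ⟨hiv, h⟩)⟩
    rw [ht.big_downTree_of_small hm hi hv his hE] at hzv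
    -- The search leads to `E`, the leftmost ordered subtree, which leaves the order at `v`.
    refine sum_liftKernel_of_searched t hm hi hv hiv hk (ht.searched_of_big hvt hiv hE hiE) z hz
      (Q := fun L => L.head? = some E ∧ L.tail.map (downVertex i (minLabel E)) =
            z.1.order (downVertex i (minLabel E) v)) (fun x hx => ?_) ?_
    · subst hx
      have hmem := (mem_orderings.1 (x.2.order_mem hv)).2
      obtain ⟨E', L, hL⟩ := List.exists_cons_of_ne_nil (List.ne_nil_of_mem ((hmem E).2 hE))
      have hE' : E' ∈ bigChildren x.1.shape v := (hmem E').1 (by rw [hL]; exact List.mem_cons_self)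
      have hsx : searchLabel x.1 i = minLabel E ↔ (x.1.order v).head? = some E := by
        rw [x.2.searchLabel_of_small hv his hL, hL, List.head?_cons, Option.some_inj]
        exact ⟨fun h => ht.bigChildren_minLabel_injOn v hE' hE h, fun h => h ▸ rfl⟩
      rw [hsx, and_assoc]
      refine and_congr_right fun hsE => ?_
      rw [← hsx] at hsE
      have hord := x.2.order_downSP_of_small hm hi (x.2.searched hi hv hiv).2 hv his ⟨E, hE⟩
      rw [hsE] at hord
      rw [x.2.downSP_eq_iff hm hi hv hiv z.2 hsE hz, hord]
      exact and_congr_left fun _ => ⟨fun h => h hc, fun h _ => h⟩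
    · rw [if_neg hc]
      exact ht.sum_orderings_of_small hγα hv his hα hE hzv

end DownLift

/-! ### Intertwining of the two chains -/

section Intertwining

variable {m n : ℕ} {α γ : ℝ}

theorem sum_mul_liftKernel (f : Tree n → ℝ) (x : SemiPlanarTree n) :
    ∑ t : Tree n, f t * liftKernel α γ n t x = f (proj x) * orderProb α γ x.1 := by
  rw [Finset.sum_eq_single_of_mem (proj x) (Finset.mem_univ _), liftKernel_eq, if_pos rfl]
  intro t _ hne
  rw [liftKernel_eq, if_neg (Ne.symm hne), mul_zero]

theorem growthRuleSP_downSP_eq_sum (hm : 1 ≤ m) (x : SemiPlanarTree (m + 1)) {i : ℕ}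
    (hi : i ∈ Finset.Icc 1 (m + 1)) (y : OrderedTree) :
    growthRuleSP α γ m (downSP x.1 i) y = ∑ z : SemiPlanarTree m,
      (open Classical in if downSP x.1 i = z.1 then 1 else 0) * growthRuleSP α γ m z.1 y := by
  classical
  obtain ⟨z₀, hz₀⟩ : ∃ z₀ : SemiPlanarTree m, z₀.1 = downSP x.1 i := ⟨⟨_, x.2.downSP hm hi⟩, rfl⟩
  rw [Finset.sum_eq_single_of_mem z₀ (Finset.mem_univ _), if_pos hz₀.symm, one_mul, hz₀]
  intro z _ hne
  rw [if_neg fun h => hne (Subtype.ext (h.symm.trans hz₀.symm)), zero_mul]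

/-- The kernel of ordered Chinese restaurants intertwines the `(α, γ)`-chain and the semi-planar
`(α, γ)`-chain. -/
theorem sum_liftKernel_mul_semiPlanarKernel (hγ : 0 ≤ γ) (hγα : γ ≤ α) (hm : 1 ≤ m)
    {t : Tree (m + 1)} (ht : Admissible α t) (y : SemiPlanarTree (m + 1)) :
    ∑ x, liftKernel α γ (m + 1) t x * semiPlanarKernel α γ (m + 1) x y =
      chainKernel α γ (m + 1) t (proj y) * orderProb α γ y.1 := by
  classical
  have hstep : ∀ i ∈ Finset.Icc 1 (m + 1),
      ∑ x : SemiPlanarTree (m + 1), liftKernel α γ (m + 1) t x *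
        growthRuleSP α γ m (downSP x.1 i) y.1 =
      downLaw α γ t.1 i (fun r => growthRule α γ m r (proj y).1) * orderProb α γ y.1 := by
    intro i hi
    calc ∑ x : SemiPlanarTree (m + 1), liftKernel α γ (m + 1) t x *
          growthRuleSP α γ m (downSP x.1 i) y.1
        = ∑ z : SemiPlanarTree m, (∑ x : SemiPlanarTree (m + 1), liftKernel α γ (m + 1) t x *
            (if downSP x.1 i = z.1 then 1 else 0)) * growthRuleSP α γ m z.1 y.1 := by
          rw [Finset.sum_congr rfl fun z _ => Finset.sum_mul _ _ _, Finset.sum_comm]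
          refine Finset.sum_congr rfl fun x _ => ?_
          rw [growthRuleSP_downSP_eq_sum hm x hi, Finset.mul_sum]
          exact Finset.sum_congr rfl fun z _ => (mul_assoc _ _ _).symm
      _ = ∑ z : SemiPlanarTree m, (∑ r : Tree m, downLaw α γ t.1 i (treeIndicator r.1) *
            liftKernel α γ m r z) * growthRuleSP α γ m z.1 y.1 := by
          refine Finset.sum_congr rfl fun z _ => congrArg (· * _) ?_
          rw [sum_mul_liftKernel (fun r => downLaw α γ t.1 i (treeIndicator r.1)) z]
          exact sum_liftKernel_downSP hγ hγα hm ht hi z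
      _ = ∑ r : Tree m, downLaw α γ t.1 i (treeIndicator r.1) *
            (growthRule α γ m r.1 y.1.shape * orderProb α γ y.1) := by
          rw [Finset.sum_congr rfl fun z _ => Finset.sum_mul _ _ _, Finset.sum_comm]
          refine Finset.sum_congr rfl fun r _ => ?_
          rw [← sum_liftKernel_mul_growthRuleSP hγ hγα r y, Finset.mul_sum]
          exact Finset.sum_congr rfl fun z _ => mul_assoc _ _ _
      _ = _ := by
          rw [downLaw_eq_sum hm t.2 hi, Finset.sum_mul]
          exact Finset.sum_congr rfl fun r _ => (mul_assoc _ _ _).symm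
  rw [chainKernel_eq_sum, Finset.sum_mul]
  simp only [semiPlanarKernel, Finset.mul_sum, Nat.add_sub_cancel]
  rw [Finset.sum_comm]
  refine Finset.sum_congr rfl fun i hi => ?_
  rw [mul_assoc, ← hstep i hi, Finset.mul_sum]
  exact Finset.sum_congr rfl fun x _ => mul_left_comm _ _ _

theorem sum_liftKernel (hγ : 0 ≤ γ) (hγα : γ ≤ α) {t : Tree n} (ht : Admissible α t) :
    ∑ x, liftKernel α γ n t x = 1 := (liftKernel_mem_stdSimplex hγ hγα ht).2

theorem liftKernel_mul_semiPlanarKernel_mul_projMatrix (hγ : 0 ≤ γ) (hγα : γ ≤ α) (hm : 1 ≤ m)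
    {t : Tree (m + 1)} (ht : Admissible α t) (s : Tree (m + 1)) :
    (liftKernel α γ (m + 1) * semiPlanarKernel α γ (m + 1) * projMatrix (m + 1)) t s =
      chainKernel α γ (m + 1) t s := by
  have h : ∀ y : SemiPlanarTree (m + 1),
      (liftKernel α γ (m + 1) * semiPlanarKernel α γ (m + 1)) t y * projMatrix (m + 1) y s =
        chainKernel α γ (m + 1) t s * liftKernel α γ (m + 1) s y := by
    intro y
    rw [Matrix.mul_apply, sum_liftKernel_mul_semiPlanarKernel hγ hγα hm ht, projMatrix,
      liftKernel_eq]
    split_ifs with h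
    · rw [h, mul_one]
    · rw [mul_zero, mul_zero]
  rw [Matrix.mul_apply, Finset.sum_congr rfl fun y _ => h y, ← Finset.mul_sum]
  by_cases hs : chainKernel α γ (m + 1) t s = 0
  · rw [hs, zero_mul]
  · rw [sum_liftKernel hγ hγα (admissible_of_chainKernel_ne_zero hγ hγα hm ht hs), mul_one]

theorem chainKernel_mem_stdSimplex (hγ : 0 ≤ γ) (hγα : γ ≤ α) (hα : α ≤ 1) (hm : 1 ≤ m)
    {t : Tree (m + 1)} (ht : Admissible α t) :
    chainKernel α γ (m + 1) t ∈ stdSimplex ℝ (Tree (m + 1)) := by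
  have hK := fun x => semiPlanarKernel_mem_stdSimplex hγ hγα hα hm x
  have hL := liftKernel_mem_stdSimplex hγ hγα ht
  constructor
  · intro s
    rw [← liftKernel_mul_semiPlanarKernel_mul_projMatrix hγ hγα hm ht, Matrix.mul_apply]
    refine Finset.sum_nonneg fun y _ => mul_nonneg ?_ ?_
    · rw [Matrix.mul_apply]
      exact Finset.sum_nonneg fun x _ => mul_nonneg (hL.1 x) ((hK x).1 y)
    · rw [projMatrix]
      split_ifs <;> norm_num
  · have h : ∀ y : SemiPlanarTree (m + 1), ∑ s, projMatrix (m + 1) y s = 1 := fun y => by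
      simp [projMatrix]
    simp only [← liftKernel_mul_semiPlanarKernel_mul_projMatrix hγ hγα hm ht, Matrix.mul_apply]
    rw [Finset.sum_comm]
    simp only [← Finset.mul_sum, h, mul_one]
    rw [Finset.sum_comm]
    simp only [← Finset.mul_sum, (hK _).2, mul_one]
    exact hL.2

end Intertwining

/-! ### The projected Markov chain -/

section Markov

variable {m : ℕ} {α γ : ℝ}

/-- The joint law of `proj (X 0) = τ 0, …, proj (X (j - 1)) = τ (j - 1)` and `X j`, for a
semi-planar chain `X` with initial law `liftKernel α γ n t`. -/
noncomputable def filterLaw (α γ : ℝ) {n : ℕ} (t : Tree n) (τ : ℕ → Tree n) :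
    ℕ → SemiPlanarTree n → ℝ
  | 0 => liftKernel α γ n t
  | j + 1 => fun y =>
    ∑ x with proj x = τ j, filterLaw α γ t τ j x * semiPlanarKernel α γ n x y

/-- Given the projected path, the semi-planar tree is distributed as an ordering of the subtrees of
the present tree. -/
theorem filterLaw_eq (hγ : 0 ≤ γ) (hγα : γ ≤ α) (hm : 1 ≤ m) {t : Tree (m + 1)}
    (ht : Admissible α t) (τ : ℕ → Tree (m + 1)) (j : ℕ) :
    ∃ c : Tree (m + 1) → ℝ, (∀ y, filterLaw α γ t τ j y = c (proj y) * orderProb α γ y.1) ∧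
      (∀ s, c s ≠ 0 → Admissible α s) ∧ c (τ j) = (Pi.single t 1 : Tree (m + 1) → ℝ) (τ 0) *
        ∏ k ∈ Finset.range j, chainKernel α γ (m + 1) (τ k) (τ (k + 1)) := by
  induction j with
  | zero =>
    refine ⟨Pi.single t 1, fun y => ?_, fun s hs => ?_, by simp⟩
    · rw [filterLaw, liftKernel_eq, Pi.single_apply]
      split_ifs <;> simp
    · by_cases h : s = t
      · exact h ▸ ht
      · exact absurd (Pi.single_eq_of_ne h 1) hs
  | succ j ih =>
    obtain ⟨c, h1, h2, h3⟩ := ih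
    refine ⟨fun s => c (τ j) * chainKernel α γ (m + 1) (τ j) s, fun y => ?_, fun s hs => ?_, ?_⟩
    · have e : filterLaw α γ t τ (j + 1) y = c (τ j) *
          ∑ x, liftKernel α γ (m + 1) (τ j) x * semiPlanarKernel α γ (m + 1) x y := by
        change (∑ x with proj x = τ j,
          filterLaw α γ t τ j x * semiPlanarKernel α γ (m + 1) x y) = _
        rw [Finset.sum_filter, Finset.mul_sum]
        refine Finset.sum_congr rfl fun x _ => ?_
        rw [liftKernel_eq]
        split_ifs with h
        · rw [h1, h, mul_assoc]
        · rw [zero_mul, mul_zero]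
      rw [e]
      by_cases hc : c (τ j) = 0
      · rw [hc]; ring
      · rw [sum_liftKernel_mul_semiPlanarKernel hγ hγα hm (h2 _ hc), mul_assoc]
    · exact admissible_of_chainKernel_ne_zero hγ hγα hm (h2 _ (left_ne_zero_of_mul hs))
        (right_ne_zero_of_mul hs)
    · rw [Finset.prod_range_succ, ← mul_assoc, ← h3]

theorem filterLaw_nonneg (hγ : 0 ≤ γ) (hγα : γ ≤ α) (hα : α ≤ 1) (hm : 1 ≤ m) {t : Tree (m + 1)}
    (ht : Admissible α t) (τ : ℕ → Tree (m + 1)) (j : ℕ) (x : SemiPlanarTree (m + 1)) :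
    0 ≤ filterLaw α γ t τ j x := by
  induction j generalizing x with
  | zero => exact (liftKernel_mem_stdSimplex hγ hγα ht).1 x
  | succ j ih =>
    exact Finset.sum_nonneg fun y _ =>
      mul_nonneg (ih y) ((semiPlanarKernel_mem_stdSimplex hγ hγα hα hm y).1 x)

/-- The law of a path of the semi-planar chain of which only the projection is prescribed before the
time `j`. -/
theorem measure_filter_event (hγ : 0 ≤ γ) (hγα : γ ≤ α) (hα : α ≤ 1) (hm : 1 ≤ m)
    {t : Tree (m + 1)} (ht : Admissible α t) {Ω : Type*} [MeasurableSpace Ω] {P : Measure Ω}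
    {X : ℕ → Ω → SemiPlanarTree (m + 1)}
    (hX : IsMarkovChain P (liftKernel α γ (m + 1) t) (semiPlanarKernel α γ (m + 1)) X)
    (τ : ℕ → Tree (m + 1)) (j N : ℕ) (hj : j ≤ N) (x : ℕ → SemiPlanarTree (m + 1)) :
    MeasurableSet {ω | (∀ k < j, proj (X k ω) = τ k) ∧ ∀ k, j ≤ k → k ≤ N → X k ω = x k} ∧
    P {ω | (∀ k < j, proj (X k ω) = τ k) ∧ ∀ k, j ≤ k → k ≤ N → X k ω = x k} =
      ENNReal.ofReal (filterLaw α γ t τ j (x j) *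
        ∏ k ∈ Finset.Ico j N, semiPlanarKernel α γ (m + 1) (x k) (x (k + 1))) := by
  induction j generalizing x with
  | zero =>
    have e : {ω | (∀ k < 0, proj (X k ω) = τ k) ∧ ∀ k, 0 ≤ k → k ≤ N → X k ω = x k} =
        {ω | ∀ k ≤ N, X k ω = x k} := by ext ω; simp
    rw [e]
    refine ⟨?_, ?_⟩
    · have e2 : {ω | ∀ k ≤ N, X k ω = x k} = ⋂ k ∈ Finset.range (N + 1), X k ⁻¹' {x k} := by
        ext ω
        simp
      rw [e2]
      exact Finset.measurableSet_biInter _ fun k _ => hX.1 k (x k)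
    · rw [hX.2 N x, Finset.range_eq_Ico]
      rfl
  | succ j ih =>
    set E : SemiPlanarTree (m + 1) → Set Ω := fun y =>
      {ω | (∀ k < j, proj (X k ω) = τ k) ∧
        ∀ k, j ≤ k → k ≤ N → X k ω = Function.update x j y k} with hE
    have hE' : ∀ y, ∀ ω, ω ∈ E y ↔ (∀ k < j, proj (X k ω) = τ k) ∧ X j ω = y ∧
        ∀ k, j + 1 ≤ k → k ≤ N → X k ω = x k := by
      intro y ω
      refine and_congr_right fun _ => ?_
      constructor
      · intro h
        refine ⟨by simpa using h j le_rfl (by omega), fun k hk hkN => ?_⟩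
        have := h k (by omega) hkN
        rwa [Function.update_of_ne (by omega)] at this
      · rintro ⟨h1, h2⟩ k hk hkN
        by_cases hkj : k = j
        · subst hkj
          rw [Function.update_self]
          exact h1
        · rw [Function.update_of_ne hkj]
          exact h2 k (by omega) hkN
    -- sum over the semi-planar trees that may be visited at time `j`
    have hunion : {ω | (∀ k < j + 1, proj (X k ω) = τ k) ∧
        ∀ k, j + 1 ≤ k → k ≤ N → X k ω = x k} =
        ⋃ y ∈ Finset.univ.filter (fun y : SemiPlanarTree (m + 1) => proj y = τ j), E y := by
      ext ω
      simp only [Set.mem_iUnion, hE', Finset.mem_filter, Finset.mem_univ, true_and, exists_prop]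
      constructor
      · rintro ⟨h1, h2⟩
        exact ⟨X j ω, h1 j (by omega), fun k hk => h1 k (by omega), rfl, h2⟩
      · rintro ⟨y, h1, h2, h3, h4⟩
        refine ⟨fun k hk => ?_, h4⟩
        rcases Nat.lt_succ_iff_lt_or_eq.1 hk with h | h
        · exact h2 k h
        · rw [h, h3, h1]
    have hmeas : ∀ y, MeasurableSet (E y) := fun y => (ih (by omega) (Function.update x j y)).1
    rw [hunion]
    refine ⟨Finset.measurableSet_biUnion _ fun y _ => hmeas y, ?_⟩
    have hK : ∀ y z, 0 ≤ semiPlanarKernel α γ (m + 1) y z := fun y z =>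
      (semiPlanarKernel_mem_stdSimplex hγ hγα hα hm y).1 z
    rw [measure_biUnion_finset _ fun y _ => hmeas y]
    · have hval : ∀ y, P (E y) = ENNReal.ofReal (filterLaw α γ t τ j y *
          semiPlanarKernel α γ (m + 1) y (x (j + 1)) *
          ∏ k ∈ Finset.Ico (j + 1) N, semiPlanarKernel α γ (m + 1) (x k) (x (k + 1))) := by
        intro y
        rw [(ih (by omega) (Function.update x j y)).2, Function.update_self,
          Finset.prod_eq_prod_Ico_succ_bot (by omega), Function.update_self,
          Function.update_of_ne (by omega), mul_assoc]
        refine congrArg _ (congrArg _ (congrArg _ (Finset.prod_congr rfl fun k hk => ?_)))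
        have := (Finset.mem_Ico.1 hk).1
        rw [Function.update_of_ne (by omega), Function.update_of_ne (by omega)]
      rw [Finset.sum_congr rfl fun y _ => hval y, ← ENNReal.ofReal_sum_of_nonneg, ← Finset.sum_mul]
      · rfl
      · exact fun y _ => mul_nonneg (mul_nonneg (filterLaw_nonneg hγ hγα hα hm ht τ j y) (hK _ _))
          (Finset.prod_nonneg fun k _ => hK _ _)
    · intro y _ z _ hyz
      refine Set.disjoint_left.2 fun ω hy hz => hyz ?_
      rw [hE'] at hy hz
      exact hy.2.1.symm.trans hz.2.1

/-- The projection of a semi-planar `(α, γ)`-chain whose initial state is a random ordering of the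
subtrees of `t` is an `(α, γ)`-chain started from `t`. -/
theorem isMarkovChain_proj (hγ : 0 ≤ γ) (hγα : γ ≤ α) (hα : α ≤ 1) (hm : 1 ≤ m)
    {t : Tree (m + 1)} (ht : Admissible α t) {Ω : Type*} [MeasurableSpace Ω] {P : Measure Ω}
    {X : ℕ → Ω → SemiPlanarTree (m + 1)}
    (hX : IsMarkovChain P (liftKernel α γ (m + 1) t) (semiPlanarKernel α γ (m + 1)) X) :
    IsMarkovChain P (Pi.single t 1) (chainKernel α γ (m + 1)) fun k ω => proj (X k ω) := by
  constructor
  · intro k s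
    have e : (fun ω => proj (X k ω)) ⁻¹' {s} =
        ⋃ x ∈ Finset.univ.filter (fun x : SemiPlanarTree (m + 1) => proj x = s), X k ⁻¹' {x} := by
      ext ω
      simp
    rw [e]
    exact Finset.measurableSet_biUnion _ fun x _ => hX.1 k x
  · intro j τ
    have hE := fun y => measure_filter_event hγ hγα hα hm ht hX τ j j le_rfl fun _ => y
    simp only [Finset.Ico_self, Finset.prod_empty, mul_one] at hE
    have hunion : {ω | ∀ k ≤ j, proj (X k ω) = τ k} =
        ⋃ y ∈ Finset.univ.filter (fun y : SemiPlanarTree (m + 1) => proj y = τ j),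
          {ω | (∀ k < j, proj (X k ω) = τ k) ∧ ∀ k, j ≤ k → k ≤ j → X k ω = y} := by
      ext ω
      simp only [Set.mem_iUnion, Finset.mem_filter, Finset.mem_univ, true_and, exists_prop,
        Set.mem_ofPred_eq]
      constructor
      · intro h
        exact ⟨X j ω, h j le_rfl, fun k hk => h k hk.le, fun k h1 h2 => by rw [le_antisymm h2 h1]⟩
      · rintro ⟨y, h1, h2, h3⟩ k hk
        rcases hk.lt_or_eq with h | h
        · exact h2 k h
        · rw [h, h3 j le_rfl le_rfl, h1]
    rw [hunion, measure_biUnion_finset _ fun y _ => (hE y).1,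
      Finset.sum_congr rfl fun y _ => (hE y).2, ← ENNReal.ofReal_sum_of_nonneg fun y _ =>
        filterLaw_nonneg hγ hγα hα hm ht τ j y]
    · congr 1
      obtain ⟨c, h1, h2, h3⟩ := filterLaw_eq hγ hγα hm ht τ j
      rw [← h3]
      have e : ∑ y with proj y = τ j, filterLaw α γ t τ j y =
          c (τ j) * ∑ y, liftKernel α γ (m + 1) (τ j) y := by
        rw [Finset.sum_filter, Finset.mul_sum]
        refine Finset.sum_congr rfl fun y _ => ?_
        rw [liftKernel_eq]
        split_ifs with h
        · rw [h1, h]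
        · rw [mul_zero]
      rw [e]
      by_cases hc : c (τ j) = 0
      · rw [hc, zero_mul]
      · rw [sum_liftKernel hγ hγα (h2 _ hc), mul_one]
    · intro y _ z _ hyz
      refine Set.disjoint_left.2 fun ω hy hz => hyz ?_
      exact (hy.2 j le_rfl le_rfl).symm.trans (hz.2 j le_rfl le_rfl)

end Markov

end AlphaGamma

theorem mainTheorem5 (α γ : ℝ) (hγ : 0 ≤ γ) (hγα : γ ≤ α) (hα : α ≤ 1) (n : ℕ) (hn : 2 ≤ n) :
    -- the kernels are stochastic
    (∀ x, AlphaGamma.semiPlanarKernel α γ n x ∈ stdSimplex ℝ (AlphaGamma.SemiPlanarTree n)) ∧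
    (∀ t, AlphaGamma.Admissible α t →
      AlphaGamma.liftKernel α γ n t ∈ stdSimplex ℝ (AlphaGamma.SemiPlanarTree n)) ∧
    (∀ t, AlphaGamma.Admissible α t →
      AlphaGamma.chainKernel α γ n t ∈ stdSimplex ℝ (AlphaGamma.Tree n)) ∧
    -- the two descriptions of the transition probabilities of the `(α, γ)`-chain agree
    (∀ t, AlphaGamma.Admissible α t → ∀ s, AlphaGamma.chainKernel α γ n t s =
      (AlphaGamma.liftKernel α γ n * AlphaGamma.semiPlanarKernel α γ n *
        AlphaGamma.projMatrix n) t s) ∧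
    -- the projected semi-planar chain is the `(α, γ)`-chain started from `t`
    (∀ t, AlphaGamma.Admissible α t →
      ∀ (Ω : Type*) [MeasurableSpace Ω] (P : MeasureTheory.Measure Ω)
        [MeasureTheory.IsProbabilityMeasure P] (X : ℕ → Ω → AlphaGamma.SemiPlanarTree n),
        AlphaGamma.IsMarkovChain P (AlphaGamma.liftKernel α γ n t)
          (AlphaGamma.semiPlanarKernel α γ n) X →
        AlphaGamma.IsMarkovChain P (Pi.single t 1) (AlphaGamma.chainKernel α γ n)
          (fun m ω => AlphaGamma.proj (X m ω))) ∧
    -- the stationary law of the `(α, γ)`-chain is that of the `n`-th step of the growth process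
    (AlphaGamma.growthLaw α γ n ∈ stdSimplex ℝ (AlphaGamma.Tree n) ∧
      (∀ t, AlphaGamma.growthLaw α γ n t ≠ 0 → AlphaGamma.Admissible α t) ∧
      Matrix.vecMul (AlphaGamma.growthLaw α γ n) (AlphaGamma.chainKernel α γ n) =
        AlphaGamma.growthLaw α γ n ∧
      ∀ μ ∈ stdSimplex ℝ (AlphaGamma.Tree n),
        (∀ t, μ t ≠ 0 → AlphaGamma.Admissible α t) →
        Matrix.vecMul μ (AlphaGamma.chainKernel α γ n) = μ → μ = AlphaGamma.growthLaw α γ n) := by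
  obtain ⟨m, rfl⟩ := Nat.exists_eq_add_of_le' hn
  have hm : 1 ≤ m + 1 := Nat.le_add_left 1 m
  exact ⟨fun x => AlphaGamma.semiPlanarKernel_mem_stdSimplex hγ hγα hα hm x,
    fun t ht => AlphaGamma.liftKernel_mem_stdSimplex hγ hγα ht,
    fun t ht => AlphaGamma.chainKernel_mem_stdSimplex hγ hγα hα hm ht,
    fun t ht s =>
      (AlphaGamma.liftKernel_mul_semiPlanarKernel_mul_projMatrix hγ hγα hm ht s).symm,
    fun t ht Ω _ P _ X hX => AlphaGamma.isMarkovChain_proj hγ hγα hα hm ht hX,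
    AlphaGamma.growthLaw_mem_stdSimplex hγ hγα hα (Nat.le_add_left 1 (m + 1)),
    fun t h => AlphaGamma.admissible_of_growthLaw_ne_zero hγ hγα (Nat.le_add_left 1 (m + 1)) t h,
    AlphaGamma.growthLaw_vecMul_chainKernel hγ hγα hα hm,
    fun μ hμ _ h => AlphaGamma.eq_growthLaw_of_stationary hγ hγα hα hm μ hμ h⟩
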